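/- \textbf{Setting.} Let $n\ge 0$ be an integer. Let $(\mathcal M,\omega=d\alpha,Q,\Theta)$ be a Hamiltonian dg manifold of degree $n-1$: $\mathcal M$ is a finite-dimensional $\mathbb Z$-graded manifold (a supermanifold with a graded Euler vector field, the parity of each coordinate being its degree mod $2$), $\alpha$ is a $1$-form of degree $n-1$ with $\omega=d\alpha$ nondegenerate, $Q$ is a vector field of degree $1$ with $Q^2=0$, and $\Theta$ is a function of degree $n$ with $\iota_Q\omega=d\Theta$ and $\{\Theta,\Theta\}=Q\Theta=0$. For a compact oriented smooth manifold $N$, possibly with boundary, let $\mathcal F_N=\mathrm{Map}(T[1]N,\mathcal M)$ be the graded manifold of maps $X$ from $T[1]N$ to $\mathcal M$. Its points with values in a Grassmann algebra $\Lambda$ are the even homomorphisms from $C^\infty(\mathcal M)$ to $\Omega^\bullet(N)\otimes\Lambda$, and its Euler vector field $E_N$ (which defines the ghost number $\mathrm{gh}$) is the lift of the Euler vector field of $\mathcal M$ minus the lift of that of $T[1]N$. Let $\delta$ be the de Rham differential of $\mathcal F_N$. In local coordinates $x^a$ of $\mathcal M$, with $\alpha=\sum_a\alpha_a\,dx^a$,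 put \[ \alpha_N=\int_N\sum_a\alpha_a(X)\,\delta X^a,\qquad \omega_N=\int_N\sum_a\delta(\alpha_a(X))\,\delta X^a,\qquad S_N=\int_N\sum_a\alpha_a(X)\,dX^a+\int_N\Theta(X) \] (so $\omega_N$ is the transgression of $\omega$), and let $Q_N$ be the vector field on $\mathcal F_N$ which is the sum of the lift of the de Rham vector field of $T[1]N$ and of the lift of $Q$, i.e. $Q_NX^a=dX^a+Q^a(X)$. Signs are those of the total parity (form degree plus ghost number), $\int_N$ having parity $\dim N$ and acting from the left. \textbf{Statement.} (1) Let $N$ be of any dimension $d$, and put $k=n-d$ (the codimension). Then $E_N$ and $Q_N$ are vector fields on $\mathcal F_N$ with $[E_N,Q_N]=Q_N$ (that is, $\mathrm{gh}(Q_N)=1$) and $Q_N^2=0$; $\alpha_N$ is a $1$-form with $\mathrm{gh}(\alpha_N)=k-1$; $\omega_N=(-1)^d\,\delta\alpha_N$ is a closed, weakly nondegenerate $2$-form with $\mathrm{gh}(\omega_N)=k-1$; and $\mathrm{gh}(S_N)=k$. (2) If $N$ has dimension $d\ge 0$ and empty boundary, then $\iota_{Q_N}\omega_N=(-1)^{d}\,\delta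 S_N$ and $L_{Q_N}\omega_N=0$. (3) Let $N$ have dimension $d\ge 1$ and boundary $\partial N$ with the induced orientation (outward normal first), and let $\pi:\mathcal F_N\to\mathcal F_{\partial N}$ be the restriction of fields. Then $\pi$ is well defined and is a submersion (every tangent vector at $\pi(X)$ is the image of a tangent vector at $X$), $\pi_*E_N=E_{\partial N}$, $\pi_*Q_N=Q_{\partial N}$, and \[ \iota_{Q_N}\omega_N=(-1)^{\dim N}\,\delta S_N+\pi^*\alpha_{\partial N}. \] By (1) and (2), the data on $\partial N$ (and on closed strata of every dimension) satisfy the BFV conditions. Thus AKSZ theories give BV-BFV theories, extended to strata of every codimension. -/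

import Mathlib

open scoped Manifold ContDiff Topology
open TopologicalSpace

noncomputable section

namespace AKSZ

/-! ### Superalgebra: parities, homomorphisms, derivations -/

/-- The Koszul sign `(-1)^(i j)`. -/
def ksign (i j : ZMod 2) : ℝ := if i = 1 ∧ j = 1 then -1 else 1

/-- Even homomorphisms of (super)algebras; `𝒜`, `P` are the parity components. -/
structure IsSuperHom {A B : Type*} [Ring A] [Algebra ℝ A] [Ring B] [Algebra ℝ B]
    (𝒜 : ZMod 2 → Submodule ℝ A) (P : ZMod 2 → Submodule ℝ B) (x : A → B) : Prop where
  map_one : x 1 = 1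
  map_mul : ∀ a b, x (a * b) = x a * x b
  map_add : ∀ a b, x (a + b) = x a + x b
  map_smul : ∀ (t : ℝ) a, x (t • a) = t • x a
  parity : ∀ i, ∀ a ∈ 𝒜 i, x a ∈ P i

/-- Derivations of parity `p` along a homomorphism `x`, i.e. tangent vectors of parity `p` at the
point `x`. -/
structure IsDerAlong {A B : Type*} [Ring A] [Algebra ℝ A] [Ring B] [Algebra ℝ B]
    (𝒜 : ZMod 2 → Submodule ℝ A) (P : ZMod 2 → Submodule ℝ B) (p : ZMod 2) (x ξ : A → B) :
    Prop where
  map_add : ∀ a b, ξ (a + b) = ξ a + ξ b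
  map_smul : ∀ (t : ℝ) a, ξ (t • a) = t • ξ a
  leibniz : ∀ i, ∀ a ∈ 𝒜 i, ∀ b, ξ (a * b) = ξ a * x b + ksign p i • (x a * ξ b)
  parity : ∀ i, ∀ a ∈ 𝒜 i, ξ a ∈ P (i + p)

/-- The Grassmann algebra on a (finite-dimensional) space `V` of odd parameters. -/
abbrev Gr (V : Type*) [AddCommGroup V] [Module ℝ V] : Type _ := ExteriorAlgebra ℝ V

/-- Even and odd part of a Grassmann algebra. -/
abbrev Gr.par (V : Type*) [AddCommGroup V] [Module ℝ V] (i : ZMod 2) : Submodule ℝ (Gr V) :=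
  CliffordAlgebra.evenOdd (0 : QuadraticForm ℝ V) i

/-! ### Graded manifolds -/

/-- Superfunctions `C^∞(W) ⊗ Λ(ℝ^q)` on the open set `W` of `ℝ^m`. -/
abbrev Model (m q : ℕ) (W : Opens (EuclideanSpace ℝ (Fin m))) : Type :=
  TensorProduct ℝ C^∞⟮𝓡 m, W; 𝓘(ℝ, ℝ), ℝ⟯ (ExteriorAlgebra ℝ (Fin q → ℝ))

/-- Restriction of smooth functions to a smaller open set. -/
def smoothRes {m : ℕ} {W W' : Opens (EuclideanSpace ℝ (Fin m))} (h : W ≤ W') :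
    C^∞⟮𝓡 m, W'; 𝓘(ℝ, ℝ), ℝ⟯ →ₐ[ℝ] C^∞⟮𝓡 m, W; 𝓘(ℝ, ℝ), ℝ⟯ :=
  { ContMDiffMap.restrictRingHom (𝓡 m) 𝓘(ℝ, ℝ) ℝ h with
    commutes' := fun _ => rfl }

/-- Restriction of superfunctions to a smaller open set. -/
def modelRes {m q : ℕ} {W W' : Opens (EuclideanSpace ℝ (Fin m))} (h : W ≤ W') :
    Model m q W' →ₐ[ℝ] Model m q W :=
  Algebra.TensorProduct.map (smoothRes h) (AlgHom.id ℝ _)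

/-- Even and odd part of the algebra of superfunctions. -/
def modelPar {m q : ℕ} (W : Opens (EuclideanSpace ℝ (Fin m))) (i : ZMod 2) :
    Submodule ℝ (Model m q W) :=
  LinearMap.range (LinearMap.lTensor C^∞⟮𝓡 m, W; 𝓘(ℝ, ℝ), ℝ⟯
    (CliffordAlgebra.evenOdd (0 : QuadraticForm ℝ (Fin q → ℝ)) i).subtype)

/-- The `i`-th even coordinate. -/
def evenCoord {m q : ℕ} (W : Opens (EuclideanSpace ℝ (Fin m))) (i : Fin m) : Model m q W :=
  TensorProduct.tmul ℝ
    (⟨fun z => (z : EuclideanSpace ℝ (Fin m)) i,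
      (EuclideanSpace.proj (𝕜 := ℝ) i).contMDiff.comp contMDiff_subtype_val⟩ :
        C^∞⟮𝓡 m, W; 𝓘(ℝ, ℝ), ℝ⟯) 1

/-- The `j`-th odd coordinate. -/
def oddCoord {m q : ℕ} (W : Opens (EuclideanSpace ℝ (Fin m))) (j : Fin q) : Model m q W :=
  TensorProduct.tmul ℝ 1 (ExteriorAlgebra.ι ℝ (Pi.single j (1 : ℝ)))

/-- Finite-dimensional graded manifolds (with matching `ℤ`- and `ℤ/2`-gradings): a sheaf of
superalgebras on the body, locally isomorphic to `C^∞(W) ⊗ Λ(ℝ^q)`, with an Euler vector field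
that multiplies the coordinates of each chart of an atlas by their degrees. -/
structure GradedManifold where
  Body : Type*
  [top : TopologicalSpace Body]
  [t2 : T2Space Body]
  [sc : SecondCountableTopology Body]
  /-- sections of the structure sheaf -/
  Sec : Opens Body → Type*
  [ring : ∀ U, Ring (Sec U)]
  [alg : ∀ U, Algebra ℝ (Sec U)]
  /-- even and odd sections -/
  par : ∀ U, ZMod 2 → Submodule ℝ (Sec U)
  par_compl : ∀ U, IsCompl (par U 0) (par U 1)
  one_mem : ∀ U, (1 : Sec U) ∈ par U 0
  mul_mem : ∀ U i j, ∀ a ∈ par U i, ∀ b ∈ par U j, a * b ∈ par U (i + j)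
  supercomm : ∀ U i j, ∀ a ∈ par U i, ∀ b ∈ par U j, a * b = ksign i j • (b * a)
  res : ∀ {U V : Opens Body}, U ≤ V → (Sec V →ₐ[ℝ] Sec U)
  res_par : ∀ {U V : Opens Body} (h : U ≤ V) (i : ZMod 2), ∀ a ∈ par V i, res h a ∈ par U i
  res_refl : ∀ (U : Opens Body) (a : Sec U), res le_rfl a = a
  res_trans : ∀ {U V W : Opens Body} (h : U ≤ V) (h' : V ≤ W) (a : Sec W),
    res h (res h' a) = res (h.trans h') a
  locality : ∀ (𝒰 : Set (Opens Body)) (a b : Sec (sSup 𝒰)),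
    (∀ U (h : U ∈ 𝒰), res (le_sSup h) a = res (le_sSup h) b) → a = b
  gluing : ∀ (𝒰 : Set (Opens Body)) (s : ∀ U : 𝒰, Sec U.1),
    (∀ U V : 𝒰, res (inf_le_left : U.1 ⊓ V.1 ≤ U.1) (s U) =
      res (inf_le_right : U.1 ⊓ V.1 ≤ V.1) (s V)) →
    ∃ a : Sec (sSup 𝒰), ∀ U : 𝒰, res (le_sSup U.2) a = s U
  /-- the graded Euler vector field -/
  euler : ∀ U, Sec U → Sec U
  euler_der : ∀ U, IsDerAlong (par U) (par U) 0 id (euler U)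
  euler_res : ∀ {U V : Opens Body} (h : U ≤ V) (a : Sec V),
    res h (euler V a) = euler U (res h a)
  /-- numbers of even and odd coordinates, and their degrees -/
  dimEven : ℕ
  dimOdd : ℕ
  degEven : Fin dimEven → ℤ
  degOdd : Fin dimOdd → ℤ
  even_degEven : ∀ i, Even (degEven i)
  odd_degOdd : ∀ j, Odd (degOdd j)
  charts : ∀ b : Body,
    ∃ (φ : OpenPartialHomeomorph Body (EuclideanSpace ℝ (Fin dimEven)))
      (Φ : ∀ (U : Opens Body) (W : Opens (EuclideanSpace ℝ (Fin dimEven))),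
        (U : Set Body) ⊆ φ.source → φ '' U = W → (Sec U ≃ₐ[ℝ] Model dimEven dimOdd W)),
      b ∈ φ.source ∧
      ∀ (U : Opens Body) (W : Opens (EuclideanSpace ℝ (Fin dimEven)))
        (hU : (U : Set Body) ⊆ φ.source) (hW : φ '' U = W),
        (∀ i a, a ∈ par U i ↔ Φ U W hU hW a ∈ modelPar W i) ∧
        (∀ (U' : Opens Body) (W' : Opens (EuclideanSpace ℝ (Fin dimEven)))
          (hU' : (U' : Set Body) ⊆ φ.source) (hW' : φ '' U' = W') (h : U ≤ U') (h' : W ≤ W')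
          (a : Sec U'), Φ U W hU hW (res h a) = modelRes h' (Φ U' W' hU' hW' a)) ∧
        (∀ i, Φ U W hU hW (euler U ((Φ U W hU hW).symm (evenCoord W i))) =
          degEven i • evenCoord W i) ∧
        (∀ j, Φ U W hU hW (euler U ((Φ U W hU hW).symm (oddCoord W j))) =
          degOdd j • oddCoord W j)

attribute [instance] GradedManifold.top GradedManifold.t2 GradedManifold.sc
  GradedManifold.ring GradedManifold.alg

/-- Global functions. -/
abbrev GradedManifold.Fun (M : GradedManifold) : Type _ := M.Sec ⊤

/-! ### Differential forms on the target -/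

/-- A list of pairs `(f, g)` represents the `1`-form `∑ f dg`, and also the exact `2`-form
`∑ df dg`. -/
abbrev OneForm (A : Type*) := List (A × A)

/-- The value of the `1`-form `∑ f dg` at a point `x` and an odd tangent vector `ξ` at `x`. Forms
are regarded as functions on the odd tangent bundle, so that all signs are governed by the total
parity (form degree plus internal parity). -/
def evalOne {A B : Type*} [Ring B] (x ξ : A → B) (α : OneForm A) : B :=
  (α.map fun fg => x fg.1 * ξ fg.2).sum

/-- The value of the `2`-form `d (∑ f dg) = ∑ df dg`. -/
def evalD {A B : Type*} [Ring B] (ξ : A → B) (α : OneForm A) : B :=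
  (α.map fun fg => ξ fg.1 * ξ fg.2).sum

section Target

variable {A : Type*} [Ring A] [Algebra ℝ A] (𝒜 : ZMod 2 → Submodule ℝ A)

/-- `(x, ξ)` is a Grassmann-valued point of the odd tangent bundle. Superfunctions on it, i.e.
differential forms, are determined by their values at these points. -/
def IsTargetPoint (V : Type) [AddCommGroup V] [Module ℝ V] (x ξ : A → Gr V) : Prop :=
  IsSuperHom 𝒜 (Gr.par V) x ∧ IsDerAlong 𝒜 (Gr.par V) 1 x ξ

/-- The `1`-form `β` has total parity `c`. -/
def OneForm.HasParity (β : OneForm A) (c : ZMod 2) : Prop :=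
  ∀ (V : Type) [AddCommGroup V] [Module ℝ V] [FiniteDimensional ℝ V] (x ξ : A → Gr V),
    IsTargetPoint 𝒜 V x ξ → evalOne x ξ β ∈ Gr.par V c

/-- `L_E β = m β` for the vector field `E`. -/
def OneForm.HasDegree (E : A → A) (β : OneForm A) (m : ℤ) : Prop :=
  ∀ (V : Type) [AddCommGroup V] [Module ℝ V] [FiniteDimensional ℝ V] (x ξ : A → Gr V),
    IsTargetPoint 𝒜 V x ξ →
      evalOne x ξ (β.map fun fg => (E fg.1, fg.2)) + evalOne x ξ (β.map fun fg => (fg.1, E fg.2)) =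
        (m : ℝ) • evalOne x ξ β

/-- `ι_v (dα) = β` for a vector field `v` of parity `p`. The operator `ι_v` is the derivation of
parity `p + 1` of functions on the odd tangent bundle which shifts `ξ` in the direction `v`. -/
def IsTargetContraction (p : ZMod 2) (v : A → A) (α β : OneForm A) : Prop :=
  ∀ (V : Type) [AddCommGroup V] [Module ℝ V] [FiniteDimensional ℝ V] (x ξ : A → Gr V),
    IsTargetPoint 𝒜 V x ξ → ∀ θ ∈ Gr.par V (p + 1), θ * θ = 0 →
      evalD (fun a => ξ a + θ * x (v a)) α = evalD ξ α + θ * evalOne x ξ β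

end Target

/-- Hamiltonian dg manifolds of degree `m`, with a chosen primitive `α` of the symplectic form
`ω = dα`. -/
structure HamiltonianDGManifold (m : ℤ) extends GradedManifold where
  α : OneForm toGradedManifold.Fun
  α_parity : α.HasParity (toGradedManifold.par ⊤) ((m + 1 : ℤ) : ZMod 2)
  α_degree : α.HasDegree (toGradedManifold.par ⊤) (toGradedManifold.euler ⊤) m
  /-- `ω = dα` is nondegenerate: `v ↦ ι_v ω` is a bijection from vector fields to `1`-forms -/
  nondegenerate : ∀ (p : ZMod 2) (β : OneForm toGradedManifold.Fun),
    β.HasParity (toGradedManifold.par ⊤) (p + 1 + (m : ZMod 2)) →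
    ∃! v : toGradedManifold.Fun → toGradedManifold.Fun,
      IsDerAlong (toGradedManifold.par ⊤) (toGradedManifold.par ⊤) p id v ∧
      IsTargetContraction (toGradedManifold.par ⊤) p v α β
  /-- the cohomological vector field -/
  Q : toGradedManifold.Fun → toGradedManifold.Fun
  Q_der : IsDerAlong (toGradedManifold.par ⊤) (toGradedManifold.par ⊤) 1 id Q
  Q_degree : ∀ f, toGradedManifold.euler ⊤ (Q f) - Q (toGradedManifold.euler ⊤ f) = Q f
  Q_sq : ∀ f, Q (Q f) = 0
  /-- the potential -/
  Θ : toGradedManifold.Fun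
  Θ_parity : Θ ∈ toGradedManifold.par ⊤ ((m + 1 : ℤ) : ZMod 2)
  Θ_degree : toGradedManifold.euler ⊤ Θ = ((m + 1 : ℤ) : ℝ) • Θ
  /-- `ι_Q ω = dΘ` -/
  hamiltonian : IsTargetContraction (toGradedManifold.par ⊤) 1 Q α [(1, Θ)]
  /-- `{Θ, Θ} = Q Θ = 0` -/
  master : Q Θ = 0

/-! ### Differential forms on the source, with Grassmann coefficients -/

section Source

/-- `Λ(E^*) ⊗ Λ(V)` as the exterior algebra of `E^* ⊕ V`. -/
abbrev Fib (E V : Type*) [AddCommGroup E] [Module ℝ E] [AddCommGroup V] [Module ℝ V] : Type _ :=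
  ExteriorAlgebra ℝ (Module.Dual ℝ E × V)

/-- Pullback along a linear map `T : E → E'` and change of parameters along `L : V → V'`. -/
def fibMap {E E' V V' : Type*} [AddCommGroup E] [Module ℝ E] [AddCommGroup E'] [Module ℝ E']
    [AddCommGroup V] [Module ℝ V] [AddCommGroup V'] [Module ℝ V']
    (T : E →ₗ[ℝ] E') (L : V →ₗ[ℝ] V') : Fib E' V →ₐ[ℝ] Fib E V' :=
  ExteriorAlgebra.map (LinearMap.prodMap T.dualMap L)

/-- Applies a real-valued linear operation `T` (a derivative, an integral) to a function with
values in the finite-dimensional space `W`: `ℓ (vecOp T f) = T (ℓ ∘ f)` for all functionals `ℓ`. -/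
def vecOp {Y W : Type*} [AddCommGroup W] [Module ℝ W] (T : (Y → ℝ) → ℝ) (f : Y → W) : W :=
  open Classical in
  if h : ∃ w : W, ∀ l : Module.Dual ℝ W, l w = T (fun y => l (f y)) then h.choose else 0

variable {d : ℕ} {H : Type*} [TopologicalSpace H]
  (I : ModelWithCorners ℝ (EuclideanSpace ℝ (Fin d)) H)
  (N : Type*) [TopologicalSpace N] [ChartedSpace H N]
  (V : Type*) [AddCommGroup V] [Module ℝ V]

/-- Not necessarily smooth, inhomogeneous differential forms on `N` with coefficients in `Λ(V)`;
for a space `V` of odd parameters these are functions on `V × T[1]N`. -/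
abbrev Form : Type _ := ∀ x : N, Fib (TangentSpace I x) V

/-- Even and odd forms. -/
def Form.par (i : ZMod 2) : Submodule ℝ (Form I N V) :=
  Submodule.pi Set.univ fun x => Gr.par (Module.Dual ℝ (TangentSpace I x) × V) i

variable {N V}

/-- The derivative of the inverse of the chart at `x₀`. -/
def chartDeriv (x₀ : N) (y : EuclideanSpace ℝ (Fin d)) :
    EuclideanSpace ℝ (Fin d) →ₗ[ℝ] TangentSpace I ((extChartAt I x₀).symm y) :=
  (mfderivWithin 𝓘(ℝ, EuclideanSpace ℝ (Fin d)) I (extChartAt I x₀).symm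
    (Set.range I) y).toLinearMap

/-- The expression of a form in the chart at `x₀`. -/
def Form.inChart (β : Form I N V) (x₀ : N) (y : EuclideanSpace ℝ (Fin d)) :
    Fib (EuclideanSpace ℝ (Fin d)) V :=
  fibMap (chartDeriv I x₀ y) LinearMap.id (β ((extChartAt I x₀).symm y))

/-- Smooth forms. -/
def Form.IsSmooth (β : Form I N V) : Prop :=
  ∀ (x₀ : N) (l : Module.Dual ℝ (Fib (EuclideanSpace ℝ (Fin d)) V)),
    ContDiffOn ℝ ∞ (fun y => l (β.inChart I x₀ y)) (extChartAt I x₀).target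

/-- The generator `dy^i`. -/
def covec (d : ℕ) (V : Type*) [AddCommGroup V] [Module ℝ V] (i : Fin d) :
    Fib (EuclideanSpace ℝ (Fin d)) V :=
  ExteriorAlgebra.ι ℝ ((EuclideanSpace.proj (𝕜 := ℝ) i).toLinearMap, (0 : V))

/-- Contraction (from the left) with the `i`-th coordinate vector. -/
def contr {d : ℕ} {V : Type*} [AddCommGroup V] [Module ℝ V] (i : Fin d) :
    Fib (EuclideanSpace ℝ (Fin d)) V →ₗ[ℝ] Fib (EuclideanSpace ℝ (Fin d)) V :=
  CliffordAlgebra.contractLeft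
    ((Module.Dual.eval ℝ (EuclideanSpace ℝ (Fin d)) (EuclideanSpace.single i 1)).comp
      (LinearMap.fst ℝ (Module.Dual ℝ (EuclideanSpace ℝ (Fin d))) V))

/-- The coefficient in `Λ(V)` of `dy^0 ∧ … ∧ dy^(d-1)`, coefficients standing on the right. -/
def topCoeff {d : ℕ} {V : Type*} [AddCommGroup V] [Module ℝ V]
    (w : Fib (EuclideanSpace ℝ (Fin d)) V) : Gr V :=
  ExteriorAlgebra.map (LinearMap.snd ℝ (Module.Dual ℝ (EuclideanSpace ℝ (Fin d))) V)
    ((List.finRange d).foldl (fun u i => contr i u) w)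

/-- The exterior derivative `∑ dy^i ∧ ∂_i` in the chart at `x` (through which the tangent space at
`x` is identified with `ℝ^d`). It acts on coefficients in `Λ(V)` as constants standing on the
right. -/
def Form.exteriorDeriv (β : Form I N V) : Form I N V := fun x =>
  (∑ i : Fin d, covec d V i *
    vecOp (fun f => fderivWithin ℝ f (Set.range I) (extChartAt I x x) (EuclideanSpace.single i 1))
      (fun y => β.inChart I x y) : Fib (EuclideanSpace ℝ (Fin d)) V)

/-- The operator multiplying `r`-forms by `r`: the Euler vector field of `T[1]N`. -/
def Form.number (β : Form I N V) : Form I N V := fun x =>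
  (∑ i : Fin d, covec d V i * contr i (β x : Fib (EuclideanSpace ℝ (Fin d)) V) :
    Fib (EuclideanSpace ℝ (Fin d)) V)

/-- Elements of `Λ(V)` as constant forms of degree zero. -/
def Form.const (θ : Gr V) : Form I N V := fun x =>
  ExteriorAlgebra.map (LinearMap.inr ℝ (Module.Dual ℝ (TangentSpace I x)) V) θ

/-- Change of parameters. -/
def Form.bc {V' : Type*} [AddCommGroup V'] [Module ℝ V'] (L : V →ₗ[ℝ] V') (β : Form I N V) :
    Form I N V' := fun _ => fibMap LinearMap.id L (β _)

variable (N) in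
/-- Orientations of `N`, given by a continuous nowhere vanishing form of top degree (of which
only the sign is ever used). -/
structure Orient where
  vol : ∀ x : N, (TangentSpace I x) [⋀^Fin d]→ₗ[ℝ] ℝ
  ne_zero : ∀ x, vol x ≠ 0
  continuousOn : ∀ x₀ : N, ContinuousOn
    (fun y => vol ((extChartAt I x₀).symm y) fun i =>
      chartDeriv I x₀ y (EuclideanSpace.single i 1)) (extChartAt I x₀).target

variable [IsManifold I ∞ N] [T2Space N] [SigmaCompactSpace N]

variable (N) in
/-- A smooth partition of unity subordinate to the domains of the charts. -/
def chartPartition : SmoothPartitionOfUnity N I N Set.univ :=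
  (SmoothPartitionOfUnity.exists_isSubordinate_chartAt_source I N).choose

/-- The integral `∫_N β ∈ Λ(V)` over the oriented manifold `N`, defined by a partition of unity.
It is linear over constants in `Λ(V)` standing on the right. -/
def Form.integral (o : Orient I N) (β : Form I N V) : Gr V :=
  ∑ᶠ c : N, vecOp
    (fun f => ∫ y in (extChartAt I c).target, f y)
    (fun y =>
      ((SignType.sign (o.vol ((extChartAt I c).symm y) fun i =>
          chartDeriv I c y (EuclideanSpace.single i 1)) : ℝ) *
        chartPartition I N c ((extChartAt I c).symm y)) • topCoeff (β.inChart I c y))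

end Source

/-! ### The mapping space `Map(T[1]N, M)`

A superspace of maps is described by its points with values in Grassmann algebras `Λ(V)`: these
are the even homomorphisms from functions on the target to functions on `V × T[1]N`. A
differential form is a function of such a point `X` and of an odd tangent vector `ξ` at it
(the symbol `δX`), with values in `Λ(V)`. -/

section Mapping

variable {d : ℕ} {H : Type*} [TopologicalSpace H]
  (I : ModelWithCorners ℝ (EuclideanSpace ℝ (Fin d)) H)
  (N : Type*) [TopologicalSpace N] [ChartedSpace H N]
  {A : Type*} [Ring A] [Algebra ℝ A] (𝒜 : ZMod 2 → Submodule ℝ A)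

/-- `Λ(V)`-points of the mapping space. -/
def IsPoint (V : Type) [AddCommGroup V] [Module ℝ V] (X : A → Form I N V) : Prop :=
  IsSuperHom 𝒜 (Form.par I N V) X ∧ ∀ a, (X a).IsSmooth I

/-- Tangent vectors of parity `p` at a point of the mapping space. -/
def IsTangent (V : Type) [AddCommGroup V] [Module ℝ V] (p : ZMod 2) (X ζ : A → Form I N V) :
    Prop :=
  IsDerAlong 𝒜 (Form.par I N V) p X ζ ∧ ∀ a, (ζ a).IsSmooth I

variable (A) in
/-- Functions of `(X, ξ)`, among them the differential forms on the mapping space. -/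
def FForm : Type _ :=
  ∀ (V : Type) [AddCommGroup V] [Module ℝ V] [FiniteDimensional ℝ V],
    (A → Form I N V) → (A → Form I N V) → Gr V

variable (A) in
/-- Families of maps `X ↦ U_X`, among them the vector fields on the mapping space. -/
def FField : Type _ :=
  ∀ (V : Type) [AddCommGroup V] [Module ℝ V] [FiniteDimensional ℝ V],
    (A → Form I N V) → (A → Form I N V)

variable {I N}

/-- The linear combination `s Ψ + t Ψ'`. -/
def FForm.comb (s : ℝ) (Ψ : FForm I N A) (t : ℝ) (Ψ' : FForm I N A) : FForm I N A :=
  fun V _ _ _ X ξ => s • Ψ V X ξ + t • Ψ' V X ξ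

/-- The multiple `s Ψ`. -/
def FForm.smul (s : ℝ) (Ψ : FForm I N A) : FForm I N A := fun V _ _ _ X ξ => s • Ψ V X ξ

/-- The zero form. -/
def FForm.zero : FForm I N A := fun _ _ _ _ _ _ => 0

/-- `Ψ` is a form of degree `r` and total parity `c`, natural in the parameters. -/
def IsForm (r : ℕ) (c : ZMod 2) (Ψ : FForm I N A) : Prop :=
  ∀ (V : Type) [AddCommGroup V] [Module ℝ V] [FiniteDimensional ℝ V] (X ξ : A → Form I N V),
    IsPoint I N 𝒜 V X → IsTangent I N 𝒜 V 1 X ξ →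
      Ψ V X ξ ∈ Gr.par V c ∧
      (∀ t : ℝ, Ψ V X (fun a => t • ξ a) = t ^ r • Ψ V X ξ) ∧
      ∀ (V' : Type) [AddCommGroup V'] [Module ℝ V'] [FiniteDimensional ℝ V'] (L : V →ₗ[ℝ] V'),
        Ψ V' (fun a => (X a).bc I L) (fun a => (ξ a).bc I L) = ExteriorAlgebra.map L (Ψ V X ξ)

/-- `U` is a vector field of parity `p` on the mapping space, natural in the parameters. -/
def IsVectorField (p : ZMod 2) (U : FField I N A) : Prop :=
  ∀ (V : Type) [AddCommGroup V] [Module ℝ V] [FiniteDimensional ℝ V] (X : A → Form I N V),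
    IsPoint I N 𝒜 V X →
      IsTangent I N 𝒜 V p X (U V X) ∧
      ∀ (V' : Type) [AddCommGroup V'] [Module ℝ V'] [FiniteDimensional ℝ V'] (L : V →ₗ[ℝ] V')
        (a : A), U V' (fun a => (X a).bc I L) a = (U V X a).bc I L

/-- `δ Ψ = Ψ'` for the de Rham differential `δ` of the mapping space, the odd vector field
`X ↦ ξ`, `ξ ↦ 0`: for an additional odd parameter `η`,
`Ψ (X + η ξ, ξ) = Ψ (X, ξ) + η Ψ' (X, ξ)`. -/
def IsDelta (Ψ Ψ' : FForm I N A) : Prop :=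
  ∀ (V V' : Type) [AddCommGroup V] [Module ℝ V] [FiniteDimensional ℝ V]
    [AddCommGroup V'] [Module ℝ V'] [FiniteDimensional ℝ V'] (L : V →ₗ[ℝ] V')
    (X ξ : A → Form I N V), IsPoint I N 𝒜 V X → IsTangent I N 𝒜 V 1 X ξ →
    ∀ η ∈ Gr.par V' 1,
      Ψ V' (fun a => (X a).bc I L + Form.const I η * (ξ a).bc I L) (fun a => (ξ a).bc I L) =
        ExteriorAlgebra.map L (Ψ V X ξ) + η * ExteriorAlgebra.map L (Ψ' V X ξ)

/-- `ι_U Ψ = Ψ'` for a vector field `U` of parity `p`: for an additional parameter `θ` of parity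
`p + 1` and of square zero, `Ψ (X, ξ + θ U_X) = Ψ (X, ξ) + θ Ψ' (X, ξ)`. -/
def IsContraction (p : ZMod 2) (U : FField I N A) (Ψ Ψ' : FForm I N A) : Prop :=
  ∀ (V V' : Type) [AddCommGroup V] [Module ℝ V] [FiniteDimensional ℝ V]
    [AddCommGroup V'] [Module ℝ V'] [FiniteDimensional ℝ V'] (L : V →ₗ[ℝ] V')
    (X ξ : A → Form I N V), IsPoint I N 𝒜 V X → IsTangent I N 𝒜 V 1 X ξ →
    ∀ θ ∈ Gr.par V' (p + 1), θ * θ = 0 →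
      Ψ V' (fun a => (X a).bc I L)
          (fun a => (ξ a).bc I L + Form.const I θ * (U V X a).bc I L) =
        ExteriorAlgebra.map L (Ψ V X ξ) + θ * ExteriorAlgebra.map L (Ψ' V X ξ)

/-- `L_U Ψ = Λ` for a vector field `U` of parity `p`, by Cartan's formula
`L_U = ι_U δ + (-1)^p δ ι_U`. -/
def IsLieDerivative (p : ZMod 2) (U : FField I N A) (Ψ Λ : FForm I N A) : Prop :=
  ∃ dΨ ιdΨ ιΨ dιΨ : FForm I N A,
    IsDelta 𝒜 Ψ dΨ ∧ IsContraction 𝒜 p U dΨ ιdΨ ∧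
    IsContraction 𝒜 p U Ψ ιΨ ∧ IsDelta 𝒜 ιΨ dιΨ ∧
    ∀ (V : Type) [AddCommGroup V] [Module ℝ V] [FiniteDimensional ℝ V] (X ξ : A → Form I N V),
      IsPoint I N 𝒜 V X → IsTangent I N 𝒜 V 1 X ξ →
        Λ V X ξ = ιdΨ V X ξ + ksign p 1 • dιΨ V X ξ

/-- `Z` is the derivative of (the components of) the vector field `Y` along the vector field `U`
of parity `p`: for an additional parameter `θ` of parity `p` and of square zero,
`Y_{X + θ U_X} = Y_X + θ Z_X`. -/
def IsDirDeriv (p : ZMod 2) (U Y Z : FField I N A) : Prop :=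
  ∀ (V V' : Type) [AddCommGroup V] [Module ℝ V] [FiniteDimensional ℝ V]
    [AddCommGroup V'] [Module ℝ V'] [FiniteDimensional ℝ V'] (L : V →ₗ[ℝ] V')
    (X : A → Form I N V), IsPoint I N 𝒜 V X →
    ∀ θ ∈ Gr.par V' p, θ * θ = 0 → ∀ a : A,
      Y V' (fun a => (X a).bc I L + Form.const I θ * (U V X a).bc I L) a =
        (Y V X a).bc I L + Form.const I θ * (Z V X a).bc I L

/-- `[U, Y] = Z` for vector fields `U`, `Y` of parities `p`, `p'`. -/
def IsBracket (p p' : ZMod 2) (U Y Z : FField I N A) : Prop :=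
  ∃ Z₁ Z₂ : FField I N A, IsDirDeriv 𝒜 p U Y Z₁ ∧ IsDirDeriv 𝒜 p' Y U Z₂ ∧
    ∀ (V : Type) [AddCommGroup V] [Module ℝ V] [FiniteDimensional ℝ V] (X : A → Form I N V),
      IsPoint I N 𝒜 V X → ∀ a, Z V X a = Z₁ V X a - ksign p p' • Z₂ V X a

/-- The `2`-form `Ψ` is (weakly) nondegenerate: a tangent vector `ζ` of parity `p` with
`ι_ζ Ψ = 0` vanishes. -/
def IsNondegenerate (Ψ : FForm I N A) : Prop :=
  ∀ (V : Type) [AddCommGroup V] [Module ℝ V] [FiniteDimensional ℝ V] (X ζ : A → Form I N V)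
    (p : ZMod 2), IsPoint I N 𝒜 V X → IsTangent I N 𝒜 V p X ζ →
    (∀ (V' : Type) [AddCommGroup V'] [Module ℝ V'] [FiniteDimensional ℝ V'] (L : V →ₗ[ℝ] V')
      (ξ : A → Form I N V'), IsTangent I N 𝒜 V' 1 (fun a => (X a).bc I L) ξ →
      ∀ θ ∈ Gr.par V' (p + 1), θ * θ = 0 →
        Ψ V' (fun a => (X a).bc I L) (fun a => ξ a + Form.const I θ * (ζ a).bc I L) =
          Ψ V' (fun a => (X a).bc I L) ξ) →
    ∀ a, ζ a = 0

/-- The data of a BV theory on a stratum of dimension `d` and codimension `k`: a space of fields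
with Euler vector field `E` (which defines the ghost number), cohomological vector field `Q` of
ghost number `1`, exact symplectic form `Ω = (-1)^d δα` of ghost number `k - 1`, and action `S` of
ghost number `k`. -/
structure IsBVDatum (k : ℤ) (E Q : FField I N A) (α Ω S : FForm I N A) : Prop where
  E_field : IsVectorField 𝒜 0 E
  Q_field : IsVectorField 𝒜 1 Q
  Q_gh : IsBracket 𝒜 0 1 E Q Q
  Q_sq : IsBracket 𝒜 1 1 Q Q (fun _ _ _ _ _ _ => 0)
  α_form : IsForm 𝒜 1 (k : ZMod 2) α
  Ω_form : IsForm 𝒜 2 ((k + 1 : ℤ) : ZMod 2) Ω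
  S_form : IsForm 𝒜 0 (k : ZMod 2) S
  α_gh : IsLieDerivative 𝒜 0 E α (FForm.smul ((k - 1 : ℤ) : ℝ) α)
  Ω_gh : IsLieDerivative 𝒜 0 E Ω (FForm.smul ((k - 1 : ℤ) : ℝ) Ω)
  S_gh : IsLieDerivative 𝒜 0 E S (FForm.smul (k : ℝ) S)
  exact : ∃ δα : FForm I N A, IsDelta 𝒜 α δα ∧
    ∀ (V : Type) [AddCommGroup V] [Module ℝ V] [FiniteDimensional ℝ V] (X ξ : A → Form I N V),
      IsPoint I N 𝒜 V X → IsTangent I N 𝒜 V 1 X ξ → Ω V X ξ = (-1 : ℝ) ^ d • δα V X ξ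
  closed : IsDelta 𝒜 Ω FForm.zero
  nondegenerate : IsNondegenerate 𝒜 Ω

/-- On a closed stratum: `ι_Q Ω = (-1)^d δS` and `L_Q Ω = 0`. -/
structure IsClosedBVDatum (k : ℤ) (E Q : FField I N A) (α Ω S : FForm I N A) : Prop
    extends IsBVDatum 𝒜 k E Q α Ω S where
  hamiltonian : ∃ δS : FForm I N A, IsDelta 𝒜 S δS ∧
    IsContraction 𝒜 1 Q Ω (FForm.smul ((-1) ^ d) δS)
  invariant : IsLieDerivative 𝒜 1 Q Ω FForm.zero

end Mapping

/-! ### Boundaries -/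

section Boundary

variable {d : ℕ} {N B : Type*} [TopologicalSpace N] [ChartedSpace (EuclideanHalfSpace (d + 1)) N]
  [TopologicalSpace B] [ChartedSpace (EuclideanSpace ℝ (Fin d)) B]
  {A : Type*} [Ring A] [Algebra ℝ A] (𝒜 : ZMod 2 → Submodule ℝ A)

/-- `j : B → N` identifies the oriented manifold `B` with the boundary of `N`, oriented by the
rule "outward normal first". -/
structure IsOrientedBoundary (oN : Orient (𝓡∂ (d + 1)) N) (oB : Orient (𝓡 d) B) (j : B → N) :
    Prop where
  smooth : ContMDiff (𝓡 d) (𝓡∂ (d + 1)) ∞ j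
  embedding : Topology.IsEmbedding j
  immersion : ∀ b, Function.Injective (mfderiv (𝓡 d) (𝓡∂ (d + 1)) j b)
  range_eq : Set.range j = (𝓡∂ (d + 1)).boundary N
  orientation : ∀ b : B,
    0 < oN.vol (j b)
        (Fin.cons (-EuclideanSpace.single 0 1 : EuclideanSpace ℝ (Fin (d + 1)))
          fun i => mfderiv (𝓡 d) (𝓡∂ (d + 1)) j b (EuclideanSpace.single i (1 : ℝ))) *
      oB.vol b (fun i => (EuclideanSpace.single i (1 : ℝ) : EuclideanSpace ℝ (Fin d)))

/-- Pullback of forms along `j : B → N`. -/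
def Form.pull (j : B → N) {V : Type*} [AddCommGroup V] [Module ℝ V]
    (β : Form (𝓡∂ (d + 1)) N V) : Form (𝓡 d) B V := fun b =>
  fibMap (mfderiv (𝓡 d) (𝓡∂ (d + 1)) j b).toLinearMap LinearMap.id (β (j b))

/-- The pullback `π^*` of forms along the restriction map `π` of fields to the boundary. -/
def FForm.pull (j : B → N) (Ψ : FForm (𝓡 d) B A) : FForm (𝓡∂ (d + 1)) N A :=
  fun V _ _ _ X ξ => Ψ V (fun a => (X a).pull j) (fun a => (ξ a).pull j)

/-- `π_* U = U'` for the restriction map `π`. -/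
def IsProjectable (j : B → N) (U : FField (𝓡∂ (d + 1)) N A) (U' : FField (𝓡 d) B A) : Prop :=
  ∀ (V : Type) [AddCommGroup V] [Module ℝ V] [FiniteDimensional ℝ V]
    (X : A → Form (𝓡∂ (d + 1)) N V), IsPoint (𝓡∂ (d + 1)) N 𝒜 V X →
    ∀ a, (U V X a).pull j = U' V (fun a => (X a).pull j) a

/-- The compatibility of the data on `N` (of dimension `d + 1`) and on its boundary `B`. -/
structure IsBVBFVPair (j : B → N)
    (E Q : FField (𝓡∂ (d + 1)) N A) (Ω S : FForm (𝓡∂ (d + 1)) N A)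
    (E' Q' : FField (𝓡 d) B A) (α' : FForm (𝓡 d) B A) : Prop where
  /-- the restriction map is well defined on fields and on tangent vectors -/
  restrict_point : ∀ (V : Type) [AddCommGroup V] [Module ℝ V] [FiniteDimensional ℝ V]
    (X : A → Form (𝓡∂ (d + 1)) N V), IsPoint (𝓡∂ (d + 1)) N 𝒜 V X →
    IsPoint (𝓡 d) B 𝒜 V (fun a => (X a).pull j)
  restrict_tangent : ∀ (V : Type) [AddCommGroup V] [Module ℝ V] [FiniteDimensional ℝ V]
    (p : ZMod 2) (X ζ : A → Form (𝓡∂ (d + 1)) N V), IsPoint (𝓡∂ (d + 1)) N 𝒜 V X →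
    IsTangent (𝓡∂ (d + 1)) N 𝒜 V p X ζ →
    IsTangent (𝓡 d) B 𝒜 V p (fun a => (X a).pull j) (fun a => (ζ a).pull j)
  /-- the restriction map is a submersion -/
  submersion : ∀ (V : Type) [AddCommGroup V] [Module ℝ V] [FiniteDimensional ℝ V]
    (p : ZMod 2) (X : A → Form (𝓡∂ (d + 1)) N V) (ζ' : A → Form (𝓡 d) B V),
    IsPoint (𝓡∂ (d + 1)) N 𝒜 V X → IsTangent (𝓡 d) B 𝒜 V p (fun a => (X a).pull j) ζ' →
    ∃ ζ : A → Form (𝓡∂ (d + 1)) N V, IsTangent (𝓡∂ (d + 1)) N 𝒜 V p X ζ ∧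
      ∀ a, (ζ a).pull j = ζ' a
  E_project : IsProjectable 𝒜 j E E'
  Q_project : IsProjectable 𝒜 j Q Q'
  /-- `ι_Q Ω = (-1)^(dim N) δS + π^* α'` -/
  hamiltonian : ∃ δS : FForm (𝓡∂ (d + 1)) N A, IsDelta 𝒜 S δS ∧
    IsContraction 𝒜 1 Q Ω (FForm.comb ((-1) ^ (d + 1)) δS 1 (FForm.pull j α'))

end Boundary

/-! ### The AKSZ theory -/

section Theory

variable {m : ℤ} (M : HamiltonianDGManifold m) {d : ℕ} {H : Type*} [TopologicalSpace H]
  (I : ModelWithCorners ℝ (EuclideanSpace ℝ (Fin d)) H)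
  (N : Type*) [TopologicalSpace N] [ChartedSpace H N]

/-- The lift of the de Rham vector field of `T[1]N`. -/
def deRhamField : FField I N M.Fun := fun _ _ _ _ X a => (X a).exteriorDeriv I

/-- The lift of a vector field on the target. -/
def liftField (v : M.Fun → M.Fun) : FField I N M.Fun := fun _ _ _ _ X a => X (v a)

/-- The cohomological vector field `Q_N`. -/
def QField : FField I N M.Fun := fun V _ _ _ X a =>
  deRhamField M I N V X a + liftField M I N M.Q V X a

/-- The graded Euler vector field of the mapping space: the lift of the Euler vector field of the
target minus the lift of the Euler vector field of `T[1]N`. -/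
def EField : FField I N M.Fun := fun V _ _ _ X a =>
  liftField M I N (M.euler ⊤) V X a - (X a).number I

variable {N} [IsManifold I ∞ N] [T2Space N] [SigmaCompactSpace N] (o : Orient I N)

/-- `α_N`, the transgression of `α`. -/
def alphaForm : FForm I N M.Fun := fun _ _ _ _ X ξ => (evalOne X ξ M.α).integral I o

/-- `ω_N`, the transgression of `ω = dα`. -/
def omegaForm : FForm I N M.Fun := fun _ _ _ _ _ ξ => (evalD ξ M.α).integral I o

/-- The action `S_N`, the sum of the kinetic part `∫ α_a(X) dX^a` and of the interaction part
`∫ Θ(X)`. -/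
def action : FForm I N M.Fun := fun V _ _ _ X _ =>
  (evalOne X (deRhamField M I N V X) M.α).integral I o + (X M.Θ).integral I o

end Theory

end AKSZ

end

open scoped Manifold ContDiff Topology
open TopologicalSpace
noncomputable section
namespace AKSZ
set_option linter.unusedSectionVars false

/-! ### Koszul signs -/

/-! At a point `x` of `N`, a form with coefficients in `Λ(V)` is an element of the exterior algebra
of `T_x^*N ⊕ V`, again a Grassmann algebra. A field `X` and a variation `ξ` therefore give, at every
`x`, a Grassmann-valued point of the odd tangent bundle of the target (`IsPoint.targetPoint`). Every
hypothesis on the target (parity and degree of `α`, `ι_Q ω = dΘ`, nondegeneracy) can thus be used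
pointwise on `N` for the integrands of `α_N`, `ω_N` and `S_N`. What remains is the calculus of these
integrands: a first order variation rule, the exterior derivative of `N`, integration, and Stokes'
theorem.

Variations. Both `δ` and `ι_U` are defined by the coefficient of an auxiliary parameter `θ`. The
relation `Form.IsShift` records such a first order expansion and obeys Leibniz rules with Koszul
signs. Pulling `θ` out of the integral costs `(-1)^(d|θ|)`; this is the origin of every `(-1)^d` in
the statement (`isDelta_integral`, `isContraction_integral`). Conversely, a coefficient can be
recovered from its product with a fresh parameter (`Gr.exists_fresh`).

The vector fields. `Q_N² = 0` holds because `d² = 0`, `Q² = 0` and the cross terms cancel. Since `d`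
raises the form degree by one and the degree operator of `T[1]N` enters `E_N` with a minus sign, `d`
and `Q` both have ghost number `1`. Integration retains only the forms of degree `d`, so a target
degree `m = n - 1` becomes the ghost number `m - d = k - 1`; the extra `d` in the kinetic term gives
`k` for the action.

The Hamiltonian identity. The integrand of `ι_{Q_N} ω_N` equals the integrand of the variation of
`S_N` plus the exact term `d(∑ α_a(X) ξ^a)`: this is the Leibniz rule combined with `ι_Q ω = dΘ`
(`omegaContraction_eq`). Stokes' theorem makes the exact term vanish on a closed manifold and turns
it into `π^* α_{∂N}` otherwise (`Form.integral_exteriorDeriv_closed`, `IsOrientedBoundary.stokes`).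
Both versions come from the divergence theorem on a box, a partition of unity, and a change of
variables valid in any coordinates (`Form.integral_eq_of_coordinates`).

Weak nondegeneracy. For a homogeneous function `g` with Hamiltonian field `v`, pairing `ζ` with the
variation `φ X∘v`, where `φ` is a parameter times a form `u`, yields `∫ u ζ(g)` up to parameters and
signs. If this vanishes for all `u`, then `ζ(g) = 0`, by the fundamental lemma of the calculus of
variations and the nondegeneracy of the wedge product (`Form.eq_zero_of_integral`).

Submersion. Writing `ω` as a finite sum `∑ df dg` and using Hamiltonian fields, every tangent vector
is a combination `ζ = ∑ ζ(f_e) X∘v_e` with finitely many fixed `f_e` and `v_e`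
(`exists_generators`). It suffices to extend the finitely many forms `ζ(f_e)` from the boundary,
which local retractions and a partition of unity achieve (`IsOrientedBoundary.exists_comap_eq`). -/

@[simp] theorem ksign_zero_left (j : ZMod 2) : ksign 0 j = 1 := by simp [ksign]
@[simp] theorem ksign_zero_right (i : ZMod 2) : ksign i 0 = 1 := by simp [ksign]
@[simp] theorem ksign_one_one : ksign 1 1 = -1 := by simp [ksign]

theorem zmod_two_cases (i : ZMod 2) : i = 0 ∨ i = 1 := by
  revert i; decide

theorem ksign_add_left (i j k : ZMod 2) : ksign (i + j) k = ksign i k * ksign j k := by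
  have h : (1 + 1 : ZMod 2) = 0 := by decide
  rcases zmod_two_cases i with rfl | rfl <;> rcases zmod_two_cases j with rfl | rfl <;>
    rcases zmod_two_cases k with rfl | rfl <;> simp [h]

theorem ksign_comm (i j : ZMod 2) : ksign i j = ksign j i := by
  simp [ksign, and_comm]

theorem ksign_mul_self (i j : ZMod 2) : ksign i j * ksign i j = 1 := by
  rcases zmod_two_cases i with rfl | rfl <;> rcases zmod_two_cases j with rfl | rfl <;> simp

theorem ksign_natCast_one (d : ℕ) : ksign (d : ZMod 2) 1 = (-1) ^ d := by
  induction d with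
  | zero => simp
  | succ d ih => rw [Nat.cast_succ, ksign_add_left, ih, pow_succ]; simp

theorem two_zmod (i : ZMod 2) : i + i = 0 := by revert i; decide

/-! ### Grassmann algebras -/

section Grassmann

variable {V V' V'' : Type*} [AddCommGroup V] [Module ℝ V] [AddCommGroup V'] [Module ℝ V']
  [AddCommGroup V''] [Module ℝ V'']

/-- The grading automorphism `u ↦ (-1)^|u| u`. -/
def gradeInv : Gr V →ₐ[ℝ] Gr V := CliffordAlgebra.involute

@[simp] theorem gradeInv_ι (v : V) : gradeInv (ExteriorAlgebra.ι ℝ v) = -ExteriorAlgebra.ι ℝ v :=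
  CliffordAlgebra.involute_ι v

@[simp] theorem gradeInv_gradeInv (u : Gr V) : gradeInv (gradeInv u) = u :=
  CliffordAlgebra.involute_involute u

namespace Gr

theorem one_mem : (1 : Gr V) ∈ Gr.par V 0 := SetLike.one_mem_graded (Gr.par V)

theorem mul_mem {i j : ZMod 2} {u v : Gr V} (hu : u ∈ Gr.par V i) (hv : v ∈ Gr.par V j) :
    u * v ∈ Gr.par V (i + j) := SetLike.mul_mem_graded (A := Gr.par V) hu hv

theorem ι_mem (v : V) : ExteriorAlgebra.ι ℝ v ∈ Gr.par V 1 :=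
  CliffordAlgebra.ι_mem_evenOdd_one _ v

theorem gradeInv_even {u : Gr V} (hu : u ∈ Gr.par V 0) : gradeInv u = u :=
  CliffordAlgebra.involute_eq_of_mem_even hu

theorem gradeInv_odd {u : Gr V} (hu : u ∈ Gr.par V 1) : gradeInv u = -u :=
  CliffordAlgebra.involute_eq_of_mem_odd hu

theorem gradeInv_of_mem {i : ZMod 2} {u : Gr V} (hu : u ∈ Gr.par V i) :
    gradeInv u = ksign i 1 • u := by
  rcases zmod_two_cases i with rfl | rfl
  · simp [gradeInv_even hu]
  · simp [gradeInv_odd hu]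

theorem exists_add (u : Gr V) : ∃ a ∈ Gr.par V 0, ∃ b ∈ Gr.par V 1, a + b = u :=
  Submodule.mem_sup.1 ((CliffordAlgebra.evenOdd_isCompl (0 : QuadraticForm ℝ V)).sup_eq_top ▸
    Submodule.mem_top (x := u))

theorem eq_zero_of_mem {i : ZMod 2} {u : Gr V} (h₁ : u ∈ Gr.par V i) (h₂ : u ∈ Gr.par V (i + 1)) :
    u = 0 := by
  have h := (CliffordAlgebra.evenOdd_isCompl (0 : QuadraticForm ℝ V)).disjoint
  rw [Submodule.disjoint_def] at h
  rcases zmod_two_cases i with rfl | rfl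
  · exact h u h₁ (by simpa using h₂)
  · exact h u (by simpa [show (1 + 1 : ZMod 2) = 0 by decide] using h₂) h₁

theorem mul_ι (u : Gr V) (v : V) :
    u * ExteriorAlgebra.ι ℝ v = ExteriorAlgebra.ι ℝ v * gradeInv u := by
  induction u using CliffordAlgebra.left_induction with
  | algebraMap r => rw [AlgHom.commutes]; exact Algebra.commutes r _
  | add x y hx hy => rw [add_mul, map_add, mul_add, hx, hy]
  | ι_mul x m hx =>
    have h := ExteriorAlgebra.ι_add_mul_swap (R := ℝ) m v
    have h' : ExteriorAlgebra.ι ℝ m * ExteriorAlgebra.ι ℝ v =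
      -(ExteriorAlgebra.ι ℝ v * ExteriorAlgebra.ι ℝ m) := eq_neg_of_add_eq_zero_left h
    change ExteriorAlgebra.ι ℝ m * x * _ = _ * gradeInv (ExteriorAlgebra.ι ℝ m * x)
    rw [mul_assoc, hx, ← mul_assoc, h', map_mul, gradeInv_ι]
    simp [mul_assoc]

theorem mul_ι_mul_ι (u : Gr V) (v w : V) :
    u * (ExteriorAlgebra.ι ℝ v * ExteriorAlgebra.ι ℝ w) =
      ExteriorAlgebra.ι ℝ v * ExteriorAlgebra.ι ℝ w * u := by
  rw [← mul_assoc, mul_ι u v, mul_assoc, mul_ι, gradeInv_gradeInv, ← mul_assoc]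

theorem mul_even {θ : Gr V} (hθ : θ ∈ Gr.par V 0) (u : Gr V) : u * θ = θ * u := by
  induction θ, hθ using CliffordAlgebra.even_induction with
  | algebraMap r => exact (Algebra.commutes r u).symm
  | add x y hx hy ihx ihy => rw [mul_add, add_mul, ihx, ihy]
  | ι_mul_ι_mul m₁ m₂ x hx ih =>
    change u * (ExteriorAlgebra.ι ℝ m₁ * ExteriorAlgebra.ι ℝ m₂ * x) =
      ExteriorAlgebra.ι ℝ m₁ * ExteriorAlgebra.ι ℝ m₂ * x * u
    rw [mul_assoc _ x u, ← ih, ← mul_assoc, mul_ι_mul_ι, mul_assoc _ u]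

theorem mul_odd {θ : Gr V} (hθ : θ ∈ Gr.par V 1) (u : Gr V) : u * θ = θ * gradeInv u := by
  induction θ, hθ using CliffordAlgebra.odd_induction with
  | ι v => exact mul_ι u v
  | add x y hx hy ihx ihy => rw [mul_add, add_mul, ihx, ihy]
  | ι_mul_ι_mul m₁ m₂ x hx ih =>
    change u * (ExteriorAlgebra.ι ℝ m₁ * ExteriorAlgebra.ι ℝ m₂ * x) =
      ExteriorAlgebra.ι ℝ m₁ * ExteriorAlgebra.ι ℝ m₂ * x * gradeInv u
    rw [mul_assoc _ x (gradeInv u), ← ih, ← mul_assoc, mul_ι_mul_ι, mul_assoc _ u]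

theorem supercomm {i j : ZMod 2} {u v : Gr V} (hu : u ∈ Gr.par V i) (hv : v ∈ Gr.par V j) :
    u * v = ksign i j • (v * u) := by
  rcases zmod_two_cases j with rfl | rfl
  · simp [mul_even hv]
  · rw [mul_odd hv, gradeInv_of_mem hu, mul_smul_comm]

theorem eq_zero_of_eq_neg {u : Gr V} (h : u = -u) : u = 0 := by
  have h' : (2 : ℝ) • u = 0 := by rw [two_smul]; nth_rewrite 2 [h]; exact add_neg_cancel u
  exact (smul_eq_zero_iff_right two_ne_zero).1 h'

theorem mem_of_gradeInv {i : ZMod 2} {u : Gr V} (h : gradeInv u = ksign i 1 • u) :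
    u ∈ Gr.par V i := by
  obtain ⟨a, ha, b, hb, rfl⟩ := exists_add u
  rw [map_add, gradeInv_even ha, gradeInv_odd hb] at h
  rcases zmod_two_cases i with rfl | rfl
  · simp only [ksign_zero_left, one_smul] at h
    rw [eq_zero_of_eq_neg (add_left_cancel h).symm, add_zero]; exact ha
  · simp only [ksign_one_one, neg_smul, one_smul, neg_add] at h
    rw [eq_zero_of_eq_neg (add_right_cancel h), zero_add]; exact hb

theorem sq_odd {θ : Gr V} (hθ : θ ∈ Gr.par V 1) : θ * θ = 0 := by
  have h := mul_odd hθ θ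
  rw [gradeInv_odd hθ, mul_neg] at h
  exact eq_zero_of_eq_neg h

theorem mul_mul_self {i : ZMod 2} {θ : Gr V} (hθ : θ ∈ Gr.par V i) (h : θ * θ = 0) (u : Gr V) :
    θ * (u * θ) = 0 := by
  rcases zmod_two_cases i with rfl | rfl
  · rw [mul_even hθ, ← mul_assoc, h, zero_mul]
  · rw [mul_odd hθ, ← mul_assoc, h, zero_mul]

theorem map_map (L : V →ₗ[ℝ] V') (L' : V' →ₗ[ℝ] V'') (u : Gr V) :
    ExteriorAlgebra.map L' (ExteriorAlgebra.map L u) = ExteriorAlgebra.map (L' ∘ₗ L) u := by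
  rw [← ExteriorAlgebra.map_comp_map]; rfl

/-- Contraction with a covector. -/
def con (f : Module.Dual ℝ V) : Gr V →ₗ[ℝ] Gr V :=
  CliffordAlgebra.contractLeft (Q := (0 : QuadraticForm ℝ V)) f

theorem con_ι_mul (f : Module.Dual ℝ V) (v : V) (u : Gr V) :
    con f (ExteriorAlgebra.ι ℝ v * u) = f v • u - ExteriorAlgebra.ι ℝ v * con f u :=
  CliffordAlgebra.contractLeft_ι_mul f v u

@[simp] theorem con_one (f : Module.Dual ℝ V) : con f 1 = 0 := CliffordAlgebra.contractLeft_one _ _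

@[simp] theorem con_algebraMap (f : Module.Dual ℝ V) (r : ℝ) : con f (algebraMap ℝ _ r) = 0 :=
  CliffordAlgebra.contractLeft_algebraMap _ _ r

theorem con_con (f : Module.Dual ℝ V) (u : Gr V) : con f (con f u) = 0 :=
  CliffordAlgebra.contractLeft_contractLeft _ u

theorem con_comm (f g : Module.Dual ℝ V) (u : Gr V) : con f (con g u) = -con g (con f u) :=
  CliffordAlgebra.contractLeft_comm _ _ u

@[simp] theorem con_zero (u : Gr V) : con 0 u = 0 := by simp [con]

theorem induction {P : Gr V → Prop} (u : Gr V) (algebraMap : ∀ r : ℝ, P (algebraMap ℝ _ r))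
    (add : ∀ x y, P x → P y → P (x + y))
    (ι_mul : ∀ x v, P x → P (ExteriorAlgebra.ι ℝ v * x)) : P u :=
  CliffordAlgebra.left_induction (Q := (0 : QuadraticForm ℝ V)) algebraMap add ι_mul u

theorem gradeInv_map (L : V →ₗ[ℝ] V') (u : Gr V) :
    gradeInv (ExteriorAlgebra.map L u) = ExteriorAlgebra.map L (gradeInv u) := by
  induction u using Gr.induction with
  | algebraMap r => simp
  | add x y hx hy => simp [hx, hy]
  | ι_mul x v hx => simp [hx]

theorem map_mem (L : V →ₗ[ℝ] V') {i : ZMod 2} {u : Gr V} (hu : u ∈ Gr.par V i) :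
    ExteriorAlgebra.map L u ∈ Gr.par V' i :=
  mem_of_gradeInv (by rw [gradeInv_map, gradeInv_of_mem hu, map_smul])

theorem con_map (L : V →ₗ[ℝ] V') (f : Module.Dual ℝ V') (u : Gr V) :
    con f (ExteriorAlgebra.map L u) = ExteriorAlgebra.map L (con (f ∘ₗ L) u) := by
  induction u using Gr.induction with
  | algebraMap r => simp
  | add x y hx hy => simp [hx, hy]
  | ι_mul x v hx => simp [con_ι_mul, hx]

theorem con_mul (f : Module.Dual ℝ V) (u v : Gr V) :
    con f (u * v) = con f u * v + gradeInv u * con f v := by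
  induction u using Gr.induction with
  | algebraMap r => simp [← Algebra.smul_def]
  | add x y hx hy => rw [add_mul, map_add, map_add, map_add, hx, hy]; noncomm_ring
  | ι_mul x w hx =>
    rw [mul_assoc, con_ι_mul, hx, con_ι_mul, map_mul, gradeInv_ι, sub_mul, smul_mul_assoc]
    noncomm_ring

theorem con_mem (f : Module.Dual ℝ V) {i : ZMod 2} {u : Gr V} (hu : u ∈ Gr.par V i) :
    con f u ∈ Gr.par V (i + 1) := by
  have key : ∀ u : Gr V, gradeInv (con f u) = - con f (gradeInv u) := by
    intro u
    induction u using Gr.induction with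
    | algebraMap r => simp
    | add x y hx hy => simp only [map_add, hx, hy, neg_add]
    | ι_mul x w hx =>
      have h : -ExteriorAlgebra.ι ℝ w = ExteriorAlgebra.ι ℝ (-w) := (map_neg _ w).symm
      rw [con_ι_mul, map_sub, map_smul, map_mul, map_mul, hx, gradeInv_ι, h, con_ι_mul]
      simp only [map_neg, neg_mul, mul_neg, neg_neg, neg_smul, neg_sub]
      abel
  refine mem_of_gradeInv ?_
  rw [key, gradeInv_of_mem hu, map_smul, ksign_add_left, ksign_one_one, mul_neg_one, neg_smul]

/-- A Grassmann parameter independent of the given ones. -/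
theorem exists_fresh (V : Type) [AddCommGroup V] [Module ℝ V] [FiniteDimensional ℝ V]
    (i : ZMod 2) :
    ∃ (V' : Type) (_ : AddCommGroup V') (_ : Module ℝ V') (_ : FiniteDimensional ℝ V')
      (L : V →ₗ[ℝ] V') (θ : Gr V'), θ ∈ Gr.par V' i ∧ θ * θ = 0 ∧
      (∀ w : Gr V, θ * ExteriorAlgebra.map L w = 0 → w = 0) ∧
      ∀ (w : Gr V) (k : ZMod 2), θ * ExteriorAlgebra.map L w ∈ Gr.par V' (i + k) →
        w ∈ Gr.par V k := by
  let f : Module.Dual ℝ (V × (ℝ × ℝ)) := LinearMap.fst ℝ ℝ ℝ ∘ₗ LinearMap.snd ℝ V (ℝ × ℝ)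
  let g : Module.Dual ℝ (V × (ℝ × ℝ)) := LinearMap.snd ℝ ℝ ℝ ∘ₗ LinearMap.snd ℝ V (ℝ × ℝ)
  let a : V × (ℝ × ℝ) := (0, (1, 0))
  let b : V × (ℝ × ℝ) := (0, (0, 1))
  let L : V →ₗ[ℝ] V × (ℝ × ℝ) := LinearMap.inl ℝ V (ℝ × ℝ)
  let P : V × (ℝ × ℝ) →ₗ[ℝ] V := LinearMap.fst ℝ V (ℝ × ℝ)
  have hPL : ∀ w : Gr V, ExteriorAlgebra.map P (ExteriorAlgebra.map L w) = w := by
    intro w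
    rw [map_map, show P ∘ₗ L = LinearMap.id from LinearMap.fst_comp_inl _ _ _,
      ExteriorAlgebra.map_id]; rfl
  have hf : ∀ w : Gr V, con f (ExteriorAlgebra.map L w) = 0 := by
    intro w
    rw [con_map, show f ∘ₗ L = 0 from rfl]; simp
  have hg : ∀ w : Gr V, con g (ExteriorAlgebra.map L w) = 0 := by
    intro w
    rw [con_map, show g ∘ₗ L = 0 from rfl]; simp
  have ha : ∀ w : Gr (V × (ℝ × ℝ)), con f (ExteriorAlgebra.ι ℝ a * w) =
      w - ExteriorAlgebra.ι ℝ a * con f w := by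
    intro w; rw [con_ι_mul, show f a = 1 from rfl, one_smul]
  have hb : ∀ w : Gr (V × (ℝ × ℝ)), con g (ExteriorAlgebra.ι ℝ b * w) =
      w - ExteriorAlgebra.ι ℝ b * con g w := by
    intro w; rw [con_ι_mul, show g b = 1 from rfl, one_smul]
  have hab : ∀ w : Gr (V × (ℝ × ℝ)), con f (ExteriorAlgebra.ι ℝ b * w) =
      - (ExteriorAlgebra.ι ℝ b * con f w) := by
    intro w; rw [con_ι_mul, show f b = 0 from rfl, zero_smul, zero_sub]
  rcases zmod_two_cases i with rfl | rfl
  -- An even parameter of square zero must be a product of two new odd generators. Contracting with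
  -- both dual covectors and projecting back to `V` is a left inverse of multiplication by it, which
  -- gives both the cancellation and the parity statement.
  · have key : ∀ w : Gr V, ExteriorAlgebra.map P (con g (con f
        (ExteriorAlgebra.ι ℝ a * ExteriorAlgebra.ι ℝ b * ExteriorAlgebra.map L w))) = w := by
      intro w
      rw [mul_assoc, ha, hab, hf, mul_zero, neg_zero, mul_zero, sub_zero, hb, hg, mul_zero,
        sub_zero, hPL]
    refine ⟨V × (ℝ × ℝ), inferInstance, inferInstance, inferInstance, L,
      ExteriorAlgebra.ι ℝ a * ExteriorAlgebra.ι ℝ b, mul_mem (i := 1) (j := 1) (ι_mem a) (ι_mem b),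
      ?_, ?_, ?_⟩
    · rw [mul_assoc, mul_ι (ExteriorAlgebra.ι ℝ a) b, ← mul_assoc (ExteriorAlgebra.ι ℝ b),
        ExteriorAlgebra.ι_sq_zero, zero_mul, mul_zero]
    · intro w hw
      rw [← key w, hw]; simp
    · intro w k hw
      rw [← key w]
      have := map_mem P (con_mem g (con_mem f hw))
      rwa [show (0 + k + 1 + 1 : ZMod 2) = k by
        rw [zero_add, add_assoc, two_zmod, add_zero]] at this
  · have key : ∀ w : Gr V, ExteriorAlgebra.map P (con f
        (ExteriorAlgebra.ι ℝ a * ExteriorAlgebra.map L w)) = w := by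
      intro w
      rw [ha, hf, mul_zero, sub_zero, hPL]
    refine ⟨V × (ℝ × ℝ), inferInstance, inferInstance, inferInstance, L,
      ExteriorAlgebra.ι ℝ a, ι_mem a, ExteriorAlgebra.ι_sq_zero a, ?_, ?_⟩
    · intro w hw
      rw [← key w, hw]; simp
    · intro w k hw
      rw [← key w]
      have := map_mem P (con_mem f hw)
      rwa [show (1 + k + 1 : ZMod 2) = k by
        rw [add_comm 1 k, add_assoc, two_zmod, add_zero]] at this

end Gr

end Grassmann

/-! ### The exterior algebra of `E^* ⊕ V` -/

/-- Euclidean space. -/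
abbrev Eu (d : ℕ) : Type := EuclideanSpace ℝ (Fin d)

instance finite_gr (V : Type*) [AddCommGroup V] [Module ℝ V] [FiniteDimensional ℝ V] :
    Module.Finite ℝ (Gr V) :=
  Module.Finite.of_basis (Module.Basis.ExteriorAlgebra (Module.finBasis ℝ V))

section Fib

variable {E E' E'' V V' V'' : Type*} [AddCommGroup E] [Module ℝ E] [AddCommGroup E'] [Module ℝ E']
  [AddCommGroup E''] [Module ℝ E''] [AddCommGroup V] [Module ℝ V] [AddCommGroup V'] [Module ℝ V']
  [AddCommGroup V''] [Module ℝ V'']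

/-- The part of degree zero in `E^*`. -/
def coeffMap : Fib E V →ₐ[ℝ] Gr V := ExteriorAlgebra.map (LinearMap.snd ℝ (Module.Dual ℝ E) V)

/-- Coefficients as elements of degree zero in `E^*`. -/
def constMap : Gr V →ₐ[ℝ] Fib E V := ExteriorAlgebra.map (LinearMap.inr ℝ (Module.Dual ℝ E) V)

@[simp] theorem coeffMap_constMap (θ : Gr V) : coeffMap (E := E) (constMap θ) = θ := by
  rw [coeffMap, constMap, Gr.map_map, LinearMap.snd_comp_inr, ExteriorAlgebra.map_id]; rfl

theorem fibMap_fibMap (T : E →ₗ[ℝ] E') (T' : E' →ₗ[ℝ] E'') (L : V →ₗ[ℝ] V') (L' : V' →ₗ[ℝ] V'')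
    (u : Fib E'' V) : fibMap T L' (fibMap T' L u) = fibMap (T' ∘ₗ T) (L' ∘ₗ L) u := by
  rw [fibMap, fibMap, Gr.map_map]; rfl

theorem fibMap_id (u : Fib E V) : fibMap LinearMap.id LinearMap.id u = u := by
  rw [fibMap, LinearMap.dualMap_id, LinearMap.prodMap_id, ExteriorAlgebra.map_id]; rfl

@[simp] theorem fibMap_ι (T : E →ₗ[ℝ] E') (L : V →ₗ[ℝ] V') (a : Module.Dual ℝ E') (v : V) :
    fibMap T L (ExteriorAlgebra.ι ℝ (a, v)) = ExteriorAlgebra.ι ℝ (a ∘ₗ T, L v) :=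
  ExteriorAlgebra.map_apply_ι _ _

theorem fibMap_constMap (T : E →ₗ[ℝ] E') (L : V →ₗ[ℝ] V') (θ : Gr V) :
    fibMap T L (constMap θ) = constMap (ExteriorAlgebra.map L θ) := by
  rw [fibMap, constMap, constMap, Gr.map_map, Gr.map_map]
  congr 2

theorem coeffMap_fibMap (T : E →ₗ[ℝ] E') (L : V →ₗ[ℝ] V') (u : Fib E' V) :
    coeffMap (fibMap T L u) = ExteriorAlgebra.map L (coeffMap u) := by
  rw [fibMap, coeffMap, coeffMap, Gr.map_map, Gr.map_map]; rfl

theorem fibMap_mem (T : E →ₗ[ℝ] E') (L : V →ₗ[ℝ] V') {i : ZMod 2} {u : Fib E' V}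
    (hu : u ∈ Gr.par _ i) : fibMap T L u ∈ Gr.par _ i := Gr.map_mem _ hu

theorem gradeInv_fibMap (T : E →ₗ[ℝ] E') (L : V →ₗ[ℝ] V') (u : Fib E' V) :
    gradeInv (fibMap T L u) = fibMap T L (gradeInv u) := Gr.gradeInv_map _ u

theorem constMap_mem {i : ZMod 2} {θ : Gr V} (hθ : θ ∈ Gr.par _ i) :
    constMap (E := E) θ ∈ Gr.par _ i := Gr.map_mem _ hθ

/-- Contraction with a vector. -/
def conV (v : E) : Fib E V →ₗ[ℝ] Fib E V :=
  Gr.con ((Module.Dual.eval ℝ E v).comp (LinearMap.fst ℝ (Module.Dual ℝ E) V))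

theorem conV_ι_mul (v : E) (a : Module.Dual ℝ E) (w : V) (u : Fib E V) :
    conV v (ExteriorAlgebra.ι ℝ (a, w) * u) = a v • u - ExteriorAlgebra.ι ℝ (a, w) * conV v u :=
  Gr.con_ι_mul _ _ _

theorem conV_fibMap (T : E →ₗ[ℝ] E') (L : V →ₗ[ℝ] V') (v : E) (u : Fib E' V) :
    conV v (fibMap T L u) = fibMap T L (conV (T v) u) := Gr.con_map _ _ _

@[simp] theorem conV_constMap (v : E) (θ : Gr V) : conV v (constMap θ) = 0 := by
  rw [conV, constMap, Gr.con_map]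
  have : ((Module.Dual.eval ℝ E v).comp (LinearMap.fst ℝ (Module.Dual ℝ E) V)) ∘ₗ
      LinearMap.inr ℝ (Module.Dual ℝ E) V = 0 := by ext; simp
  rw [this]; simp

theorem conV_mul (v : E) (u w : Fib E V) : conV v (u * w) = conV v u * w + gradeInv u * conV v w :=
  Gr.con_mul _ _ _

theorem conV_mem (v : E) {i : ZMod 2} {u : Fib E V} (hu : u ∈ Gr.par _ i) :
    conV v u ∈ Gr.par _ (i + 1) := Gr.con_mem _ hu

theorem conV_conV (v : E) (u : Fib E V) : conV v (conV v u) = 0 := Gr.con_con _ u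

theorem conV_comm (v w : E) (u : Fib E V) : conV v (conV w u) = -conV w (conV v u) :=
  Gr.con_comm _ _ u

theorem conV_add (v w : E) (u : Fib E V) : conV (v + w) u = conV v u + conV w u := by
  rw [conV, conV, conV, map_add]
  simp [Gr.con, LinearMap.add_comp]

theorem conV_smul (t : ℝ) (v : E) (u : Fib E V) : conV (t • v) u = t • conV v u := by
  rw [conV, conV, map_smul]
  simp [Gr.con, LinearMap.smul_comp]

/-- `conV` as a linear map into the opposite of the endomorphism algebra. -/
def conOp : E →ₗ[ℝ] (Module.End ℝ (Fib E V))ᵐᵒᵖ where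
  toFun v := MulOpposite.op (conV v)
  map_add' v w := by
    exact MulOpposite.unop_injective (LinearMap.ext fun u => conV_add v w u)
  map_smul' t v := by
    exact MulOpposite.unop_injective (LinearMap.ext fun u => conV_smul t v u)

/-- Iterated contraction, as an alternating map of the vectors. -/
def conAlt (n : ℕ) (w : Fib E V) : E [⋀^Fin n]→ₗ[ℝ] Fib E V :=
  LinearMap.compAlternatingMap
    ((LinearMap.applyₗ w) ∘ₗ (MulOpposite.opLinearEquiv ℝ).symm.toLinearMap ∘ₗ
      (ExteriorAlgebra.lift ℝ ⟨conOp (E := E) (V := V), fun v =>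
        MulOpposite.unop_injective (LinearMap.ext fun u => conV_conV v u)⟩).toLinearMap)
    (ExteriorAlgebra.ιMulti ℝ n)

/-- A left fold applies the first vector first, whereas a product of endomorphisms applies the last
one first; this is why the contractions are collected in the opposite algebra. -/
theorem foldl_conV (l : List E) (w : Fib E V) :
    l.foldl (fun u v => conV v u) w = ((l.map (conOp (E := E) (V := V))).prod).unop w := by
  induction l generalizing w with
  | nil => simp
  | cons v l ih => rw [List.foldl_cons, ih]; simp [conOp]

theorem conAlt_apply (n : ℕ) (w : Fib E V) (v : Fin n → E) :
    conAlt n w v = (List.finRange n).foldl (fun u i => conV (v i) u) w := by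
  rw [← List.foldl_map (f := v) (g := fun u x => conV x u), foldl_conV]
  change ((ExteriorAlgebra.lift ℝ ⟨conOp (E := E) (V := V), _⟩)
    (ExteriorAlgebra.ιMulti ℝ n v)).unop w = _
  rw [ExteriorAlgebra.ιMulti_apply, map_list_prod, List.map_ofFn, List.map_map, List.ofFn_eq_map]
  congr 3
  refine List.map_congr_left fun i _ => ?_
  exact ExteriorAlgebra.lift_ι_apply ℝ _ _ _

end Fib

/-! ### The top coefficient and the degree operator -/

section Top

variable {d : ℕ} {V V' : Type*} [AddCommGroup V] [Module ℝ V] [AddCommGroup V'] [Module ℝ V']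

theorem contr_eq (i : Fin d) :
    contr (V := V) i = conV (EuclideanSpace.single i (1 : ℝ)) := rfl

theorem topCoeff_eq (w : Fib (Eu d) V) :
    topCoeff w = coeffMap (conAlt d w fun i => EuclideanSpace.single i (1 : ℝ)) := by
  rw [conAlt_apply]; rfl

variable (d V) in
/-- `topCoeff` as a linear map. -/
def topCoeffL : Fib (Eu d) V →ₗ[ℝ] Gr V where
  toFun := topCoeff
  map_add' u w := by
    simp only [topCoeff]
    rw [← map_add]
    congr 1
    induction List.finRange d generalizing u w with
    | nil => rfl
    | cons i l ih => rw [List.foldl_cons, List.foldl_cons, List.foldl_cons, map_add, ih]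
  map_smul' t u := by
    simp only [topCoeff, RingHom.id_apply]
    rw [← map_smul]
    congr 1
    induction List.finRange d generalizing u with
    | nil => rfl
    | cons i l ih => rw [List.foldl_cons, List.foldl_cons, map_smul, ih]

theorem topCoeffL_apply (w : Fib (Eu d) V) : topCoeffL d V w = topCoeff w := rfl

theorem foldl_contr_fibMap {E : Type*} [AddCommGroup E] [Module ℝ E] (T : Eu d →ₗ[ℝ] E)
    (L : V →ₗ[ℝ] V') (l : List (Fin d)) (w : Fib E V) :
    l.foldl (fun u i => contr i u) (fibMap T L w) =
      fibMap T L (l.foldl (fun u i => conV (T (EuclideanSpace.single i 1)) u) w) := by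
  induction l generalizing w with
  | nil => rfl
  | cons i l ih => rw [List.foldl_cons, List.foldl_cons, contr_eq, conV_fibMap, ih]

/-- Iterated contraction is alternating in the `d` vectors, so replacing the standard basis by its
image under `T` multiplies the result by `det T`. The independence of the integral from the
coordinates rests on this. -/
theorem topCoeff_fibMap (T : Eu d →ₗ[ℝ] Eu d) (L : V →ₗ[ℝ] V') (w : Fib (Eu d) V) :
    topCoeff (fibMap T L w) = LinearMap.det T • ExteriorAlgebra.map L (topCoeff w) := by
  have h1 : topCoeff (fibMap T L w) =
      ExteriorAlgebra.map L (coeffMap (conAlt d w fun i => T (EuclideanSpace.single i (1 : ℝ)))) := by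
    rw [conAlt_apply, ← coeffMap_fibMap T, ← foldl_contr_fibMap]; rfl
  rw [h1, topCoeff_eq, ← map_smul]
  congr 1
  rw [← sub_eq_zero, ← Module.forall_dual_apply_eq_zero_iff ℝ]
  intro l
  let e := (EuclideanSpace.basisFun (Fin d) ℝ).toBasis
  let g : Eu d [⋀^Fin d]→ₗ[ℝ] ℝ := (l ∘ₗ (coeffMap (E := Eu d) (V := V)).toLinearMap).compAlternatingMap (conAlt d w)
  have hg := AlternatingMap.eq_smul_basis_det e g
  have he : (e : Fin d → Eu d) = fun i => EuclideanSpace.single i (1 : ℝ) := by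
    ext1 i; simp [e]
  have h2 : g (fun i => T (EuclideanSpace.single i (1 : ℝ))) =
      LinearMap.det T * g (fun i => EuclideanSpace.single i (1 : ℝ)) := by
    rw [show (fun i => T (EuclideanSpace.single i (1 : ℝ))) = T ∘ e by rw [he]; rfl, ← he]
    conv_lhs => rw [hg]
    rw [AlternatingMap.smul_apply, Module.Basis.det_comp, Module.Basis.det_self]
    simp [mul_comm]
  rw [map_sub, map_smul]
  exact sub_eq_zero.2 h2

/-- Contractions in the directions of `E` annihilate constants, hence never act on a factor standing
on the right. -/
theorem topCoeff_mul_constMap (w : Fib (Eu d) V) (θ : Gr V) :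
    topCoeff (w * constMap θ) = topCoeff w * θ := by
  have : ∀ (l : List (Fin d)) (w : Fib (Eu d) V), l.foldl (fun u i => contr i u) (w * constMap θ) =
      l.foldl (fun u i => contr i u) w * constMap θ := by
    intro l
    induction l with
    | nil => intro w; rfl
    | cons i l ih =>
      intro w
      rw [List.foldl_cons, List.foldl_cons, ← ih, contr_eq, conV_mul, conV_constMap, mul_zero,
        add_zero]
  change coeffMap (List.foldl _ _ _) = coeffMap (List.foldl _ _ _) * θ
  rw [this, map_mul, coeffMap_constMap]

theorem topCoeff_mem {i : ZMod 2} {w : Fib (Eu d) V} (hw : w ∈ Gr.par _ i) :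
    topCoeff w ∈ Gr.par V (i + d) := by
  have : ∀ (l : List (Fin d)) (i : ZMod 2) (w : Fib (Eu d) V), w ∈ Gr.par _ i →
      l.foldl (fun u i => contr i u) w ∈ Gr.par _ (i + l.length) := by
    intro l
    induction l with
    | nil => intro i w hw; simpa using hw
    | cons j l ih =>
      intro i w hw
      rw [List.foldl_cons, List.length_cons, Nat.cast_succ, add_comm (l.length : ZMod 2), ← add_assoc]
      exact ih _ _ (conV_mem _ hw)
  have h := this (List.finRange d) i w hw
  rw [List.length_finRange] at h
  exact Gr.map_mem _ h

/-- The degree operator. -/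
def fibNum (u : Fib (Eu d) V) : Fib (Eu d) V := ∑ i : Fin d, covec d V i * contr i u

theorem sum_smul_covec (a : Module.Dual ℝ (Eu d)) :
    ∑ i : Fin d, a (EuclideanSpace.single i 1) • covec d V i = ExteriorAlgebra.ι ℝ (a, (0 : V)) := by
  simp only [covec, ← map_smul, ← map_sum]
  congr 1
  ext1
  · rw [Prod.fst_sum]
    apply (EuclideanSpace.basisFun (Fin d) ℝ).toBasis.ext
    intro j
    simp
  · rw [Prod.snd_sum]; simp

theorem fibNum_add (u w : Fib (Eu d) V) : fibNum (u + w) = fibNum u + fibNum w := by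
  simp [fibNum, mul_add, Finset.sum_add_distrib]

theorem fibNum_smul (t : ℝ) (u : Fib (Eu d) V) : fibNum (t • u) = t • fibNum u := by
  simp [fibNum, Finset.smul_sum]

theorem ι_mul_covec (p : Module.Dual ℝ (Eu d) × V) (i : Fin d) :
    covec d V i * ExteriorAlgebra.ι ℝ p = -(ExteriorAlgebra.ι ℝ p * covec d V i) := 
  eq_neg_of_add_eq_zero_left (ExteriorAlgebra.ι_add_mul_swap _ _)

theorem fibNum_ι_mul (a : Module.Dual ℝ (Eu d)) (v : V) (u : Fib (Eu d) V) :
    fibNum (ExteriorAlgebra.ι ℝ (a, v) * u) =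
      ExteriorAlgebra.ι ℝ (a, (0 : V)) * u + ExteriorAlgebra.ι ℝ (a, v) * fibNum u := by
  rw [← sum_smul_covec, fibNum, fibNum, Finset.sum_mul, Finset.mul_sum, ← Finset.sum_add_distrib]
  refine Finset.sum_congr rfl fun i _ => ?_
  rw [contr_eq, conV_ι_mul, mul_sub, ← mul_assoc, ι_mul_covec, mul_smul_comm, smul_mul_assoc,
    neg_mul, sub_neg_eq_add, mul_assoc]

theorem fibNum_constMap (θ : Gr V) : fibNum (d := d) (constMap θ) = 0 := by
  simp [fibNum, contr_eq]

theorem fibNum_algebraMap (r : ℝ) : fibNum (d := d) (V := V) (algebraMap ℝ _ r) = 0 := by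
  simpa using fibNum_constMap (d := d) (V := V) (algebraMap ℝ _ r)

/-- The degree operator multiplies the generators from `E^*` by one and those from `V` by zero; the
derivation property follows by induction on products of generators. -/
theorem fibNum_mul (u w : Fib (Eu d) V) : fibNum (u * w) = fibNum u * w + u * fibNum w := by
  induction u using Gr.induction with
  | algebraMap r => rw [fibNum_algebraMap, ← Algebra.smul_def, ← Algebra.smul_def, fibNum_smul]; simp
  | add x y hx hy => rw [add_mul, fibNum_add, hx, hy, fibNum_add]; noncomm_ring
  | ι_mul x v hx =>
    obtain ⟨a, v⟩ := v
    rw [mul_assoc, fibNum_ι_mul, fibNum_ι_mul, hx]; noncomm_ring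

theorem fibNum_fibMap {d' : ℕ} (T : Eu d →ₗ[ℝ] Eu d') (L : V →ₗ[ℝ] V') (u : Fib (Eu d') V) :
    fibNum (fibMap T L u) = fibMap T L (fibNum u) := by
  induction u using Gr.induction with
  | algebraMap r => rw [AlgHom.commutes, fibNum_algebraMap, fibNum_algebraMap, map_zero]
  | add x y hx hy => rw [map_add, fibNum_add, hx, hy, fibNum_add, map_add]
  | ι_mul x v hx =>
    obtain ⟨a, v⟩ := v
    rw [map_mul, fibMap_ι, fibNum_ι_mul, fibNum_ι_mul, hx, map_add, map_mul, map_mul, fibMap_ι,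
      fibMap_ι, map_zero]

theorem covec_mem (i : Fin d) : covec d V i ∈ Gr.par _ 1 := Gr.ι_mem _

theorem fibNum_mem {i : ZMod 2} {u : Fib (Eu d) V} (hu : u ∈ Gr.par _ i) :
    fibNum u ∈ Gr.par _ i := by
  refine Submodule.sum_mem _ fun j _ => ?_
  have := Gr.mul_mem (covec_mem (V := V) j) (conV_mem (EuclideanSpace.single j (1 : ℝ)) hu)
  rwa [add_comm i, ← add_assoc, two_zmod, zero_add] at this

theorem conV_covec_mul (v : Eu d) (i : Fin d) (u : Fib (Eu d) V) :
    conV v (covec d V i * u) = v i • u - covec d V i * conV v u := conV_ι_mul _ _ _ _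

theorem sum_smul_contr (v : Eu d) (u : Fib (Eu d) V) : ∑ i, v i • contr i u = conV v u := by
  have h : v = ∑ i, v i • EuclideanSpace.single i (1 : ℝ) := by
    have := (EuclideanSpace.basisFun (Fin d) ℝ).toBasis.sum_repr v
    simpa using this.symm
  have h2 : ∀ (s : Finset (Fin d)), conV (∑ i ∈ s, v i • EuclideanSpace.single i (1 : ℝ)) u =
      ∑ i ∈ s, v i • contr i u := by
    intro s
    induction s using Finset.induction_on with
    | empty => 
      rw [Finset.sum_empty, Finset.sum_empty, ← zero_smul ℝ (0 : Eu d), conV_smul, zero_smul]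
    | insert j s hj ih => rw [Finset.sum_insert hj, Finset.sum_insert hj, conV_add, conV_smul, ih]; rfl
  conv_rhs => rw [h]
  rw [h2]

theorem conV_fibNum (v : Eu d) (u : Fib (Eu d) V) :
    conV v (fibNum u) = fibNum (conV v u) + conV v u := by
  conv_rhs => rw [add_comm, ← sum_smul_contr v u]
  rw [fibNum, fibNum, map_sum, ← Finset.sum_add_distrib]
  refine Finset.sum_congr rfl fun i _ => ?_
  rw [conV_covec_mul, contr_eq, conV_comm v, mul_neg, sub_neg_eq_add, sum_smul_contr]

/-- Each contraction lowers the degree by one, so moving the degree operator through `d`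
contractions adds `d`. What is left over is the degree operator applied last, and its values have no
component of degree zero in `E^*`. -/
theorem topCoeff_fibNum (w : Fib (Eu d) V) : topCoeff (fibNum w) = (d : ℝ) • topCoeff w := by
  have : ∀ (l : List (Fin d)) (w : Fib (Eu d) V), l.foldl (fun u i => contr i u) (fibNum w) =
      fibNum (l.foldl (fun u i => contr i u) w) +
        (l.length : ℝ) • l.foldl (fun u i => contr i u) w := by
    intro l
    induction l with
    | nil => intro w; simp
    | cons i l ih =>
      intro w
      have hadd : ∀ u w : Fib (Eu d) V, l.foldl (fun u i => contr i u) (u + w) =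
          l.foldl (fun u i => contr i u) u + l.foldl (fun u i => contr i u) w := by
        clear ih
        induction l with
        | nil => intro u w; rfl
        | cons i l ih => intro u w; rw [List.foldl_cons, List.foldl_cons, List.foldl_cons, map_add, ih]
      rw [List.foldl_cons, List.foldl_cons, contr_eq, conV_fibNum, hadd, ih, List.length_cons,
        Nat.cast_succ, add_smul, one_smul, add_assoc]
  have h0 : ∀ u : Fib (Eu d) V, coeffMap (fibNum u) = 0 := by
    intro u
    rw [fibNum, map_sum]
    refine Finset.sum_eq_zero fun i _ => ?_
    rw [map_mul, coeffMap, covec, ExteriorAlgebra.map_apply_ι]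
    simp
  change coeffMap (List.foldl _ _ _) = (d : ℝ) • coeffMap (List.foldl _ _ _)
  rw [this, map_add, h0, zero_add, map_smul, List.length_finRange]

end Top

/-! ### Restriction to the face of the half space, and duality by the top coefficient -/

section Top

variable {d : ℕ} {V V' : Type*} [AddCommGroup V] [Module ℝ V] [AddCommGroup V'] [Module ℝ V']

/-- The inclusion `y ↦ (0, y)` of the boundary of the half space. -/
def bdryIncl (d : ℕ) : Eu d →L[ℝ] Eu (d + 1) :=
  LinearMap.toContinuousLinearMap
    { toFun := fun y => WithLp.toLp 2 (Fin.cons 0 y.ofLp)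
      map_add' := fun x y => by
        ext i; refine Fin.cases ?_ (fun i => ?_) i <;> simp
      map_smul' := fun t y => by
        ext i; refine Fin.cases ?_ (fun i => ?_) i <;> simp }

@[simp] theorem bdryIncl_zero (y : Eu d) : bdryIncl d y 0 = 0 := rfl
@[simp] theorem bdryIncl_succ (y : Eu d) (i : Fin d) : bdryIncl d y i.succ = y i := rfl

theorem bdryIncl_single (i : Fin d) :
    bdryIncl d (EuclideanSpace.single i 1) = EuclideanSpace.single i.succ 1 := by
  ext j
  refine Fin.cases ?_ (fun j => ?_) j
  · simp [(Fin.succ_ne_zero i).symm]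
  · simp

/-- The first contraction removes the leading `dy^0`; the other contractions use only directions
tangent to the face, and any surviving factor `dy^0` dies in degree zero. No sign arises, since
`dy^0` stands first. This evaluates the face term in Stokes' theorem. -/
theorem topCoeff_covec_zero_mul (w : Fib (Eu (d + 1)) V) :
    topCoeff (covec (d + 1) V 0 * w) =
      topCoeff (fibMap (bdryIncl d).toLinearMap LinearMap.id w) := by
  have hadd : ∀ (l : List (Fin d)) (u w : Fib (Eu (d + 1)) V),
      l.foldl (fun u i => contr i.succ u) (u - w) =
        l.foldl (fun u i => contr i.succ u) u - l.foldl (fun u i => contr i.succ u) w := by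
    intro l
    induction l with
    | nil => intro u w; rfl
    | cons i l ih =>
      intro u w; rw [List.foldl_cons, List.foldl_cons, List.foldl_cons, map_sub, ih]
  have hcov : ∀ (l : List (Fin d)) (w : Fib (Eu (d + 1)) V), ∃ z,
      l.foldl (fun u i => contr i.succ u) (covec (d + 1) V 0 * w) = covec (d + 1) V 0 * z := by
    intro l
    induction l with
    | nil => intro w; exact ⟨w, rfl⟩
    | cons i l ih =>
      intro w
      rw [List.foldl_cons, contr_eq, conV_covec_mul]
      have : (EuclideanSpace.single i.succ (1 : ℝ) : Eu (d + 1)) 0 = 0 := by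
        simp [(Fin.succ_ne_zero i).symm]
      rw [this, zero_smul, zero_sub, ← mul_neg]
      exact ih _
  have h1 : topCoeff (fibMap (bdryIncl d).toLinearMap LinearMap.id w) =
      coeffMap ((List.finRange d).foldl (fun u i => contr i.succ u) w) := by
    change coeffMap (List.foldl _ _ _) = _
    rw [foldl_contr_fibMap, coeffMap_fibMap, ExteriorAlgebra.map_id]
    simp only [ContinuousLinearMap.coe_coe, bdryIncl_single]
    rfl
  rw [h1]
  change coeffMap (List.foldl _ _ _) = _
  rw [List.finRange_succ, List.foldl_cons, List.foldl_map, contr_eq, conV_covec_mul, hadd]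
  obtain ⟨z, hz⟩ := hcov (List.finRange d) (conV (EuclideanSpace.single 0 1) w)
  rw [hz, map_sub, map_mul]
  have : coeffMap (covec (d + 1) V 0) = 0 := by
    rw [coeffMap, covec, ExteriorAlgebra.map_apply_ι]; simp
  rw [this, zero_mul, sub_zero]
  simp

/-! ### Nondegeneracy of the top coefficient -/

/-- The projection killing the `i`-th coordinate. -/
def killCoord (i : Fin d) : Eu d →ₗ[ℝ] Eu d :=
  LinearMap.id - LinearMap.smulRight (EuclideanSpace.proj (𝕜 := ℝ) i).toLinearMap
    (EuclideanSpace.single i (1 : ℝ))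

theorem fibMap_killCoord (i : Fin d) (z : Fib (Eu d) V) :
    fibMap (killCoord i) LinearMap.id z = z - covec d V i * contr i z := by
  have hi : covec d V i * covec d V i = 0 := ExteriorAlgebra.ι_sq_zero _
  induction z using Gr.induction with
  | algebraMap r => rw [AlgHom.commutes, contr_eq]; simp [conV]
  | add x y hx hy => rw [map_add, hx, hy, map_add, mul_add]; abel
  | ι_mul x v hx =>
    obtain ⟨a, v⟩ := v
    have h : fibMap (killCoord i) LinearMap.id (ExteriorAlgebra.ι ℝ (a, v)) =
        ExteriorAlgebra.ι ℝ (a, v) - a (EuclideanSpace.single i 1) • covec d V i := by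
      rw [fibMap_ι, covec, ← map_smul, ← map_sub]
      congr 1
      ext1
      · ext1 y
        simp [killCoord, mul_comm]
      · simp
    have hc : covec d V i * ExteriorAlgebra.ι ℝ (a, v) =
      -(ExteriorAlgebra.ι ℝ (a, v) * covec d V i) := ι_mul_covec _ _
    have hc' : ∀ z, covec d V i * (ExteriorAlgebra.ι ℝ (a, v) * z) =
      -(ExteriorAlgebra.ι ℝ (a, v) * (covec d V i * z)) := by
      intro z; rw [← mul_assoc, hc, neg_mul, mul_assoc]
    have hcc : ∀ z, covec d V i * (covec d V i * z) = 0 := fun z => by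
      rw [← mul_assoc, hi, zero_mul]
    rw [map_mul, h, hx, contr_eq, conV_ι_mul]
    simp only [mul_sub, sub_mul, smul_mul_assoc, mul_smul_comm, hc', hcc, smul_zero]
    abel

/-- By `fibMap_killCoord`, a form annihilated by the `i`-th contraction is invariant under pullback
along the projection that kills the `i`-th coordinate. Composing these projections over all
coordinates gives pullback along zero, which retains only the coefficient part. -/
theorem eq_constMap_of_contr_eq_zero {z : Fib (Eu d) V} (h : ∀ i, contr i z = 0) :
    z = constMap (coeffMap z) := by
  have key : ∀ s : Finset (Fin d), fibMap (LinearMap.id - ∑ i ∈ s, LinearMap.smulRight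
      (EuclideanSpace.proj (𝕜 := ℝ) i).toLinearMap (EuclideanSpace.single i (1 : ℝ)))
      LinearMap.id z = z := by
    intro s
    induction s using Finset.induction_on with
    | empty => rw [Finset.sum_empty, sub_zero, fibMap_id]
    | insert i s hi ih =>
      conv_rhs => rw [← ih]
      have hk : z = fibMap (killCoord i) LinearMap.id z := by
        rw [fibMap_killCoord, h, mul_zero, sub_zero]
      conv_rhs => rw [hk, fibMap_fibMap]
      congr 2
      ext1 y
      simp only [killCoord, Finset.sum_insert hi, LinearMap.sub_apply, LinearMap.id_apply,
        LinearMap.add_apply, LinearMap.smulRight_apply, LinearMap.comp_apply,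
        ContinuousLinearMap.coe_coe, EuclideanSpace.coe_proj, PiLp.sub_apply]
      have : ((∑ i ∈ s, LinearMap.smulRight (EuclideanSpace.proj (𝕜 := ℝ) i).toLinearMap
          (EuclideanSpace.single i (1 : ℝ))) y : Eu d) i = 0 := by
        rw [LinearMap.sum_apply, WithLp.ofLp_sum, Finset.sum_apply]
        refine Finset.sum_eq_zero fun j hj => ?_
        have hij : i ≠ j := fun hij => hi (hij ▸ hj)
        simp [hij]
      rw [this, sub_zero]
      abel
  have h1 := key Finset.univ
  have h0 : (LinearMap.id - ∑ i : Fin d, LinearMap.smulRight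
      (EuclideanSpace.proj (𝕜 := ℝ) i).toLinearMap (EuclideanSpace.single i (1 : ℝ)) :
      Eu d →ₗ[ℝ] Eu d) = 0 := by
    apply (EuclideanSpace.basisFun (Fin d) ℝ).toBasis.ext
    intro j
    simp [LinearMap.sum_apply]
  rw [h0] at h1
  conv_lhs => rw [← h1]
  rw [constMap, coeffMap, Gr.map_map, fibMap]
  congr 2
  ext <;> simp

/-- The monomial `dy^{i_1} ∧ dy^{i_2} ∧ …`. -/
def covecProd (V : Type*) [AddCommGroup V] [Module ℝ V] (L : List (Fin d)) : Fib (Eu d) V :=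
  (L.map (covec d V)).prod

theorem covecProd_mem (L : List (Fin d)) : covecProd V L ∈ Gr.par _ (L.length : ZMod 2) := by
  induction L with
  | nil => simpa [covecProd] using Gr.one_mem
  | cons i L ih =>
    rw [List.length_cons, Nat.cast_succ, add_comm]
    exact Gr.mul_mem (covec_mem i) ih

/-- The wedge pairing is nondegenerate: a direction `i` is peeled off by showing separately that
`ι_i z` and `ι_i (dy^i z)` vanish, the first by testing with monomials free of `dy^i`, the second by
inserting `dy^i` next to `z`. -/
theorem eq_zero_of_topCoeff {w : Fib (Eu d) V}
    (h : ∀ L : List (Fin d), topCoeff (covecProd V L * w) = 0) : w = 0 := by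
  have hcon : ∀ (i : Fin d) (L : List (Fin d)), i ∉ L → contr i (covecProd V L) = 0 := by
    intro i L
    induction L with
    | nil => intro _; simp [covecProd, contr_eq, conV]
    | cons j L ih =>
      intro hi
      have hij : j ≠ i := fun h => hi (h ▸ List.mem_cons_self)
      change contr i (covec d V j * covecProd V L) = 0
      rw [contr_eq, conV_covec_mul, ← contr_eq, ih fun h => hi (List.mem_cons_of_mem _ h)]
      simp [hij]
  have hlin : ∀ (l : List (Fin d)) (t : ℝ) (w : Fib (Eu d) V),
      l.foldl (fun u i => contr i u) (t • w) = t • l.foldl (fun u i => contr i u) w := by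
    intro l
    induction l with
    | nil => intro t w; rfl
    | cons i l ih => intro t w; rw [List.foldl_cons, List.foldl_cons, map_smul, ih]
  -- For the induction, the directions outside `l` have already been eliminated: `z` is annihilated
  -- by their contractions, and only monomials in the directions of `l` are available for testing.
  have key : ∀ (l : List (Fin d)), l.Nodup → ∀ z : Fib (Eu d) V, (∀ i, i ∉ l → contr i z = 0) →
      (∀ L : List (Fin d), (∀ j ∈ L, j ∈ l) →
        coeffMap (l.foldl (fun u i => contr i u) (covecProd V L * z)) = 0) → z = 0 := by
    intro l
    induction l with
    | nil =>
      intro _ z hz hL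
      have := hL [] (by simp)
      simp only [covecProd, List.map_nil, List.prod_nil, one_mul, List.foldl_nil] at this
      rw [eq_constMap_of_contr_eq_zero (z := z) (fun i => hz i (by simp)), this, map_zero]
    | cons i l ih =>
      intro hl z hz hL
      rw [List.nodup_cons] at hl
      have hmove : ∀ (L : List (Fin d)), (∀ j ∈ L, j ∈ l) → ∀ z,
          contr i (covecProd V L * z) = ksign (L.length : ZMod 2) 1 • (covecProd V L * contr i z) := by
        intro L hL z
        rw [contr_eq, conV_mul, ← contr_eq, hcon i L fun h => hl.1 (hL i h), zero_mul, zero_add,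
          Gr.gradeInv_of_mem (covecProd_mem L), smul_mul_assoc]
      have hne : ∀ k : ZMod 2, ksign k 1 ≠ 0 := fun k hk => by
        have := ksign_mul_self k 1
        rw [hk] at this; simp at this
      have h1 : contr i z = 0 := by
        refine ih hl.2 _ (fun j hj => ?_) fun L hLl => ?_
        · rcases eq_or_ne j i with rfl | hji
          · exact conV_conV _ _
          · rw [contr_eq, contr_eq, conV_comm, ← contr_eq, ← contr_eq, hz j (by simp [hj, hji]), map_zero, neg_zero]
        · have := hL L fun j hj => List.mem_cons_of_mem _ (hLl j hj)
          rw [List.foldl_cons, hmove L hLl, hlin, map_smul] at this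
          exact (smul_eq_zero_iff_right (hne _)).1 this
      have h0 : contr i (covec d V i * z) = 0 := by
        refine ih hl.2 _ (fun j hj => ?_) fun L hLl => ?_
        · rcases eq_or_ne j i with rfl | hji
          · exact conV_conV _ _
          · rw [contr_eq, contr_eq, conV_comm, conV_covec_mul, ← contr_eq, ← contr_eq, hz j (by simp [hj, hji])]
            simp [hji.symm]
        · have := hL (L ++ [i]) (by
            intro j hj
            rcases List.mem_append.1 hj with hj | hj
            · exact List.mem_cons_of_mem _ (hLl j hj)
            · simp at hj; simp [hj])
          have hLi : covecProd V (L ++ [i]) * z = covecProd V L * (covec d V i * z) := by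
            simp [covecProd, mul_assoc]
          rw [hLi, List.foldl_cons, hmove L hLl, hlin, map_smul] at this
          exact (smul_eq_zero_iff_right (hne _)).1 this
      -- The identity `ι_i (dy^i z) = z - dy^i ι_i z` leaves only `z`.
      rw [contr_eq, conV_covec_mul, ← contr_eq, h1] at h0
      simpa using h0
  exact key (List.finRange d) (List.nodup_finRange d) w (fun i hi => absurd (List.mem_finRange i) hi)
    fun L _ => h L

end Top

/-! ### Derivations along homomorphisms -/

section Der

variable {A B C : Type*} [Ring A] [Algebra ℝ A] [Ring B] [Algebra ℝ B] [Ring C] [Algebra ℝ C]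
  {𝒜 : ZMod 2 → Submodule ℝ A} {P : ZMod 2 → Submodule ℝ B} {P' : ZMod 2 → Submodule ℝ C}

theorem IsSuperHom.comp {x : A → B} (hx : IsSuperHom 𝒜 P x) (F : B →ₐ[ℝ] C)
    (hF : ∀ i, ∀ b ∈ P i, F b ∈ P' i) : IsSuperHom 𝒜 P' (fun a => F (x a)) where
  map_one := by rw [hx.map_one, _root_.map_one]
  map_mul a b := by rw [hx.map_mul, _root_.map_mul]
  map_add a b := by rw [hx.map_add, _root_.map_add]
  map_smul t a := by rw [hx.map_smul, _root_.map_smul]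
  parity i a ha := hF i _ (hx.parity i a ha)

theorem IsDerAlong.comp {p : ZMod 2} {x ξ : A → B} (h : IsDerAlong 𝒜 P p x ξ) (F : B →ₐ[ℝ] C)
    (hF : ∀ i, ∀ b ∈ P i, F b ∈ P' i) : IsDerAlong 𝒜 P' p (fun a => F (x a)) (fun a => F (ξ a)) where
  map_add a b := by rw [h.map_add, _root_.map_add]
  map_smul t a := by rw [h.map_smul, _root_.map_smul]
  leibniz i a ha b := by
    rw [h.leibniz i a ha, _root_.map_add, _root_.map_mul, _root_.map_smul, _root_.map_mul]
  parity i a ha := hF _ _ (h.parity i a ha)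

theorem IsDerAlong.comp_left {p : ZMod 2} {x : A → B} {v : A → A} (hx : IsSuperHom 𝒜 P x)
    (hv : IsDerAlong 𝒜 𝒜 p id v) : IsDerAlong 𝒜 P p x (fun a => x (v a)) where
  map_add a b := by rw [hv.map_add, hx.map_add]
  map_smul t a := by rw [hv.map_smul, hx.map_smul]
  leibniz i a ha b := by
    rw [hv.leibniz i a ha, hx.map_add, hx.map_mul, hx.map_smul, hx.map_mul]; rfl
  parity i a ha := hx.parity _ _ (hv.parity i a ha)

theorem IsDerAlong.add {p : ZMod 2} {x ξ ζ : A → B} (h : IsDerAlong 𝒜 P p x ξ)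
    (h' : IsDerAlong 𝒜 P p x ζ) : IsDerAlong 𝒜 P p x (fun a => ξ a + ζ a) where
  map_add a b := by rw [h.map_add, h'.map_add]; abel
  map_smul t a := by rw [h.map_smul, h'.map_smul, smul_add]
  leibniz i a ha b := by
    rw [h.leibniz i a ha, h'.leibniz i a ha, add_mul, mul_add, smul_add]; abel
  parity i a ha := add_mem (h.parity i a ha) (h'.parity i a ha)

theorem IsDerAlong.zero (p : ZMod 2) (x : A → B) : IsDerAlong 𝒜 P p x (fun _ => 0) where
  map_add a b := by simp
  map_smul t a := by simp
  leibniz i a ha b := by simp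
  parity i a ha := zero_mem _

theorem IsDerAlong.smul {p : ZMod 2} {x ξ : A → B} (h : IsDerAlong 𝒜 P p x ξ) (s : ℝ) :
    IsDerAlong 𝒜 P p x (fun a => s • ξ a) where
  map_add a b := by rw [h.map_add, smul_add]
  map_smul t a := by rw [h.map_smul, smul_comm]
  leibniz i a ha b := by
    rw [h.leibniz i a ha, smul_add, smul_mul_assoc, mul_smul_comm, smul_comm s]
  parity i a ha := Submodule.smul_mem _ _ (h.parity i a ha)

/-- Forms are evaluated on odd tangent vectors only. A tangent vector of parity `p` is made odd by a
factor `φ` of parity `p + 1`. -/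
theorem IsDerAlong.mul_left (hmul : ∀ i j, ∀ a ∈ P i, ∀ b ∈ P j, a * b ∈ P (i + j))
    (hcomm : ∀ i j, ∀ a ∈ P i, ∀ b ∈ P j, a * b = ksign i j • (b * a))
    {p q : ZMod 2} {x ξ : A → B} (hx : IsSuperHom 𝒜 P x) (h : IsDerAlong 𝒜 P p x ξ)
    {φ : B} (hφ : φ ∈ P q) : IsDerAlong 𝒜 P (q + p) x (fun a => φ * ξ a) where
  map_add a b := by rw [h.map_add, mul_add]
  map_smul t a := by rw [h.map_smul, mul_smul_comm]
  leibniz i a ha b := by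
    rw [h.leibniz i a ha, mul_add, mul_smul_comm, ← mul_assoc, ← mul_assoc, ← mul_assoc,
      hcomm q i φ hφ (x a) (hx.parity i a ha), smul_mul_assoc, smul_smul, ksign_add_left, mul_comm (ksign p i)]
  parity i a ha := by
    have := hmul _ _ _ hφ _ (h.parity i a ha)
    rwa [add_left_comm] at this

theorem IsSuperHom.map_zero {x : A → B} (h : IsSuperHom 𝒜 P x) : x 0 = 0 := by
  have := h.map_smul 0 0
  simpa using this

end Der

/-! ### Evaluation of forms on the target -/

/-- The `q`-th power of the grading automorphism. -/
def gradePow {V : Type*} [AddCommGroup V] [Module ℝ V] (q : ZMod 2) : Gr V →ₐ[ℝ] Gr V :=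
  if q = 1 then gradeInv else AlgHom.id ℝ _

section Pow

variable {V : Type*} [AddCommGroup V] [Module ℝ V]

@[simp] theorem gradePow_zero (u : Gr V) : gradePow 0 u = u := by simp [gradePow]
@[simp] theorem gradePow_one (u : Gr V) : gradePow 1 u = gradeInv u := by simp [gradePow]

theorem Gr.mul_par {q : ZMod 2} {θ : Gr V} (hθ : θ ∈ Gr.par V q) (u : Gr V) :
    u * θ = θ * gradePow q u := by
  rcases zmod_two_cases q with rfl | rfl
  · simp [Gr.mul_even hθ]
  · simp [Gr.mul_odd hθ]

theorem gradePow_of_mem {i q : ZMod 2} {u : Gr V} (hu : u ∈ Gr.par V i) :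
    gradePow q u = ksign i q • u := by
  rcases zmod_two_cases q with rfl | rfl
  · simp
  · simp [Gr.gradeInv_of_mem hu]

end Pow

section Eval

variable {A : Type*} {V V' : Type*} [AddCommGroup V] [Module ℝ V] [AddCommGroup V'] [Module ℝ V']

theorem evalOne_add_mul (x x' ξ : A → Gr V) (θ : Gr V) (α : OneForm A) :
    evalOne (fun a => x a + θ * x' a) ξ α = evalOne x ξ α + θ * evalOne x' ξ α := by
  induction α with
  | nil => simp [evalOne]
  | cons fg α ih =>
    simp only [evalOne, List.map_cons, List.sum_cons] at ih ⊢
    rw [ih]; noncomm_ring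

/-- The term of second order contains `θ` twice and vanishes because `θ` can be moved next to
itself. Moving `θ` to the left past `ξ f` is recorded by the power of the grading automorphism. -/
theorem evalD_add_mul {q : ZMod 2} {θ : Gr V} (hθ : θ ∈ Gr.par V q) (h : θ * θ = 0)
    (ξ u : A → Gr V) (α : OneForm A) :
    evalD (fun a => ξ a + θ * u a) α =
      evalD ξ α + θ * (α.map fun fg => u fg.1 * ξ fg.2 + gradePow q (ξ fg.1) * u fg.2).sum := by
  induction α with
  | nil => simp [evalD]
  | cons fg α ih =>
    simp only [evalD, List.map_cons, List.sum_cons] at ih ⊢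
    rw [ih]
    have h1 : θ * u fg.1 * (θ * u fg.2) = 0 := by
      rw [← mul_assoc, mul_assoc θ, Gr.mul_mul_self hθ h, zero_mul]
    have h2 : ξ fg.1 * (θ * u fg.2) = θ * (gradePow q (ξ fg.1) * u fg.2) := by
      rw [← mul_assoc, Gr.mul_par hθ, mul_assoc]
    rw [add_mul, mul_add, mul_add, h1, h2]
    noncomm_ring

theorem evalD_mul {q : ZMod 2} {θ : Gr V} (hθ : θ ∈ Gr.par V q) (h : θ * θ = 0)
    (u : A → Gr V) (α : OneForm A) : evalD (fun a => θ * u a) α = 0 := by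
  have := evalD_add_mul hθ h (fun _ : A => 0) u α
  simpa [evalD] using this

theorem evalOne_map (F : Gr V →ₐ[ℝ] Gr V') (x ξ : A → Gr V) (α : OneForm A) :
    evalOne (fun a => F (x a)) (fun a => F (ξ a)) α = F (evalOne x ξ α) := by
  simp [evalOne, map_list_sum, Function.comp_def]

theorem evalD_map (F : Gr V →ₐ[ℝ] Gr V') (ξ : A → Gr V) (α : OneForm A) :
    evalD (fun a => F (ξ a)) α = F (evalD ξ α) := by
  simp [evalD, map_list_sum, Function.comp_def]

end Eval

/-! ### Displacement of target points along odd tangent vectors -/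

section TargetPoint

variable {A : Type*} [Ring A] [Algebra ℝ A] {𝒜 : ZMod 2 → Submodule ℝ A}
  {V V' : Type} [AddCommGroup V] [Module ℝ V] [AddCommGroup V'] [Module ℝ V']

theorem gr_supercomm (i j : ZMod 2) (a : Gr V) (ha : a ∈ Gr.par V i) (b : Gr V)
    (hb : b ∈ Gr.par V j) : a * b = ksign i j • (b * a) := Gr.supercomm ha hb

theorem IsTargetPoint.map {x ξ : A → Gr V} (h : IsTargetPoint 𝒜 V x ξ) (L : V →ₗ[ℝ] V') :
    IsTargetPoint 𝒜 V' (fun a => ExteriorAlgebra.map L (x a))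
      (fun a => ExteriorAlgebra.map L (ξ a)) :=
  ⟨h.1.comp _ fun _ _ => Gr.map_mem L, h.2.comp _ fun _ _ => Gr.map_mem L⟩

/-- This is the flow of the de Rham vector field `x ↦ ξ`, `ξ ↦ 0` for an odd time `η`.
Multiplicativity uses `η² = 0`; `ξ` remains a derivation along the displaced point because the two
terms with `η`, `ξ a` and `ξ b` cancel by oddness. -/
theorem IsTargetPoint.shift {x ξ : A → Gr V} (h : IsTargetPoint 𝒜 V x ξ)
    (hdec : ∀ a : A, ∃ b ∈ 𝒜 0, ∃ c ∈ 𝒜 1, b + c = a) {η : Gr V}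
    (hη : η ∈ Gr.par V 1) : IsTargetPoint 𝒜 V (fun a => x a + η * ξ a) ξ := by
  obtain ⟨hx, hξ⟩ := h
  have h11 : (1 + 1 : ZMod 2) = 0 := two_zmod 1
  have hηη : η * η = 0 := Gr.sq_odd hη
  have hm : ∀ i, ∀ a ∈ 𝒜 i, ∀ b, x (a * b) + η * ξ (a * b) =
      (x a + η * ξ a) * (x b + η * ξ b) := by
    intro i a ha b
    rw [hx.map_mul, hξ.leibniz i a ha]
    have e1 : x a * (η * ξ b) = ksign 1 i • (η * (x a * ξ b)) := by
      rw [← mul_assoc, Gr.supercomm (hx.parity i a ha) hη, smul_mul_assoc, ksign_comm, mul_assoc]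
    have e2 : η * ξ a * (η * ξ b) = 0 := by
      rw [← mul_assoc, mul_assoc η, Gr.mul_mul_self hη hηη, zero_mul]
    rw [add_mul, mul_add (x a), mul_add (η * ξ a), e1, e2, mul_add, mul_smul_comm, mul_assoc]
    abel
  refine ⟨⟨?_, ?_, ?_, ?_, ?_⟩, ?_, ?_, ?_, ?_⟩
  -- The Leibniz rule is available for a homogeneous first factor only, and the unit is not assumed
  -- to be even here; it is therefore split into its two components.
  · have h1 : ξ 1 = 0 := by
      obtain ⟨b, hb, c, hc, hbc⟩ := hdec 1
      have hb1 : ∀ i, ∀ a ∈ 𝒜 i, ksign 1 i • (x a * ξ 1) = 0 := by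
        intro i a ha
        have := hξ.leibniz i a ha 1
        rw [mul_one, hx.map_one, mul_one] at this
        simpa using this
      have h2 : ∀ i, ∀ a ∈ 𝒜 i, x a * ξ 1 = 0 := by
        intro i a ha
        have := congrArg (fun z => ksign 1 i • z) (hb1 i a ha)
        simpa [smul_smul, ksign_mul_self] using this
      have h3 : x 1 * ξ 1 = 0 := by
        rw [← hbc, hx.map_add, add_mul, hbc, h2 0 b hb, h2 1 c hc, add_zero]
      rwa [hx.map_one, one_mul] at h3
    simp [hx.map_one, h1]
  · intro a b
    obtain ⟨a0, h0, a1, h1, rfl⟩ := hdec a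
    have := hm 0 a0 h0 b
    have h' := hm 1 a1 h1 b
    simp only [add_mul, hx.map_add, hξ.map_add, mul_add] at this h' ⊢
    exact Eq.trans (by abel) ((congrArg₂ (fun u v => u + v) this h').trans (by abel))
  · intro a b
    simp only [hx.map_add, hξ.map_add, mul_add]; abel
  · intro t a
    simp only [hx.map_smul, hξ.map_smul, mul_smul_comm, smul_add]
  · intro i a ha
    have := Gr.mul_mem hη (hξ.parity i a ha)
    rw [add_comm i 1, ← add_assoc, h11, zero_add] at this
    exact add_mem (hx.parity i a ha) this
  · exact hξ.map_add
  · exact hξ.map_smul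
  · intro i a ha b
    rw [hξ.leibniz i a ha]
    have e : ξ a * (η * ξ b) + ksign 1 i • (η * ξ a * ξ b) = 0 := by
      rw [← mul_assoc, Gr.supercomm (hξ.parity i a ha) hη, ksign_add_left, smul_mul_assoc,
        ksign_comm i 1, ← add_smul]
      simp
    rw [mul_add, add_mul, smul_add]
    have e' := congrArg (fun z => ξ a * x b + ksign 1 i • (x a * ξ b) + z) e
    simp only [add_zero] at e'
    rw [← e']
    abel
  · exact hξ.parity

end TargetPoint

theorem sum_map_flatMap {α β M : Type*} [AddCommMonoid M] (f : α → List β) (g : β → M)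
    (l : List α) : ((l.flatMap f).map g).sum = (l.map fun a => ((f a).map g).sum).sum := by
  induction l with
  | nil => rfl
  | cons a l ih => rw [List.flatMap_cons, List.map_append, List.sum_append, ih]; rfl

/-! ### Consequences for `ω = dα`, and Hamiltonian vector fields -/

section Target

variable {A : Type*} [Ring A] [Algebra ℝ A] {𝒜 : ZMod 2 → Submodule ℝ A}
  {V : Type} [AddCommGroup V] [Module ℝ V] [FiniteDimensional ℝ V]

/-- The value of `dα` is the coefficient of a fresh odd parameter in the value of `α` at the
displaced point, so it inherits a parity from `α`. The statement on degrees below is obtained in the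
same way. -/
theorem OneForm.HasParity.evalD_mem (hdec : ∀ a : A, ∃ b ∈ 𝒜 0, ∃ c ∈ 𝒜 1, b + c = a)
    {α : OneForm A} {c : ZMod 2} (h : α.HasParity 𝒜 c) {x ξ : A → Gr V}
    (hx : IsTargetPoint 𝒜 V x ξ) : evalD ξ α ∈ Gr.par V (c + 1) := by
  obtain ⟨V', _, _, _, L, θ, hθ, -, -, hpar⟩ := Gr.exists_fresh V 1
  have h1 := h V' _ _ ((hx.map L).shift hdec hθ)
  rw [evalOne_add_mul, evalOne_map] at h1
  have h2 := Gr.map_mem L (h V x ξ hx)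
  have h3 := (Submodule.add_mem_iff_right _ h2).1 h1
  rw [show evalOne (fun a => ExteriorAlgebra.map L (ξ a)) (fun a => ExteriorAlgebra.map L (ξ a)) α =
    ExteriorAlgebra.map L (evalD ξ α) from evalD_map _ _ _] at h3
  refine hpar _ (c + 1) ?_
  rwa [add_left_comm, two_zmod, add_zero]

theorem OneForm.HasDegree.evalD_eq (hdec : ∀ a : A, ∃ b ∈ 𝒜 0, ∃ c ∈ 𝒜 1, b + c = a)
    {E : A → A} {α : OneForm A} {m : ℤ} (h : α.HasDegree 𝒜 E m) {x ξ : A → Gr V}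
    (hx : IsTargetPoint 𝒜 V x ξ) :
    (α.map fun fg => ξ (E fg.1) * ξ fg.2 + ξ fg.1 * ξ (E fg.2)).sum = (m : ℝ) • evalD ξ α := by
  obtain ⟨V', _, _, _, L, θ, hθ, -, hcan, -⟩ := Gr.exists_fresh V 1
  have h0 := h V x ξ hx
  have h1 := h V' _ _ ((hx.map L).shift hdec hθ)
  rw [evalOne_add_mul, evalOne_add_mul, evalOne_add_mul, evalOne_map, evalOne_map, evalOne_map,
    evalOne_map, evalOne_map, evalOne_map, smul_add, ← map_smul, ← h0, map_add] at h1
  have h2 : θ * ExteriorAlgebra.map L (evalOne ξ ξ (α.map fun fg => (E fg.1, fg.2)) +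
      evalOne ξ ξ (α.map fun fg => (fg.1, E fg.2)) - (m : ℝ) • evalOne ξ ξ α) = 0 := by
    rw [map_sub, map_add, map_smul, mul_sub, mul_add, mul_smul_comm, sub_eq_zero]
    rw [add_add_add_comm] at h1
    exact add_left_cancel h1
  have h3 := sub_eq_zero.1 (hcan _ h2)
  change _ = (m : ℝ) • evalOne ξ ξ α
  rw [← h3, List.sum_map_add]
  simp [evalOne, Function.comp_def]

/-- A fresh parameter `θ` is cancelled from the defining identity of the contraction, leaving an
explicit formula that no longer mentions parameters. -/
theorem IsTargetContraction.eval {p : ZMod 2} {v : A → A} {α β : OneForm A}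
    (h : IsTargetContraction 𝒜 p v α β) {x ξ : A → Gr V} (hx : IsTargetPoint 𝒜 V x ξ) :
    (α.map fun fg => x (v fg.1) * ξ fg.2 + gradePow (p + 1) (ξ fg.1) * x (v fg.2)).sum =
      evalOne x ξ β := by
  obtain ⟨V', _, _, _, L, θ, hθ, hθθ, hcan, -⟩ := Gr.exists_fresh V (p + 1)
  have h1 := h V' _ _ (hx.map L) θ hθ hθθ
  rw [evalD_add_mul hθ hθθ, evalOne_map] at h1
  refine sub_eq_zero.1 (hcan _ ?_)
  rw [map_sub, mul_sub, sub_eq_zero, ← add_left_cancel h1, map_list_sum, List.map_map]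
  congr 2
  refine List.map_congr_left fun fg _ => ?_
  have : ∀ u : Gr V, ExteriorAlgebra.map L (gradePow (p + 1) u) =
      gradePow (p + 1) (ExteriorAlgebra.map L u) := by
    intro u
    rcases zmod_two_cases (p + 1) with h | h <;> simp [h, Gr.gradeInv_map]
  simp [this]

omit [FiniteDimensional ℝ V] in
theorem evalOne_one {x ξ : A → Gr V} (hx : IsTargetPoint 𝒜 V x ξ) (g : A) :
    evalOne x ξ [(1, g)] = ξ g := by
  simp [evalOne, hx.1.map_one]

theorem IsTargetContraction.evalD_add {p r : ZMod 2} {v : A → A} {α : OneForm A} {g : A}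
    (h : IsTargetContraction 𝒜 p v α [(1, g)]) {x ζ : A → Gr V} (hx : IsSuperHom 𝒜 (Gr.par V) x)
    (hζ : IsDerAlong 𝒜 (Gr.par V) r x ζ) {θ φ : Gr V} (hθ : θ ∈ Gr.par V (r + 1))
    (hφ : φ ∈ Gr.par V (p + 1)) (hφφ : φ * φ = 0) :
    evalD (fun a => θ * ζ a + φ * x (v a)) α =
      evalD (fun a => θ * ζ a) α + φ * (θ * ζ g) := by
  have hξ := IsDerAlong.mul_left (fun i j a ha b hb => Gr.mul_mem ha hb) gr_supercomm hx hζ hθ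
  rw [show r + 1 + r = 1 by rw [add_right_comm, two_zmod, zero_add]] at hξ
  have hp : IsTargetPoint 𝒜 V x (fun a => θ * ζ a) := ⟨hx, hξ⟩
  rw [h V x _ hp φ hφ hφφ, evalOne_one hp]

/-- The derivative of `g` along `ζ`, in terms of the Hamiltonian vector field `v` of `g`. -/
theorem IsTargetContraction.apply_eq {p r : ZMod 2} {v : A → A} {α : OneForm A} {g : A}
    (h : IsTargetContraction 𝒜 p v α [(1, g)]) {x ζ : A → Gr V} (hx : IsSuperHom 𝒜 (Gr.par V) x)
    (hζ : IsDerAlong 𝒜 (Gr.par V) r x ζ) :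
    ζ g = (α.map fun fg => gradePow (r + 1) (x (v fg.1)) * ζ fg.2 +
      ksign (r + 1) (p + 1) • (gradePow (p + 1) (ζ fg.1) * x (v fg.2))).sum := by
  obtain ⟨V', _, _, _, L, θ, hθ, hθθ, hcan, -⟩ := Gr.exists_fresh V (r + 1)
  have hx' := hx.comp (P' := Gr.par V') (ExteriorAlgebra.map L) fun _ _ => Gr.map_mem L
  have hζ' := hζ.comp (P' := Gr.par V') (ExteriorAlgebra.map L) fun _ _ => Gr.map_mem L
  have hξ := IsDerAlong.mul_left (fun i j a ha b hb => Gr.mul_mem ha hb) gr_supercomm hx' hζ' hθ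
  rw [show r + 1 + r = 1 by rw [add_right_comm, two_zmod, zero_add]] at hξ
  have hp : IsTargetPoint 𝒜 V' (fun a => ExteriorAlgebra.map L (x a)) _ := ⟨hx', hξ⟩
  have h1 := h.eval hp
  rw [evalOne_one hp] at h1
  have hgp : ∀ (q : ZMod 2) (u : Gr V), ExteriorAlgebra.map L (gradePow q u) =
      gradePow q (ExteriorAlgebra.map L u) := by
    intro q u
    rcases zmod_two_cases q with h | h <;> simp [h, Gr.gradeInv_map]
  symm
  refine sub_eq_zero.1 (hcan _ ?_)
  rw [map_sub, mul_sub, sub_eq_zero, ← h1, map_list_sum, List.map_map, ← List.sum_map_mul_left]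
  congr 1
  refine List.map_congr_left fun fg _ => ?_
  rw [map_mul, gradePow_of_mem hθ, ← mul_assoc, Gr.mul_par hθ]
  simp [hgp, mul_add, mul_assoc]

/-- This is the graded antisymmetry of the Poisson bracket: the value of `ω` at `θ x∘v + φ x∘w` is
computed once by treating `φ x∘w` as the increment and once by treating `θ x∘v` as the increment,
and both independent parameters are cancelled. -/
theorem IsTargetContraction.antisymm {p q : ZMod 2} {v w : A → A} {α : OneForm A} {a b : A}
    (hv : IsTargetContraction 𝒜 p v α [(1, a)]) (hw : IsTargetContraction 𝒜 q w α [(1, b)])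
    (hv' : IsDerAlong 𝒜 𝒜 p id v) (hw' : IsDerAlong 𝒜 𝒜 q id w) {x : A → Gr V}
    (hx : IsSuperHom 𝒜 (Gr.par V) x) : x (v b) = ksign (p + 1) (q + 1) • x (w a) := by
  obtain ⟨V₁, _, _, _, L₁, θ, hθ, hθθ, hcan₁, -⟩ := Gr.exists_fresh V (p + 1)
  obtain ⟨V₂, _, _, _, L₂, φ, hφ, hφφ, hcan₂, -⟩ := Gr.exists_fresh V₁ (q + 1)
  have hx₂ := (hx.comp (P' := Gr.par V₁) (ExteriorAlgebra.map L₁) fun _ _ => Gr.map_mem L₁).comp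
    (P' := Gr.par V₂) (ExteriorAlgebra.map L₂) fun _ _ => Gr.map_mem L₂
  have hθ' := Gr.map_mem L₂ hθ
  have hθθ' : ExteriorAlgebra.map L₂ θ * ExteriorAlgebra.map L₂ θ = 0 := by
    rw [← map_mul, hθθ, map_zero]
  have h1 := hw.evalD_add hx₂ (IsDerAlong.comp_left hx₂ hv') hθ' hφ hφφ
  have h2 := hv.evalD_add hx₂ (IsDerAlong.comp_left hx₂ hw') hφ hθ' hθθ'
  rw [evalD_mul hθ' hθθ', zero_add] at h1
  rw [evalD_mul hφ hφφ, zero_add] at h2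
  simp only [add_comm (φ * _)] at h2
  rw [h1, ← mul_assoc (ExteriorAlgebra.map L₂ θ) φ, Gr.supercomm hθ' hφ, smul_mul_assoc,
    mul_assoc φ, ← sub_eq_zero] at h2
  have h3 : φ * ExteriorAlgebra.map L₂ (θ * ExteriorAlgebra.map L₁
      (x (v b) - ksign (p + 1) (q + 1) • x (w a))) = 0 := by
    rw [← h2]
    simp only [map_mul, map_sub, map_smul, mul_sub, mul_smul_comm]
  exact sub_eq_zero.1 (hcan₁ _ (hcan₂ _ h3))

/-- Derivations along homomorphisms into Grassmann algebras are generated by finitely many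
vector fields. -/
theorem exists_generators {α : OneForm A} {m : ZMod 2}
    (hdec : ∀ a : A, ∃ b ∈ 𝒜 0, ∃ c ∈ 𝒜 1, b + c = a)
    (hnd : ∀ k, ∀ g ∈ 𝒜 k, ∃ v : A → A, IsDerAlong 𝒜 𝒜 (k + m) id v ∧
      IsTargetContraction 𝒜 (k + m) v α [(1, g)]) :
    ∃ G : List (ZMod 2 × A × (A → A)),
      (∀ e ∈ G, e.2.1 ∈ 𝒜 e.1 ∧ IsDerAlong 𝒜 𝒜 e.1 id e.2.2) ∧
      ∀ (V : Type) [AddCommGroup V] [Module ℝ V] [FiniteDimensional ℝ V] (r : ZMod 2)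
        (x ζ : A → Gr V), IsSuperHom 𝒜 (Gr.par V) x → IsDerAlong 𝒜 (Gr.par V) r x ζ →
        ∀ g, ζ g = (G.map fun e => ζ e.2.1 * x (e.2.2 g)).sum := by
  choose! H hH hH' using hnd
  choose c0 hc0 c1 hc1 hc using hdec
  let c : ZMod 2 → A → A := fun i a => if i = 0 then c0 a else c1 a
  have hcm : ∀ i a, c i a ∈ 𝒜 i := by
    intro i a
    rcases zmod_two_cases i with rfl | rfl
    · exact hc0 a
    · exact hc1 a
  have hcs : ∀ i a, c i a + c (i + 1) a = a := by
    intro i a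
    rcases zmod_two_cases i with rfl | rfl
    · exact hc a
    · rw [two_zmod, add_comm]; exact hc a
  -- For each term `df dg` of `ω`, only the homogeneous pieces with parities `i` and `i + m` are
  -- kept, each paired with the Hamiltonian field of the other piece. The function and the field of
  -- a generator then have equal parity.
  let e : A × A → ZMod 2 → List (ZMod 2 × A × (A → A)) := fun fg i =>
    [(i, c i fg.1, H (i + m) (c (i + m) fg.2)),
     (i + m, c (i + m) fg.2, fun a => ksign (i + m + 1) (i + 1) • H i (c i fg.1) a)]
  have hmm : ∀ i : ZMod 2, i + m + m = i := fun i => by rw [add_assoc, two_zmod, add_zero]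
  refine ⟨α.flatMap fun fg => e fg 0 ++ e fg 1, ?_, ?_⟩
  · have he : ∀ fg i, ∀ x ∈ e fg i, x.2.1 ∈ 𝒜 x.1 ∧ IsDerAlong 𝒜 𝒜 x.1 id x.2.2 := by
      intro fg i x hx
      simp only [e, List.mem_cons, List.not_mem_nil, or_false] at hx
      rcases hx with rfl | rfl
      · refine ⟨hcm _ _, ?_⟩
        have := hH (i + m) _ (hcm (i + m) fg.2)
        rwa [hmm] at this
      · exact ⟨hcm _ _, (hH i _ (hcm i fg.1)).smul _⟩
    intro x hx
    obtain ⟨fg, -, hx⟩ := List.mem_flatMap.1 hx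
    rcases List.mem_append.1 hx with h | h
    · exact he _ _ x h
    · exact he _ _ x h
  · intro V _ _ _ r x ζ hx hζ
    let R : A → Gr V := fun g =>
      ((α.flatMap fun fg => e fg 0 ++ e fg 1).map fun e => ζ e.2.1 * x (e.2.2 g)).sum
    change ∀ g, ζ g = R g
    have hR : ∀ g g', R (g + g') = R g + R g' := by
      intro g g'
      change _ = (List.map _ _).sum + (List.map _ _).sum
      rw [← List.sum_map_add]
      change (List.map _ _).sum = _
      congr 1
      refine List.map_congr_left fun x' hx' => ?_
      have he : ∀ fg i, ∀ x ∈ e fg i, ∀ g g', x.2.2 (g + g') = x.2.2 g + x.2.2 g' := by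
        intro fg i x hx g g'
        simp only [e, List.mem_cons, List.not_mem_nil, or_false] at hx
        rcases hx with rfl | rfl
        · exact (hH (i + m) _ (hcm (i + m) fg.2)).map_add g g'
        · exact ((hH i _ (hcm i fg.1)).smul _).map_add g g'
      obtain ⟨fg, -, hx'⟩ := List.mem_flatMap.1 hx'
      have : x'.2.2 (g + g') = x'.2.2 g + x'.2.2 g' := by
        rcases List.mem_append.1 hx' with h | h
        · exact he _ _ _ h g g'
        · exact he _ _ _ h g g'
      rw [this, hx.map_add, mul_add]
    suffices h : ∀ k, ∀ g ∈ 𝒜 k, ζ g = R g by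
      intro g
      rw [← hc g, hζ.map_add, hR, h 0 _ (hc0 g), h 1 _ (hc1 g)]
    intro k g hg
    set v := H k g with hv
    have hvd := hH k g hg
    let T : A → A → Gr V := fun f f' => gradePow (r + 1) (x (v f)) * ζ f' +
      ksign (r + 1) (k + m + 1) • (gradePow (k + m + 1) (ζ f) * x (v f'))
    have hT1 : ∀ f f' f'', T (f + f') f'' = T f f'' + T f' f'' := by
      intro f f' f''
      simp only [T, hvd.map_add, hx.map_add, hζ.map_add, map_add, add_mul, smul_add, hv]
      abel
    have hT2 : ∀ f f' f'', T f (f' + f'') = T f f' + T f f'' := by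
      intro f f' f''
      simp only [T, hvd.map_add, hx.map_add, hζ.map_add, mul_add, smul_add, hv]
      abel
    have hgp : ∀ {q i : ZMod 2} {u : Gr V}, u ∈ Gr.par V i → gradePow q u ∈ Gr.par V i := by
      intro q i u hu
      rw [gradePow_of_mem hu]; exact Submodule.smul_mem _ _ hu
    have hTm : ∀ i j, ∀ f ∈ 𝒜 i, ∀ f' ∈ 𝒜 j, T f f' ∈ Gr.par V (i + j + (k + m + r)) := by
      intro i j f hf f' hf'
      refine add_mem ?_ (Submodule.smul_mem _ _ ?_)
      · have := Gr.mul_mem (hgp (q := r + 1) (hx.parity _ _ (hvd.parity _ _ hf))) (hζ.parity _ _ hf')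
        convert this using 2; ring
      · have := Gr.mul_mem (hgp (q := k + m + 1) (hζ.parity _ _ hf)) (hx.parity _ _ (hvd.parity _ _ hf'))
        convert this using 2; ring
    -- The field `v` depends on `g`, but antisymmetry of the bracket trades `x (v f)` for the
    -- Hamiltonian field of `f` applied to `g`. This yields generators independent of `g`, `x` and
    -- `ζ`; the remaining work is to check the Koszul signs case by case.
    have hTe : ∀ i fg, T (c i fg.1) (c (i + m) fg.2) =
        ((e fg i).map fun e => ζ e.2.1 * x (e.2.2 g)).sum := by
      intro i fg
      have e1 : x (v (c (i + m) fg.2)) = ksign (k + m + 1) (i + 1) •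
          x (H (i + m) (c (i + m) fg.2) g) := by
        have := (hH' k g hg).antisymm (hH' (i + m) _ (hcm (i + m) fg.2)) hvd
          (hH (i + m) _ (hcm (i + m) fg.2)) hx
        rwa [hmm] at this
      have e2 : x (v (c i fg.1)) = ksign (k + m + 1) (i + m + 1) • x (H i (c i fg.1) g) :=
        (hH' k g hg).antisymm (hH' i _ (hcm i fg.1)) hvd (hH i _ (hcm i fg.1)) hx
      have m1 := hζ.parity _ _ (hcm i fg.1)
      have m2 := hx.parity _ _ (hvd.parity _ _ (hcm i fg.1))
      have m3 := hζ.parity _ _ (hcm (i + m) fg.2)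
      have m4 := hx.parity _ _ ((hH i _ (hcm i fg.1)).parity _ _ hg)
      simp only [T, e, List.map_cons, List.map_nil, List.sum_cons, List.sum_nil, add_zero]
      rw [gradePow_of_mem m2, gradePow_of_mem m1, e1, e2, hx.map_smul]
      simp only [smul_mul_assoc, mul_smul_comm, smul_smul]
      rw [Gr.supercomm m4 m3, smul_smul, add_comm]
      have h11 : (1 + 1 : ZMod 2) = 0 := by decide
      congr 1
      · rw [show ksign (r + 1) (k + m + 1) * (ksign (k + m + 1) (i + 1) * ksign (i + r) (k + m + 1)) = 1 from ?_, one_smul]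
        rcases zmod_two_cases r with rfl | rfl <;> rcases zmod_two_cases (k + m) with h | h <;>
          rcases zmod_two_cases i with rfl | rfl <;> simp [h, h11]
      · congr 1
        have : k + (i + m) = i + (k + m) := by ring
        rw [this]
        generalize k + m = p
        clear * - h11
        rcases zmod_two_cases r with rfl | rfl <;> rcases zmod_two_cases p with rfl | rfl <;>
          rcases zmod_two_cases i with rfl | rfl <;> rcases zmod_two_cases m with rfl | rfl <;>
          simp [h11]
    have hsum : ζ g = (α.map fun fg => T fg.1 fg.2).sum := (hH' k g hg).apply_eq hx hζ
    -- `W j` collects the pieces of `α` of total parity `j`. As `ζ g` is homogeneous, the part with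
    -- `j = m + 1`, which the generators do not cover, must vanish.
    let W : ZMod 2 → Gr V := fun j => (α.map fun fg => T (c 0 fg.1) (c j fg.2) +
      T (c 1 fg.1) (c (1 + j) fg.2)).sum
    have hW : ∀ j, W j ∈ Gr.par V (j + (k + m + r)) := by
      intro j
      refine list_sum_mem fun y hy => ?_
      obtain ⟨fg, -, rfl⟩ := List.mem_map.1 hy
      refine add_mem ?_ ?_
      · have := hTm 0 j _ (hcm 0 fg.1) _ (hcm j fg.2)
        rwa [zero_add] at this
      · have := hTm 1 (1 + j) _ (hcm 1 fg.1) _ (hcm (1 + j) fg.2)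
        rwa [← add_assoc 1 1 j, two_zmod, zero_add] at this
    have hWs : ζ g = W m + W (m + 1) := by
      rw [hsum, ← List.sum_map_add]
      congr 1
      refine List.map_congr_left fun fg _ => ?_
      have h1 := hcs 0 fg.1
      rw [zero_add] at h1
      have h2 := hcs m fg.2
      have h3 := hcs (1 + m) fg.2
      rw [add_assoc 1 m 1] at h3
      conv_lhs => rw [← h1, hT1]
      conv_lhs => arg 1; rw [← h2, hT2]
      conv_lhs => arg 2; rw [← h3, hT2]
      abel
    have hz := hζ.parity k g hg
    have hm0 : W m ∈ Gr.par V (k + r) := by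
      have := hW m
      rwa [show m + (k + m + r) = k + r + (m + m) by ring, two_zmod, add_zero] at this
    have hm1 : W (m + 1) ∈ Gr.par V (k + r + 1) := by
      have := hW (m + 1)
      rwa [show m + 1 + (k + m + r) = k + r + 1 + (m + m) by ring, two_zmod, add_zero] at this
    have hz0 : W (m + 1) = 0 := by
      refine Gr.eq_zero_of_mem ?_ hm1
      rw [hWs] at hz
      exact (Submodule.add_mem_iff_right _ hm0).1 hz
    rw [hWs, hz0, add_zero]
    refine Eq.trans ?_ (sum_map_flatMap _ _ _).symm
    refine congrArg List.sum (List.map_congr_left fun fg _ => ?_)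
    have t0 := hTe 0 fg
    have t1 := hTe 1 fg
    rw [zero_add] at t0
    rw [t0, t1, List.map_append, List.sum_append]

end Target

/-! ### Calculus for functions with values in Grassmann algebras -/

section Norm

variable (V : Type*) [AddCommGroup V] [Module ℝ V] [FiniteDimensional ℝ V]

/-- A norm on a finite-dimensional Grassmann algebra. -/
instance grNormedAddCommGroup : NormedAddCommGroup (Gr V) :=
  NormedAddCommGroup.induced (Gr V) (Fin (Module.finrank ℝ (Gr V)) → ℝ)
    (Module.finBasis ℝ (Gr V)).equivFun (Module.finBasis ℝ (Gr V)).equivFun.injective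

instance grNormedSpace : NormedSpace ℝ (Gr V) :=
  NormedSpace.induced ℝ (Gr V) (Fin (Module.finrank ℝ (Gr V)) → ℝ)
    (Module.finBasis ℝ (Gr V)).equivFun

end Norm

/-! ### Componentwise operations on vector-valued functions -/

section VecOp

variable {Y W W' E : Type*} [NormedAddCommGroup W] [NormedSpace ℝ W] [FiniteDimensional ℝ W]
  [NormedAddCommGroup W'] [NormedSpace ℝ W'] [FiniteDimensional ℝ W']
  [NormedAddCommGroup E] [NormedSpace ℝ E]

/-- Linear functionals separate points, so the vector selected by choice in `vecOp` is unique. This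
identifies it with honest derivatives and integrals. -/
theorem vecOp_eq {W : Type*} [AddCommGroup W] [Module ℝ W] {T : (Y → ℝ) → ℝ} {f : Y → W} {w : W}
    (h : ∀ l : Module.Dual ℝ W, l w = T (fun y => l (f y))) : vecOp T f = w := by
  have hex : ∃ w : W, ∀ l : Module.Dual ℝ W, l w = T (fun y => l (f y)) := ⟨w, h⟩
  rw [vecOp, dif_pos hex, ← sub_eq_zero, ← Module.forall_dual_apply_eq_zero_iff ℝ]
  intro l
  rw [map_sub, hex.choose_spec l, h l, sub_self]

theorem fderivWithin_linear (F : W →ₗ[ℝ] W') {f : E → W} {s : Set E} {y : E}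
    (hf : DifferentiableWithinAt ℝ f s y) (hs : UniqueDiffWithinAt ℝ s y) (v : E) :
    fderivWithin ℝ (fun z => F (f z)) s y v = F (fderivWithin ℝ f s y v) := by
  have := (LinearMap.toContinuousLinearMap F).hasFDerivAt.comp_hasFDerivWithinAt y
    hf.hasFDerivWithinAt
  exact congrArg (fun g => g v) (this.fderivWithin hs)

theorem vecOp_fderivWithin {f : E → W} {s : Set E} {y : E}
    (hf : DifferentiableWithinAt ℝ f s y) (hs : UniqueDiffWithinAt ℝ s y) (v : E) :
    vecOp (fun g => fderivWithin ℝ g s y v) f = fderivWithin ℝ f s y v :=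
  vecOp_eq fun l => (fderivWithin_linear l hf hs v).symm

theorem vecOp_integral [MeasurableSpace Y] {μ : MeasureTheory.Measure Y} {f : Y → W}
    (hf : MeasureTheory.Integrable f μ) : vecOp (fun g => ∫ y, g y ∂μ) f = ∫ y, f y ∂μ := by
  have := FiniteDimensional.complete ℝ W
  exact vecOp_eq fun l => ((LinearMap.toContinuousLinearMap l).integral_comp_comm hf).symm

theorem contDiffWithinAt_iff_dual {f : E → W} {s : Set E} {y : E} {n : ℕ∞ω} :
    ContDiffWithinAt ℝ n f s y ↔ ∀ l : Module.Dual ℝ W, ContDiffWithinAt ℝ n (fun z => l (f z)) s y := by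
  constructor
  · intro h l
    exact (LinearMap.toContinuousLinearMap l).contDiff.comp_contDiffWithinAt h
  · intro h
    let e := (Module.finBasis ℝ W).equivFun.toContinuousLinearEquiv
    have h1 : ContDiffWithinAt ℝ n (fun z => e (f z)) s y := by
      rw [contDiffWithinAt_pi]
      exact fun i => h ((Module.finBasis ℝ W).coord i)
    have h2 := e.symm.contDiff.comp_contDiffWithinAt h1
    refine h2.congr_of_eventuallyEq (Filter.Eventually.of_forall fun z => ?_) ?_ <;> simp

theorem contDiffWithinAt_linear (F : W →ₗ[ℝ] W') {f : E → W} {s : Set E} {y : E} {n : ℕ∞ω}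
    (hf : ContDiffWithinAt ℝ n f s y) : ContDiffWithinAt ℝ n (fun z => F (f z)) s y :=
  (LinearMap.toContinuousLinearMap F).contDiff.comp_contDiffWithinAt hf

end VecOp

section Mul

variable {V E : Type*} [AddCommGroup V] [Module ℝ V] [FiniteDimensional ℝ V]
  [NormedAddCommGroup E] [NormedSpace ℝ E] {f g : E → Gr V} {s : Set E} {y : E}

/-- Multiplication in a Grassmann algebra as a continuous bilinear map. -/
def grMulL (V : Type*) [AddCommGroup V] [Module ℝ V] [FiniteDimensional ℝ V] :
    Gr V →L[ℝ] Gr V →L[ℝ] Gr V := (LinearMap.mul ℝ (Gr V)).toContinuousBilinearMap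

theorem contDiffWithinAt_mul {n : ℕ∞ω} (hf : ContDiffWithinAt ℝ n f s y) (hg : ContDiffWithinAt ℝ n g s y) :
    ContDiffWithinAt ℝ n (fun z => f z * g z) s y :=
  (grMulL V).isBoundedBilinearMap.contDiff.comp_contDiffWithinAt (hf.prodMk hg)

theorem fderivWithin_gr_mul (hf : DifferentiableWithinAt ℝ f s y)
    (hg : DifferentiableWithinAt ℝ g s y) (hs : UniqueDiffWithinAt ℝ s y) (v : E) :
    fderivWithin ℝ (fun z => f z * g z) s y v =
      fderivWithin ℝ f s y v * g y + f y * fderivWithin ℝ g s y v := by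
  have h := ((grMulL V).hasFDerivWithinAt_of_bilinear hf.hasFDerivWithinAt
    hg.hasFDerivWithinAt).fderivWithin hs
  refine (congrArg (fun F => F v) h).trans ?_
  rw [add_comm]
  rfl

end Mul

/-! ### The exterior derivative on subsets of Euclidean space -/

section LocalForms

variable {d d' : ℕ} {V V' : Type*} [AddCommGroup V] [Module ℝ V] [FiniteDimensional ℝ V]
  [AddCommGroup V'] [Module ℝ V'] [FiniteDimensional ℝ V']
  {s : Set (Eu d)} {s' : Set (Eu d')} {y : Eu d}

/-- The exterior derivative of a form on a subset of Euclidean space. -/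
def locD (s : Set (Eu d)) (γ : Eu d → Fib (Eu d) V) (y : Eu d) : Fib (Eu d) V :=
  ∑ i : Fin d, covec d V i * fderivWithin ℝ γ s y (EuclideanSpace.single i 1)

theorem locD_congr {γ δ : Eu d → Fib (Eu d) V} (h : γ =ᶠ[𝓝[s] y] δ) (hy : y ∈ s) :
    locD s γ y = locD s δ y := by
  simp only [locD, h.fderivWithin_eq (h.self_of_nhdsWithin hy)]

theorem locD_add {γ δ : Eu d → Fib (Eu d) V} (hγ : DifferentiableWithinAt ℝ γ s y)
    (hδ : DifferentiableWithinAt ℝ δ s y) (hs : UniqueDiffWithinAt ℝ s y) :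
    locD s (fun z => γ z + δ z) y = locD s γ y + locD s δ y := by
  simp only [locD, ← Finset.sum_add_distrib]
  refine Finset.sum_congr rfl fun i _ => ?_
  rw [fderivWithin_fun_add hs hγ hδ, add_apply, mul_add]

theorem locD_linear (F : Fib (Eu d) V →ₗ[ℝ] Fib (Eu d) V') (hF : ∀ i u, F (covec d V i * u) =
    covec d V' i * F u) {γ : Eu d → Fib (Eu d) V} (hγ : DifferentiableWithinAt ℝ γ s y)
    (hs : UniqueDiffWithinAt ℝ s y) : locD s (fun z => F (γ z)) y = F (locD s γ y) := by
  simp only [locD, map_sum, hF, fderivWithin_linear F hγ hs]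

theorem locD_gradeInv {γ : Eu d → Fib (Eu d) V} (hγ : DifferentiableWithinAt ℝ γ s y)
    (hs : UniqueDiffWithinAt ℝ s y) :
    locD s (fun z => gradeInv (γ z)) y = -gradeInv (locD s γ y) := by
  simp only [locD, map_sum, map_mul, ← Finset.sum_neg_distrib]
  refine Finset.sum_congr rfl fun i _ => ?_
  have := fderivWithin_linear (gradeInv (V := Module.Dual ℝ (Eu d) × V)).toLinearMap hγ hs
    (EuclideanSpace.single i 1)
  simp only [AlgHom.toLinearMap_apply] at this
  rw [this, covec, gradeInv_ι, neg_mul, neg_neg]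

theorem locD_mul {γ δ : Eu d → Fib (Eu d) V} (hγ : DifferentiableWithinAt ℝ γ s y)
    (hδ : DifferentiableWithinAt ℝ δ s y) (hs : UniqueDiffWithinAt ℝ s y) :
    locD s (fun z => γ z * δ z) y = locD s γ y * δ y + gradeInv (γ y) * locD s δ y := by
  simp only [locD, Finset.sum_mul, Finset.mul_sum, ← Finset.sum_add_distrib]
  refine Finset.sum_congr rfl fun i _ => ?_
  rw [fderivWithin_gr_mul hγ hδ hs, mul_add, ← mul_assoc, ← mul_assoc, ← mul_assoc]
  congr 2
  rw [Gr.mul_odd (covec_mem i), gradeInv_gradeInv]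

theorem locD_fibNum {γ : Eu d → Fib (Eu d) V} (hγ : DifferentiableWithinAt ℝ γ s y)
    (hs : UniqueDiffWithinAt ℝ s y) :
    fibNum (locD s γ y) = locD s (fun z => fibNum (γ z)) y + locD s γ y := by
  let F : Fib (Eu d) V →ₗ[ℝ] Fib (Eu d) V :=
    { toFun := fibNum, map_add' := fibNum_add, map_smul' := fibNum_smul }
  have hsum : fibNum (locD s γ y) = ∑ i : Fin d, fibNum (covec d V i *
      fderivWithin ℝ γ s y (EuclideanSpace.single i 1)) := map_sum F _ _
  rw [hsum, locD, locD, ← Finset.sum_add_distrib]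
  refine Finset.sum_congr rfl fun i _ => ?_
  have := fderivWithin_linear F hγ hs (EuclideanSpace.single i 1)
  rw [show fderivWithin ℝ (fun z => fibNum (γ z)) s y (EuclideanSpace.single i 1) =
    fibNum (fderivWithin ℝ γ s y (EuclideanSpace.single i 1)) from this, covec, fibNum_ι_mul, add_comm]

theorem locD_mem {γ : Eu d → Fib (Eu d) V} {i : ZMod 2} (h : ∀ z, γ z ∈ Gr.par _ i)
    (hγ : DifferentiableWithinAt ℝ γ s y)
    (hs : UniqueDiffWithinAt ℝ s y) : locD s γ y ∈ Gr.par _ (i + 1) := by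
  refine Gr.mem_of_gradeInv ?_
  have h1 := locD_gradeInv hγ hs
  have h2 : (fun z => gradeInv (γ z)) = fun z =>
      (ksign i 1 • (LinearMap.id : Fib (Eu d) V →ₗ[ℝ] Fib (Eu d) V)) (γ z) := by
    ext1 z; rw [Gr.gradeInv_of_mem (h z)]; rfl
  rw [h2, locD_linear _ _ hγ hs] at h1
  · rw [← neg_eq_iff_eq_neg.2 h1, ksign_add_left, ksign_one_one, mul_neg_one, neg_smul]; rfl
  · intro i u; simp

/-- Exchanging the indices fixes the coefficients and reverses the sign of `dy^i dy^j`, so the sum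
is its own negative. -/
theorem sum_covec_mul_covec (a : Fin d → Fin d → Fib (Eu d) V) (h : ∀ i j, a i j = a j i) :
    ∑ i, ∑ j, covec d V i * (covec d V j * a i j) = 0 := by
  have h1 : ∑ i, ∑ j, covec d V i * (covec d V j * a i j) =
      -∑ i, ∑ j, covec d V i * (covec d V j * a i j) := by
    conv_lhs => rw [Finset.sum_comm]
    rw [← Finset.sum_neg_distrib]
    refine Finset.sum_congr rfl fun i _ => ?_
    rw [← Finset.sum_neg_distrib]
    refine Finset.sum_congr rfl fun j _ => ?_
    rw [h j i, ← mul_assoc, ← mul_assoc, ← neg_mul]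
    congr 1
    exact ι_mul_covec _ _
  exact Gr.eq_zero_of_eq_neg h1

/-- The second derivative within a set is symmetric at points in the closure of the interior. The
ranges of models with corners satisfy this, so boundary points need no separate treatment. -/
theorem locD_locD {γ : Eu d → Fib (Eu d) V} (hγ : ContDiffWithinAt ℝ ∞ γ s y)
    (hs : UniqueDiffOn ℝ s) (hy : y ∈ s) (hy' : y ∈ closure (interior s)) :
    locD s (locD s γ) y = 0 := by
  have hsymm : IsSymmSndFDerivWithinAt ℝ γ s y :=
    hγ.isSymmSndFDerivWithinAt
      (by rw [minSmoothness_of_isRCLikeNormedField]; exact WithTop.coe_le_coe.2 le_top) hs hy' hy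
  have hd : DifferentiableWithinAt ℝ (fderivWithin ℝ γ s) s y :=
    (hγ.fderivWithin_right (m := 1) hs (by norm_cast) hy).differentiableWithinAt (by norm_num)
  have h1 : ∀ i, fderivWithin ℝ (locD s γ) s y (EuclideanSpace.single i 1) =
      ∑ j : Fin d, covec d V j * fderivWithin ℝ (fderivWithin ℝ γ s) s y
        (EuclideanSpace.single i 1) (EuclideanSpace.single j 1) := by
    intro i
    let F : (Eu d →L[ℝ] Fib (Eu d) V) →ₗ[ℝ] Fib (Eu d) V :=
      { toFun := fun T => ∑ j : Fin d, covec d V j * T (EuclideanSpace.single j 1)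
        map_add' := fun T T' => by simp [mul_add, Finset.sum_add_distrib]
        map_smul' := fun t T => by simp [Finset.smul_sum] }
    exact fderivWithin_linear F hd (hs y hy) (EuclideanSpace.single i 1)
  rw [locD]
  simp only [h1, Finset.mul_sum]
  exact sum_covec_mul_covec _ fun i j => hsymm _ _

end LocalForms

/-! ### Naturality of the exterior derivative in Euclidean space -/

section LocalPullback

variable {d d' : ℕ} {V V' E : Type*} [AddCommGroup V] [Module ℝ V] [FiniteDimensional ℝ V]
  [AddCommGroup V'] [Module ℝ V'] [FiniteDimensional ℝ V'] [NormedAddCommGroup E] [NormedSpace ℝ E]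

/-- The `1`-form `a ∘ T`, as a linear function of `T`. -/
def compCovec (V : Type*) [AddCommGroup V] [Module ℝ V] (a : Module.Dual ℝ (Eu d')) :
    (Eu d →L[ℝ] Eu d') →ₗ[ℝ] Fib (Eu d) V :=
  ExteriorAlgebra.ι ℝ ∘ₗ LinearMap.inl ℝ (Module.Dual ℝ (Eu d)) V ∘ₗ
    LinearMap.llcomp ℝ (Eu d) (Eu d') ℝ a ∘ₗ ContinuousLinearMap.coeLM ℝ

theorem fibMap_ι_eq (T : Eu d →L[ℝ] Eu d') (L : V →ₗ[ℝ] V') (a : Module.Dual ℝ (Eu d')) (v : V) :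
    fibMap T.toLinearMap L (ExteriorAlgebra.ι ℝ (a, v)) =
      compCovec V' a T + ExteriorAlgebra.ι ℝ (0, L v) := by
  rw [fibMap_ι, compCovec]
  simp only [LinearMap.comp_apply, ← map_add]
  congr 1
  ext1
  · ext1 z; simp
  · simp

theorem contDiffWithinAt_fibMap_const {n : ℕ∞ω} {T : E → (Eu d →L[ℝ] Eu d')} {s : Set E} {y : E}
    (hT : ContDiffWithinAt ℝ n T s y) (L : V →ₗ[ℝ] V') (e : Fib (Eu d') V) :
    ContDiffWithinAt ℝ n (fun z => fibMap (T z).toLinearMap L e) s y := by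
  induction e using Gr.induction with
  | algebraMap r => simp only [AlgHom.commutes]; exact contDiffWithinAt_const
  | add x y hx hy => simp only [map_add]; exact hx.add hy
  | ι_mul x v hx =>
    obtain ⟨a, v⟩ := v
    simp only [map_mul, fibMap_ι_eq]
    exact contDiffWithinAt_mul ((contDiffWithinAt_linear _ hT).add contDiffWithinAt_const) hx

theorem contDiffWithinAt_fibMap {n : ℕ∞ω} {T : E → (Eu d →L[ℝ] Eu d')} {f : E → Fib (Eu d') V}
    {s : Set E} {y : E} (hT : ContDiffWithinAt ℝ n T s y) (hf : ContDiffWithinAt ℝ n f s y)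
    (L : V →ₗ[ℝ] V') : ContDiffWithinAt ℝ n (fun z => fibMap (T z).toLinearMap L (f z)) s y := by
  let b := Module.finBasis ℝ (Fib (Eu d') V)
  have h : (fun z => fibMap (T z).toLinearMap L (f z)) = fun z =>
      ∑ k, b.coord k (f z) • fibMap (T z).toLinearMap L (b k) := by
    ext1 z
    conv_lhs => rw [← b.sum_repr (f z)]
    simp only [map_sum, map_smul]
    rfl
  rw [h]
  exact ContDiffWithinAt.sum fun k _ =>
    (contDiffWithinAt_linear (b.coord k) hf).smul (contDiffWithinAt_fibMap_const hT L _)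

theorem compCovec_eq_sum (a : Module.Dual ℝ (Eu d')) (T : Eu d →L[ℝ] Eu d') :
    compCovec V a T = ∑ i, a (T (EuclideanSpace.single i 1)) • covec d V i := by
  have := sum_smul_covec (V := V) (a ∘ₗ T.toLinearMap)
  exact this.symm

/-- A constant form pulled back along a smooth map is closed. -/
theorem locD_fibMap_const {s : Set (Eu d)} {y : Eu d} {φ : Eu d → Eu d'}
    (hφ : ContDiffWithinAt ℝ ∞ φ s y) (hs : UniqueDiffOn ℝ s) (hy : y ∈ s)
    (hy' : y ∈ closure (interior s)) (e : Fib (Eu d') V) :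
    locD s (fun z => fibMap (fderivWithin ℝ φ s z).toLinearMap LinearMap.id e) y = 0 := by
  have hD : ContDiffWithinAt ℝ ∞ (fderivWithin ℝ φ s) s y :=
    hφ.fderivWithin_right hs (by norm_cast) hy
  have hd : ∀ e : Fib (Eu d') V, DifferentiableWithinAt ℝ
      (fun z => fibMap (fderivWithin ℝ φ s z).toLinearMap LinearMap.id e) s y := fun e =>
    (contDiffWithinAt_fibMap_const hD LinearMap.id e).differentiableWithinAt (by simp)
  have hd0 := hD.differentiableWithinAt (by simp)
  induction e using Gr.induction with
  | algebraMap r =>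
    simp [locD]
  | add x z hx hz =>
    simp only [map_add]
    rw [locD_add (hd _) (hd _) (hs y hy), hx, hz, add_zero]
  | ι_mul x v hx =>
    obtain ⟨a, v⟩ := v
    have hsymm : IsSymmSndFDerivWithinAt ℝ φ s y :=
      hφ.isSymmSndFDerivWithinAt
        (by rw [minSmoothness_of_isRCLikeNormedField]; exact WithTop.coe_le_coe.2 le_top) hs hy' hy
    have hι := hd (ExteriorAlgebra.ι ℝ (a, v))
    -- On a generator, the pullback of a covector is linear in the derivative of `φ`, so its
    -- exterior derivative antisymmetrises the second derivative of `φ` and vanishes.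
    have h0 : locD s (fun z => fibMap (fderivWithin ℝ φ s z).toLinearMap LinearMap.id
        (ExteriorAlgebra.ι ℝ (a, v))) y = 0 := by
      simp only [fibMap_ι_eq]
      have hc : DifferentiableWithinAt ℝ (fun z => compCovec V a (fderivWithin ℝ φ s z)) s y :=
        (contDiffWithinAt_linear (compCovec V a) hD).differentiableWithinAt (by simp)
      rw [locD_add hc (differentiableWithinAt_const _) (hs y hy)]
      have h1 : locD s (fun _ : Eu d => (ExteriorAlgebra.ι ℝ ((0 : Module.Dual ℝ (Eu d)),
          (LinearMap.id : V →ₗ[ℝ] V) v) : Fib (Eu d) V)) y = 0 := by simp [locD]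
      rw [h1, add_zero, locD]
      simp only [fderivWithin_linear (compCovec V a) hd0 (hs y hy)]
      simp only [compCovec_eq_sum, Finset.mul_sum]
      have := sum_covec_mul_covec (fun i j => a (fderivWithin ℝ (fderivWithin ℝ φ s) s y
        (EuclideanSpace.single i 1) (EuclideanSpace.single j 1)) • (1 : Fib (Eu d) V)) fun i j => by
          rw [hsymm]
      simpa using this
    simp only [map_mul]
    rw [locD_mul hι (hd _) (hs y hy), h0, hx, zero_mul, mul_zero, add_zero]

/-- Expand `γ` in a basis of constant forms. The pulled back basis forms are closed by
`locD_fibMap_const`, so only the derivatives of the coefficients contribute, and the chain rule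
turns them into the pullback of `locD s' γ`. -/
theorem locD_pull {s : Set (Eu d)} {s' : Set (Eu d')} {y : Eu d} {φ : Eu d → Eu d'}
    {γ : Eu d' → Fib (Eu d') V} (hφ : ContDiffWithinAt ℝ ∞ φ s y)
    (hγ : DifferentiableWithinAt ℝ γ s' (φ y)) (hs : UniqueDiffOn ℝ s) (hy : y ∈ s)
    (hy' : y ∈ closure (interior s)) (hm : ∀ᶠ z in 𝓝[s] y, φ z ∈ s') :
    locD s (fun z => fibMap (fderivWithin ℝ φ s z).toLinearMap LinearMap.id (γ (φ z))) y =
      fibMap (fderivWithin ℝ φ s y).toLinearMap LinearMap.id (locD s' γ (φ y)) := by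
  let b := Module.finBasis ℝ (Fib (Eu d') V)
  have hD : ContDiffWithinAt ℝ ∞ (fderivWithin ℝ φ s) s y :=
    hφ.fderivWithin_right hs (by norm_cast) hy
  set T := fderivWithin ℝ φ s y with hT
  let F : Fin _ → Eu d → Fib (Eu d) V := fun k z =>
    fibMap (fderivWithin ℝ φ s z).toLinearMap LinearMap.id (b k)
  have hF : ∀ k, DifferentiableWithinAt ℝ (F k) s y := fun k =>
    (contDiffWithinAt_fibMap_const hD LinearMap.id (b k)).differentiableWithinAt (by simp)
  have hφd := (hφ.differentiableWithinAt (by simp)).hasFDerivWithinAt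
  have hm' : Filter.Tendsto φ (𝓝[s] y) (𝓝[s'] (φ y)) :=
    tendsto_nhdsWithin_iff.2 ⟨hφ.continuousWithinAt, hm⟩
  have hc : ∀ k, HasFDerivWithinAt (fun z => b.coord k (γ (φ z)))
      ((LinearMap.toContinuousLinearMap (b.coord k)).comp ((fderivWithin ℝ γ s' (φ y)).comp T)) s y := by
    intro k
    exact (LinearMap.toContinuousLinearMap (b.coord k)).hasFDerivAt.comp_hasFDerivWithinAt y
      (hγ.hasFDerivWithinAt.comp_of_tendsto y hφd hm')
  have h : (fun z => fibMap (fderivWithin ℝ φ s z).toLinearMap LinearMap.id (γ (φ z))) = fun z =>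
      ∑ k, b.coord k (γ (φ z)) • F k z := by
    ext1 z
    conv_lhs => rw [← b.sum_repr (γ (φ z))]
    simp only [map_sum, map_smul]
    rfl
  have hder : ∀ v, fderivWithin ℝ (fun z => ∑ k, b.coord k (γ (φ z)) • F k z) s y v =
      ∑ k, (b.coord k (γ (φ y)) • fderivWithin ℝ (F k) s y v +
        b.coord k (fderivWithin ℝ γ s' (φ y) (T v)) • F k y) := by
    intro v
    have := (HasFDerivWithinAt.fun_sum fun k (_ : k ∈ Finset.univ) =>
      (hc k).smul (hF k).hasFDerivWithinAt).fderivWithin (hs y hy)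
    refine (congrArg (fun g => g v) this).trans ?_
    simp
  rw [h, locD]
  simp only [hder, Finset.sum_add_distrib, mul_add]
  have h1 : ∑ i, covec d V i * ∑ k, b.coord k (γ (φ y)) •
      fderivWithin ℝ (F k) s y (EuclideanSpace.single i 1) = 0 := by
    simp only [Finset.mul_sum]
    rw [Finset.sum_comm]
    refine Finset.sum_eq_zero fun k _ => ?_
    have := locD_fibMap_const hφ hs hy hy' (b k)
    rw [locD] at this
    simp only [mul_smul_comm, ← Finset.smul_sum]
    exact (congrArg _ this).trans (smul_zero _)
  have h2 : ∀ u : Fib (Eu d') V, ∑ k, b.coord k u • F k y = fibMap T.toLinearMap LinearMap.id u := by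
    intro u
    conv_rhs => rw [← b.sum_repr u]
    simp only [map_sum, map_smul]
    rfl
  simp only [h1, h2, zero_add]
  have h3 : ∀ v : Eu d', v = ∑ j, v j • EuclideanSpace.single j (1 : ℝ) := by
    intro v
    have := (EuclideanSpace.basisFun (Fin d') ℝ).toBasis.sum_repr v
    simpa using this.symm
  have h4 : ∀ j, fibMap T.toLinearMap LinearMap.id (covec d' V j) =
      ∑ i, (T (EuclideanSpace.single i 1)) j • covec d V i := by
    intro j
    rw [covec, fibMap_ι_eq]
    have := compCovec_eq_sum (V := V) (EuclideanSpace.proj (𝕜 := ℝ) j).toLinearMap T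
    rw [this]
    simp
  have h5 : ∀ i, fibMap T.toLinearMap LinearMap.id
      (fderivWithin ℝ γ s' (φ y) (T (EuclideanSpace.single i 1))) =
      ∑ j, (T (EuclideanSpace.single i 1)) j • fibMap T.toLinearMap LinearMap.id
        (fderivWithin ℝ γ s' (φ y) (EuclideanSpace.single j 1)) := by
    intro i
    conv_lhs => rw [h3 (T (EuclideanSpace.single i 1))]
    simp only [map_sum, map_smul]
  simp only [h5, locD, map_sum, map_mul, h4, Finset.mul_sum, Finset.sum_mul, mul_smul_comm,
    smul_mul_assoc]
  exact Finset.sum_comm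

end LocalPullback

/-! ### Differential forms on manifolds -/

section Pointwise

variable {d d' : ℕ} {H H' : Type*} [TopologicalSpace H] [TopologicalSpace H']
  {I : ModelWithCorners ℝ (Eu d) H} {I' : ModelWithCorners ℝ (Eu d') H'}
  {N N' : Type*} [TopologicalSpace N] [ChartedSpace H N] [TopologicalSpace N'] [ChartedSpace H' N']
  {V V' V'' : Type*} [AddCommGroup V] [Module ℝ V] [AddCommGroup V'] [Module ℝ V']
  [AddCommGroup V''] [Module ℝ V'']

/-- The value of a form at `x`, where the tangent space at `x` is identified with `ℝ^d`. -/
def Form.val (β : Form I N V) (x : N) : Fib (Eu d) V := β x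

theorem Form.ext {β γ : Form I N V} (h : ∀ x, β.val x = γ.val x) : β = γ := funext h

theorem Form.val_add (β γ : Form I N V) (x : N) : (β + γ).val x = β.val x + γ.val x := rfl
theorem Form.val_sub (β γ : Form I N V) (x : N) : (β - γ).val x = β.val x - γ.val x := rfl
theorem Form.val_neg (β : Form I N V) (x : N) : (-β).val x = -β.val x := rfl
theorem Form.val_mul (β γ : Form I N V) (x : N) : (β * γ).val x = β.val x * γ.val x := rfl
theorem Form.val_smul (t : ℝ) (β : Form I N V) (x : N) : (t • β).val x = t • β.val x := rfl
theorem Form.val_zero (x : N) : (0 : Form I N V).val x = 0 := rfl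
theorem Form.val_one (x : N) : (1 : Form I N V).val x = 1 := rfl
theorem Form.val_const (θ : Gr V) (x : N) : (Form.const I θ : Form I N V).val x = constMap θ := rfl
theorem Form.val_number (β : Form I N V) (x : N) : (β.number I).val x = fibNum (β.val x) := rfl
theorem Form.val_bc (L : V →ₗ[ℝ] V') (β : Form I N V) (x : N) :
    (β.bc I L).val x = fibMap LinearMap.id L (β.val x) := rfl

theorem Form.mem_par {β : Form I N V} {i : ZMod 2} :
    β ∈ Form.par I N V i ↔ ∀ x, β.val x ∈ Gr.par _ i := by
  simp only [Form.par, Submodule.mem_pi, Set.mem_univ, true_implies]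
  rfl

/-- The grading involution on forms. -/
def Form.inv (β : Form I N V) : Form I N V := fun x =>
  (gradeInv (β.val x) : Fib (Eu d) V)

theorem Form.val_inv (β : Form I N V) (x : N) : β.inv.val x = gradeInv (β.val x) := rfl

/-- Pullback of forms along a map. -/
def Form.comap (f : N → N') (β : Form I' N' V) : Form I N V := fun x =>
  fibMap (mfderiv I I' f x).toLinearMap LinearMap.id (β (f x))

variable (I I') in
/-- The derivative of a map between manifolds, as a map of Euclidean spaces. -/
def eucDeriv (f : N → N') (x : N) : Eu d →L[ℝ] Eu d' := mfderiv I I' f x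

variable (I) in
/-- The derivative of the inverse of a chart, as a map of Euclidean spaces. -/
def chartInvDeriv (x₀ : N) (y : Eu d) : Eu d →L[ℝ] Eu d :=
  mfderivWithin 𝓘(ℝ, Eu d) I (extChartAt I x₀).symm (Set.range I) y

theorem Form.val_comap (f : N → N') (β : Form I' N' V) (x : N) :
    (β.comap f : Form I N V).val x =
      fibMap (eucDeriv I I' f x).toLinearMap LinearMap.id (β.val (f x)) := rfl

theorem Form.inChart_eq (β : Form I N V) (x₀ : N) (y : Eu d) : β.inChart I x₀ y =
    fibMap (chartInvDeriv I x₀ y).toLinearMap LinearMap.id (β.val ((extChartAt I x₀).symm y)) := rfl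

theorem Form.inChart_add (β γ : Form I N V) (x₀ : N) (y : Eu d) :
    (β + γ).inChart I x₀ y = β.inChart I x₀ y + γ.inChart I x₀ y := by
  simp only [Form.inChart_eq, Form.val_add, map_add]
theorem Form.inChart_mul (β γ : Form I N V) (x₀ : N) (y : Eu d) :
    (β * γ).inChart I x₀ y = β.inChart I x₀ y * γ.inChart I x₀ y := by
  simp only [Form.inChart_eq, Form.val_mul, map_mul]
theorem Form.inChart_smul (t : ℝ) (β : Form I N V) (x₀ : N) (y : Eu d) :
    (t • β).inChart I x₀ y = t • β.inChart I x₀ y := by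
  simp only [Form.inChart_eq, Form.val_smul, map_smul]
theorem Form.inChart_zero (x₀ : N) (y : Eu d) : (0 : Form I N V).inChart I x₀ y = 0 := by
  simp only [Form.inChart_eq, Form.val_zero, map_zero]
theorem Form.inChart_const (θ : Gr V) (x₀ : N) (y : Eu d) :
    (Form.const I θ : Form I N V).inChart I x₀ y = constMap θ := by
  rw [Form.inChart_eq, Form.val_const, fibMap_constMap]
  simp
theorem Form.inChart_number (β : Form I N V) (x₀ : N) (y : Eu d) :
    (β.number I).inChart I x₀ y = fibNum (β.inChart I x₀ y) := by
  simp only [Form.inChart_eq, Form.val_number, fibNum_fibMap]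
theorem Form.inChart_bc (L : V →ₗ[ℝ] V') (β : Form I N V) (x₀ : N) (y : Eu d) :
    (β.bc I L).inChart I x₀ y = fibMap LinearMap.id L (β.inChart I x₀ y) := by
  simp only [Form.inChart_eq, Form.val_bc, fibMap_fibMap]
  rfl
theorem Form.inChart_inv (β : Form I N V) (x₀ : N) (y : Eu d) :
    β.inv.inChart I x₀ y = gradeInv (β.inChart I x₀ y) := by
  simp only [Form.inChart_eq, Form.val_inv, gradeInv_fibMap]
theorem Form.inChart_mem {β : Form I N V} {i : ZMod 2} (h : β ∈ Form.par I N V i) (x₀ : N)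
    (y : Eu d) : β.inChart I x₀ y ∈ Gr.par _ i :=
  fibMap_mem _ _ (Form.mem_par.1 h _)

/-! Algebra of forms -/

theorem Form.inv_inv (β : Form I N V) : β.inv.inv = β :=
  Form.ext fun x => by simp only [Form.val_inv, gradeInv_gradeInv]
theorem Form.inv_add (β γ : Form I N V) : (β + γ).inv = β.inv + γ.inv :=
  Form.ext fun x => by simp only [Form.val_inv, Form.val_add, map_add]
theorem Form.inv_mul (β γ : Form I N V) : (β * γ).inv = β.inv * γ.inv :=
  Form.ext fun x => by simp only [Form.val_inv, Form.val_mul, map_mul]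
theorem Form.inv_of_mem {β : Form I N V} {i : ZMod 2} (h : β ∈ Form.par I N V i) :
    β.inv = ksign i 1 • β :=
  Form.ext fun x => by
    rw [Form.val_inv, Form.val_smul, Gr.gradeInv_of_mem (Form.mem_par.1 h x)]

theorem Form.const_mem {θ : Gr V} {i : ZMod 2} (h : θ ∈ Gr.par V i) :
    (Form.const I θ : Form I N V) ∈ Form.par I N V i :=
  Form.mem_par.2 fun _ => constMap_mem h
theorem Form.bc_mem (L : V →ₗ[ℝ] V') {β : Form I N V} {i : ZMod 2} (h : β ∈ Form.par I N V i) :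
    β.bc I L ∈ Form.par I N V' i :=
  Form.mem_par.2 fun x => fibMap_mem _ _ (Form.mem_par.1 h x)
theorem Form.mul_mem {β γ : Form I N V} {i j : ZMod 2} (h : β ∈ Form.par I N V i)
    (h' : γ ∈ Form.par I N V j) : β * γ ∈ Form.par I N V (i + j) :=
  Form.mem_par.2 fun x => Gr.mul_mem (Form.mem_par.1 h x) (Form.mem_par.1 h' x)
theorem Form.number_mem {β : Form I N V} {i : ZMod 2} (h : β ∈ Form.par I N V i) :
    β.number I ∈ Form.par I N V i :=
  Form.mem_par.2 fun x => fibNum_mem (Form.mem_par.1 h x)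
theorem Form.supercomm {β γ : Form I N V} {i j : ZMod 2} (h : β ∈ Form.par I N V i)
    (h' : γ ∈ Form.par I N V j) : β * γ = ksign i j • (γ * β) :=
  Form.ext fun x => Gr.supercomm (Form.mem_par.1 h x) (Form.mem_par.1 h' x)

theorem Form.number_add (β γ : Form I N V) : (β + γ).number I = β.number I + γ.number I :=
  Form.ext fun _ => fibNum_add _ _
theorem Form.number_smul (t : ℝ) (β : Form I N V) : (t • β).number I = t • β.number I :=
  Form.ext fun _ => fibNum_smul _ _
theorem Form.number_mul (β γ : Form I N V) :
    (β * γ).number I = β.number I * γ + β * γ.number I :=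
  Form.ext fun _ => fibNum_mul _ _
theorem Form.number_const (θ : Gr V) : (Form.const I θ : Form I N V).number I = 0 :=
  Form.ext fun _ => fibNum_constMap _
theorem Form.number_bc (L : V →ₗ[ℝ] V') (β : Form I N V) :
    (β.bc I L).number I = (β.number I).bc I L :=
  Form.ext fun x => by simp only [Form.val_number, Form.val_bc, fibNum_fibMap]

theorem Form.bc_add (L : V →ₗ[ℝ] V') (β γ : Form I N V) :
    (β + γ).bc I L = β.bc I L + γ.bc I L := Form.ext fun _ => map_add _ _ _
theorem Form.bc_sub (L : V →ₗ[ℝ] V') (β γ : Form I N V) :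
    (β - γ).bc I L = β.bc I L - γ.bc I L := Form.ext fun _ => map_sub _ _ _
theorem Form.bc_mul (L : V →ₗ[ℝ] V') (β γ : Form I N V) :
    (β * γ).bc I L = β.bc I L * γ.bc I L := Form.ext fun _ => map_mul _ _ _
theorem Form.bc_smul (L : V →ₗ[ℝ] V') (t : ℝ) (β : Form I N V) :
    (t • β).bc I L = t • β.bc I L := Form.ext fun x => by simp only [Form.val_bc, Form.val_smul, map_smul]
theorem Form.bc_one (L : V →ₗ[ℝ] V') : (1 : Form I N V).bc I L = 1 :=
  Form.ext fun _ => map_one _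
theorem Form.bc_zero (L : V →ₗ[ℝ] V') : (0 : Form I N V).bc I L = 0 :=
  Form.ext fun _ => map_zero _

theorem Form.const_mul (θ θ' : Gr V) :
    (Form.const I (θ * θ') : Form I N V) = Form.const I θ * Form.const I θ' :=
  Form.ext fun _ => map_mul _ _ _

theorem Form.comap_add (f : N → N') (β γ : Form I' N' V) :
    (β + γ).comap f = (β.comap f + γ.comap f : Form I N V) := Form.ext fun _ => map_add _ _ _
theorem Form.comap_sub (f : N → N') (β γ : Form I' N' V) :
    (β - γ).comap f = (β.comap f - γ.comap f : Form I N V) := Form.ext fun _ => map_sub _ _ _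
theorem Form.comap_mul (f : N → N') (β γ : Form I' N' V) :
    (β * γ).comap f = (β.comap f * γ.comap f : Form I N V) := Form.ext fun _ => map_mul _ _ _
theorem Form.comap_smul (f : N → N') (t : ℝ) (β : Form I' N' V) :
    (t • β).comap f = (t • β.comap f : Form I N V) := Form.ext fun x => by
    simp only [Form.val_comap, Form.val_smul, map_smul]
theorem Form.comap_one (f : N → N') :
    (1 : Form I' N' V).comap f = (1 : Form I N V) := Form.ext fun _ => map_one _
theorem Form.comap_mem (f : N → N') {β : Form I' N' V} {i : ZMod 2}
    (h : β ∈ Form.par I' N' V i) : (β.comap f : Form I N V) ∈ Form.par I N V i :=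
  Form.mem_par.2 fun _ => fibMap_mem _ _ (Form.mem_par.1 h _)
theorem Form.number_comap (f : N → N') (β : Form I' N' V) :
    (β.comap f : Form I N V).number I = (β.number I').comap f :=
  Form.ext fun x => by simp only [Form.val_number, Form.val_comap, fibNum_fibMap]

end Pointwise

/-! ### Smooth forms and the exterior derivative -/

section Manifold

variable {d d' : ℕ} {H H' : Type*} [TopologicalSpace H] [TopologicalSpace H']
  {I : ModelWithCorners ℝ (Eu d) H} {I' : ModelWithCorners ℝ (Eu d') H'}
  {N N' : Type*} [TopologicalSpace N] [ChartedSpace H N] [TopologicalSpace N'] [ChartedSpace H' N']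
  {V V' : Type*} [AddCommGroup V] [Module ℝ V] [AddCommGroup V'] [Module ℝ V']

variable (I I') in
/-- The expression of a map in charts. -/
def chartMap (f : N → N') (x₀ : N) (x₁ : N') : Eu d → Eu d' :=
  extChartAt I' x₁ ∘ f ∘ (extChartAt I x₀).symm

theorem eventually_mem_target {x₀ : N} {y : Eu d} (hy : y ∈ (extChartAt I x₀).target) :
    ∀ᶠ z in 𝓝[Set.range I] y, z ∈ (extChartAt I x₀).target :=
  extChartAt_target_mem_nhdsWithin_of_mem hy

theorem eventually_chart {f : N → N'} {x₀ : N} {x₁ : N'} {y : Eu d}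
    (hy : y ∈ (extChartAt I x₀).target) (hf : ContinuousAt f ((extChartAt I x₀).symm y))
    (hx : f ((extChartAt I x₀).symm y) ∈ (extChartAt I' x₁).source) :
    ∀ᶠ z in 𝓝 y, f ((extChartAt I x₀).symm z) ∈ (extChartAt I' x₁).source :=
  (hf.comp (continuousAt_extChartAt_symm'' hy)).eventually
    ((isOpen_extChartAt_source (I := I') x₁).mem_nhds hx)

theorem contDiffWithinAt_chartMap [IsManifold I ∞ N] [IsManifold I' ∞ N'] {f : N → N'} {x₀ : N}
    {x₁ : N'} {y : Eu d} (hy : y ∈ (extChartAt I x₀).target)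
    (hf : ContMDiffAt I I' ∞ f ((extChartAt I x₀).symm y))
    (hx : f ((extChartAt I x₀).symm y) ∈ (extChartAt I' x₁).source) :
    ContDiffWithinAt ℝ ∞ (chartMap I I' f x₀ x₁) (Set.range I) y := by
  have h0 : (extChartAt I x₀).symm y ∈ (chartAt H x₀).source := by
    simpa using (extChartAt I x₀).map_target hy
  have := ((contMDiffAt_iff_of_mem_source (y := x₁) h0 (by simpa using hx)).1 hf).2
  rwa [(extChartAt I x₀).right_inv hy] at this

/-- The chain rule is applied to `f` after the inverse chart and then to the chart of the target
manifold; the inverse of the latter undoes its derivative. -/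
theorem fderivWithin_chartMap [IsManifold I ∞ N] [IsManifold I' ∞ N'] {f : N → N'} {x₀ : N}
    {x₁ : N'} {y : Eu d} (hy : y ∈ (extChartAt I x₀).target)
    (hf : MDifferentiableAt I I' f ((extChartAt I x₀).symm y))
    (hx : f ((extChartAt I x₀).symm y) ∈ (extChartAt I' x₁).source) :
    (chartInvDeriv I' x₁ (chartMap I I' f x₀ x₁ y)).comp
        (fderivWithin ℝ (chartMap I I' f x₀ x₁) (Set.range I) y) =
      (eucDeriv I I' f ((extChartAt I x₀).symm y)).comp (chartInvDeriv I x₀ y) := by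
  have U : UniqueMDiffWithinAt 𝓘(ℝ, Eu d) (Set.range I) y :=
    I.uniqueMDiffOn _ (extChartAt_target_subset_range x₀ hy)
  have h1 := mdifferentiableWithinAt_extChartAt_symm (I := I) hy
  have h2 : MDifferentiableAt I' 𝓘(ℝ, Eu d') (extChartAt I' x₁) (f ((extChartAt I x₀).symm y)) :=
    mdifferentiableAt_extChartAt (by simpa using hx)
  have e1 := mfderiv_comp_mfderivWithin (x := y) (s := Set.range I) (g := f) hf h1 U
  have e2 := mfderiv_comp_mfderivWithin (x := y) (s := Set.range I)
    (f := f ∘ (extChartAt I x₀).symm) (g := extChartAt I' x₁) h2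
    (MDifferentiableAt.comp_mdifferentiableWithinAt y hf h1) U
  have e3 := mfderivWithin_extChartAt_symm_comp_mfderiv_extChartAt' (I := I') hx
  rw [mfderivWithin_eq_fderivWithin] at e2
  ext1 v
  have e2' := congrArg (fun T => T v) e2
  have e1' := congrArg (fun T => T v) e1
  have e3' := congrArg (fun T => T (mfderivWithin 𝓘(ℝ, Eu d) I' (f ∘ (extChartAt I x₀).symm)
    (Set.range I) y v)) e3
  have e4 : fderivWithin ℝ (chartMap I I' f x₀ x₁) (Set.range I) y v =
    mfderiv I' 𝓘(ℝ, Eu d') (extChartAt I' x₁) (f ((extChartAt I x₀).symm y))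
      (mfderivWithin 𝓘(ℝ, Eu d) I' (f ∘ (extChartAt I x₀).symm) (Set.range I) y v) := e2'
  change chartInvDeriv I' x₁ _ (fderivWithin ℝ (chartMap I I' f x₀ x₁) (Set.range I) y v) = _
  rw [e4]
  exact e3'.trans e1'

/-- The expression of a pullback in charts. -/
theorem Form.inChart_comap [IsManifold I ∞ N] [IsManifold I' ∞ N'] {f : N → N'} {x₀ : N} {x₁ : N'}
    {y : Eu d} (hy : y ∈ (extChartAt I x₀).target)
    (hf : MDifferentiableAt I I' f ((extChartAt I x₀).symm y))
    (hx : f ((extChartAt I x₀).symm y) ∈ (extChartAt I' x₁).source) (β : Form I' N' V) :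
    (β.comap f : Form I N V).inChart I x₀ y =
      fibMap (fderivWithin ℝ (chartMap I I' f x₀ x₁) (Set.range I) y).toLinearMap LinearMap.id
        (β.inChart I' x₁ (chartMap I I' f x₀ x₁ y)) := by
  rw [Form.inChart_eq, Form.val_comap, Form.inChart_eq, fibMap_fibMap, fibMap_fibMap]
  have h : (extChartAt I' x₁).symm (chartMap I I' f x₀ x₁ y) = f ((extChartAt I x₀).symm y) :=
    (extChartAt I' x₁).left_inv hx
  rw [h]
  have := fderivWithin_chartMap hy hf hx
  have h2 := congrArg ContinuousLinearMap.toLinearMap this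
  rw [ContinuousLinearMap.toLinearMap_comp, ContinuousLinearMap.toLinearMap_comp] at h2
  rw [h2]

theorem Form.comap_id (β : Form I N V) : (β.comap id : Form I N V) = β :=
  Form.ext fun x => by
    rw [Form.val_comap]
    have : eucDeriv I I (id : N → N) x = ContinuousLinearMap.id ℝ (Eu d) := mfderiv_id
    rw [this]
    exact fibMap_id _

/-- Change of charts. -/
theorem Form.inChart_change [IsManifold I ∞ N] {x₀ x₁ : N} {y : Eu d}
    (hy : y ∈ (extChartAt I x₀).target)
    (hx : (extChartAt I x₀).symm y ∈ (extChartAt I x₁).source) (β : Form I N V) :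
    β.inChart I x₀ y =
      fibMap (fderivWithin ℝ (chartMap I I id x₀ x₁) (Set.range I) y).toLinearMap LinearMap.id
        (β.inChart I x₁ (chartMap I I id x₀ x₁ y)) := by
  conv_lhs => rw [← Form.comap_id β]
  exact Form.inChart_comap hy mdifferentiableAt_id hx β

theorem Form.val_eq_inChart [IsManifold I ∞ N] (β : Form I N V) (x : N) :
    β.val x = β.inChart I x (extChartAt I x x) := by
  rw [Form.inChart_eq, extChartAt_to_inv]
  have : chartInvDeriv I x (extChartAt I x x) = ContinuousLinearMap.id ℝ (Eu d) :=
    mfderivWithin_range_extChartAt_symm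
  rw [this]
  exact (fibMap_id _).symm

variable [FiniteDimensional ℝ V] [FiniteDimensional ℝ V']

theorem Form.isSmooth_iff {β : Form I N V} : β.IsSmooth I ↔ ∀ x₀ : N,
    ∀ y ∈ (extChartAt I x₀).target, ContDiffWithinAt ℝ ∞ (β.inChart I x₀) (Set.range I) y := by
  refine forall_congr' fun x₀ => ?_
  have h : ∀ y ∈ (extChartAt I x₀).target, ∀ l : Module.Dual ℝ (Fib (Eu d) V),
      ContDiffWithinAt ℝ ∞ (fun y => l (β.inChart I x₀ y)) (extChartAt I x₀).target y ↔
      ContDiffWithinAt ℝ ∞ (fun y => l (β.inChart I x₀ y)) (Set.range I) y := fun y hy l =>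
    contDiffWithinAt_congr_set <| nhdsWithin_eq_iff_eventuallyEq.1 <|
      nhdsWithin_extChartAt_target_eq_of_mem hy
  constructor
  · intro hβ y hy
    exact contDiffWithinAt_iff_dual.2 fun l => (h y hy l).1 (hβ l y hy)
  · intro hβ l y hy
    exact (h y hy l).2 (contDiffWithinAt_iff_dual.1 (hβ y hy) l)

theorem Form.IsSmooth.contDiffWithinAt {β : Form I N V} (hβ : β.IsSmooth I) {x₀ : N} {y : Eu d}
    (hy : y ∈ (extChartAt I x₀).target) : ContDiffWithinAt ℝ ∞ (β.inChart I x₀) (Set.range I) y :=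
  Form.isSmooth_iff.1 hβ x₀ y hy

theorem Form.IsSmooth.differentiableWithinAt {β : Form I N V} (hβ : β.IsSmooth I) {x₀ : N}
    {y : Eu d} (hy : y ∈ (extChartAt I x₀).target) :
    DifferentiableWithinAt ℝ (β.inChart I x₀) (Set.range I) y :=
  (hβ.contDiffWithinAt hy).differentiableWithinAt (by simp)

theorem Form.IsSmooth.linear {β : Form I N V} (hβ : β.IsSmooth I) {γ : Form I N V'}
    (F : Fib (Eu d) V →ₗ[ℝ] Fib (Eu d) V')
    (h : ∀ x₀ y, γ.inChart I x₀ y = F (β.inChart I x₀ y)) : γ.IsSmooth I :=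
  Form.isSmooth_iff.2 fun x₀ y hy => by
    rw [show γ.inChart I x₀ = fun y => F (β.inChart I x₀ y) from funext (h x₀)]
    exact contDiffWithinAt_linear F (hβ.contDiffWithinAt hy)

theorem Form.IsSmooth.add {β γ : Form I N V} (hβ : β.IsSmooth I) (hγ : γ.IsSmooth I) :
    (β + γ).IsSmooth I :=
  Form.isSmooth_iff.2 fun x₀ y hy => by
    rw [show (β + γ).inChart I x₀ = fun y => β.inChart I x₀ y + γ.inChart I x₀ y from
      funext (Form.inChart_add β γ x₀)]
    exact (hβ.contDiffWithinAt hy).add (hγ.contDiffWithinAt hy)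

theorem Form.IsSmooth.mul {β γ : Form I N V} (hβ : β.IsSmooth I) (hγ : γ.IsSmooth I) :
    (β * γ).IsSmooth I :=
  Form.isSmooth_iff.2 fun x₀ y hy => by
    rw [show (β * γ).inChart I x₀ = fun y => β.inChart I x₀ y * γ.inChart I x₀ y from
      funext (Form.inChart_mul β γ x₀)]
    exact contDiffWithinAt_mul (hβ.contDiffWithinAt hy) (hγ.contDiffWithinAt hy)

theorem Form.IsSmooth.smul {β : Form I N V} (hβ : β.IsSmooth I) (t : ℝ) : (t • β).IsSmooth I :=
  hβ.linear (t • LinearMap.id) (Form.inChart_smul t β)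

theorem Form.IsSmooth.sub {β γ : Form I N V} (hβ : β.IsSmooth I) (hγ : γ.IsSmooth I) :
    (β - γ).IsSmooth I := by
  have := hβ.add (hγ.smul (-1))
  rwa [neg_one_smul, ← sub_eq_add_neg] at this

theorem Form.IsSmooth.inv {β : Form I N V} (hβ : β.IsSmooth I) : β.inv.IsSmooth I :=
  hβ.linear (gradeInv (V := Module.Dual ℝ (Eu d) × V)).toLinearMap (Form.inChart_inv β)

theorem Form.IsSmooth.number {β : Form I N V} (hβ : β.IsSmooth I) : (β.number I).IsSmooth I :=
  hβ.linear { toFun := fibNum, map_add' := fibNum_add, map_smul' := fibNum_smul }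
    (Form.inChart_number β)

theorem Form.IsSmooth.bc {β : Form I N V} (hβ : β.IsSmooth I) (L : V →ₗ[ℝ] V') :
    (β.bc I L).IsSmooth I :=
  hβ.linear (fibMap (E := Eu d) LinearMap.id L).toLinearMap (Form.inChart_bc L β)

theorem Form.isSmooth_const (θ : Gr V) : (Form.const I θ : Form I N V).IsSmooth I :=
  Form.isSmooth_iff.2 fun x₀ y _ => by
    rw [show (Form.const I θ : Form I N V).inChart I x₀ = fun _ => constMap θ from
      funext (Form.inChart_const θ x₀)]
    exact contDiffWithinAt_const

theorem Form.isSmooth_zero : (0 : Form I N V).IsSmooth I :=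
  Form.isSmooth_iff.2 fun x₀ y _ => by
    rw [show (0 : Form I N V).inChart I x₀ = fun _ => 0 from funext (Form.inChart_zero x₀)]
    exact contDiffWithinAt_const

theorem Form.isSmooth_list_sum {ι : Type*} (l : List ι) (f : ι → Form I N V)
    (h : ∀ i ∈ l, (f i).IsSmooth I) : (l.map f).sum.IsSmooth I := by
  induction l with
  | nil => exact Form.isSmooth_zero
  | cons a l ih =>
    rw [List.map_cons, List.sum_cons]
    exact (h a (by simp)).add (ih fun i hi => h i (by simp [hi]))

/-- Smoothness of `f` is demanded only on an open set, so that the result covers pullback along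
charts and along locally defined retractions. -/
theorem Form.IsSmooth.contDiffWithinAt_comap [IsManifold I ∞ N] [IsManifold I' ∞ N'] {f : N → N'}
    {U : Set N} (hU : IsOpen U) (hf : ContMDiffOn I I' ∞ f U) {β : Form I' N' V}
    (hβ : β.IsSmooth I') {x₀ : N} {y : Eu d} (hy : y ∈ (extChartAt I x₀).target)
    (hyU : (extChartAt I x₀).symm y ∈ U) :
    ContDiffWithinAt ℝ ∞ ((β.comap f : Form I N V).inChart I x₀) (Set.range I) y := by
  set x₁ := f ((extChartAt I x₀).symm y) with hx₁
  have hx : f ((extChartAt I x₀).symm y) ∈ (extChartAt I' x₁).source := mem_extChartAt_source _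
  have hfU : ∀ z ∈ U, ContMDiffAt I I' ∞ f z := fun z hz => hf.contMDiffAt (hU.mem_nhds hz)
  have hφ := contDiffWithinAt_chartMap hy (hfU _ hyU) hx
  have hr : y ∈ Set.range I := extChartAt_target_subset_range x₀ hy
  have hD : ContDiffWithinAt ℝ ∞ (fderivWithin ℝ (chartMap I I' f x₀ x₁) (Set.range I))
      (Set.range I) y := hφ.fderivWithin_right I.uniqueDiffOn (by norm_cast) hr
  have hc' : ContDiffWithinAt ℝ ∞ (fun z => β.inChart I' x₁ (chartMap I I' f x₀ x₁ z))
      (Set.range I) y :=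
    ContDiffWithinAt.comp (t := Set.range I') y
      (hβ.contDiffWithinAt ((extChartAt I' x₁).map_source hx)) hφ fun z _ => Set.mem_range_self _
  have hm : ∀ z ∈ U, MDifferentiableAt I I' f z := fun z hz => (hfU z hz).mdifferentiableAt (by simp)
  have hev : ∀ᶠ z in 𝓝 y, (extChartAt I x₀).symm z ∈ U :=
    (continuousAt_extChartAt_symm'' hy).eventually (hU.mem_nhds hyU)
  refine (contDiffWithinAt_fibMap hD hc' LinearMap.id).congr_of_eventuallyEq ?_
    (Form.inChart_comap hy (hm _ hyU) hx β)
  filter_upwards [eventually_mem_target hy, hev.filter_mono nhdsWithin_le_nhds,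
    (eventually_chart hy (hfU _ hyU).continuousAt hx).filter_mono nhdsWithin_le_nhds] with z hz hzU hz'
  exact Form.inChart_comap hz (hm _ hzU) hz' β

theorem Form.IsSmooth.comap [IsManifold I ∞ N] [IsManifold I' ∞ N'] {f : N → N'}
    (hf : ContMDiff I I' ∞ f) {β : Form I' N' V} (hβ : β.IsSmooth I') :
    (β.comap f : Form I N V).IsSmooth I :=
  Form.isSmooth_iff.2 fun _ _ hy =>
    hβ.contDiffWithinAt_comap isOpen_univ hf.contMDiffOn hy (Set.mem_univ _)

/-! The exterior derivative -/

variable [IsManifold I ∞ N] [IsManifold I' ∞ N']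

theorem Form.val_exteriorDeriv {β : Form I N V} (hβ : β.IsSmooth I) (x : N) :
    (β.exteriorDeriv I).val x = locD (Set.range I) (β.inChart I x) (extChartAt I x x) := by
  have h : ∀ i, vecOp (fun f => fderivWithin ℝ f (Set.range I) (extChartAt I x x)
      (EuclideanSpace.single i 1)) (fun y => β.inChart I x y) =
      fderivWithin ℝ (β.inChart I x) (Set.range I) (extChartAt I x x)
        (EuclideanSpace.single i 1) := fun i =>
    vecOp_fderivWithin (hβ.differentiableWithinAt (mem_extChartAt_target x))
      (I.uniqueDiffOn _ (Set.mem_range_self _)) _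
  have h0 : (β.exteriorDeriv I).val x = ∑ i, covec d V i * vecOp (fun f => fderivWithin ℝ f
      (Set.range I) (extChartAt I x x) (EuclideanSpace.single i 1)) (fun y => β.inChart I x y) := rfl
  simp only [h0, h, locD]

/-- The expression of the pullback of a form by a map, with the exterior derivative taken
in charts. -/
theorem locD_comap {f : N → N'} (hf : ContMDiff I I' ∞ f) {β : Form I' N' V} (hβ : β.IsSmooth I')
    {x₀ : N} {x₁ : N'} {y : Eu d} (hy : y ∈ (extChartAt I x₀).target)
    (hx : f ((extChartAt I x₀).symm y) ∈ (extChartAt I' x₁).source) :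
    locD (Set.range I) ((β.comap f : Form I N V).inChart I x₀) y =
      fibMap (fderivWithin ℝ (chartMap I I' f x₀ x₁) (Set.range I) y).toLinearMap LinearMap.id
        (locD (Set.range I') (β.inChart I' x₁) (chartMap I I' f x₀ x₁ y)) := by
  have hr : y ∈ Set.range I := extChartAt_target_subset_range x₀ hy
  have hm : ∀ z, MDifferentiableAt I I' f z := fun z => (hf z).mdifferentiableAt (by simp)
  rw [← locD_pull (contDiffWithinAt_chartMap hy (hf _) hx)
    (hβ.differentiableWithinAt ((extChartAt I' x₁).map_source hx)) I.uniqueDiffOn hr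
    (I.range_subset_closure_interior hr) (Filter.Eventually.of_forall fun z => Set.mem_range_self _)]
  refine locD_congr ?_ hr
  filter_upwards [eventually_mem_target hy, (eventually_chart hy (hf _).continuousAt hx).filter_mono
    nhdsWithin_le_nhds] with z hz hz'
  exact Form.inChart_comap hz (hm _) hz' β

/-- At each point the exterior derivative is defined through the preferred chart of that point.
Naturality under the transition maps, that is, pullback along the identity, makes it agree with the
derivative in an arbitrary chart. -/
theorem Form.inChart_exteriorDeriv {β : Form I N V} (hβ : β.IsSmooth I) {x₀ : N} {y : Eu d}
    (hy : y ∈ (extChartAt I x₀).target) :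
    (β.exteriorDeriv I).inChart I x₀ y = locD (Set.range I) (β.inChart I x₀) y := by
  set x₁ := (extChartAt I x₀).symm y with hx₁
  have hx : id ((extChartAt I x₀).symm y) ∈ (extChartAt I x₁).source := mem_extChartAt_source _
  have h := locD_comap (I' := I) (f := (id : N → N)) contMDiff_id hβ hy hx
  rw [Form.comap_id] at h
  rw [h, Form.inChart_change hy hx]
  have h2 : chartMap I I id x₀ x₁ y = extChartAt I x₁ x₁ := rfl
  rw [h2, ← Form.val_eq_inChart, Form.val_exteriorDeriv hβ]

theorem Form.IsSmooth.exteriorDeriv {β : Form I N V} (hβ : β.IsSmooth I) :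
    (β.exteriorDeriv I).IsSmooth I := by
  refine Form.isSmooth_iff.2 fun x₀ y hy => ?_
  have hr : y ∈ Set.range I := extChartAt_target_subset_range x₀ hy
  have h : ContDiffWithinAt ℝ ∞ (locD (Set.range I) (β.inChart I x₀)) (Set.range I) y := by
    have hD : ContDiffWithinAt ℝ ∞ (fderivWithin ℝ (β.inChart I x₀) (Set.range I))
      (Set.range I) y := (hβ.contDiffWithinAt hy).fderivWithin_right I.uniqueDiffOn
        (by norm_cast) hr
    exact ContDiffWithinAt.sum fun i _ => contDiffWithinAt_mul contDiffWithinAt_const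
      (hD.clm_apply contDiffWithinAt_const)
  refine h.congr_of_eventuallyEq ?_ (Form.inChart_exteriorDeriv hβ hy)
  filter_upwards [eventually_mem_target hy] with z hz
  exact Form.inChart_exteriorDeriv hβ hz

theorem Form.exteriorDeriv_exteriorDeriv {β : Form I N V} (hβ : β.IsSmooth I) :
    (β.exteriorDeriv I).exteriorDeriv I = 0 := by
  refine Form.ext fun x => ?_
  have hy := mem_extChartAt_target (I := I) x
  have hr : extChartAt I x x ∈ Set.range I := Set.mem_range_self _
  rw [Form.val_exteriorDeriv hβ.exteriorDeriv, locD_congr (δ := locD (Set.range I) (β.inChart I x)) _ hr,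
    locD_locD (hβ.contDiffWithinAt hy) I.uniqueDiffOn hr (I.range_subset_closure_interior hr)]
  · rfl
  · filter_upwards [eventually_mem_target hy] with z hz
    exact Form.inChart_exteriorDeriv hβ hz

theorem Form.exteriorDeriv_add {β γ : Form I N V} (hβ : β.IsSmooth I) (hγ : γ.IsSmooth I) :
    (β + γ).exteriorDeriv I = β.exteriorDeriv I + γ.exteriorDeriv I := by
  refine Form.ext fun x => ?_
  have hy := mem_extChartAt_target (I := I) x
  have hs := I.uniqueDiffOn _ (Set.mem_range_self (chartAt H x x))
  rw [Form.val_add, Form.val_exteriorDeriv (hβ.add hγ), Form.val_exteriorDeriv hβ,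
    Form.val_exteriorDeriv hγ, ← locD_add (hβ.differentiableWithinAt hy)
      (hγ.differentiableWithinAt hy) hs]
  congr 1
  exact funext (Form.inChart_add β γ x)

theorem Form.exteriorDeriv_linear {β : Form I N V} (hβ : β.IsSmooth I) {γ : Form I N V'}
    (F : Fib (Eu d) V →ₗ[ℝ] Fib (Eu d) V')
    (hF : ∀ i u, F (covec d V i * u) = covec d V' i * F u)
    (h : ∀ x₀ y, γ.inChart I x₀ y = F (β.inChart I x₀ y)) (x : N) :
    (γ.exteriorDeriv I).val x = F ((β.exteriorDeriv I).val x) := by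
  have hy := mem_extChartAt_target (I := I) x
  have hs := I.uniqueDiffOn _ (Set.mem_range_self (chartAt H x x))
  rw [Form.val_exteriorDeriv (hβ.linear F h), Form.val_exteriorDeriv hβ,
    ← locD_linear F hF (hβ.differentiableWithinAt hy) hs]
  congr 1
  exact funext (h x)

theorem Form.exteriorDeriv_smul {β : Form I N V} (hβ : β.IsSmooth I) (t : ℝ) :
    (t • β).exteriorDeriv I = t • β.exteriorDeriv I :=
  Form.ext fun x => Form.exteriorDeriv_linear hβ (t • LinearMap.id) (by simp)
    (Form.inChart_smul t β) x

theorem Form.exteriorDeriv_bc {β : Form I N V} (hβ : β.IsSmooth I) (L : V →ₗ[ℝ] V') :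
    (β.bc I L).exteriorDeriv I = (β.exteriorDeriv I).bc I L :=
  Form.ext fun x => Form.exteriorDeriv_linear hβ (fibMap (E := Eu d) LinearMap.id L).toLinearMap
    (by intro i u; simp only [AlgHom.toLinearMap_apply, map_mul]; simp [covec]) (Form.inChart_bc L β) x

theorem Form.exteriorDeriv_sub {β γ : Form I N V} (hβ : β.IsSmooth I) (hγ : γ.IsSmooth I) :
    (β - γ).exteriorDeriv I = β.exteriorDeriv I - γ.exteriorDeriv I := by
  have h : β - γ = β + (-1 : ℝ) • γ := by rw [neg_one_smul, sub_eq_add_neg]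
  rw [h, Form.exteriorDeriv_add hβ (hγ.smul _), Form.exteriorDeriv_smul hγ, neg_one_smul,
    sub_eq_add_neg]

theorem Form.exteriorDeriv_mul {β γ : Form I N V} (hβ : β.IsSmooth I) (hγ : γ.IsSmooth I) :
    (β * γ).exteriorDeriv I = β.exteriorDeriv I * γ + β.inv * γ.exteriorDeriv I := by
  refine Form.ext fun x => ?_
  have hy := mem_extChartAt_target (I := I) x
  have hs := I.uniqueDiffOn _ (Set.mem_range_self (chartAt H x x))
  rw [Form.val_add, Form.val_mul, Form.val_mul, Form.val_exteriorDeriv (hβ.mul hγ),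
    Form.val_exteriorDeriv hβ, Form.val_exteriorDeriv hγ, Form.val_inv, Form.val_eq_inChart γ,
    Form.val_eq_inChart β, ← locD_mul (hβ.differentiableWithinAt hy)
      (hγ.differentiableWithinAt hy) hs]
  congr 1
  exact funext (Form.inChart_mul β γ x)

theorem Form.exteriorDeriv_const (θ : Gr V) :
    (Form.const I θ : Form I N V).exteriorDeriv I = 0 := by
  refine Form.ext fun x => ?_
  rw [Form.val_exteriorDeriv (Form.isSmooth_const θ)]
  have : (Form.const I θ : Form I N V).inChart I x = fun _ => constMap θ :=
    funext (Form.inChart_const θ x)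
  rw [this, Form.val_zero]
  simp [locD]

theorem Form.exteriorDeriv_mem {β : Form I N V} (hβ : β.IsSmooth I) {i : ZMod 2}
    (h : β ∈ Form.par I N V i) : β.exteriorDeriv I ∈ Form.par I N V (i + 1) := by
  refine Form.mem_par.2 fun x => ?_
  rw [Form.val_exteriorDeriv hβ]
  exact locD_mem (fun z => Form.inChart_mem h x z)
    (hβ.differentiableWithinAt (mem_extChartAt_target x))
    (I.uniqueDiffOn _ (Set.mem_range_self (chartAt H x x)))

theorem Form.number_exteriorDeriv {β : Form I N V} (hβ : β.IsSmooth I) :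
    (β.exteriorDeriv I).number I = (β.number I).exteriorDeriv I + β.exteriorDeriv I := by
  refine Form.ext fun x => ?_
  rw [Form.val_number, Form.val_add, Form.val_exteriorDeriv hβ, Form.val_exteriorDeriv hβ.number,
    locD_fibNum (hβ.differentiableWithinAt (mem_extChartAt_target x))
    (I.uniqueDiffOn _ (Set.mem_range_self (chartAt H x x)))]
  congr 2
  exact funext fun y => (Form.inChart_number β x y).symm

theorem Form.exteriorDeriv_comap {f : N → N'} (hf : ContMDiff I I' ∞ f) {β : Form I' N' V}
    (hβ : β.IsSmooth I') :
    (β.comap f : Form I N V).exteriorDeriv I = (β.exteriorDeriv I').comap f := by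
  refine Form.ext fun x => ?_
  have hy := mem_extChartAt_target (I := I) x
  have hx : f ((extChartAt I x).symm (extChartAt I x x)) ∈ (extChartAt I' (f x)).source := by
    rw [extChartAt_to_inv]; exact mem_extChartAt_source _
  rw [Form.val_exteriorDeriv (hβ.comap hf), locD_comap hf hβ hy hx, Form.val_eq_inChart,
    Form.inChart_comap hy ((hf _).mdifferentiableAt (by simp)) hx, Form.inChart_exteriorDeriv hβ]
  exact (extChartAt I' (f x)).map_source hx

end Manifold

/-! ### Integration -/

section Algebra

variable {d : ℕ} {V : Type*} [AddCommGroup V] [Module ℝ V]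

/-- Coefficients come out on the right. Moving `θ` to the right past `w`, and then back to the left
past the top coefficient, whose parity differs from that of `w` by `d`, leaves exactly the sign
`(-1)^(|θ| d)`. This is the parity of the integral sign. -/
theorem topCoeff_constMap_mul {p : ZMod 2} {θ : Gr V} (hθ : θ ∈ Gr.par V p) (w : Fib (Eu d) V) :
    topCoeff (constMap θ * w) = ksign p d • (θ * topCoeff w) := by
  have h : ∀ i, ∀ w ∈ Gr.par (Module.Dual ℝ (Eu d) × V) i,
      topCoeff (constMap θ * w) = ksign p d • (θ * topCoeff w) := by
    intro i w hw
    rw [Gr.supercomm (constMap_mem hθ) hw, ← topCoeffL_apply, map_smul, topCoeffL_apply,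
      topCoeff_mul_constMap, Gr.supercomm (topCoeff_mem hw) hθ, smul_smul, ksign_add_left,
      ← mul_assoc, ksign_comm i p, ksign_mul_self, one_mul, ksign_comm]
  obtain ⟨a, ha, b, hb, rfl⟩ := Gr.exists_add w
  rw [mul_add, ← topCoeffL_apply, ← topCoeffL_apply, map_add, map_add, topCoeffL_apply,
    topCoeffL_apply, topCoeffL_apply, topCoeffL_apply, h 0 a ha, h 1 b hb, mul_add, smul_add]

end Algebra

/-! ### The integral and its independence of coordinates -/

section Integral

variable {d : ℕ} {H : Type*} [TopologicalSpace H]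
  {I : ModelWithCorners ℝ (Eu d) H} {N : Type*} [TopologicalSpace N] [ChartedSpace H N]
  {V V' : Type*} [AddCommGroup V] [Module ℝ V] [AddCommGroup V'] [Module ℝ V']
  (o : Orient I N)

/-- The value of the orientation form on the standard basis of the tangent space at `x`. -/
def Orient.dens (x : N) : ℝ :=
  o.vol x fun i => (EuclideanSpace.single i (1 : ℝ) : Eu d)

/-- The density of the orientation form in the chart at `c`. -/
def Orient.chartDens (c : N) (y : Eu d) : ℝ :=
  o.vol ((extChartAt I c).symm y) fun i => chartDeriv I c y (EuclideanSpace.single i 1)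

/-- The sign of the orientation in the chart at `c`. -/
def Orient.chartSign (c : N) (y : Eu d) : ℝ := (SignType.sign (o.chartDens c y) : ℝ)

theorem alternating_apply_comp (vol : (Eu d) [⋀^Fin d]→ₗ[ℝ] ℝ) (T : Eu d →ₗ[ℝ] Eu d)
    (v : Fin d → Eu d) : vol (fun i => T (v i)) = LinearMap.det T * vol v := by
  let e := (EuclideanSpace.basisFun (Fin d) ℝ).toBasis
  rw [vol.eq_smul_basis_det e, AlternatingMap.smul_apply, AlternatingMap.smul_apply]
  have := e.det_comp T v
  rw [show (fun i => T (v i)) = T ∘ v from rfl, this, smul_eq_mul, smul_eq_mul]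
  ring

theorem Orient.dens_ne_zero (x : N) : o.dens x ≠ 0 := by
  intro h
  refine o.ne_zero x ?_
  let vol : (Eu d) [⋀^Fin d]→ₗ[ℝ] ℝ := o.vol x
  have h1 : vol (EuclideanSpace.basisFun (Fin d) ℝ).toBasis = 0 := by
    rw [OrthonormalBasis.coe_toBasis]
    have : (⇑(EuclideanSpace.basisFun (Fin d) ℝ) : Fin d → Eu d) =
      fun i => EuclideanSpace.single i (1 : ℝ) := by ext1 i; simp
    rw [this]; exact h
  have h2 : vol = 0 := by
    rw [vol.eq_smul_basis_det (EuclideanSpace.basisFun (Fin d) ℝ).toBasis, h1, zero_smul]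
  exact h2

theorem Orient.chartDens_eq (c : N) (y : Eu d) : o.chartDens c y =
    LinearMap.det (chartInvDeriv I c y).toLinearMap * o.dens ((extChartAt I c).symm y) :=
  alternating_apply_comp (o.vol ((extChartAt I c).symm y)) (chartInvDeriv I c y).toLinearMap _

variable [IsManifold I ∞ N]

theorem isUnit_det_chartInvDeriv {c : N} {y : Eu d} (hy : y ∈ (extChartAt I c).target) :
    LinearMap.det (chartInvDeriv I c y).toLinearMap ≠ 0 := by
  obtain ⟨e, he⟩ := isInvertible_mfderivWithin_extChartAt_symm (I := I) hy
  let e' : Eu d ≃L[ℝ] Eu d := e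
  have : (chartInvDeriv I c y).toLinearMap = (e'.toLinearEquiv : Eu d →ₗ[ℝ] Eu d) := by
    ext1 v
    exact congrArg (fun T => T v) he.symm
  rw [this]
  exact (LinearEquiv.isUnit_det' e'.toLinearEquiv).ne_zero

theorem Orient.chartDens_ne_zero {c : N} {y : Eu d} (hy : y ∈ (extChartAt I c).target) :
    o.chartDens c y ≠ 0 := by
  rw [o.chartDens_eq]
  exact mul_ne_zero (isUnit_det_chartInvDeriv hy) (o.dens_ne_zero _)

theorem Orient.chartDens_change {c c' : N} {y : Eu d} (hy : y ∈ (extChartAt I c).target)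
    (hx : (extChartAt I c).symm y ∈ (extChartAt I c').source) : o.chartDens c y =
      LinearMap.det (fderivWithin ℝ (chartMap I I id c c') (Set.range I) y).toLinearMap *
        o.chartDens c' (chartMap I I id c c' y) := by
  have h := fderivWithin_chartMap (I := I) (I' := I) (f := id) hy mdifferentiableAt_id hx
  have h1 : eucDeriv I I (id : N → N) ((extChartAt I c).symm y) = ContinuousLinearMap.id ℝ (Eu d) :=
    mfderiv_id
  rw [h1, ContinuousLinearMap.id_comp] at h
  have h2 : (extChartAt I c').symm (chartMap I I id c c' y) = (extChartAt I c).symm y :=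
    (extChartAt I c').left_inv hx
  rw [o.chartDens_eq, o.chartDens_eq, h2, ← h, ContinuousLinearMap.toLinearMap_comp,
    LinearMap.det_comp]
  ring

theorem Orient.continuousOn_chartSign (c : N) :
    ContinuousOn (o.chartSign c) (extChartAt I c).target := by
  intro y hy
  have h1 : ContinuousWithinAt (o.chartDens c) (extChartAt I c).target y := o.continuousOn c y hy
  have h2 : ContinuousWithinAt (fun y => SignType.sign (o.chartDens c y)) (extChartAt I c).target y :=
    (continuousAt_sign_of_ne_zero (o.chartDens_ne_zero hy)).comp_continuousWithinAt h1
  exact (continuous_of_discreteTopology (f := fun s : SignType => (s : ℝ))).continuousAt.comp_continuousWithinAt h2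

/-- The densities in two charts differ by the Jacobian determinant, whose sign is transferred to the
orientation sign; what remains is the absolute value required by the change of variables formula. -/
theorem Orient.chartSign_change {c c' : N} {y : Eu d} (hy : y ∈ (extChartAt I c).target)
    (hx : (extChartAt I c).symm y ∈ (extChartAt I c').source) : o.chartSign c y *
      LinearMap.det (fderivWithin ℝ (chartMap I I id c c') (Set.range I) y).toLinearMap =
      |LinearMap.det (fderivWithin ℝ (chartMap I I id c c') (Set.range I) y).toLinearMap| *
        o.chartSign c' (chartMap I I id c c' y) := by
  rw [Orient.chartSign, Orient.chartSign, o.chartDens_change hy hx, sign_mul, ← sign_mul_self]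
  push_cast
  ring

theorem measurableSet_extChartAt_target_inter (c : N) {U : Set N} (hU : IsOpen U) :
    MeasurableSet ((extChartAt I c).target ∩ (extChartAt I c).symm ⁻¹' U) := by
  have h0 : MeasurableSet (extChartAt I c).target := by
    rw [extChartAt_target]
    exact (I.continuous_symm.isOpen_preimage _ (chartAt H c).open_target).measurableSet.inter
      I.isClosed_range.measurableSet
  obtain ⟨W, hW, h⟩ := continuousOn_iff'.1 (continuousOn_extChartAt_symm (I := I) c) U hU
  rw [Set.inter_comm, h]
  exact hW.measurableSet.inter h0

theorem measurableSet_extChartAt_target (c : N) : MeasurableSet (extChartAt I c).target := by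
  simpa using measurableSet_extChartAt_target_inter (I := I) c isOpen_univ

variable [T2Space N] [SigmaCompactSpace N]

/-- The integrand of the integral of a form in the chart at `c`. -/
def Form.integrand (β : Form I N V) (c : N) (y : Eu d) : Gr V :=
  (o.chartSign c y * chartPartition I N c ((extChartAt I c).symm y)) • topCoeff (β.inChart I c y)

theorem tsupport_chartPartition (c : N) :
    tsupport (chartPartition I N c) ⊆ (extChartAt I c).source := by
  rw [extChartAt_source]
  exact (SmoothPartitionOfUnity.exists_isSubordinate_chartAt_source I N).choose_spec c

variable [CompactSpace N]

variable (I N) in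
theorem finite_chartPartition : {c | (Function.support (chartPartition I N c)).Nonempty}.Finite :=
  (chartPartition I N).locallyFinite.finite_nonempty_of_compact

variable (I N) in
/-- The finitely many charts used in the partition of unity. -/
def chartIndex : Finset N := (finite_chartPartition I N).toFinset

theorem chartPartition_of_notMem {c : N} (hc : c ∉ chartIndex I N) (x : N) :
    chartPartition I N c x = 0 := by
  by_contra h
  exact hc ((finite_chartPartition I N).mem_toFinset.2 ⟨x, h⟩)

theorem sum_chartPartition (x : N) : ∑ c ∈ chartIndex I N, chartPartition I N c x = 1 := by
  rw [← (chartPartition I N).sum_eq_one (Set.mem_univ x)]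
  refine (finsum_eq_sum_of_support_subset _ fun c hc => ?_).symm
  by_contra h
  exact hc (chartPartition_of_notMem h x)

variable [FiniteDimensional ℝ V] [FiniteDimensional ℝ V']

theorem Form.integrableOn_integrand {β : Form I N V} (hβ : β.IsSmooth I) (c : N) :
    MeasureTheory.IntegrableOn (β.integrand o c) (extChartAt I c).target := by
  -- The chart domain may be unbounded, but the partition function confines the integrand to a
  -- compact subset on which it is continuous.
  set K := extChartAt I c '' tsupport (chartPartition I N c) with hK
  have hKs := tsupport_chartPartition (I := I) c
  have hKt : K ⊆ (extChartAt I c).target := by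
    rintro _ ⟨x, hx, rfl⟩
    exact (extChartAt I c).map_source (hKs hx)
  have hKc : IsCompact K :=
    (isClosed_tsupport _).isCompact.image_of_continuousOn ((continuousOn_extChartAt c).mono hKs)
  have hcont : ContinuousOn (β.integrand o c) (extChartAt I c).target := by
    refine ((o.continuousOn_chartSign c).mul ?_).smul ?_
    · exact (chartPartition I N c).contMDiff.continuous.comp_continuousOn (continuousOn_extChartAt_symm c)
    · intro y hy
      have := contDiffWithinAt_linear (topCoeffL d V) (hβ.contDiffWithinAt hy)
      exact this.continuousWithinAt.mono (extChartAt_target_subset_range c)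
  refine ((hcont.mono hKt).integrableOn_compact hKc).of_forall_sdiff_eq_zero
    (measurableSet_extChartAt_target c) fun y hy => ?_
  have : chartPartition I N c ((extChartAt I c).symm y) = 0 := by
    by_contra h
    exact hy.2 ⟨_, subset_tsupport _ h, (extChartAt I c).right_inv hy.1⟩
  rw [Form.integrand, this, mul_zero, zero_smul]

theorem Form.integral_eq {β : Form I N V} (hβ : β.IsSmooth I) : β.integral I o =
    ∑ c ∈ chartIndex I N, ∫ y in (extChartAt I c).target, β.integrand o c y := by
  have h : ∀ c, vecOp (fun f => ∫ y in (extChartAt I c).target, f y) (β.integrand o c) =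
      ∫ y in (extChartAt I c).target, β.integrand o c y := fun c =>
    vecOp_integral (Form.integrableOn_integrand o hβ c)
  have h0 : β.integral I o = ∑ᶠ c : N,
    vecOp (fun f => ∫ y in (extChartAt I c).target, f y) (β.integrand o c) := rfl
  simp only [h0, h]
  refine finsum_eq_sum_of_support_subset _ fun c hc => ?_
  by_contra hn
  refine hc ?_
  have : β.integrand o c = fun _ => 0 := funext fun y => by
    rw [Form.integrand, chartPartition_of_notMem hn, mul_zero, zero_smul]
  simp [this]

/-- A linear operation on forms that acts on top coefficients through a fixed linear map commutes
with the integral. Linearity, change of parameters, the degree operator and constant left factors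
are all instances. -/
theorem Form.integral_linear {β : Form I N V} (hβ : β.IsSmooth I) {γ : Form I N V'}
    (hγ : γ.IsSmooth I) (F : Gr V →ₗ[ℝ] Gr V')
    (h : ∀ c y, topCoeff (γ.inChart I c y) = F (topCoeff (β.inChart I c y))) :
    γ.integral I o = F (β.integral I o) := by
  have := FiniteDimensional.complete ℝ (Gr V)
  have := FiniteDimensional.complete ℝ (Gr V')
  rw [Form.integral_eq o hβ, Form.integral_eq o hγ, map_sum]
  refine Finset.sum_congr rfl fun c _ => ?_
  have h2 := (LinearMap.toContinuousLinearMap F).integral_comp_comm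
    (Form.integrableOn_integrand o hβ c)
  refine Eq.trans ?_ h2
  congr 1
  ext1 y
  simp only [Form.integrand, h]
  exact ((LinearMap.toContinuousLinearMap F).map_smul _ _).symm

theorem Form.integral_add {β γ : Form I N V} (hβ : β.IsSmooth I) (hγ : γ.IsSmooth I) :
    (β + γ).integral I o = β.integral I o + γ.integral I o := by
  rw [Form.integral_eq o hβ, Form.integral_eq o hγ, Form.integral_eq o (hβ.add hγ),
    ← Finset.sum_add_distrib]
  refine Finset.sum_congr rfl fun c _ => ?_
  rw [← MeasureTheory.integral_add (Form.integrableOn_integrand o hβ c)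
    (Form.integrableOn_integrand o hγ c)]
  congr 1
  ext1 y
  simp only [Form.integrand, Form.inChart_add, ← topCoeffL_apply, map_add, smul_add]

theorem Form.integral_smul {β : Form I N V} (hβ : β.IsSmooth I) (t : ℝ) :
    (t • β).integral I o = t • β.integral I o :=
  Form.integral_linear o hβ (hβ.smul t) (t • LinearMap.id) fun c y => by
    rw [Form.inChart_smul, ← topCoeffL_apply, map_smul]; rfl

theorem Form.integral_sub {β γ : Form I N V} (hβ : β.IsSmooth I) (hγ : γ.IsSmooth I) :
    (β - γ).integral I o = β.integral I o - γ.integral I o := by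
  have h : β - γ = β + (-1 : ℝ) • γ := by rw [neg_one_smul, sub_eq_add_neg]
  rw [h, Form.integral_add o hβ (hγ.smul _), Form.integral_smul o hγ, neg_one_smul, sub_eq_add_neg]

theorem Form.integral_zero : (0 : Form I N V).integral I o = 0 := by
  have := Form.integral_smul o (Form.isSmooth_zero (I := I) (N := N) (V := V)) 0
  rwa [zero_smul, zero_smul] at this

theorem Form.integral_list_sum {ι : Type*} (l : List ι) (f : ι → Form I N V)
    (h : ∀ i ∈ l, (f i).IsSmooth I) :
    (l.map f).sum.integral I o = (l.map fun i => (f i).integral I o).sum := by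
  induction l with
  | nil => exact Form.integral_zero o
  | cons a l ih =>
    rw [List.map_cons, List.sum_cons, List.map_cons, List.sum_cons,
      Form.integral_add o (h a (by simp))
        (Form.isSmooth_list_sum l f fun i hi => h i (by simp [hi])),
      ih fun i hi => h i (by simp [hi])]

theorem Form.integral_finset_sum {ι : Type*} (s : Finset ι) (f : ι → Form I N V)
    (h : ∀ i ∈ s, (f i).IsSmooth I) :
    (∑ i ∈ s, f i).integral I o = ∑ i ∈ s, (f i).integral I o := by
  rw [← Finset.sum_map_toList s f, ← Finset.sum_map_toList s]
  exact Form.integral_list_sum o _ f fun i hi => h i (Finset.mem_toList.1 hi)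

theorem Form.integral_bc {β : Form I N V} (hβ : β.IsSmooth I) (L : V →ₗ[ℝ] V') :
    (β.bc I L).integral I o = ExteriorAlgebra.map L (β.integral I o) :=
  Form.integral_linear o hβ (hβ.bc L) (ExteriorAlgebra.map L).toLinearMap fun c y => by
    rw [Form.inChart_bc, topCoeff_fibMap]; simp

theorem Form.integral_const_mul {β : Form I N V} (hβ : β.IsSmooth I) {p : ZMod 2} {θ : Gr V}
    (hθ : θ ∈ Gr.par V p) :
    (Form.const I θ * β).integral I o = ksign p d • (θ * β.integral I o) :=
  Form.integral_linear o hβ ((Form.isSmooth_const θ).mul hβ) (ksign p d • LinearMap.mulLeft ℝ θ)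
    fun c y => by rw [Form.inChart_mul, Form.inChart_const, topCoeff_constMap_mul hθ]; rfl

theorem Form.integral_number {β : Form I N V} (hβ : β.IsSmooth I) :
    (β.number I).integral I o = (d : ℝ) • β.integral I o :=
  Form.integral_linear o hβ hβ.number ((d : ℝ) • LinearMap.id) fun c y => by
    rw [Form.inChart_number, topCoeff_fibNum]; rfl

theorem Form.integral_mem {β : Form I N V} (hβ : β.IsSmooth I) {i : ZMod 2}
    (h : β ∈ Form.par I N V i) : β.integral I o ∈ Gr.par V (i + d) := by
  refine Gr.mem_of_gradeInv ?_
  rw [← Form.integral_smul o hβ]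
  refine (Form.integral_linear o hβ (hβ.smul _) gradeInv.toLinearMap fun c y => ?_).symm
  rw [Form.inChart_smul, ← topCoeffL_apply, map_smul, AlgHom.toLinearMap_apply,
    Gr.gradeInv_of_mem (topCoeff_mem (Form.inChart_mem h c y))]
  rfl

/-- Computation of an integral in a system of coordinates on the support of the integrand. -/
theorem Form.integral_eq_of_coordinates {U : Set N} (hU : IsOpen U) {ψ : N → Eu d}
    (hψ : Set.InjOn ψ U) {γ : Form I N V} (hγ : γ.IsSmooth I) (hsupp : ∀ x ∉ U, γ.val x = 0)
    (G : Eu d → Gr V) (D : N → Eu d → Eu d →L[ℝ] Eu d)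
    (hD : ∀ c, ∀ y ∈ (extChartAt I c).target, (extChartAt I c).symm y ∈ U →
      HasFDerivWithinAt (ψ ∘ (extChartAt I c).symm) (D c y) (Set.range I) y)
    (hG : ∀ c, ∀ y ∈ (extChartAt I c).target, (extChartAt I c).symm y ∈ U →
      o.chartSign c y • topCoeff (γ.inChart I c y) =
        |(D c y).det| • G (ψ ((extChartAt I c).symm y))) :
    γ.integral I o = ∫ z in ψ '' U, G z := by
  have := FiniteDimensional.complete ℝ (Gr V)
  let A : N → Set (Eu d) := fun c => (extChartAt I c).target ∩ (extChartAt I c).symm ⁻¹' U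
  have hA : ∀ c, MeasurableSet (A c) := fun c => measurableSet_extChartAt_target_inter c hU
  -- The partition function of the chart `c`, transported to the coordinates `ψ`. Its values outside
  -- the image of `U` are irrelevant.
  let r : N → Eu d → ℝ := fun c =>
    Function.extend (fun u : U => ψ u) (fun u : U => chartPartition I N c u) 0
  have hr : ∀ c, ∀ x ∈ U, r c (ψ x) = chartPartition I N c x := fun c x hx =>
    (Set.injOn_iff_injective.1 hψ).extend_apply _ _ (⟨x, hx⟩ : U)
  have hDA : ∀ c, ∀ y ∈ A c, HasFDerivWithinAt (ψ ∘ (extChartAt I c).symm) (D c y) (A c) y :=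
    fun c y hy => (hD c y hy.1 hy.2).mono
      (Set.inter_subset_left.trans (extChartAt_target_subset_range c))
  have hinj : ∀ c, Set.InjOn (ψ ∘ (extChartAt I c).symm) (A c) := fun c =>
    hψ.comp ((extChartAt I c).symm.injOn.mono Set.inter_subset_left) fun y hy => hy.2
  have hkey : ∀ c, ∀ y ∈ A c, γ.integrand o c y =
      |(D c y).det| • (r c ((ψ ∘ (extChartAt I c).symm) y) • G ((ψ ∘ (extChartAt I c).symm) y)) := by
    intro c y hy
    rw [Function.comp_apply, hr c _ hy.2, smul_comm, ← hG c y hy.1 hy.2, Form.integrand, smul_smul,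
      mul_comm]
  have himg : ∀ c, (ψ ∘ (extChartAt I c).symm) '' A c ⊆ ψ '' U := by
    rintro c _ ⟨y, hy, rfl⟩
    exact ⟨_, hy.2, rfl⟩
  have hsub : ∀ c, ∀ z ∈ ψ '' U \ (ψ ∘ (extChartAt I c).symm) '' A c, r c z • G z = 0 := by
    rintro c _ ⟨⟨x, hx, rfl⟩, hz⟩
    have : chartPartition I N c x = 0 := by
      by_contra h
      have hs := tsupport_chartPartition (I := I) c (subset_tsupport _ h)
      refine hz ⟨extChartAt I c x, ⟨(extChartAt I c).map_source hs, ?_⟩, ?_⟩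
      · rw [Set.mem_preimage, (extChartAt I c).left_inv hs]; exact hx
      · rw [Function.comp_apply, (extChartAt I c).left_inv hs]
    rw [hr c x hx, this, zero_smul]
  -- No regularity of the image is assumed. It is the union of finitely many images of measurable
  -- sets under injective differentiable maps, one for each chart used by the partition.
  have hmeas : MeasurableSet (ψ '' U) := by
    have : ψ '' U = ⋃ c ∈ chartIndex I N, (ψ ∘ (extChartAt I c).symm) '' A c := by
      refine Set.Subset.antisymm ?_ (Set.iUnion₂_subset fun c _ => himg c)
      rintro _ ⟨x, hx, rfl⟩
      obtain ⟨c, hc, hne⟩ : ∃ c ∈ chartIndex I N, chartPartition I N c x ≠ 0 := by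
        by_contra! h
        have := sum_chartPartition (I := I) x
        rw [Finset.sum_eq_zero h] at this
        exact zero_ne_one this
      have hs := tsupport_chartPartition (I := I) c (subset_tsupport _ hne)
      refine Set.mem_biUnion hc ⟨extChartAt I c x, ⟨(extChartAt I c).map_source hs, ?_⟩, ?_⟩
      · rw [Set.mem_preimage, (extChartAt I c).left_inv hs]; exact hx
      · rw [Function.comp_apply, (extChartAt I c).left_inv hs]
    rw [this]
    exact Finset.measurableSet_biUnion _ fun c _ =>
      MeasureTheory.measurable_image_of_fderivWithin (hA c) (hDA c) (hinj c)
  have hint : ∀ c, MeasureTheory.IntegrableOn (fun z => r c z • G z) (ψ '' U) := by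
    intro c
    refine MeasureTheory.IntegrableOn.of_forall_sdiff_eq_zero ?_ hmeas (hsub c)
    rw [MeasureTheory.integrableOn_image_iff_integrableOn_abs_det_fderiv_smul _ (hA c) (hDA c)
      (hinj c)]
    exact ((Form.integrableOn_integrand o hγ c).mono_set Set.inter_subset_left).congr_fun
      (hkey c) (hA c)
  -- After the change of variables, every chart contributes the same function `G`, weighted by its
  -- partition function; the weights then sum to one.
  have hterm : ∀ c, ∫ y in (extChartAt I c).target, γ.integrand o c y =
      ∫ z in ψ '' U, r c z • G z := by
    intro c
    rw [MeasureTheory.setIntegral_eq_of_subset_of_forall_sdiff_eq_zero hmeas (himg c) (hsub c),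
      MeasureTheory.integral_image_eq_integral_abs_det_fderiv_smul _ (hA c) (hDA c) (hinj c),
      MeasureTheory.setIntegral_eq_of_subset_of_forall_sdiff_eq_zero
        (measurableSet_extChartAt_target c) (Set.inter_subset_left (t := (extChartAt I c).symm ⁻¹' U))]
    · exact MeasureTheory.setIntegral_congr_fun (hA c) (hkey c)
    · intro y hy
      have hn : (extChartAt I c).symm y ∉ U := fun h => hy.2 ⟨hy.1, h⟩
      rw [Form.integrand, Form.inChart_eq, hsupp _ hn, map_zero, ← topCoeffL_apply, map_zero,
        smul_zero]
  rw [Form.integral_eq o hγ, Finset.sum_congr rfl fun c _ => hterm c,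
    ← MeasureTheory.integral_finsetSum _ fun c _ => hint c]
  refine MeasureTheory.setIntegral_congr_fun hmeas ?_
  rintro _ ⟨x, hx, rfl⟩
  simp only [← Finset.sum_smul, hr _ x hx]
  rw [sum_chartPartition, one_smul]

/-- The integral of a form supported in a chart. -/
theorem Form.integral_eq_chart (c : N) {γ : Form I N V} (hγ : γ.IsSmooth I)
    (hsupp : ∀ x ∉ (extChartAt I c).source, γ.val x = 0) :
    γ.integral I o =
      ∫ y in (extChartAt I c).target, o.chartSign c y • topCoeff (γ.inChart I c y) := by
  rw [← (extChartAt I c).image_source_eq_target]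
  refine Form.integral_eq_of_coordinates o (isOpen_extChartAt_source c) (extChartAt I c).injOn hγ
    hsupp (fun y => o.chartSign c y • topCoeff (γ.inChart I c y))
    (fun c' y => fderivWithin ℝ (chartMap I I id c' c) (Set.range I) y) ?_ ?_
  · intro c' y hy hx
    exact ((contDiffWithinAt_chartMap (I := I) (I' := I) (f := id) hy contMDiffAt_id
      hx).differentiableWithinAt (by simp)).hasFDerivWithinAt
  · intro c' y hy hx
    have h1 : extChartAt I c ((extChartAt I c').symm y) = chartMap I I id c' c y := rfl
    rw [h1, Form.inChart_change hy hx, topCoeff_fibMap, ExteriorAlgebra.map_id, AlgHom.id_apply,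
      smul_smul, smul_smul, o.chartSign_change hy hx]

end Integral

/-! ### Stokes' theorem in Euclidean space -/

section LocalStokes

variable {d : ℕ} {V : Type*} [AddCommGroup V] [Module ℝ V] [FiniteDimensional ℝ V]

/-- `w ↦ topCoeff (dy^i w)` as a continuous linear map. -/
def faceCoeff (V : Type*) [AddCommGroup V] [Module ℝ V] [FiniteDimensional ℝ V] (i : Fin d) :
    Fib (Eu d) V →L[ℝ] Gr V :=
  LinearMap.toContinuousLinearMap (topCoeffL d V ∘ₗ LinearMap.mulLeft ℝ (covec d V i))

theorem faceCoeff_apply (i : Fin d) (w : Fib (Eu d) V) :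
    faceCoeff V i w = topCoeff (covec d V i * w) := rfl

theorem topCoeff_locD (s : Set (Eu d)) (F : Eu d → Fib (Eu d) V) (y : Eu d) :
    topCoeff (locD s F y) =
      ∑ i, faceCoeff V i (fderivWithin ℝ F s y (EuclideanSpace.single i 1)) := by
  rw [← topCoeffL_apply, locD, map_sum]; rfl

/-- The top coefficient of the exterior derivative is the divergence of the vector field with
components `faceCoeff V i (F y)`, so this is the divergence theorem. -/
theorem integral_locD_box {s : Set (Eu (d + 1))} {F : Eu (d + 1) → Fib (Eu (d + 1)) V}
    (hs : UniqueDiffOn ℝ s) (hF : ContDiffOn ℝ ∞ F s) {a b : Fin (d + 1) → ℝ} (hle : a ≤ b)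
    (hbox : ∀ x ∈ Set.Icc a b, WithLp.toLp 2 x ∈ s)
    (hint : ∀ x ∈ Set.univ.pi fun i => Set.Ioo (a i) (b i), s ∈ 𝓝 (WithLp.toLp 2 x)) :
    ∫ x in Set.Icc a b, topCoeff (locD s F (WithLp.toLp 2 x)) =
      ∑ i : Fin (d + 1), ((∫ x in Set.Icc (a ∘ i.succAbove) (b ∘ i.succAbove),
          faceCoeff V i (F (WithLp.toLp 2 (i.insertNth (b i) x)))) -
        ∫ x in Set.Icc (a ∘ i.succAbove) (b ∘ i.succAbove),
          faceCoeff V i (F (WithLp.toLp 2 (i.insertNth (a i) x)))) := by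
  have := FiniteDimensional.complete ℝ (Gr V)
  let e : (Fin (d + 1) → ℝ) →L[ℝ] Eu (d + 1) :=
    (PiLp.continuousLinearEquiv 2 ℝ (fun _ : Fin (d + 1) => ℝ)).symm.toContinuousLinearMap
  have hcD : ContinuousOn (fderivWithin ℝ F s) s :=
    hF.continuousOn_fderivWithin hs (by simp)
  have he : ContinuousOn e (Set.Icc a b) := e.continuous.continuousOn
  have hsum : ∀ x, topCoeff (locD s F (WithLp.toLp 2 x)) = ∑ i,
      ((faceCoeff V i).comp ((fderivWithin ℝ F s (e x)).comp e)) (Pi.single i (1 : ℝ)) := by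
    intro x
    rw [topCoeff_locD]
    rfl
  simp only [hsum]
  refine MeasureTheory.integral_divergence_of_hasFDerivAt_off_countable' a b hle
    (fun i x => faceCoeff V i (F (e x)))
    (fun i x => (faceCoeff V i).comp ((fderivWithin ℝ F s (e x)).comp e)) ∅ Set.countable_empty
    ?_ ?_ ?_
  · intro i
    exact (faceCoeff V i).continuous.comp_continuousOn (hF.continuousOn.comp he hbox)
  · intro x hx i
    have hx' := hint x hx.1
    have hd : HasFDerivAt F (fderivWithin ℝ F s (e x)) (e x) :=
      ((hF.differentiableOn (by simp) _ (mem_of_mem_nhds hx')).hasFDerivWithinAt).hasFDerivAt hx'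
    exact (faceCoeff V i).hasFDerivAt.comp x (hd.comp x e.hasFDerivAt)
  · refine ContinuousOn.integrableOn_compact isCompact_Icc ?_
    refine continuousOn_finsetSum _ fun i _ => ?_
    exact (faceCoeff V i).continuous.comp_continuousOn
      ((hcD.comp he hbox).clm_apply continuousOn_const)

theorem integral_euclidean {W : Type*} [NormedAddCommGroup W] [NormedSpace ℝ W] (s : Set (Eu d))
    (g : Eu d → W) : ∫ y in s, g y = ∫ x in WithLp.toLp 2 ⁻¹' s, g (WithLp.toLp 2 x) :=
  ((PiLp.volume_preserving_toLp (Fin d)).setIntegral_preimage_emb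
    (MeasurableEquiv.toLp 2 (Fin d → ℝ)).measurableEmbedding g s).symm

theorem locD_eq_zero_of_norm {s : Set (Eu d)} {F : Eu d → Fib (Eu d) V} {R : ℝ}
    (hR : ∀ y, R < ‖y‖ → F y = 0) {y : Eu d} (hy : R < ‖y‖) : locD s F y = 0 := by
  have h : F =ᶠ[𝓝 y] fun _ => 0 :=
    ((isOpen_lt continuous_const continuous_norm).mem_nhds hy |> Filter.mem_of_superset) fun z hz =>
      hR z hz
  have h2 : fderivWithin ℝ F s y = fderivWithin ℝ (fun _ => 0) s y :=
    (h.filter_mono nhdsWithin_le_nhds).fderivWithin_eq (hR y hy)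
  simp [locD, h2]

theorem lt_norm_of_lt_abs {R : ℝ} {x : Fin d → ℝ} {i : Fin d} (h : R < |x i|) :
    R < ‖(WithLp.toLp 2 x : Eu d)‖ :=
  h.trans_le (PiLp.norm_apply_le (WithLp.toLp 2 x : Eu d) i)

theorem integral_locD_univ {F : Eu d → Fib (Eu d) V} (hF : ContDiffOn ℝ ∞ F Set.univ) {R : ℝ}
    (hR : ∀ y, R < ‖y‖ → F y = 0) : ∫ y in Set.univ, topCoeff (locD Set.univ F y) = 0 := by
  -- In dimension zero there are no directions, and the exterior derivative is an empty sum.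
  rcases d with _ | d
  · simp [locD, ← topCoeffL_apply]
  have hz : topCoeff (0 : Fib (Eu (d + 1)) V) = 0 := map_zero (topCoeffL _ V)
  -- `R` may be negative. This half-width is positive and exceeds `R`, so `F` vanishes on every face
  -- of the box.
  let b : Fin (d + 1) → ℝ := fun _ => |R| + 1
  have hb : ∀ i, R < |b i| := fun i => by
    have : |b i| = |R| + 1 := abs_of_nonneg (by positivity)
    rw [this]; linarith [le_abs_self R]
  have h1 : ∫ y in Set.univ, topCoeff (locD Set.univ F y) =
      ∫ x in Set.Icc (-b) b, topCoeff (locD Set.univ F (WithLp.toLp 2 x)) := by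
    rw [integral_euclidean]
    refine MeasureTheory.setIntegral_eq_of_subset_of_forall_sdiff_eq_zero MeasurableSet.univ
      (Set.subset_univ _) fun x hx => ?_
    have : ∃ i, |b i| < |x i| := by
      by_contra! h
      refine hx.2 ⟨fun i => ?_, fun i => ?_⟩
      · have := (abs_le.1 (h i)).1
        rwa [abs_of_nonneg (show (0 : ℝ) ≤ b i by positivity)] at this
      · have := (abs_le.1 (h i)).2
        rwa [abs_of_nonneg (show (0 : ℝ) ≤ b i by positivity)] at this
    obtain ⟨i, hi⟩ := this
    rw [locD_eq_zero_of_norm hR (lt_norm_of_lt_abs ((hb i).trans hi)), hz]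
  have hle : -b ≤ b := fun i => neg_le_self (show (0 : ℝ) ≤ b i by positivity)
  rw [h1, integral_locD_box uniqueDiffOn_univ hF hle (by simp) (by simp)]
  refine Finset.sum_eq_zero fun i _ => ?_
  have h2 : ∀ x : Fin d → ℝ, F (WithLp.toLp 2 (i.insertNth (b i) x)) = 0 := fun x =>
    hR _ (lt_norm_of_lt_abs (i := i) (by rw [Fin.insertNth_apply_same]; exact hb i))
  have h3 : ∀ x : Fin d → ℝ, F (WithLp.toLp 2 (i.insertNth ((-b) i) x)) = 0 := fun x =>
    hR _ (lt_norm_of_lt_abs (i := i) (by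
      rw [Fin.insertNth_apply_same, Pi.neg_apply, abs_neg]; exact hb i))
  simp only [h2, h3, map_zero, MeasureTheory.integral_zero, sub_zero]

/-- Only the face `y 0 = 0` of a large box meets the support. It is a lower face, whence the minus
sign, which corresponds to the outward normal being the negative of the first basis vector. -/
theorem integral_locD_halfSpace {s : Set (Eu (d + 1))} (hs : s = {y | 0 ≤ y 0})
    (hu : UniqueDiffOn ℝ s) {F : Eu (d + 1) → Fib (Eu (d + 1)) V} (hF : ContDiffOn ℝ ∞ F s) {R : ℝ}
    (hR : ∀ y, R < ‖y‖ → F y = 0) : ∫ y in s, topCoeff (locD s F y) =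
      -∫ x : Eu d, topCoeff (fibMap (bdryIncl d).toLinearMap LinearMap.id (F (bdryIncl d x))) := by
  have hz : topCoeff (0 : Fib (Eu (d + 1)) V) = 0 := map_zero (topCoeffL _ V)
  have hRpos : (0 : ℝ) ≤ |R| + 1 := by positivity
  let b : Fin (d + 1) → ℝ := fun _ => |R| + 1
  -- The box starts at `0` in the normal direction, so it lies in the half space and one of its
  -- faces lies on the boundary.
  let a : Fin (d + 1) → ℝ := Fin.cons 0 fun _ => -(|R| + 1)
  have hRb : R < |(|R| + 1)| := by
    rw [abs_of_nonneg hRpos]; linarith [le_abs_self R]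
  have hle : a ≤ b := fun i => by
    refine Fin.cases ?_ (fun i => ?_) i
    · exact hRpos
    · exact neg_le_self hRpos
  have hms : MeasurableSet (WithLp.toLp 2 ⁻¹' s : Set (Fin (d + 1) → ℝ)) := by
    rw [hs]
    exact (isClosed_le continuous_const (continuous_apply 0)).measurableSet
  have hsub : Set.Icc a b ⊆ WithLp.toLp 2 ⁻¹' s := fun x hx => by
    rw [hs]; exact hx.1 0
  have h1 : ∫ y in s, topCoeff (locD s F y) =
      ∫ x in Set.Icc a b, topCoeff (locD s F (WithLp.toLp 2 x)) := by
    rw [integral_euclidean]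
    refine MeasureTheory.setIntegral_eq_of_subset_of_forall_sdiff_eq_zero hms hsub fun x hx => ?_
    have hx0 : 0 ≤ x 0 := by
      have := hx.1; rw [hs] at this; exact this
    have : ∃ i, |R| + 1 < |x i| := by
      by_contra! h
      refine hx.2 ⟨fun i => ?_, fun i => (abs_le.1 (h i)).2⟩
      refine Fin.cases hx0 (fun i => (abs_le.1 (h i.succ)).1) i
    obtain ⟨i, hi⟩ := this
    rw [locD_eq_zero_of_norm hR (lt_norm_of_lt_abs (lt_trans (by linarith [le_abs_self R]) hi)), hz]
  rw [h1, integral_locD_box hu hF hle hsub]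
  · rw [Fin.sum_univ_succ, Finset.sum_eq_zero, add_zero]
    · have h2 : ∀ x : Fin d → ℝ, F (WithLp.toLp 2 ((0 : Fin (d + 1)).insertNth (b 0) x)) = 0 :=
        fun x => hR _ (lt_norm_of_lt_abs (i := 0) (by rw [Fin.insertNth_apply_same]; exact hRb))
      have h3 : ∀ x : Fin d → ℝ, (WithLp.toLp 2 ((0 : Fin (d + 1)).insertNth (a 0) x) : Eu (d + 1)) =
          bdryIncl d (WithLp.toLp 2 x) := by
        intro x
        rw [Fin.insertNth_zero']; rfl
      simp only [h2, h3, map_zero, MeasureTheory.integral_zero, zero_sub]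
      congr 1
      rw [← MeasureTheory.setIntegral_univ, ← MeasureTheory.setIntegral_univ (μ := MeasureTheory.volume),
        integral_euclidean, Set.preimage_univ]
      simp only [MeasureTheory.setIntegral_univ, faceCoeff_apply, topCoeff_covec_zero_mul]
      refine MeasureTheory.setIntegral_eq_integral_of_forall_compl_eq_zero fun x hx => ?_
      have : ∃ i, |R| + 1 < |x i| := by
        by_contra! h
        exact hx ⟨fun i => (abs_le.1 (h i)).1, fun i => (abs_le.1 (h i)).2⟩
      obtain ⟨i, hi⟩ := this
      have h4 : F (bdryIncl d (WithLp.toLp 2 x)) = 0 := by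
        refine hR _ (lt_of_lt_of_le (lt_trans (by linarith [le_abs_self R]) hi)
          (PiLp.norm_apply_le (bdryIncl d (WithLp.toLp 2 x)) i.succ))
      rw [h4, map_zero, ← topCoeffL_apply, map_zero]
    · intro i _
      have h2 : ∀ x : Fin d → ℝ, F (WithLp.toLp 2 (i.succ.insertNth (b i.succ) x)) = 0 := fun x =>
        hR _ (lt_norm_of_lt_abs (i := i.succ) (by rw [Fin.insertNth_apply_same]; exact hRb))
      have h3 : ∀ x : Fin d → ℝ, F (WithLp.toLp 2 (i.succ.insertNth (a i.succ) x)) = 0 := fun x =>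
        hR _ (lt_norm_of_lt_abs (i := i.succ) (by
          rw [Fin.insertNth_apply_same]
          change R < |(-(|R| + 1))|
          rw [abs_neg]; exact hRb))
      simp [h2, h3]
  · intro x hx
    rw [hs]
    have ho : IsOpen {y : Eu (d + 1) | 0 < y 0} := isOpen_lt continuous_const
      (EuclideanSpace.proj (𝕜 := ℝ) (0 : Fin (d + 1))).continuous
    exact Filter.mem_of_superset (ho.mem_nhds (hx 0 (Set.mem_univ _)).1) fun y hy =>
      le_of_lt (show (0 : ℝ) < y 0 from hy)

end LocalStokes

/-! ### Stokes' theorem on manifolds -/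

section FunctionMul

variable {d d' : ℕ} {H H' : Type*} [TopologicalSpace H] [TopologicalSpace H']
  {I : ModelWithCorners ℝ (Eu d) H} {I' : ModelWithCorners ℝ (Eu d') H'}
  {N N' : Type*} [TopologicalSpace N] [ChartedSpace H N] [TopologicalSpace N'] [ChartedSpace H' N']
  {V : Type*} [AddCommGroup V] [Module ℝ V]

/-- The multiple of a form by a function. -/
def Form.fmul (f : N → ℝ) (β : Form I N V) : Form I N V := fun x => f x • β x

theorem Form.val_fmul (f : N → ℝ) (β : Form I N V) (x : N) :
    (β.fmul f).val x = f x • β.val x := rfl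

theorem Form.inChart_fmul (f : N → ℝ) (β : Form I N V) (c : N) (y : Eu d) :
    (β.fmul f).inChart I c y = f ((extChartAt I c).symm y) • β.inChart I c y := by
  rw [Form.inChart_eq, Form.val_fmul, map_smul, Form.inChart_eq]

theorem Form.fmul_mem (f : N → ℝ) {β : Form I N V} {i : ZMod 2} (h : β ∈ Form.par I N V i) :
    β.fmul f ∈ Form.par I N V i :=
  Form.mem_par.2 fun x => Submodule.smul_mem _ _ (Form.mem_par.1 h x)

variable [FiniteDimensional ℝ V]

theorem Form.IsSmooth.fmul [IsManifold I ∞ N] {f : N → ℝ} (hf : ContMDiff I 𝓘(ℝ, ℝ) ∞ f)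
    {β : Form I N V} (hβ : β.IsSmooth I) : (β.fmul f).IsSmooth I :=
  Form.isSmooth_iff.2 fun c y hy => by
    rw [show (β.fmul f).inChart I c = fun y => f ((extChartAt I c).symm y) • β.inChart I c y from
      funext (Form.inChart_fmul f β c)]
    have hf' : ContDiffWithinAt ℝ ∞ (fun y => f ((extChartAt I c).symm y)) (Set.range I) y :=
      contMDiffWithinAt_iff_contDiffWithinAt.1
        ((hf _).comp_contMDiffWithinAt y (contMDiffWithinAt_extChartAt_symm_range c hy))
    exact hf'.smul (hβ.contDiffWithinAt hy)

theorem Form.isSmooth_finset_sum {ι : Type*} (s : Finset ι) (f : ι → Form I N V)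
    (h : ∀ i ∈ s, (f i).IsSmooth I) : (∑ i ∈ s, f i).IsSmooth I := by
  rw [← Finset.sum_map_toList s f]
  exact Form.isSmooth_list_sum _ f fun i hi => h i (Finset.mem_toList.1 hi)

theorem Form.exteriorDeriv_zero [IsManifold I ∞ N] : (0 : Form I N V).exteriorDeriv I = 0 := by
  have := Form.exteriorDeriv_smul (Form.isSmooth_zero (I := I) (N := N) (V := V)) 0
  rwa [zero_smul, zero_smul] at this

theorem Form.exteriorDeriv_finset_sum [IsManifold I ∞ N] {ι : Type*} (s : Finset ι)
    (f : ι → Form I N V) (h : ∀ i ∈ s, (f i).IsSmooth I) :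
    (∑ i ∈ s, f i).exteriorDeriv I = ∑ i ∈ s, (f i).exteriorDeriv I := by
  classical
  induction s using Finset.induction_on with
  | empty => exact Form.exteriorDeriv_zero
  | insert a s ha ih =>
    rw [Finset.sum_insert ha, Finset.sum_insert ha,
      Form.exteriorDeriv_add (h a (by simp)) (Form.isSmooth_finset_sum s f fun i hi =>
        h i (by simp [hi])), ih fun i hi => h i (by simp [hi])]

theorem Form.val_finset_sum {ι : Type*} (s : Finset ι) (f : ι → Form I N V) (x : N) :
    (∑ i ∈ s, f i).val x = ∑ i ∈ s, (f i).val x :=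
  Finset.sum_apply (M := fun x => Fib (TangentSpace I x) V) x s f

theorem Form.exteriorDeriv_eq_zero_of_eventually [IsManifold I ∞ N] {β : Form I N V}
    (hβ : β.IsSmooth I) {x : N} (h : ∀ᶠ z in 𝓝 x, β.val z = 0) : (β.exteriorDeriv I).val x = 0 := by
  rw [Form.val_exteriorDeriv hβ]
  have h1 : ∀ᶠ y in 𝓝 (extChartAt I x x), β.val ((extChartAt I x).symm y) = 0 := by
    have := continuousAt_extChartAt_symm (I := I) x
    rw [ContinuousAt, extChartAt_to_inv] at this
    exact this.eventually h
  have h2 : β.inChart I x =ᶠ[𝓝[Set.range I] (extChartAt I x x)] fun _ => 0 := by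
    filter_upwards [h1.filter_mono nhdsWithin_le_nhds] with y hy
    rw [Form.inChart_eq, hy, map_zero]
  rw [locD_congr h2 (Set.mem_range_self _)]
  simp [locD]

variable [IsManifold I ∞ N] [T2Space N] [SigmaCompactSpace N] [CompactSpace N]

theorem Form.sum_fmul_chartPartition (β : Form I N V) :
    ∑ c ∈ chartIndex I N, β.fmul (chartPartition I N c) = β :=
  Form.ext fun x => by
    simp only [Form.val_finset_sum, Form.val_fmul, ← Finset.sum_smul]
    rw [sum_chartPartition, one_smul]

theorem Form.IsSmooth.fmul_chartPartition {β : Form I N V} (hβ : β.IsSmooth I) (c : N) :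
    (β.fmul (chartPartition I N c)).IsSmooth I := hβ.fmul (chartPartition I N c).contMDiff

theorem Form.val_fmul_chartPartition (β : Form I N V) (c : N) {x : N}
    (hx : x ∉ tsupport (chartPartition I N c)) : (β.fmul (chartPartition I N c)).val x = 0 := by
  rw [Form.val_fmul, image_eq_zero_of_notMem_tsupport hx, zero_smul]

theorem Form.integral_exteriorDeriv_eq_sum (o : Orient I N) {β : Form I N V} (hβ : β.IsSmooth I) :
    (β.exteriorDeriv I).integral I o =
      ∑ c ∈ chartIndex I N, ((β.fmul (chartPartition I N c)).exteriorDeriv I).integral I o := by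
  conv_lhs => rw [← Form.sum_fmul_chartPartition β]
  rw [Form.exteriorDeriv_finset_sum _ _ fun c _ => hβ.fmul_chartPartition c,
    Form.integral_finset_sum o _ _ fun c _ => (hβ.fmul_chartPartition c).exteriorDeriv]

end FunctionMul

/-! ### Localisation of Stokes' theorem to one chart -/

section SignedChart

variable {d : ℕ} {H : Type*} [TopologicalSpace H]
  {I : ModelWithCorners ℝ (Eu d) H} {N : Type*} [TopologicalSpace N] [ChartedSpace H N]
  {V : Type*} [AddCommGroup V] [Module ℝ V] (o : Orient I N)

open Classical in
/-- A form supported in a chart, with the sign of the orientation, as a form on Euclidean space. -/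
def Form.signedChart (γ : Form I N V) (c : N) (y : Eu d) : Fib (Eu d) V :=
  if y ∈ (extChartAt I c).target then o.chartSign c y • γ.inChart I c y else 0

variable [IsManifold I ∞ N] [FiniteDimensional ℝ V] {γ : Form I N V} {c : N} {K : Set N}

/-- The orientation density is continuous and nowhere zero, so its sign is locally constant and may
be treated as a constant factor under the exterior derivative. -/
theorem Form.signedChart_eventuallyEq {y : Eu d} (hy : y ∈ (extChartAt I c).target) :
    γ.signedChart o c =ᶠ[𝓝[Set.range I] y] fun z => o.chartSign c y • γ.inChart I c z := by
  have h1 : ContinuousWithinAt (fun y => SignType.sign (o.chartDens c y)) (extChartAt I c).target y :=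
    (continuousAt_sign_of_ne_zero (o.chartDens_ne_zero hy)).comp_continuousWithinAt
      (o.continuousOn c y hy)
  have h2 : ∀ᶠ z in 𝓝[(extChartAt I c).target] y,
      SignType.sign (o.chartDens c z) = SignType.sign (o.chartDens c y) :=
    h1.eventually (IsOpen.mem_nhds (isOpen_discrete {SignType.sign (o.chartDens c y)}) rfl)
  rw [nhdsWithin_extChartAt_target_eq_of_mem hy] at h2
  filter_upwards [h2, eventually_mem_target hy] with z hz hz'
  rw [Form.signedChart, if_pos hz', Orient.chartSign, hz]
  rfl

theorem Form.signedChart_eq_zero (hsupp : ∀ x ∉ K, γ.val x = 0) {y : Eu d}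
    (hy : y ∉ extChartAt I c '' K) : γ.signedChart o c y = 0 := by
  rw [Form.signedChart]
  split_ifs with h
  · have : (extChartAt I c).symm y ∉ K := fun hK => hy ⟨_, hK, (extChartAt I c).right_inv h⟩
    rw [Form.inChart_eq, hsupp _ this, map_zero, smul_zero]
  · rfl

theorem isCompact_image_extChartAt (hK : IsCompact K) (hKc : K ⊆ (extChartAt I c).source) :
    IsCompact (extChartAt I c '' K) :=
  hK.image_of_continuousOn ((continuousOn_extChartAt c).mono hKc)

theorem Form.exists_norm_signedChart (hK : IsCompact K) (hKc : K ⊆ (extChartAt I c).source)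
    (hsupp : ∀ x ∉ K, γ.val x = 0) : ∃ R : ℝ, ∀ y, R < ‖y‖ → γ.signedChart o c y = 0 := by
  obtain ⟨R, hR⟩ := (isCompact_image_extChartAt hK hKc).isBounded.exists_norm_le
  exact ⟨R, fun y hy => Form.signedChart_eq_zero o hsupp fun h => absurd (hR y h) (not_le.2 hy)⟩

theorem Form.signedChart_eventuallyEq_zero (hK : IsCompact K) (hKc : K ⊆ (extChartAt I c).source)
    (hsupp : ∀ x ∉ K, γ.val x = 0) {y : Eu d} (hy : y ∉ (extChartAt I c).target) :
    γ.signedChart o c =ᶠ[𝓝 y] fun _ => 0 := by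
  have hy' : y ∉ extChartAt I c '' K := by
    rintro ⟨x, hx, rfl⟩
    exact hy ((extChartAt I c).map_source (hKc hx))
  filter_upwards [(isCompact_image_extChartAt hK hKc).isClosed.isOpen_compl.mem_nhds hy'] with z hz
  exact Form.signedChart_eq_zero o hsupp hz

theorem Form.contDiffOn_signedChart (hγ : γ.IsSmooth I) (hK : IsCompact K)
    (hKc : K ⊆ (extChartAt I c).source) (hsupp : ∀ x ∉ K, γ.val x = 0) :
    ContDiffOn ℝ ∞ (γ.signedChart o c) (Set.range I) := by
  intro y hy
  by_cases h : y ∈ (extChartAt I c).target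
  · exact ((hγ.contDiffWithinAt h).const_smul (o.chartSign c y)).congr_of_eventuallyEq
      (Form.signedChart_eventuallyEq o h) (if_pos h)
  · have := Form.signedChart_eventuallyEq_zero o hK hKc hsupp h
    exact contDiffWithinAt_const.congr_of_eventuallyEq (this.filter_mono nhdsWithin_le_nhds)
      this.self_of_nhds

variable [T2Space N] [SigmaCompactSpace N] [CompactSpace N]

/-- The compact support inside the chart lets the coordinate expression be extended by zero to the
whole model range without losing smoothness; the integral over the chart becomes one over Euclidean
space or the half space. -/
theorem Form.integral_exteriorDeriv_chart (hγ : γ.IsSmooth I) (hK : IsCompact K)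
    (hKc : K ⊆ (extChartAt I c).source) (hsupp : ∀ x ∉ K, γ.val x = 0) :
    (γ.exteriorDeriv I).integral I o =
      ∫ y in Set.range I, topCoeff (locD (Set.range I) (γ.signedChart o c) y) := by
  have hd : ∀ x ∉ (extChartAt I c).source, (γ.exteriorDeriv I).val x = 0 := fun x hx => by
    refine Form.exteriorDeriv_eq_zero_of_eventually hγ ?_
    filter_upwards [hK.isClosed.isOpen_compl.mem_nhds fun h => hx (hKc h)] with z hz
    exact hsupp z hz
  rw [Form.integral_eq_chart o c hγ.exteriorDeriv hd,
    MeasureTheory.setIntegral_eq_of_subset_of_forall_sdiff_eq_zero I.isClosed_range.measurableSet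
      (extChartAt_target_subset_range c)]
  · refine MeasureTheory.setIntegral_congr_fun (measurableSet_extChartAt_target c) fun y hy => ?_
    have hr := extChartAt_target_subset_range c hy
    rw [Form.inChart_exteriorDeriv hγ hy, locD_congr (Form.signedChart_eventuallyEq o hy) hr]
    have := locD_linear (s := Set.range I) (y := y)
      (o.chartSign c y • (LinearMap.id : Fib (Eu d) V →ₗ[ℝ] Fib (Eu d) V)) (by simp)
      (hγ.differentiableWithinAt hy) (I.uniqueDiffOn y hr)
    simp only [LinearMap.smul_apply, LinearMap.id_apply] at this
    rw [this, ← topCoeffL_apply, ← topCoeffL_apply, map_smul]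
  · intro y hy
    have := Form.signedChart_eventuallyEq_zero o hK hKc hsupp hy.2
    rw [locD_congr (this.filter_mono nhdsWithin_le_nhds) hy.1]
    simp [locD, ← topCoeffL_apply]

end SignedChart

/-! ### Closed manifolds -/

section Closed

variable {d : ℕ} {B : Type*} [TopologicalSpace B] [ChartedSpace (Eu d) B]
  [IsManifold (𝓡 d) ∞ B] [T2Space B] [SigmaCompactSpace B] [CompactSpace B]
  {V : Type*} [AddCommGroup V] [Module ℝ V] [FiniteDimensional ℝ V] (o : Orient (𝓡 d) B)

/-- Stokes' theorem on a closed manifold. -/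
theorem Form.integral_exteriorDeriv_closed {β : Form (𝓡 d) B V} (hβ : β.IsSmooth (𝓡 d)) :
    (β.exteriorDeriv (𝓡 d)).integral (𝓡 d) o = 0 := by
  rw [Form.integral_exteriorDeriv_eq_sum o hβ]
  refine Finset.sum_eq_zero fun c _ => ?_
  have hK : IsCompact (tsupport (chartPartition (𝓡 d) B c)) := (isClosed_tsupport _).isCompact
  have hs : ∀ x ∉ tsupport (chartPartition (𝓡 d) B c),
      (β.fmul (chartPartition (𝓡 d) B c)).val x = 0 := fun x hx =>
    Form.val_fmul_chartPartition β c hx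
  have hγ := hβ.fmul_chartPartition c
  obtain ⟨R, hR⟩ := Form.exists_norm_signedChart o hK (tsupport_chartPartition c) hs
  have hF := Form.contDiffOn_signedChart o hγ hK (tsupport_chartPartition c) hs
  rw [Form.integral_exteriorDeriv_chart o hγ hK (tsupport_chartPartition c) hs]
  rw [show Set.range (𝓡 d) = Set.univ from Set.range_id] at hF ⊢
  exact integral_locD_univ hF hR

end Closed

/-! ### Stokes' theorem on manifolds with boundary -/

section BoundaryLinear

variable {d : ℕ}

/-- The projection that forgets the first coordinate. -/
def bdryProj (d : ℕ) : Eu (d + 1) →L[ℝ] Eu d :=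
  LinearMap.toContinuousLinearMap
    { toFun := fun y => WithLp.toLp 2 fun i => y i.succ
      map_add' := fun _ _ => rfl
      map_smul' := fun _ _ => rfl }

theorem bdryProj_apply (y : Eu (d + 1)) (i : Fin d) : bdryProj d y i = y i.succ := rfl

theorem bdryIncl_bdryProj {y : Eu (d + 1)} (hy : y 0 = 0) : bdryIncl d (bdryProj d y) = y := by
  ext i
  refine Fin.cases ?_ (fun i => ?_) i
  · rw [bdryIncl_zero, hy]
  · rw [bdryIncl_succ, bdryProj_apply]

theorem bdryProj_bdryIncl (y : Eu d) : bdryProj d (bdryIncl d y) = y := rfl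

/-- The remaining vectors lie in the span of the last `d` basis vectors. Expanding `w` in the basis,
every component other than the zeroth repeats a vector and drops out. -/
theorem alternating_cons_bdryIncl (vol : (Eu (d + 1)) [⋀^Fin (d + 1)]→ₗ[ℝ] ℝ) (w : Eu (d + 1))
    (T : Eu d →ₗ[ℝ] Eu d) :
    vol (Fin.cons w fun i => bdryIncl d (T (EuclideanSpace.single i 1))) =
      LinearMap.det T * (w 0 * vol fun i => EuclideanSpace.single i 1) := by
  have h1 := alternating_apply_comp ((vol.curryLeft w).compLinearMap (bdryIncl d).toLinearMap) T
    fun i => EuclideanSpace.single i 1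
  refine Eq.trans h1 ?_
  congr 1
  have h2 : ((vol.curryLeft w).compLinearMap (bdryIncl d).toLinearMap)
      (fun i => EuclideanSpace.single i 1) =
      vol.toMultilinearMap (Fin.cons w fun i : Fin d => EuclideanSpace.single i.succ 1) := by
    change vol (Fin.cons w fun i : Fin d => bdryIncl d (EuclideanSpace.single i 1)) = _
    simp only [bdryIncl_single]
    rfl
  rw [h2]
  have hw : w = ∑ j, w j • EuclideanSpace.single j (1 : ℝ) := by
    have := (EuclideanSpace.basisFun (Fin (d + 1)) ℝ).toBasis.sum_repr w
    simpa using this.symm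
  let F : Eu (d + 1) →ₗ[ℝ] ℝ :=
    { toFun := fun u => vol.curryLeft u fun i : Fin d => EuclideanSpace.single i.succ 1
      map_add' := fun u u' => by rw [map_add]; rfl
      map_smul' := fun t u => by rw [map_smul]; rfl }
  have h3 : F w = ∑ j, w j * F (EuclideanSpace.single j 1) := by
    conv_lhs => rw [hw]
    simp only [map_sum, map_smul, smul_eq_mul]
  have h4 : ∀ i : Fin d, F (EuclideanSpace.single i.succ 1) = 0 := fun i =>
    vol.map_eq_zero_of_eq (i := 0) (j := i.succ)
      (Matrix.vecCons (EuclideanSpace.single i.succ (1 : ℝ)) fun i : Fin d =>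
        EuclideanSpace.single i.succ 1) rfl (Fin.succ_ne_zero i).symm
  have h5 : F (EuclideanSpace.single 0 1) = vol fun i => EuclideanSpace.single i 1 := by
    refine congrArg vol (funext fun i => ?_)
    refine Fin.cases rfl (fun i => rfl) i
  change F w = _
  rw [h3, Fin.sum_univ_succ, h5]
  simp [h4]

/-- Here `a` and `b` play the part of the densities of the two orientations and `D` that of the
Jacobian of the boundary coordinates; the negative product encodes the outward normal. -/
theorem sign_mul_eq_neg {a b D : ℝ} (h : a * D * b < 0) :
    (SignType.sign b : ℝ) * D = -(|D| * (SignType.sign a : ℝ)) := by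
  rcases lt_trichotomy a 0 with ha | rfl | ha <;> rcases lt_trichotomy b 0 with hb | rfl | hb <;>
    rcases lt_trichotomy D 0 with hD | rfl | hD <;>
    simp_all [sign_pos, sign_neg, abs_of_pos, abs_of_neg]
  · exact absurd h (not_lt.2 (mul_pos_of_neg_of_neg (mul_neg_of_neg_of_pos ha hD) hb).le)
  · exact absurd h (not_lt.2 (mul_pos (mul_pos_of_neg_of_neg ha hD) hb).le)
  · exact absurd h (not_lt.2 (mul_pos_of_neg_of_neg (mul_neg_of_pos_of_neg ha hD) hb).le)
  · exact absurd h (not_lt.2 (mul_pos (mul_pos ha hD) hb).le)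

end BoundaryLinear

/-! ### Boundary charts and the induced orientation -/

section Boundary

variable {d : ℕ} {N B : Type*} [TopologicalSpace N] [ChartedSpace (EuclideanHalfSpace (d + 1)) N]
  [IsManifold (𝓡∂ (d + 1)) ∞ N] [TopologicalSpace B] [ChartedSpace (Eu d) B]
  [IsManifold (𝓡 d) ∞ B]

theorem extChartAt_zero_nonneg (c x : N) : 0 ≤ extChartAt (𝓡∂ (d + 1)) c x 0 := by
  have : extChartAt (𝓡∂ (d + 1)) c x ∈ Set.range (𝓡∂ (d + 1)) := Set.mem_range_self _
  rwa [range_modelWithCornersEuclideanHalfSpace] at this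

theorem mem_boundary_iff {c x : N} (hx : x ∈ (extChartAt (𝓡∂ (d + 1)) c).source) :
    x ∈ (𝓡∂ (d + 1)).boundary N ↔ extChartAt (𝓡∂ (d + 1)) c x 0 = 0 := by
  have hx' : x ∈ (chartAt (EuclideanHalfSpace (d + 1)) c).source := by simpa using hx
  have h1 := ModelWithCorners.isInteriorPoint_iff_of_mem_atlas (I := 𝓡∂ (d + 1)) (n := ∞) (x := x)
    (by simp) (ChartedSpace.chart_mem_atlas c) hx'
  have h2 : extChartAt (𝓡∂ (d + 1)) c x ∈
      interior ((chartAt (EuclideanHalfSpace (d + 1)) c).extend (𝓡∂ (d + 1))).target ↔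
      0 < extChartAt (𝓡∂ (d + 1)) c x 0 := by
    have hi := interior_range_modelWithCornersEuclideanHalfSpace (d + 1)
    constructor
    · intro h
      have := OpenPartialHomeomorph.interior_extend_target_subset_interior_range _ h
      rwa [hi] at this
    · intro h
      refine OpenPartialHomeomorph.mem_interior_extend_target _
        ((chartAt (EuclideanHalfSpace (d + 1)) c).map_source hx') ?_
      rw [hi]; exact h
  change ModelWithCorners.IsBoundaryPoint _ x ↔ _
  rw [ModelWithCorners.isBoundaryPoint_iff_not_isInteriorPoint, h1]
  refine (not_congr h2).trans ?_
  rw [not_lt]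
  exact ⟨fun h => le_antisymm h (extChartAt_zero_nonneg c x), fun h => h.le⟩

/-- The zeroth component of `φ` attains its minimum `0` at `y`, so its derivative is nonnegative
along directions pointing into the convex set `s`. -/
theorem fderivWithin_zero_nonneg {k : ℕ} {φ : Eu k → Eu (d + 1)} {s : Set (Eu k)} {y v : Eu k}
    (hφ : DifferentiableWithinAt ℝ φ s y) (h0 : ∀ z, 0 ≤ φ z 0) (hy : φ y 0 = 0)
    (hs : Convex ℝ s) (hys : y ∈ s) (hv : y + v ∈ s) : 0 ≤ fderivWithin ℝ φ s y v 0 := by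
  have h1 : HasFDerivWithinAt (fun z => φ z 0)
      ((EuclideanSpace.proj (𝕜 := ℝ) (0 : Fin (d + 1))).comp (fderivWithin ℝ φ s y)) s y :=
    (EuclideanSpace.proj (𝕜 := ℝ) (0 : Fin (d + 1))).hasFDerivAt.comp_hasFDerivWithinAt y
      hφ.hasFDerivWithinAt
  have h2 : IsLocalMinOn (fun z => φ z 0) s y :=
    Filter.Eventually.of_forall fun z => by simp only [hy]; exact h0 z
  exact h2.hasFDerivWithinAt_nonneg h1
    (mem_posTangentConeAt_of_segment_subset (hs.segment_subset hys hv))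

/-- At a boundary point, changes of charts preserve inward directions. -/
theorem fderivWithin_chartMap_inward {x c : N} (hx : x ∈ (𝓡∂ (d + 1)).boundary N)
    (hc : x ∈ (extChartAt (𝓡∂ (d + 1)) c).source) :
    0 < fderivWithin ℝ (chartMap (𝓡∂ (d + 1)) (𝓡∂ (d + 1)) id x c) (Set.range (𝓡∂ (d + 1)))
      (extChartAt (𝓡∂ (d + 1)) x x) (EuclideanSpace.single 0 1) 0 := by
  set I := 𝓡∂ (d + 1)
  set y := extChartAt I x x with hy
  have hyt : y ∈ (extChartAt I x).target := mem_extChartAt_target x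
  have hsx : (extChartAt I x).symm y = x := extChartAt_to_inv x
  have hc' : id ((extChartAt I x).symm y) ∈ (extChartAt I c).source := by rw [hsx]; exact hc
  have hr : Set.range I = {z | 0 ≤ z 0} := range_modelWithCornersEuclideanHalfSpace (d + 1)
  have hconv : Convex ℝ (Set.range I) := I.convex_range
  have hyr : y ∈ Set.range I := Set.mem_range_self _
  have hy0 : y 0 = 0 := (mem_boundary_iff (mem_extChartAt_source x)).1 hx
  set φ := chartMap I I id x c with hφ
  have hd : DifferentiableWithinAt ℝ φ (Set.range I) y :=
    (contDiffWithinAt_chartMap (f := id) hyt contMDiffAt_id hc').differentiableWithinAt (by simp)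
  have h0 : ∀ z, 0 ≤ φ z 0 := fun z => extChartAt_zero_nonneg c _
  have hφy : φ y 0 = 0 := by
    have : φ y = extChartAt I c x := by rw [hφ, chartMap]; simp only [Function.comp_apply, hsx, id]
    rw [this]
    exact (mem_boundary_iff hc).1 hx
  have hpos : ∀ v : Eu (d + 1), 0 ≤ v 0 → 0 ≤ fderivWithin ℝ φ (Set.range I) y v 0 := fun v hv => by
    refine fderivWithin_zero_nonneg hd h0 hφy hconv hyr ?_
    rw [hr]
    change 0 ≤ y 0 + v 0
    rw [hy0, zero_add]; exact hv
  -- For a tangential direction both `v` and `-v` point into the closed half space, so the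
  -- inequality becomes an equality.
  have hzero : ∀ v : Eu (d + 1), v 0 = 0 → fderivWithin ℝ φ (Set.range I) y v 0 = 0 := fun v hv => by
    refine le_antisymm ?_ (hpos v hv.ge)
    have := hpos (-v) (by change 0 ≤ -(v 0); rw [hv, neg_zero])
    rw [map_neg] at this
    exact neg_nonneg.1 this
  -- Equality would put the whole image of the derivative into the boundary hyperplane,
  -- contradicting its invertibility.
  refine lt_of_le_of_ne (hpos _ (by simp)) fun hne => ?_
  have hall : ∀ v : Eu (d + 1), fderivWithin ℝ φ (Set.range I) y v 0 = 0 := fun v => by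
    have h1 := hzero (v - v 0 • EuclideanSpace.single 0 1) (by simp)
    rwa [map_sub, map_smul, PiLp.sub_apply, PiLp.smul_apply, ← hne, smul_zero, sub_zero] at h1
  have hcomp := fderivWithin_chartMap (I := I) (I' := I) (f := id) hyt mdifferentiableAt_id hc'
  have h1 : eucDeriv I I (id : N → N) ((extChartAt I x).symm y) =
      ContinuousLinearMap.id ℝ (Eu (d + 1)) := mfderiv_id
  have h2 : chartInvDeriv I x y = ContinuousLinearMap.id ℝ (Eu (d + 1)) :=
    mfderivWithin_range_extChartAt_symm
  rw [h1, h2, ContinuousLinearMap.id_comp] at hcomp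
  have hinj : Function.Injective (fderivWithin ℝ φ (Set.range I) y) := fun u v huv => by
    have := congrArg (chartInvDeriv I c (φ y)) huv
    have e : ∀ w, chartInvDeriv I c (φ y) (fderivWithin ℝ φ (Set.range I) y w) = w := fun w =>
      congrArg (fun T => T w) hcomp
    rwa [e, e] at this
  obtain ⟨v, hv⟩ := (LinearMap.injective_iff_surjective
    (f := (fderivWithin ℝ φ (Set.range I) y).toLinearMap)).1 hinj (EuclideanSpace.single 0 1)
  have := hall v
  rw [show fderivWithin ℝ φ (Set.range I) y v = EuclideanSpace.single 0 1 from hv] at this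
  simp at this

variable {oN : Orient (𝓡∂ (d + 1)) N} {oB : Orient (𝓡 d) B} {j : B → N}

/-- The coordinates of the boundary given by a chart of the manifold. -/
def bdryCoord (j : B → N) (c : N) (b : B) : Eu d :=
  bdryProj d (extChartAt (𝓡∂ (d + 1)) c (j b))

namespace IsOrientedBoundary

variable (h : IsOrientedBoundary oN oB j)
include h

theorem mem_boundary (b : B) : j b ∈ (𝓡∂ (d + 1)).boundary N := h.range_eq ▸ Set.mem_range_self b

theorem bdryIncl_bdryCoord {c : N} {b : B} (hb : j b ∈ (extChartAt (𝓡∂ (d + 1)) c).source) :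
    bdryIncl d (bdryCoord j c b) = extChartAt (𝓡∂ (d + 1)) c (j b) :=
  bdryIncl_bdryProj ((mem_boundary_iff hb).1 (h.mem_boundary b))

theorem differentiableWithinAt_chartMap {b : B} {c : N} {y : Eu d}
    (hy : y ∈ (extChartAt (𝓡 d) b).target)
    (hc : j ((extChartAt (𝓡 d) b).symm y) ∈ (extChartAt (𝓡∂ (d + 1)) c).source) :
    DifferentiableWithinAt ℝ (chartMap (𝓡 d) (𝓡∂ (d + 1)) j b c) (Set.range (𝓡 d)) y :=
  (contDiffWithinAt_chartMap hy (h.smooth _) hc).differentiableWithinAt (by simp)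

/-- The zeroth coordinate vanishes at the boundary point and is nowhere negative; as all directions
in `Eu d` are admissible, its derivative is zero and the image is tangent to the boundary
hyperplane. -/
theorem fderivWithin_chartMap_eq {b : B} {c : N} {y : Eu d} (hy : y ∈ (extChartAt (𝓡 d) b).target)
    (hc : j ((extChartAt (𝓡 d) b).symm y) ∈ (extChartAt (𝓡∂ (d + 1)) c).source) :
    (bdryIncl d).comp ((bdryProj d).comp
      (fderivWithin ℝ (chartMap (𝓡 d) (𝓡∂ (d + 1)) j b c) (Set.range (𝓡 d)) y)) =
      fderivWithin ℝ (chartMap (𝓡 d) (𝓡∂ (d + 1)) j b c) (Set.range (𝓡 d)) y := by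
  ext1 v
  refine bdryIncl_bdryProj ?_
  have hd := h.differentiableWithinAt_chartMap hy hc
  have h0 : ∀ z, 0 ≤ chartMap (𝓡 d) (𝓡∂ (d + 1)) j b c z 0 := fun z => extChartAt_zero_nonneg c _
  have hφy : chartMap (𝓡 d) (𝓡∂ (d + 1)) j b c y 0 = 0 :=
    (mem_boundary_iff hc).1 (h.mem_boundary _)
  have hr : Set.range (𝓡 d) = Set.univ := Set.range_id
  have hpos : ∀ v, 0 ≤ fderivWithin ℝ (chartMap (𝓡 d) (𝓡∂ (d + 1)) j b c) (Set.range (𝓡 d)) y v 0 :=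
    fun v => fderivWithin_zero_nonneg hd h0 hφy (by rw [hr]; exact convex_univ) (by rw [hr]; trivial)
      (by rw [hr]; trivial)
  refine le_antisymm ?_ (hpos v)
  have := hpos (-v)
  rw [map_neg] at this
  exact neg_nonneg.1 this

/-- The outward normal first rule in charts. -/
theorem chartSign_mul_det {b : B} {c : N} {y : Eu d} (hy : y ∈ (extChartAt (𝓡 d) b).target)
    (hc : j ((extChartAt (𝓡 d) b).symm y) ∈ (extChartAt (𝓡∂ (d + 1)) c).source) :
    oB.chartSign b y * LinearMap.det ((bdryProj d).comp
      (fderivWithin ℝ (chartMap (𝓡 d) (𝓡∂ (d + 1)) j b c) (Set.range (𝓡 d)) y)).toLinearMap =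
    -(|LinearMap.det ((bdryProj d).comp
      (fderivWithin ℝ (chartMap (𝓡 d) (𝓡∂ (d + 1)) j b c) (Set.range (𝓡 d)) y)).toLinearMap| *
      oN.chartSign c (chartMap (𝓡 d) (𝓡∂ (d + 1)) j b c y)) := by
  refine sign_mul_eq_neg ?_
  set Dφ := fderivWithin ℝ (chartMap (𝓡 d) (𝓡∂ (d + 1)) j b c) (Set.range (𝓡 d)) y with hDφ
  set T := ((bdryProj d).comp Dφ).toLinearMap with hT
  have hDT : ∀ v, Dφ v = bdryIncl d (T v) := fun v =>
    (congrArg (fun F => F v) (h.fderivWithin_chartMap_eq hy hc)).symm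
  set x := (extChartAt (𝓡 d) b).symm y with hx
  set C := chartInvDeriv (𝓡∂ (d + 1)) c (chartMap (𝓡 d) (𝓡∂ (d + 1)) j b c y) with hC
  set K := chartInvDeriv (𝓡 d) b y with hK
  set J := eucDeriv (𝓡 d) (𝓡∂ (d + 1)) j x with hJ
  have hCD : ∀ v, C (Dφ v) = J (K v) := fun v => congrArg (fun F => F v)
    (fderivWithin_chartMap hy ((h.smooth _).mdifferentiableAt (by simp)) hc)
  -- The orientation rule uses the inward basis vector of the preferred chart at `j x`. Its
  -- expression `e` in the chart `c` still points inward, by `fderivWithin_chartMap_inward`.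
  obtain ⟨e, hCe, he⟩ : ∃ e : Eu (d + 1), C e = EuclideanSpace.single 0 1 ∧ 0 < e 0 := by
    refine ⟨_, ?_, fderivWithin_chartMap_inward (h.mem_boundary x) hc⟩
    have hc' : id ((extChartAt (𝓡∂ (d + 1)) (j x)).symm (extChartAt (𝓡∂ (d + 1)) (j x) (j x))) ∈
        (extChartAt (𝓡∂ (d + 1)) c).source := by rw [extChartAt_to_inv]; exact hc
    have hcomp := fderivWithin_chartMap (I := 𝓡∂ (d + 1)) (I' := 𝓡∂ (d + 1)) (f := id)
      (mem_extChartAt_target (j x)) mdifferentiableAt_id hc'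
    have h1 : ∀ z, eucDeriv (𝓡∂ (d + 1)) (𝓡∂ (d + 1)) (id : N → N) z =
        ContinuousLinearMap.id ℝ (Eu (d + 1)) := fun z => mfderiv_id
    have h2 : chartInvDeriv (𝓡∂ (d + 1)) (j x) (extChartAt (𝓡∂ (d + 1)) (j x) (j x)) =
        ContinuousLinearMap.id ℝ (Eu (d + 1)) := mfderivWithin_range_extChartAt_symm
    have h3 : chartMap (𝓡∂ (d + 1)) (𝓡∂ (d + 1)) id (j x) c (extChartAt (𝓡∂ (d + 1)) (j x) (j x)) =
        chartMap (𝓡 d) (𝓡∂ (d + 1)) j b c y := by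
      simp only [chartMap, Function.comp_apply, extChartAt_to_inv, id]
      rfl
    rw [h1, h2, h3] at hcomp
    exact congrArg (fun F => F (EuclideanSpace.single 0 1)) hcomp
  let vol : (Eu (d + 1)) [⋀^Fin (d + 1)]→ₗ[ℝ] ℝ := oN.vol (j x)
  let q : ℝ := vol (Fin.cons (EuclideanSpace.single 0 1 : Eu (d + 1)) fun i =>
    J (EuclideanSpace.single i 1))
  -- The volume form is evaluated on the inward vector followed by the boundary frame of the chart
  -- `b`, once through the frame of the tangent space of `B` and once through the chart `c` of `N`.
  have hq : LinearMap.det K.toLinearMap * q =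
      oN.chartDens c (chartMap (𝓡 d) (𝓡∂ (d + 1)) j b c y) * (e 0 * LinearMap.det T) := by
    have h1 := alternating_apply_comp ((vol.curryLeft (EuclideanSpace.single 0 1)).compLinearMap
      J.toLinearMap) K.toLinearMap fun i => EuclideanSpace.single i 1
    refine Eq.trans h1.symm ?_
    change vol (Fin.cons (EuclideanSpace.single 0 1 : Eu (d + 1)) fun i : Fin d =>
      J (K (EuclideanSpace.single i 1))) = _
    have h2 : (Fin.cons (EuclideanSpace.single 0 1 : Eu (d + 1)) fun i : Fin d =>
        J (K (EuclideanSpace.single i 1)) : Fin (d + 1) → Eu (d + 1)) = fun i => C.toLinearMap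
        ((Fin.cons e fun i => bdryIncl d (T (EuclideanSpace.single i 1)) :
          Fin (d + 1) → Eu (d + 1)) i) := by
      funext i
      refine Fin.cases hCe.symm (fun i => ?_) i
      change J (K _) = C (bdryIncl d (T _))
      rw [← hDT, hCD]
    rw [h2, alternating_apply_comp, alternating_cons_bdryIncl, oN.chartDens_eq]
    have h3 : (extChartAt (𝓡∂ (d + 1)) c).symm (chartMap (𝓡 d) (𝓡∂ (d + 1)) j b c y) = j x :=
      (extChartAt (𝓡∂ (d + 1)) c).left_inv hc
    rw [h3]
    have h4 : (vol fun i => EuclideanSpace.single i 1) = oN.dens (j x) := rfl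
    rw [h4]
    ring
  have ho : 0 < -q * oB.dens x := by
    have h1 := h.orientation x
    have h2 : -q = vol (Fin.cons (-EuclideanSpace.single 0 1 : Eu (d + 1)) fun i =>
        J (EuclideanSpace.single i 1)) := by
      have := congrArg (fun F => F fun i : Fin d => J (EuclideanSpace.single i 1))
        (map_neg vol.curryLeft (EuclideanSpace.single 0 1))
      exact this.symm
    rw [h2]
    exact h1
  have hdet : LinearMap.det K.toLinearMap ≠ 0 := isUnit_det_chartInvDeriv hy
  change oN.chartDens c _ * LinearMap.det T * oB.chartDens b y < 0
  rw [oB.chartDens_eq]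
  -- Multiplied by the positive number `e 0`, the product becomes minus a square times the positive
  -- quantity of the orientation rule.
  have h5 : e 0 * (oN.chartDens c (chartMap (𝓡 d) (𝓡∂ (d + 1)) j b c y) * LinearMap.det T *
      (LinearMap.det K.toLinearMap * oB.dens x)) =
      -((LinearMap.det K.toLinearMap) ^ 2 * (-q * oB.dens x)) := by
    linear_combination -(LinearMap.det K.toLinearMap * oB.dens x) * hq
  have h6 : e 0 * (oN.chartDens c (chartMap (𝓡 d) (𝓡∂ (d + 1)) j b c y) * LinearMap.det T *
      (LinearMap.det K.toLinearMap * oB.dens x)) < 0 := by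
    rw [h5]
    exact neg_neg_of_pos (mul_pos (by positivity) ho)
  exact (mul_neg_iff.1 h6).resolve_right (fun hh => absurd hh.1 (not_lt.2 he.le)) |>.2

variable [T2Space N] [SigmaCompactSpace N] [CompactSpace N] [T2Space B] [SigmaCompactSpace B]
  [CompactSpace B] {V : Type*} [AddCommGroup V] [Module ℝ V] [FiniteDimensional ℝ V]

/-- The chart of `N` at `c` induces coordinates on part of `B` that need not come from the atlas of
`B`, which is why the integral is needed in arbitrary coordinates. The minus sign is that of
`chartSign_mul_det`. -/
theorem integral_comap_chart {γ : Form (𝓡∂ (d + 1)) N V} (hγ : γ.IsSmooth (𝓡∂ (d + 1))) {c : N}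
    (hsupp : ∀ x ∉ (extChartAt (𝓡∂ (d + 1)) c).source, γ.val x = 0) :
    (γ.comap j : Form (𝓡 d) B V).integral (𝓡 d) oB =
      -∫ z : Eu d, topCoeff (fibMap (bdryIncl d).toLinearMap LinearMap.id
        (γ.signedChart oN c (bdryIncl d z))) := by
  have hz : ∀ k, topCoeff (0 : Fib (Eu k) V) = 0 := fun k => map_zero (topCoeffL k V)
  rw [← MeasureTheory.integral_neg]
  have hU : IsOpen (j ⁻¹' (extChartAt (𝓡∂ (d + 1)) c).source) :=
    (isOpen_extChartAt_source c).preimage h.smooth.continuous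
  rw [Form.integral_eq_of_coordinates oB hU (ψ := bdryCoord j c) ?_ (hγ.comap h.smooth) ?_
    (fun z => -topCoeff (fibMap (bdryIncl d).toLinearMap LinearMap.id
        (γ.signedChart oN c (bdryIncl d z))))
    (fun b y => (bdryProj d).comp
      (fderivWithin ℝ (chartMap (𝓡 d) (𝓡∂ (d + 1)) j b c) (Set.range (𝓡 d)) y)) ?_ ?_]
  -- A point of the boundary hyperplane in the chart target represents a boundary point of `N`,
  -- hence lies in the range of `j`. So outside the coordinate image of `B` the point is outside the
  -- target, and the integrand vanishes.
  · refine MeasureTheory.setIntegral_eq_integral_of_forall_compl_eq_zero fun z hzU => ?_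
    have : bdryIncl d z ∉ (extChartAt (𝓡∂ (d + 1)) c).target := fun ht => by
      have hs := (extChartAt (𝓡∂ (d + 1)) c).map_target ht
      have hb : (extChartAt (𝓡∂ (d + 1)) c).symm (bdryIncl d z) ∈ Set.range j := by
        rw [h.range_eq, mem_boundary_iff hs, (extChartAt (𝓡∂ (d + 1)) c).right_inv ht]
        rfl
      obtain ⟨b, hb⟩ := hb
      refine hzU ⟨b, ?_, ?_⟩
      · rw [Set.mem_preimage, hb]; exact hs
      · rw [bdryCoord, hb, (extChartAt (𝓡∂ (d + 1)) c).right_inv ht, bdryProj_bdryIncl]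
    rw [Form.signedChart, if_neg this, map_zero, hz, neg_zero]
  · intro b hb b' hb' hbb
    have := congrArg (bdryIncl d) hbb
    rw [h.bdryIncl_bdryCoord hb, h.bdryIncl_bdryCoord hb'] at this
    exact h.embedding.injective ((extChartAt (𝓡∂ (d + 1)) c).injOn hb hb' this)
  · intro b hb
    rw [Form.val_comap, hsupp _ hb, map_zero]
  · intro b y hy hb
    exact (bdryProj d).hasFDerivAt.comp_hasFDerivWithinAt y
      (h.differentiableWithinAt_chartMap hy hb).hasFDerivWithinAt
  · intro b y hy hb
    have hφ : bdryIncl d (bdryCoord j c ((extChartAt (𝓡 d) b).symm y)) =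
        chartMap (𝓡 d) (𝓡∂ (d + 1)) j b c y := h.bdryIncl_bdryCoord hb
    have ht : chartMap (𝓡 d) (𝓡∂ (d + 1)) j b c y ∈ (extChartAt (𝓡∂ (d + 1)) c).target :=
      (extChartAt (𝓡∂ (d + 1)) c).map_source hb
    have hf : ∀ w : Fib (Eu (d + 1)) V, topCoeff (fibMap (fderivWithin ℝ
        (chartMap (𝓡 d) (𝓡∂ (d + 1)) j b c) (Set.range (𝓡 d)) y).toLinearMap LinearMap.id w) =
        LinearMap.det ((bdryProj d).comp (fderivWithin ℝ
        (chartMap (𝓡 d) (𝓡∂ (d + 1)) j b c) (Set.range (𝓡 d)) y)).toLinearMap •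
        topCoeff (fibMap (bdryIncl d).toLinearMap LinearMap.id w) := by
      intro w
      conv_lhs => rw [← h.fderivWithin_chartMap_eq hy hb]
      rw [ContinuousLinearMap.toLinearMap_comp, ← LinearMap.id_comp (LinearMap.id : V →ₗ[ℝ] V),
        ← fibMap_fibMap, topCoeff_fibMap, ExteriorAlgebra.map_id, LinearMap.id_comp]
      rfl
    rw [Form.inChart_comap hy ((h.smooth _).mdifferentiableAt (by simp)) hb, hf, hφ,
      Form.signedChart, if_pos ht, map_smul, ← topCoeffL_apply (V := V) (_ • _), map_smul, topCoeffL_apply,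
      smul_smul, h.chartSign_mul_det hy hb, neg_smul, mul_smul, smul_neg]

/-- Stokes' theorem. -/
theorem stokes {β : Form (𝓡∂ (d + 1)) N V} (hβ : β.IsSmooth (𝓡∂ (d + 1))) :
    (β.exteriorDeriv (𝓡∂ (d + 1))).integral (𝓡∂ (d + 1)) oN =
      (β.comap j : Form (𝓡 d) B V).integral (𝓡 d) oB := by
  have h1 : (β.comap j : Form (𝓡 d) B V) = ∑ c ∈ chartIndex (𝓡∂ (d + 1)) N,
      (β.fmul (chartPartition (𝓡∂ (d + 1)) N c)).comap j := by
    refine Form.ext fun b => ?_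
    rw [Form.val_finset_sum, Form.val_comap]
    conv_lhs => rw [← Form.sum_fmul_chartPartition β]
    rw [Form.val_finset_sum, map_sum]
    rfl
  rw [Form.integral_exteriorDeriv_eq_sum oN hβ, h1, Form.integral_finset_sum oB _ _
    fun c _ => (hβ.fmul_chartPartition c).comap h.smooth]
  refine Finset.sum_congr rfl fun c _ => ?_
  have hK : IsCompact (tsupport (chartPartition (𝓡∂ (d + 1)) N c)) :=
    (isClosed_tsupport _).isCompact
  have hs : ∀ x ∉ tsupport (chartPartition (𝓡∂ (d + 1)) N c),
      (β.fmul (chartPartition (𝓡∂ (d + 1)) N c)).val x = 0 := fun x hx =>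
    Form.val_fmul_chartPartition β c hx
  have hγ := hβ.fmul_chartPartition c
  obtain ⟨R, hR⟩ := Form.exists_norm_signedChart oN hK (tsupport_chartPartition c) hs
  have hF := Form.contDiffOn_signedChart oN hγ hK (tsupport_chartPartition c) hs
  rw [Form.integral_exteriorDeriv_chart oN hγ hK (tsupport_chartPartition c) hs,
    h.integral_comap_chart hγ fun x hx => hs x fun hx' => hx (tsupport_chartPartition c hx')]
  -- Both sides are minus the same integral over the hyperplane: the sign of the lower face on one
  -- side, that of the outward normal on the other.
  exact integral_locD_halfSpace (range_modelWithCornersEuclideanHalfSpace (d + 1))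
    (𝓡∂ (d + 1)).uniqueDiffOn hF hR

end IsOrientedBoundary

end Boundary

/-! ### Extension of forms from the boundary -/

section LocalSmooth

variable {d : ℕ} {H : Type*} [TopologicalSpace H]
  {I : ModelWithCorners ℝ (Eu d) H} {N : Type*} [TopologicalSpace N] [ChartedSpace H N]
  [IsManifold I ∞ N] {V : Type*} [AddCommGroup V] [Module ℝ V] [FiniteDimensional ℝ V]

/-- A form which is smooth on an open set, times a function supported in this set. -/
theorem Form.isSmooth_fmul_of_tsupport {U : Set N} {β : Form I N V}
    (hβ : ∀ (c : N), ∀ y ∈ (extChartAt I c).target, (extChartAt I c).symm y ∈ U →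
      ContDiffWithinAt ℝ ∞ (β.inChart I c) (Set.range I) y)
    {f : N → ℝ} (hf : ContMDiff I 𝓘(ℝ, ℝ) ∞ f) (hfU : tsupport f ⊆ U) :
    (β.fmul f).IsSmooth I :=
  Form.isSmooth_iff.2 fun c y hy => by
    rw [show (β.fmul f).inChart I c = fun y => f ((extChartAt I c).symm y) • β.inChart I c y from
      funext (Form.inChart_fmul f β c)]
    by_cases hyU : (extChartAt I c).symm y ∈ tsupport f
    · have hf' : ContDiffWithinAt ℝ ∞ (fun y => f ((extChartAt I c).symm y)) (Set.range I) y :=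
        contMDiffWithinAt_iff_contDiffWithinAt.1
          ((hf _).comp_contMDiffWithinAt y (contMDiffWithinAt_extChartAt_symm_range c hy))
      exact hf'.smul (hβ c y hy (hfU hyU))
    · have h1 : ∀ᶠ z in 𝓝 y, (extChartAt I c).symm z ∉ tsupport f :=
        (continuousAt_extChartAt_symm'' hy).eventually
          ((isClosed_tsupport f).isOpen_compl.mem_nhds hyU)
      refine (contDiffWithinAt_const (c := (0 : Fib (Eu d) V))).congr_of_eventuallyEq ?_ ?_
      · filter_upwards [h1.filter_mono nhdsWithin_le_nhds] with z hz
        rw [image_eq_zero_of_notMem_tsupport hz, zero_smul]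
      · rw [image_eq_zero_of_notMem_tsupport hyU, zero_smul]

end LocalSmooth

/-! ### Retractions to the boundary and extension of forms -/

section Boundary

variable {d : ℕ} {N B : Type*} [TopologicalSpace N] [ChartedSpace (EuclideanHalfSpace (d + 1)) N]
  [IsManifold (𝓡∂ (d + 1)) ∞ N]
  [TopologicalSpace B] [ChartedSpace (EuclideanSpace ℝ (Fin d)) B] [IsManifold (𝓡 d) ∞ B]
  {oN : Orient (𝓡∂ (d + 1)) N} {oB : Orient (𝓡 d) B} {j : B → N}

namespace IsOrientedBoundary

variable (h : IsOrientedBoundary oN oB j)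
include h

/-- The derivative of `j` in charts is injective and takes values in the boundary hyperplane, so its
projection is an injective endomorphism of `Eu d`, hence invertible. This prepares the inverse
function theorem. -/
theorem exists_hasFDerivAt_bdryCoord {b : B} {c : N} {y : Eu d}
    (hy : y ∈ (extChartAt (𝓡 d) b).target)
    (hc : j ((extChartAt (𝓡 d) b).symm y) ∈ (extChartAt (𝓡∂ (d + 1)) c).source) :
    ContDiffAt ℝ ∞ (bdryProj d ∘ chartMap (𝓡 d) (𝓡∂ (d + 1)) j b c) y ∧
    ∃ T : Eu d ≃L[ℝ] Eu d, HasFDerivAt (bdryProj d ∘ chartMap (𝓡 d) (𝓡∂ (d + 1)) j b c)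
      (T : Eu d →L[ℝ] Eu d) y := by
  have hr : Set.range (𝓡 d) = Set.univ := Set.range_id
  have h1 := contDiffWithinAt_chartMap hy (h.smooth _) hc
  have h2 := h1.differentiableWithinAt (by simp)
  have h3 := h.chartSign_mul_det hy hc
  set D := fderivWithin ℝ (chartMap (𝓡 d) (𝓡∂ (d + 1)) j b c) (Set.range (𝓡 d)) y with hD
  have h4 := h2.hasFDerivWithinAt
  rw [hr, contDiffWithinAt_univ] at h1
  rw [hr, hasFDerivWithinAt_univ, ← hr, ← hD] at h4
  refine ⟨(bdryProj d).contDiff.contDiffAt.comp y h1, ?_⟩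
  have hker : LinearMap.ker D.toLinearMap = ⊥ := by
    refine LinearMap.ker_eq_bot'.2 fun v hv => ?_
    have h5 := congrArg (fun F => F v)
      (fderivWithin_chartMap hy ((h.smooth _).mdifferentiableAt (by simp)) hc)
    have h6 : eucDeriv (𝓡 d) (𝓡∂ (d + 1)) j ((extChartAt (𝓡 d) b).symm y)
        (chartInvDeriv (𝓡 d) b y v) = 0 := by
      refine h5.symm.trans ?_
      change chartInvDeriv _ _ _ (D v) = 0
      rw [show D v = 0 from hv, map_zero]
    have h7 : chartInvDeriv (𝓡 d) b y v = 0 := h.immersion _ (h6.trans (map_zero _).symm)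
    have hu := ((Module.End.isUnit_iff _).1 ((LinearMap.isUnit_iff_isUnit_det _).2
      (isUnit_iff_ne_zero.2 (isUnit_det_chartInvDeriv (I := 𝓡 d) hy)))).1
    exact hu (h7.trans (map_zero _).symm)
  have hinj : Function.Injective ((bdryProj d).comp D).toLinearMap := by
    refine LinearMap.ker_eq_bot.1 (LinearMap.ker_eq_bot'.2 fun v hv => ?_)
    refine LinearMap.ker_eq_bot'.1 hker v ?_
    have h5 := congrArg (fun F => F v) (h.fderivWithin_chartMap_eq hy hc)
    refine h5.symm.trans ?_
    change bdryIncl d (((bdryProj d).comp D) v) = 0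
    rw [show ((bdryProj d).comp D) v = 0 from hv, map_zero]
  refine ⟨(LinearEquiv.ofInjectiveEndo _ hinj).toContinuousLinearEquiv, ?_⟩
  have h8 := (bdryProj d).hasFDerivAt.comp y h4
  convert! h8 using 1

/-- Locally around the boundary there are smooth retractions to the boundary. -/
theorem exists_retraction (b : B) : ∃ (U : Set N) (r : N → B), IsOpen U ∧ j b ∈ U ∧
    ContMDiffOn (𝓡∂ (d + 1)) (𝓡 d) ∞ r U ∧ ∀ b', j b' ∈ U → r (j b') = b' := by
  set c := j b with hc
  set e := extChartAt (𝓡 d) b with he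
  set ψ : Eu d → Eu d := bdryProj d ∘ chartMap (𝓡 d) (𝓡∂ (d + 1)) j b c with hψ
  set D : Set (Eu d) := e.target ∩ e.symm ⁻¹' (j ⁻¹' (extChartAt (𝓡∂ (d + 1)) c).source) with hDdef
  have hD : IsOpen D := (continuousOn_extChartAt_symm b).isOpen_inter_preimage
    (isOpen_extChartAt_target b) ((isOpen_extChartAt_source c).preimage h.smooth.continuous)
  have hbD : e b ∈ D := ⟨mem_extChartAt_target b, by
    rw [Set.mem_preimage, Set.mem_preimage, he, extChartAt_to_inv]; exact mem_extChartAt_source c⟩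
  obtain ⟨hs, T, hT⟩ := h.exists_hasFDerivAt_bdryCoord hbD.1 hbD.2
  -- The retraction projects a chart of `N` onto the boundary hyperplane and then applies the local
  -- inverse of the boundary coordinates.
  let Φ := hs.toOpenPartialHomeomorph ψ hT (by simp)
  have hΦ : ∀ y, Φ y = ψ y := fun y => rfl
  have hbΦ : e b ∈ Φ.source := hs.mem_toOpenPartialHomeomorph_source hT (by simp)
  have hW : IsOpen (Φ.target ∩ Φ.symm ⁻¹' D) := Φ.symm.isOpen_inter_preimage hD
  have hO : IsOpen (e.source ∩ e ⁻¹' Φ.source) :=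
    (continuousOn_extChartAt b).isOpen_inter_preimage (isOpen_extChartAt_source b) Φ.open_source
  -- Here the embedding property enters: every point `b'` with `j b'` in `O` lies in the region
  -- where the boundary coordinates are inverted by `Φ`, so that the retraction returns `b'`.
  obtain ⟨O, hO', hOe⟩ := h.embedding.isOpen_iff.1 hO
  have hψe : ∀ b' ∈ e.source, ψ (e b') = bdryProj d (extChartAt (𝓡∂ (d + 1)) c (j b')) :=
    fun b' hb' => by rw [hψ, Function.comp_apply, chartMap, Function.comp_apply, Function.comp_apply, e.left_inv hb']
  refine ⟨(extChartAt (𝓡∂ (d + 1)) c).source ∩ extChartAt (𝓡∂ (d + 1)) c ⁻¹'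
    (bdryProj d ⁻¹' (Φ.target ∩ Φ.symm ⁻¹' D)) ∩ O,
    fun x => e.symm (Φ.symm (bdryProj d (extChartAt (𝓡∂ (d + 1)) c x))), ?_, ?_, ?_, ?_⟩
  · exact ((continuousOn_extChartAt c).isOpen_inter_preimage (isOpen_extChartAt_source c)
      (hW.preimage (bdryProj d).continuous)).inter hO'
  · refine ⟨⟨mem_extChartAt_source c, ?_⟩, ?_⟩
    · rw [Set.mem_preimage, Set.mem_preimage, hc, ← hψe b (mem_extChartAt_source b), ← hΦ]
      refine ⟨Φ.map_source hbΦ, ?_⟩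
      rw [Set.mem_preimage, Φ.left_inv hbΦ]
      exact hbD
    · have : b ∈ j ⁻¹' O := by rw [hOe]; exact ⟨mem_extChartAt_source b, hbΦ⟩
      exact this
  · rintro x ⟨⟨hx, hxW⟩, -⟩
    refine ContMDiffAt.contMDiffWithinAt ?_
    obtain ⟨hxt, hxD⟩ := hxW
    have h1 : ContMDiffAt (𝓡∂ (d + 1)) 𝓘(ℝ, Eu (d + 1)) ∞ (extChartAt (𝓡∂ (d + 1)) c) x :=
      contMDiffAt_extChartAt' (by rwa [extChartAt_source] at hx)
    obtain ⟨hs', T', hT'⟩ := h.exists_hasFDerivAt_bdryCoord hxD.1 hxD.2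
    have h2 : ContDiffAt ℝ ∞ Φ.symm (bdryProj d (extChartAt (𝓡∂ (d + 1)) c x)) :=
      Φ.contDiffAt_symm hxt hT' hs'
    have h3 : ContDiffAt ℝ ∞ (Φ.symm ∘ bdryProj d) (extChartAt (𝓡∂ (d + 1)) c x) :=
      h2.comp _ (bdryProj d).contDiff.contDiffAt
    have h4 : ContMDiffAt 𝓘(ℝ, Eu d) (𝓡 d) ∞ e.symm
        (Φ.symm (bdryProj d (extChartAt (𝓡∂ (d + 1)) c x))) :=
      (contMDiffOn_extChartAt_symm b).contMDiffAt ((isOpen_extChartAt_target b).mem_nhds hxD.1)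
    exact h4.comp x (h3.contMDiffAt.comp x h1)
  · rintro b' ⟨-, hb'⟩
    have hb : b' ∈ e.source ∩ e ⁻¹' Φ.source := by rw [← hOe]; exact hb'
    change e.symm (Φ.symm (bdryProj d (extChartAt (𝓡∂ (d + 1)) c (j b')))) = b'
    rw [← hψe b' hb.1, ← hΦ, Φ.left_inv hb.2, e.left_inv hb.1]

variable [T2Space N] [SigmaCompactSpace N] [CompactSpace N] [CompactSpace B]
  {V : Type*} [AddCommGroup V] [Module ℝ V] [FiniteDimensional ℝ V]

/-- Pull `β` back along local retractions and glue with a partition of unity on the compact image of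
`j`. Since each retraction composed with `j` is locally the identity, each piece restricts to its
weight times `β`. -/
theorem exists_comap_eq {β : Form (𝓡 d) B V} (hβ : β.IsSmooth (𝓡 d)) {i : ZMod 2}
    (hi : β ∈ Form.par (𝓡 d) B V i) : ∃ γ : Form (𝓡∂ (d + 1)) N V, γ.IsSmooth (𝓡∂ (d + 1)) ∧
      γ ∈ Form.par (𝓡∂ (d + 1)) N V i ∧ γ.comap j = β := by
  choose U r hU hbU hr hrj using h.exists_retraction
  obtain ⟨f, hf⟩ := SmoothPartitionOfUnity.exists_isSubordinate (𝓡∂ (d + 1))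
    (isCompact_range h.smooth.continuous).isClosed U hU
    (by rintro _ ⟨b, rfl⟩; exact Set.mem_iUnion.2 ⟨b, hbU b⟩)
  have hfin : {b | (Function.support (f b)).Nonempty}.Finite :=
    f.locallyFinite.finite_nonempty_of_compact
  refine ⟨∑ b ∈ hfin.toFinset, (β.comap (r b) : Form (𝓡∂ (d + 1)) N V).fmul (f b), ?_, ?_, ?_⟩
  · exact Form.isSmooth_finset_sum _ _ fun b _ => Form.isSmooth_fmul_of_tsupport
      (fun c y hy hyU => hβ.contDiffWithinAt_comap (hU b) (hr b) hy hyU) (f b).contMDiff (hf b)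
  · exact Submodule.sum_mem _ fun b _ => Form.fmul_mem _ (Form.comap_mem _ hi)
  · refine Form.ext fun x => ?_
    have hx : ∀ b, fibMap (eucDeriv (𝓡 d) (𝓡∂ (d + 1)) j x).toLinearMap LinearMap.id
        (((β.comap (r b) : Form (𝓡∂ (d + 1)) N V).fmul (f b)).val (j x)) = f b (j x) • β.val x := by
      intro b
      rw [Form.val_fmul, map_smul]
      -- Outside `U b` the map `r b` is arbitrary; such points are harmless because their weight is
      -- zero.
      by_cases hb : f b (j x) = 0
      · rw [hb, zero_smul, zero_smul]
      have hxU : j x ∈ U b := hf b (subset_tsupport _ hb)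
      rw [Form.val_comap, fibMap_fibMap, hrj b x hxU]
      have h1 : MDifferentiableAt (𝓡∂ (d + 1)) (𝓡 d) (r b) (j x) :=
        ((hr b).contMDiffAt ((hU b).mem_nhds hxU)).mdifferentiableAt (by simp)
      have h2 : mfderiv (𝓡 d) (𝓡 d) (r b ∘ j) x = (mfderiv (𝓡∂ (d + 1)) (𝓡 d) (r b) (j x)).comp
        (mfderiv (𝓡 d) (𝓡∂ (d + 1)) j x) :=
        mfderiv_comp x h1 ((h.smooth x).mdifferentiableAt (by simp))
      have h3 : r b ∘ j =ᶠ[𝓝 x] id := by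
        filter_upwards [((hU b).preimage h.smooth.continuous).mem_nhds hxU] with z hz
        exact hrj b z hz
      have h4 : (eucDeriv (𝓡∂ (d + 1)) (𝓡 d) (r b) (j x)).comp (eucDeriv (𝓡 d) (𝓡∂ (d + 1)) j x) =
          ContinuousLinearMap.id ℝ (Eu d) :=
        h2.symm.trans (h3.mfderiv_eq.trans mfderiv_id)
      have h5 := congrArg ContinuousLinearMap.toLinearMap h4
      rw [ContinuousLinearMap.toLinearMap_comp] at h5
      rw [h5, LinearMap.id_comp]
      congr 1
      exact fibMap_id _
    rw [Form.val_comap, Form.val_finset_sum, map_sum, Finset.sum_congr rfl fun b _ => hx b,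
      ← Finset.sum_smul, f.sum_finsupport' (j x) (Set.mem_range_self x), one_smul]
    intro b hb
    exact hfin.mem_toFinset.2 ⟨j x, (f.mem_finsupport _).1 hb⟩

end IsOrientedBoundary

end Boundary

/-! ### First order variations of forms -/

section Shift

variable {d : ℕ} {H : Type*} [TopologicalSpace H]
  {I : ModelWithCorners ℝ (Eu d) H} {N : Type*} [TopologicalSpace N] [ChartedSpace H N]
  {V V' : Type*} [AddCommGroup V] [Module ℝ V] [AddCommGroup V'] [Module ℝ V']

/-- The `q`-th power of the grading involution. -/
def Form.gpow (q : ZMod 2) (β : Form I N V) : Form I N V := if q = 1 then β.inv else β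

@[simp] theorem Form.gpow_zero (β : Form I N V) : β.gpow 0 = β := by simp [Form.gpow]
@[simp] theorem Form.gpow_one (β : Form I N V) : β.gpow 1 = β.inv := by simp [Form.gpow]

theorem Form.val_gpow (q : ZMod 2) (β : Form I N V) (x : N) :
    (β.gpow q).val x = gradePow q (β.val x) := by
  rcases zmod_two_cases q with rfl | rfl
  · simp
  · simp [Form.val_inv]

theorem Form.one_smul (β : Form I N V) : (1 : ℝ) • β = β :=
  Form.ext fun x => by rw [Form.val_smul, _root_.one_smul]

theorem Form.neg_one_smul (β : Form I N V) : (-1 : ℝ) • β = -β :=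
  Form.ext fun x => by rw [Form.val_smul, _root_.neg_one_smul]; rfl

theorem Form.mul_const {q : ZMod 2} {θ : Gr V} (hθ : θ ∈ Gr.par V q) (β : Form I N V) :
    β * Form.const I θ = Form.const I θ * β.gpow q :=
  Form.ext fun x => by
    rw [Form.val_mul, Form.val_mul, Form.val_gpow, Form.val_const, Gr.mul_par (constMap_mem hθ)]

theorem Form.const_mul_self {θ : Gr V} (h : θ * θ = 0) :
    (Form.const I θ * Form.const I θ : Form I N V) = 0 := by
  rw [← Form.const_mul, h]
  exact Form.ext fun x => map_zero _

theorem Form.inv_bc (L : V →ₗ[ℝ] V') (β : Form I N V) : (β.bc I L).inv = β.inv.bc I L :=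
  Form.ext fun x => by simp only [Form.val_inv, Form.val_bc, gradeInv_fibMap]

theorem Form.inv_const_mul {q : ZMod 2} {θ : Gr V} (hθ : θ ∈ Gr.par V q) (β : Form I N V) :
    (Form.const I θ * β).inv = Form.const I θ * (ksign q 1 • β.inv) := by
  rw [Form.inv_mul, Form.inv_of_mem (Form.const_mem hθ), smul_mul_assoc, mul_smul_comm]

theorem Form.bc_list_sum {ι : Type*} (L : V →ₗ[ℝ] V') (l : List ι) (f : ι → Form I N V) :
    ((l.map f).sum).bc I L = (l.map fun i => (f i).bc I L).sum := by
  induction l with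
  | nil => exact Form.bc_zero L
  | cons a l ih => simp only [List.map_cons, List.sum_cons, Form.bc_add, ih]

theorem Form.number_list_sum {ι : Type*} (l : List ι) (f : ι → Form I N V) :
    ((l.map f).sum).number I = (l.map fun i => (f i).number I).sum := by
  induction l with
  | nil => simpa using Form.number_smul (I := I) (N := N) (V := V) 0 0
  | cons a l ih => simp only [List.map_cons, List.sum_cons, Form.number_add, ih]

theorem Form.val_list_sum {ι : Type*} (l : List ι) (f : ι → Form I N V) (x : N) :
    ((l.map f).sum).val x = (l.map fun i => (f i).val x).sum := by
  induction l with
  | nil => rfl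
  | cons a l ih => simp only [List.map_cons, List.sum_cons, Form.val_add, ih]

/-- `β₁ = β + θ β'`. -/
def Form.IsShift (θ : Gr V) (β β₁ β' : Form I N V) : Prop := β₁ = β + Form.const I θ * β'

namespace Form.IsShift

variable {q : ZMod 2} {θ : Gr V} {β β₁ β' γ γ₁ γ' : Form I N V}

theorem self (θ : Gr V) (β β' : Form I N V) : IsShift θ β (β + Form.const I θ * β') β' := rfl

theorem rfl' (θ : Gr V) (β : Form I N V) : IsShift θ β β 0 := by
  rw [IsShift, mul_zero, add_zero]

theorem congr (h : IsShift θ β β₁ β') (e : β' = γ') : IsShift θ β β₁ γ' := e ▸ h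

theorem add (h : IsShift θ β β₁ β') (h' : IsShift θ γ γ₁ γ') :
    IsShift θ (β + γ) (β₁ + γ₁) (β' + γ') := by
  rw [IsShift] at *
  rw [h, h', mul_add]; abel

theorem sub (h : IsShift θ β β₁ β') (h' : IsShift θ γ γ₁ γ') :
    IsShift θ (β - γ) (β₁ - γ₁) (β' - γ') := by
  rw [IsShift] at *
  rw [h, h', mul_sub]; abel

/-- The Leibniz rule: the term with `θ` twice vanishes, and the second term acquires the sign of
moving `θ` to the left past `β`. -/
theorem mul (hθ : θ ∈ Gr.par V q) (hθθ : θ * θ = 0) (h : IsShift θ β β₁ β')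
    (h' : IsShift θ γ γ₁ γ') : IsShift θ (β * γ) (β₁ * γ₁) (β' * γ + β.gpow q * γ') := by
  rw [IsShift] at *
  have h1 : Form.const I θ * β' * (Form.const I θ * γ') = 0 := by
    rw [← mul_assoc, mul_assoc _ β', Form.mul_const hθ, ← mul_assoc, Form.const_mul_self hθθ,
      zero_mul, zero_mul]
  have h2 : β * (Form.const I θ * γ') = Form.const I θ * (β.gpow q * γ') := by
    rw [← mul_assoc, Form.mul_const hθ, mul_assoc]
  rw [h, h', add_mul, mul_add, mul_add, h1, h2, mul_add, mul_assoc]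
  abel

theorem number (h : IsShift θ β β₁ β') : IsShift θ (β.number I) (β₁.number I) (β'.number I) := by
  rw [IsShift] at *
  rw [h, Form.number_add, Form.number_mul, Form.number_const, zero_mul, zero_add]

theorem inv (hθ : θ ∈ Gr.par V q) (h : IsShift θ β β₁ β') :
    IsShift θ β.inv β₁.inv (ksign q 1 • β'.inv) := by
  rw [IsShift] at *
  rw [h, Form.inv_add, Form.inv_const_mul hθ]

theorem list_sum {ι : Type*} (l : List ι) {f f₁ f' : ι → Form I N V}
    (h : ∀ i, IsShift θ (f i) (f₁ i) (f' i)) :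
    IsShift θ (l.map f).sum (l.map f₁).sum (l.map f').sum := by
  induction l with
  | nil => exact rfl' θ 0
  | cons a l ih => simpa only [List.map_cons, List.sum_cons] using (h a).add ih

/-- The exterior derivative is odd and kills constants, so passing the parameter costs `(-1)^q`. -/
theorem exteriorDeriv [FiniteDimensional ℝ V] [IsManifold I ∞ N] (hθ : θ ∈ Gr.par V q)
    (hβ : β.IsSmooth I) (hβ' : β'.IsSmooth I) (h : IsShift θ β β₁ β') :
    IsShift θ (β.exteriorDeriv I) (β₁.exteriorDeriv I) (ksign q 1 • β'.exteriorDeriv I) := by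
  rw [IsShift] at *
  rw [h, Form.exteriorDeriv_add hβ ((Form.isSmooth_const θ).mul hβ'),
    Form.exteriorDeriv_mul (Form.isSmooth_const θ) hβ', Form.exteriorDeriv_const, zero_mul, zero_add,
    Form.inv_of_mem (Form.const_mem hθ), smul_mul_assoc, mul_smul_comm]

end Form.IsShift

end Shift

/-! ### Densities on the mapping space -/

theorem IsDerAlong.sub {A B : Type*} [Ring A] [Algebra ℝ A] [Ring B] [Algebra ℝ B]
    {𝒜 : ZMod 2 → Submodule ℝ A} {P : ZMod 2 → Submodule ℝ B} {p : ZMod 2} {x ξ ζ : A → B}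
    (h : IsDerAlong 𝒜 P p x ξ) (h' : IsDerAlong 𝒜 P p x ζ) :
    IsDerAlong 𝒜 P p x (fun a => ξ a - ζ a) := by
  simpa only [neg_one_smul, ← sub_eq_add_neg] using h.add (h'.smul (-1))

section Points

variable {d : ℕ} {H : Type*} [TopologicalSpace H]
  {I : ModelWithCorners ℝ (Eu d) H} {N : Type*} [TopologicalSpace N] [ChartedSpace H N]
  {A : Type*} [Ring A] [Algebra ℝ A] {𝒜 : ZMod 2 → Submodule ℝ A}
  {V V' : Type} [AddCommGroup V] [Module ℝ V] [FiniteDimensional ℝ V] [AddCommGroup V']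
  [Module ℝ V'] [FiniteDimensional ℝ V']

variable (I V) in
/-- The value of forms at a point, as a homomorphism. -/
def Form.valHom (x : N) : Form I N V →ₐ[ℝ] Fib (Eu d) V :=
  Pi.evalAlgHom ℝ (fun x : N => Fib (TangentSpace I x) V) x

theorem IsPoint.val {X : A → Form I N V} (h : IsPoint I N 𝒜 V X) (x : N) :
    IsSuperHom 𝒜 (Gr.par (Module.Dual ℝ (Eu d) × V)) fun a => (X a).val x :=
  h.1.comp (Form.valHom I V x) fun _ _ hb => Form.mem_par.1 hb x

theorem IsTangent.val {p : ZMod 2} {X ζ : A → Form I N V} (h : IsTangent I N 𝒜 V p X ζ) (x : N) :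
    IsDerAlong 𝒜 (Gr.par (Module.Dual ℝ (Eu d) × V)) p (fun a => (X a).val x)
      fun a => (ζ a).val x :=
  h.1.comp (Form.valHom I V x) fun _ _ hb => Form.mem_par.1 hb x

/-- The covectors at `x` serve as additional odd parameters. All pointwise hypotheses on the target
enter the theory through this specialisation. -/
theorem IsPoint.targetPoint {X ξ : A → Form I N V} (h : IsPoint I N 𝒜 V X)
    (h' : IsTangent I N 𝒜 V 1 X ξ) (x : N) :
    IsTargetPoint 𝒜 (Module.Dual ℝ (Eu d) × V) (fun a => (X a).val x) fun a => (ξ a).val x :=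
  ⟨h.val x, h'.val x⟩

/-- Change of parameters, as a homomorphism. -/
def Form.bcHom (L : V →ₗ[ℝ] V') : Form I N V →ₐ[ℝ] Form I N V' where
  toFun β := β.bc I L
  map_one' := Form.bc_one L
  map_mul' := Form.bc_mul L
  map_zero' := Form.bc_zero L
  map_add' := Form.bc_add L
  commutes' r := by
    rw [Algebra.algebraMap_eq_smul_one, Algebra.algebraMap_eq_smul_one, Form.bc_smul, Form.bc_one]

theorem IsPoint.bc {X : A → Form I N V} (h : IsPoint I N 𝒜 V X) (L : V →ₗ[ℝ] V') :
    IsPoint I N 𝒜 V' fun a => (X a).bc I L :=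
  ⟨h.1.comp (Form.bcHom L) fun _ _ => Form.bc_mem L, fun a => (h.2 a).bc L⟩

theorem IsTangent.bc {p : ZMod 2} {X ζ : A → Form I N V} (h : IsTangent I N 𝒜 V p X ζ)
    (L : V →ₗ[ℝ] V') : IsTangent I N 𝒜 V' p (fun a => (X a).bc I L) fun a => (ζ a).bc I L :=
  ⟨h.1.comp (Form.bcHom L) fun _ _ => Form.bc_mem L, fun a => (h.2 a).bc L⟩

theorem IsTangent.sub {p : ZMod 2} {X ξ ζ : A → Form I N V} (h : IsTangent I N 𝒜 V p X ξ)
    (h' : IsTangent I N 𝒜 V p X ζ) : IsTangent I N 𝒜 V p X fun a => ξ a - ζ a :=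
  ⟨h.1.sub h'.1,
    fun a => (h.2 a).sub (h'.2 a)⟩

theorem IsTangent.add {p : ZMod 2} {X ξ ζ : A → Form I N V} (h : IsTangent I N 𝒜 V p X ξ)
    (h' : IsTangent I N 𝒜 V p X ζ) : IsTangent I N 𝒜 V p X fun a => ξ a + ζ a :=
  ⟨h.1.add h'.1, fun a => (h.2 a).add (h'.2 a)⟩

theorem IsPoint.lift {X : A → Form I N V} (h : IsPoint I N 𝒜 V X) {p : ZMod 2} {v : A → A}
    (hv : IsDerAlong 𝒜 𝒜 p id v) : IsTangent I N 𝒜 V p X fun a => X (v a) :=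
  ⟨IsDerAlong.comp_left h.1 hv, fun a => h.2 (v a)⟩

theorem IsPoint.mul_left {X ζ : A → Form I N V} (h : IsPoint I N 𝒜 V X) {p q : ZMod 2}
    (hζ : IsTangent I N 𝒜 V p X ζ) {φ : Form I N V} (hφ : φ ∈ Form.par I N V q)
    (hφ' : φ.IsSmooth I) : IsTangent I N 𝒜 V (q + p) X fun a => φ * ζ a :=
  ⟨IsDerAlong.mul_left (fun _ _ _ ha _ hb => Form.mul_mem ha hb)
    (fun _ _ _ ha _ hb => Form.supercomm ha hb) h.1 hζ.1 hφ, fun a => hφ'.mul (hζ.2 a)⟩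

theorem IsPoint.number {X : A → Form I N V} (h : IsPoint I N 𝒜 V X) :
    IsTangent I N 𝒜 V 0 X fun a => (X a).number I := by
  refine ⟨⟨fun a b => ?_, fun t a => ?_, fun i a ha b => ?_, fun i a ha => ?_⟩,
    fun a => (h.2 a).number⟩
  · rw [h.1.map_add, Form.number_add]
  · rw [h.1.map_smul, Form.number_smul]
  · rw [h.1.map_mul, Form.number_mul, ksign_zero_left, Form.one_smul]
  · rw [add_zero]; exact Form.number_mem (h.1.parity i a ha)

theorem IsPoint.exteriorDeriv [IsManifold I ∞ N] {X : A → Form I N V} (h : IsPoint I N 𝒜 V X) :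
    IsTangent I N 𝒜 V 1 X fun a => (X a).exteriorDeriv I := by
  refine ⟨⟨fun a b => ?_, fun t a => ?_, fun i a ha b => ?_, fun i a ha => ?_⟩,
    fun a => (h.2 a).exteriorDeriv⟩
  · rw [h.1.map_add, Form.exteriorDeriv_add (h.2 a) (h.2 b)]
  · rw [h.1.map_smul, Form.exteriorDeriv_smul (h.2 a)]
  · rw [h.1.map_mul, Form.exteriorDeriv_mul (h.2 a) (h.2 b), Form.inv_of_mem (h.1.parity i a ha),
      ksign_comm]
    exact congrArg _ (smul_mul_assoc (ksign 1 i) (X a) ((X b).exteriorDeriv I))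
  · exact Form.exteriorDeriv_mem (h.2 a) (h.1.parity i a ha)

variable (I N A) in
/-- Form-valued functions of `(X, ξ)`. -/
abbrev Density : Type _ :=
  ∀ (V : Type) [AddCommGroup V] [Module ℝ V] [FiniteDimensional ℝ V],
    (A → Form I N V) → (A → Form I N V) → Form I N V

variable (𝒜) in
/-- Smoothness and naturality of densities. -/
def IsDensity (F : Density I N A) : Prop :=
  ∀ (V : Type) [AddCommGroup V] [Module ℝ V] [FiniteDimensional ℝ V] (X ξ : A → Form I N V),
    IsPoint I N 𝒜 V X → IsTangent I N 𝒜 V 1 X ξ → (F V X ξ).IsSmooth I ∧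
      ∀ (V' : Type) [AddCommGroup V'] [Module ℝ V'] [FiniteDimensional ℝ V'] (L : V →ₗ[ℝ] V'),
        F V' (fun a => (X a).bc I L) (fun a => (ξ a).bc I L) = (F V X ξ).bc I L

namespace IsDensity

theorem point (a : A) : IsDensity 𝒜 (fun _ _ _ _ X _ => X a : Density I N A) :=
  fun _ _ _ _ _ _ hX _ => ⟨hX.2 a, fun _ _ _ _ _ => rfl⟩

theorem tangent (a : A) : IsDensity 𝒜 (fun _ _ _ _ _ ξ => ξ a : Density I N A) :=
  fun _ _ _ _ _ _ _ hξ => ⟨hξ.2 a, fun _ _ _ _ _ => rfl⟩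

theorem zero : IsDensity 𝒜 (fun _ _ _ _ _ _ => 0 : Density I N A) :=
  fun _ _ _ _ _ _ _ _ => ⟨Form.isSmooth_zero, fun _ _ _ _ L => (Form.bc_zero L).symm⟩

variable {F G : Density I N A}

theorem add (hF : IsDensity 𝒜 F) (hG : IsDensity 𝒜 G) :
    IsDensity 𝒜 (fun V _ _ _ X ξ => F V X ξ + G V X ξ : Density I N A) :=
  fun V _ _ _ X ξ hX hξ => ⟨(hF V X ξ hX hξ).1.add (hG V X ξ hX hξ).1, fun V' _ _ _ L => by
    beta_reduce
    rw [(hF V X ξ hX hξ).2, (hG V X ξ hX hξ).2, Form.bc_add]⟩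

theorem sub (hF : IsDensity 𝒜 F) (hG : IsDensity 𝒜 G) :
    IsDensity 𝒜 (fun V _ _ _ X ξ => F V X ξ - G V X ξ : Density I N A) :=
  fun V _ _ _ X ξ hX hξ => ⟨(hF V X ξ hX hξ).1.sub (hG V X ξ hX hξ).1, fun V' _ _ _ L => by
    beta_reduce
    rw [(hF V X ξ hX hξ).2, (hG V X ξ hX hξ).2, Form.bc_sub]⟩

theorem mul (hF : IsDensity 𝒜 F) (hG : IsDensity 𝒜 G) :
    IsDensity 𝒜 (fun V _ _ _ X ξ => F V X ξ * G V X ξ : Density I N A) :=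
  fun V _ _ _ X ξ hX hξ => ⟨(hF V X ξ hX hξ).1.mul (hG V X ξ hX hξ).1, fun V' _ _ _ L => by
    beta_reduce
    rw [(hF V X ξ hX hξ).2, (hG V X ξ hX hξ).2, Form.bc_mul]⟩

theorem inv (hF : IsDensity 𝒜 F) :
    IsDensity 𝒜 (fun V _ _ _ X ξ => (F V X ξ).inv : Density I N A) :=
  fun V _ _ _ X ξ hX hξ => ⟨(hF V X ξ hX hξ).1.inv, fun V' _ _ _ L => by
    beta_reduce
    rw [(hF V X ξ hX hξ).2, Form.inv_bc]⟩

theorem number (hF : IsDensity 𝒜 F) :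
    IsDensity 𝒜 (fun V _ _ _ X ξ => (F V X ξ).number I : Density I N A) :=
  fun V _ _ _ X ξ hX hξ => ⟨(hF V X ξ hX hξ).1.number, fun V' _ _ _ L => by
    beta_reduce
    rw [(hF V X ξ hX hξ).2, Form.number_bc]⟩

theorem exteriorDeriv [IsManifold I ∞ N] (hF : IsDensity 𝒜 F) :
    IsDensity 𝒜 (fun V _ _ _ X ξ => (F V X ξ).exteriorDeriv I : Density I N A) :=
  fun V _ _ _ X ξ hX hξ => ⟨(hF V X ξ hX hξ).1.exteriorDeriv, fun V' _ _ _ L => by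
    beta_reduce
    rw [(hF V X ξ hX hξ).2, Form.exteriorDeriv_bc (hF V X ξ hX hξ).1]⟩

theorem list_sum {ι : Type*} (l : List ι) {F : ι → Density I N A} (hF : ∀ i, IsDensity 𝒜 (F i)) :
    IsDensity 𝒜 (fun V _ _ _ X ξ => (l.map fun i => F i V X ξ).sum : Density I N A) :=
  fun V _ _ _ X ξ hX hξ => ⟨Form.isSmooth_list_sum l _ fun i _ => (hF i V X ξ hX hξ).1,
    fun V' _ _ _ L => by
      rw [Form.bc_list_sum]
      exact congrArg (fun f => (l.map f).sum) (funext fun i => (hF i V X ξ hX hξ).2 V' L)⟩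

end IsDensity

variable [IsManifold I ∞ N] [T2Space N] [SigmaCompactSpace N] [CompactSpace N] (o : Orient I N)

/-- Integration of a density. -/
def Density.integral (F : Density I N A) : FForm I N A :=
  fun V _ _ _ X ξ => (F V X ξ).integral I o

theorem IsDelta.congr {Ψ Ψ' Φ' : FForm I N A} (h : IsDelta 𝒜 Ψ Ψ')
    (e : ∀ (V : Type) [AddCommGroup V] [Module ℝ V] [FiniteDimensional ℝ V]
      (X ξ : A → Form I N V), IsPoint I N 𝒜 V X → IsTangent I N 𝒜 V 1 X ξ →
      Ψ' V X ξ = Φ' V X ξ) : IsDelta 𝒜 Ψ Φ' :=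
  fun V V' _ _ _ _ _ _ L X ξ hX hξ η hη => by rw [h V V' L X ξ hX hξ η hη, e V X ξ hX hξ]

theorem IsContraction.congr {p : ZMod 2} {U : FField I N A} {Ψ Ψ' Φ' : FForm I N A}
    (h : IsContraction 𝒜 p U Ψ Ψ')
    (e : ∀ (V : Type) [AddCommGroup V] [Module ℝ V] [FiniteDimensional ℝ V]
      (X ξ : A → Form I N V), IsPoint I N 𝒜 V X → IsTangent I N 𝒜 V 1 X ξ →
      Ψ' V X ξ = Φ' V X ξ) : IsContraction 𝒜 p U Ψ Φ' :=
  fun V V' _ _ _ _ _ _ L X ξ hX hξ θ hθ hθθ => by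
    rw [h V V' L X ξ hX hξ θ hθ hθθ, e V X ξ hX hξ]

theorem IsDelta.add {Ψ Ψ' Φ Φ' : FForm I N A} (h : IsDelta 𝒜 Ψ Ψ') (h' : IsDelta 𝒜 Φ Φ') :
    IsDelta 𝒜 (fun V _ _ _ X ξ => Ψ V X ξ + Φ V X ξ) (fun V _ _ _ X ξ => Ψ' V X ξ + Φ' V X ξ) :=
  fun V V' _ _ _ _ _ _ L X ξ hX hξ η hη => by
    beta_reduce
    rw [h V V' L X ξ hX hξ η hη, h' V V' L X ξ hX hξ η hη, map_add, map_add, mul_add]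
    abel

theorem IsForm.add {r : ℕ} {c : ZMod 2} {Ψ Φ : FForm I N A} (h : IsForm 𝒜 r c Ψ)
    (h' : IsForm 𝒜 r c Φ) : IsForm 𝒜 r c (fun V _ _ _ X ξ => Ψ V X ξ + Φ V X ξ) := by
  intro V _ _ _ X ξ hX hξ
  obtain ⟨h1, h2, h3⟩ := h V X ξ hX hξ
  obtain ⟨h1', h2', h3'⟩ := h' V X ξ hX hξ
  refine ⟨add_mem h1 h1', fun t => ?_, fun V' _ _ _ L => ?_⟩
  · beta_reduce
    rw [h2, h2', smul_add]
  · beta_reduce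
    rw [h3, h3', map_add]

theorem isDelta_zero : IsDelta 𝒜 (FForm.zero : FForm I N A) FForm.zero :=
  fun V V' _ _ _ _ _ _ L X ξ _ _ η _ => by simp [FForm.zero]

theorem isContraction_zero (p : ZMod 2) (U : FField I N A) :
    IsContraction 𝒜 p U FForm.zero FForm.zero :=
  fun V V' _ _ _ _ _ _ L X ξ _ _ η _ _ => by simp [FForm.zero]

theorem IsDelta.smul {Ψ Ψ' : FForm I N A} (h : IsDelta 𝒜 Ψ Ψ') (s : ℝ) :
    IsDelta 𝒜 (FForm.smul s Ψ) (FForm.smul s Ψ') :=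
  fun V V' _ _ _ _ _ _ L X ξ hX hξ η hη => by
    simp only [FForm.smul, h V V' L X ξ hX hξ η hη, smul_add, map_smul, mul_smul_comm]

theorem IsContraction.smul {p : ZMod 2} {U : FField I N A} {Ψ Ψ' : FForm I N A}
    (h : IsContraction 𝒜 p U Ψ Ψ') (s : ℝ) :
    IsContraction 𝒜 p U (FForm.smul s Ψ) (FForm.smul s Ψ') :=
  fun V V' _ _ _ _ _ _ L X ξ hX hξ θ hθ hθθ => by
    simp only [FForm.smul, h V V' L X ξ hX hξ θ hθ hθθ, smul_add, map_smul, mul_smul_comm]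

/-- It suffices to vary the integrand. The odd parameter leaves the integral with the sign `(-1)^d`,
and naturality reduces a general change of parameters to a computation over one parameter space. -/
theorem isDelta_integral {F F' : Density I N A} (hF : IsDensity 𝒜 F) (hF' : IsDensity 𝒜 F')
    (h : ∀ (V : Type) [AddCommGroup V] [Module ℝ V] [FiniteDimensional ℝ V]
      (X ξ : A → Form I N V), IsPoint I N 𝒜 V X → IsTangent I N 𝒜 V 1 X ξ → ∀ η ∈ Gr.par V 1,
      η * η = 0 →
      Form.IsShift η (F V X ξ) (F V (fun a => X a + Form.const I η * ξ a) ξ) (F' V X ξ)) :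
    IsDelta 𝒜 (F.integral o) (FForm.smul ((-1) ^ d) (F'.integral o)) := by
  intro V V' _ _ _ _ _ _ L X ξ hX hξ η hη
  have h1 := h V' _ _ (hX.bc L) (hξ.bc L) η hη (Gr.sq_odd hη)
  rw [Form.IsShift] at h1
  have hs := (hF V' _ _ (hX.bc L) (hξ.bc L)).1
  have hs' := (hF' V' _ _ (hX.bc L) (hξ.bc L)).1
  rw [Density.integral, h1, Form.integral_add o hs ((Form.isSmooth_const η).mul hs'),
    Form.integral_const_mul o hs' hη, (hF V X ξ hX hξ).2, (hF' V X ξ hX hξ).2,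
    Form.integral_bc o (hF V X ξ hX hξ).1, Form.integral_bc o (hF' V X ξ hX hξ).1]
  simp only [FForm.smul, Density.integral, map_smul, mul_smul_comm]
  rw [ksign_comm, ksign_natCast_one]

/-- For an odd field the parameter is even and no sign appears; for an even field the sign is
`(-1)^d`, which cancels against the sign of `δ` in Cartan's formula. -/
theorem isContraction_integral {p q : ZMod 2} (hq : p + 1 = q) {U : FField I N A}
    (hU : IsVectorField 𝒜 p U) {F F' : Density I N A} (hF : IsDensity 𝒜 F) (hF' : IsDensity 𝒜 F')
    (h : ∀ (V : Type) [AddCommGroup V] [Module ℝ V] [FiniteDimensional ℝ V]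
      (X ξ : A → Form I N V), IsPoint I N 𝒜 V X → IsTangent I N 𝒜 V 1 X ξ →
      ∀ θ ∈ Gr.par V q, θ * θ = 0 →
      Form.IsShift θ (F V X ξ) (F V X fun a => ξ a + Form.const I θ * U V X a) (F' V X ξ)) :
    IsContraction 𝒜 p U (F.integral o) (FForm.smul (ksign q d) (F'.integral o)) := by
  subst hq
  intro V V' _ _ _ _ _ _ L X ξ hX hξ θ hθ hθθ
  have h1 := h V' _ _ (hX.bc L) (hξ.bc L) θ hθ hθθ
  simp only [Form.IsShift, (hU V X hX).2 V' L] at h1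
  have hs := (hF V' _ _ (hX.bc L) (hξ.bc L)).1
  have hs' := (hF' V' _ _ (hX.bc L) (hξ.bc L)).1
  rw [Density.integral, h1, Form.integral_add o hs ((Form.isSmooth_const θ).mul hs'),
    Form.integral_const_mul o hs' hθ, (hF V X ξ hX hξ).2, (hF' V X ξ hX hξ).2,
    Form.integral_bc o (hF V X ξ hX hξ).1, Form.integral_bc o (hF' V X ξ hX hξ).1]
  simp only [FForm.smul, Density.integral, map_smul, mul_smul_comm]

theorem isContraction_integral_even {U : FField I N A} (hU : IsVectorField 𝒜 0 U)
    {F F' : Density I N A} (hF : IsDensity 𝒜 F) (hF' : IsDensity 𝒜 F')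
    (h : ∀ (V : Type) [AddCommGroup V] [Module ℝ V] [FiniteDimensional ℝ V]
      (X ξ : A → Form I N V), IsPoint I N 𝒜 V X → IsTangent I N 𝒜 V 1 X ξ →
      ∀ θ ∈ Gr.par V 1, θ * θ = 0 →
      Form.IsShift θ (F V X ξ) (F V X fun a => ξ a + Form.const I θ * U V X a) (F' V X ξ)) :
    IsContraction 𝒜 0 U (F.integral o) (FForm.smul ((-1) ^ d) (F'.integral o)) := by
  have := isContraction_integral o (zero_add 1) hU hF hF' h
  rwa [ksign_comm, ksign_natCast_one] at this

theorem isContraction_integral_odd {U : FField I N A} (hU : IsVectorField 𝒜 1 U)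
    {F F' : Density I N A} (hF : IsDensity 𝒜 F) (hF' : IsDensity 𝒜 F')
    (h : ∀ (V : Type) [AddCommGroup V] [Module ℝ V] [FiniteDimensional ℝ V]
      (X ξ : A → Form I N V), IsPoint I N 𝒜 V X → IsTangent I N 𝒜 V 1 X ξ →
      ∀ θ ∈ Gr.par V 0, θ * θ = 0 →
      Form.IsShift θ (F V X ξ) (F V X fun a => ξ a + Form.const I θ * U V X a) (F' V X ξ)) :
    IsContraction 𝒜 1 U (F.integral o) (F'.integral o) :=
  (isContraction_integral o (two_zmod 1) hU hF hF' h).congr fun V _ _ _ X ξ _ _ => by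
    rw [FForm.smul, ksign_zero_left, one_smul]

theorem isForm_integral {F : Density I N A} (hF : IsDensity 𝒜 F) (r : ℕ) {c c' : ZMod 2}
    (hc : c' + d = c)
    (h : ∀ (V : Type) [AddCommGroup V] [Module ℝ V] [FiniteDimensional ℝ V]
      (X ξ : A → Form I N V), IsPoint I N 𝒜 V X → IsTangent I N 𝒜 V 1 X ξ →
      F V X ξ ∈ Form.par I N V c' ∧ ∀ t : ℝ, F V X (fun a => t • ξ a) = t ^ r • F V X ξ) :
    IsForm 𝒜 r c (F.integral o) := by
  intro V _ _ _ X ξ hX hξ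
  have hs := (hF V X ξ hX hξ).1
  refine ⟨hc ▸ Form.integral_mem o hs (h V X ξ hX hξ).1, fun t => ?_, fun V' _ _ _ L => ?_⟩
  · rw [Density.integral, (h V X ξ hX hξ).2, Form.integral_smul o hs]; rfl
  · rw [Density.integral, (hF V X ξ hX hξ).2, Form.integral_bc o hs]; rfl

end Points

/-! ### The vector fields of the AKSZ theory -/

theorem list_sum_map_add {ι B : Type*} [AddCommGroup B] (l : List ι) (f g : ι → B) :
    (l.map f).sum + (l.map g).sum = (l.map fun i => f i + g i).sum := by
  induction l with
  | nil => simp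
  | cons a l ih => simp only [List.map_cons, List.sum_cons, ← ih]; abel

theorem list_sum_map_sub {ι B : Type*} [AddCommGroup B] (l : List ι) (f g : ι → B) :
    (l.map f).sum - (l.map g).sum = (l.map fun i => f i - g i).sum := by
  induction l with
  | nil => simp
  | cons a l ih => simp only [List.map_cons, List.sum_cons, ← ih]; abel

theorem neg_one_pow_smul_smul {W : Type*} [AddCommGroup W] [Module ℝ W] (d : ℕ) (w : W) :
    (-1 : ℝ) ^ d • (-1 : ℝ) ^ d • w = w := by
  rw [smul_smul, ← mul_pow, neg_one_mul, neg_neg, one_pow, one_smul]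

theorem GradedManifold.exists_add (M : GradedManifold) (a : M.Fun) :
    ∃ b ∈ M.par ⊤ 0, ∃ c ∈ M.par ⊤ 1, b + c = a := by
  obtain ⟨b, c, hb, hc, h⟩ :=
    Submodule.codisjoint_iff_exists_add_eq.1 (M.par_compl ⊤).codisjoint a
  exact ⟨b, hb, c, hc, h⟩

section Fields

variable {m : ℤ} (M : HamiltonianDGManifold m) {d : ℕ} {H : Type*} [TopologicalSpace H]
  {I : ModelWithCorners ℝ (Eu d) H} {N : Type*} [TopologicalSpace N] [ChartedSpace H N]
  {V V' : Type} [AddCommGroup V] [Module ℝ V] [FiniteDimensional ℝ V] [AddCommGroup V']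
  [Module ℝ V'] [FiniteDimensional ℝ V']

theorem EField_apply (X : M.Fun → Form I N V) (a : M.Fun) :
    EField M I N V X a = X (M.euler ⊤ a) - (X a).number I := rfl

theorem QField_apply (X : M.Fun → Form I N V) (a : M.Fun) :
    QField M I N V X a = (X a).exteriorDeriv I + X (M.Q a) := rfl

theorem isVectorField_EField : IsVectorField (M.par ⊤) 0 (EField M I N) :=
  fun V _ _ _ X hX => ⟨(hX.lift (M.euler_der ⊤)).sub hX.number, fun V' _ _ _ L a => by
    rw [EField_apply, EField_apply, Form.bc_sub, Form.number_bc]⟩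

theorem isShift_EField {X Y : M.Fun → Form I N V} (θ : Gr V) (a : M.Fun) :
    Form.IsShift θ (EField M I N V X a)
      (EField M I N V (fun a => X a + Form.const I θ * Y a) a) (EField M I N V Y a) :=
  (Form.IsShift.self θ _ _).sub (Form.IsShift.self θ _ _).number

variable [IsManifold I ∞ N]

theorem isVectorField_QField : IsVectorField (M.par ⊤) 1 (QField M I N) :=
  fun V _ _ _ X hX => ⟨hX.exteriorDeriv.add (hX.lift M.Q_der), fun V' _ _ _ L a => by
    rw [QField_apply, QField_apply, Form.bc_add, Form.exteriorDeriv_bc (hX.2 a)]⟩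

theorem isShift_QField {q : ZMod 2} {X Y : M.Fun → Form I N V} {θ : Gr V} (hθ : θ ∈ Gr.par V q)
    {a : M.Fun} (hX : (X a).IsSmooth I) (hY : (Y a).IsSmooth I) :
    Form.IsShift θ (QField M I N V X a)
      (QField M I N V (fun a => X a + Form.const I θ * Y a) a)
      (ksign q 1 • (Y a).exteriorDeriv I + Y (M.Q a)) :=
  ((Form.IsShift.self θ _ _).exteriorDeriv hθ hX hY).add (Form.IsShift.self θ _ _)

theorem IsDirDeriv.of_isShift {p : ZMod 2} {U Y Z : FField I N M.Fun}
    (hU : IsVectorField (M.par ⊤) p U) (hY : IsVectorField (M.par ⊤) 0 Y ∨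
      IsVectorField (M.par ⊤) 1 Y)
    (hZ : ∀ (V : Type) [AddCommGroup V] [Module ℝ V] [FiniteDimensional ℝ V]
      (X : M.Fun → Form I N V), IsPoint I N (M.par ⊤) V X →
      ∀ (V' : Type) [AddCommGroup V'] [Module ℝ V'] [FiniteDimensional ℝ V'] (L : V →ₗ[ℝ] V')
        (a : M.Fun), Z V' (fun a => (X a).bc I L) a = (Z V X a).bc I L)
    (h : ∀ (V : Type) [AddCommGroup V] [Module ℝ V] [FiniteDimensional ℝ V]
      (X : M.Fun → Form I N V), IsPoint I N (M.par ⊤) V X → ∀ θ ∈ Gr.par V p, θ * θ = 0 → ∀ a,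
      Form.IsShift θ (Y V X a) (Y V (fun a => X a + Form.const I θ * U V X a) a) (Z V X a)) :
    IsDirDeriv (M.par ⊤) p U Y Z := by
  intro V V' _ _ _ _ _ _ L X hX θ hθ hθθ a
  have h1 := h V' _ (hX.bc L) θ hθ hθθ a
  have h2 : Y V' (fun a => (X a).bc I L) a = (Y V X a).bc I L := by
    rcases hY with hY | hY
    · exact (hY V X hX).2 V' L a
    · exact (hY V X hX).2 V' L a
  simp only [Form.IsShift, (hU V X hX).2 V' L, h2, hZ V X hX V' L] at h1
  exact h1

/-- The mixed terms commute. The target part is the degree condition on `Q`; the source part is the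
commutator of the degree operator with `d`, which is `d`, the minus sign in `EField` being matched
by the reversed order of composition. -/
theorem isBracket_EField_QField :
    IsBracket (M.par ⊤) 0 1 (EField M I N) (QField M I N) (QField M I N) := by
  have hE := isVectorField_EField (I := I) (N := N) M
  have hQ := isVectorField_QField (I := I) (N := N) M
  refine ⟨fun V _ _ _ X a => (EField M I N V X a).exteriorDeriv I + EField M I N V X (M.Q a),
    fun V _ _ _ X a => EField M I N V (QField M I N V X) a,
    IsDirDeriv.of_isShift M hE (Or.inr hQ) ?_ ?_, IsDirDeriv.of_isShift M hQ (Or.inl hE) ?_ ?_, ?_⟩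
  · intro V _ _ _ X hX V' _ _ _ L a
    rw [(hE V X hX).2, (hE V X hX).2, Form.exteriorDeriv_bc ((hE V X hX).1.2 a), Form.bc_add]
  · intro V _ _ _ X hX θ hθ _ a
    refine (isShift_QField M hθ (hX.2 a) ((hE V X hX).1.2 a)).congr ?_
    rw [ksign_zero_left, Form.one_smul]
  · intro V _ _ _ X hX V' _ _ _ L a
    rw [EField_apply, EField_apply, (hQ V X hX).2, (hQ V X hX).2, Form.number_bc, Form.bc_sub]
  · intro V _ _ _ X hX θ hθ _ a
    exact isShift_EField M θ a
  · intro V _ _ _ X hX a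
    have h1 : X (M.Q a) = X (M.euler ⊤ (M.Q a)) - X (M.Q (M.euler ⊤ a)) := by
      conv_lhs => rw [← M.Q_degree a]
      have := hX.1.map_add (M.euler ⊤ (M.Q a) - M.Q (M.euler ⊤ a)) (M.Q (M.euler ⊤ a))
      rw [sub_add_cancel] at this
      rw [this, add_sub_cancel_right]
    rw [ksign_zero_left, Form.one_smul]
    simp only [EField_apply, QField_apply, Form.number_add]
    rw [Form.number_exteriorDeriv (hX.2 a), Form.exteriorDeriv_sub (hX.2 _) (hX.2 a).number, h1]
    abel

/-- Differentiating `Q_N` along itself gives `-d(dX + X∘Q)` plus `d(X∘Q) + X∘Q∘Q`: the cross terms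
cancel and the others vanish by `d² = 0` and `Q² = 0`. -/
theorem isBracket_QField_QField :
    IsBracket (M.par ⊤) 1 1 (QField M I N) (QField M I N) (fun _ _ _ _ _ _ => 0) := by
  have hQ := isVectorField_QField (I := I) (N := N) M
  let Z : FField I N M.Fun := fun V _ _ _ X a =>
    ksign 1 1 • (QField M I N V X a).exteriorDeriv I + QField M I N V X (M.Q a)
  have hZ : IsDirDeriv (M.par ⊤) 1 (QField M I N) (QField M I N) Z := by
    refine IsDirDeriv.of_isShift M hQ (Or.inr hQ) ?_ ?_
    · intro V _ _ _ X hX V' _ _ _ L a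
      simp only [Z]
      rw [(hQ V X hX).2, (hQ V X hX).2, Form.exteriorDeriv_bc ((hQ V X hX).1.2 a), Form.bc_add,
        Form.bc_smul]
    · intro V _ _ _ X hX θ hθ _ a
      exact isShift_QField M hθ (hX.2 a) ((hQ V X hX).1.2 a)
  have hZ0 : ∀ (V : Type) [AddCommGroup V] [Module ℝ V] [FiniteDimensional ℝ V]
      (X : M.Fun → Form I N V), IsPoint I N (M.par ⊤) V X → ∀ a, Z V X a = 0 := by
    intro V _ _ _ X hX a
    simp only [Z, QField_apply]
    rw [Form.exteriorDeriv_add (hX.2 a).exteriorDeriv (hX.2 _),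
      Form.exteriorDeriv_exteriorDeriv (hX.2 a), M.Q_sq, hX.1.map_zero, ksign_one_one,
      Form.neg_one_smul, zero_add, add_zero, neg_add_cancel]
  refine ⟨Z, Z, hZ, hZ, fun V _ _ _ X hX a => ?_⟩
  rw [hZ0 V X hX a, ksign_one_one, Form.neg_one_smul, neg_zero, sub_zero]

end Fields

/-! ### The differential forms of the AKSZ theory -/

section Forms

variable {m : ℤ} (M : HamiltonianDGManifold m) {d : ℕ} {H : Type*} [TopologicalSpace H]
  {I : ModelWithCorners ℝ (Eu d) H} {N : Type*} [TopologicalSpace N] [ChartedSpace H N]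
  {V : Type} [AddCommGroup V] [Module ℝ V] [FiniteDimensional ℝ V]
  {X ξ : M.Fun → Form I N V}

/-- The integrand of `α_N`. -/
def alphaDensity : Density I N M.Fun := fun _ _ _ _ X ξ => evalOne X ξ M.α

/-- The integrand of `ω_N`. -/
def omegaDensity : Density I N M.Fun := fun _ _ _ _ _ ξ => evalD ξ M.α

/-- The integrand of the kinetic part of the action. -/
def kineticDensity : Density I N M.Fun := fun V _ _ _ X _ =>
  evalOne X (deRhamField M I N V X) M.α

/-- The integrand of the variation of the kinetic part of the action. -/
def kineticVariation : Density I N M.Fun := fun _ _ _ _ X ξ =>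
  (M.α.map fun fg => ξ fg.1 * (X fg.2).exteriorDeriv I - (X fg.1).inv * (ξ fg.2).exteriorDeriv I).sum

theorem val_evalOne (X ξ : M.Fun → Form I N V) (x : N) :
    (evalOne X ξ M.α).val x = evalOne (fun a => (X a).val x) (fun a => (ξ a).val x) M.α :=
  Form.val_list_sum _ _ x

theorem val_evalD (ξ : M.Fun → Form I N V) (x : N) :
    (evalD ξ M.α).val x = evalD (fun a => (ξ a).val x) M.α :=
  Form.val_list_sum _ _ x

theorem isDensity_alpha : IsDensity (M.par ⊤) (alphaDensity M (I := I) (N := N)) :=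
  IsDensity.list_sum M.α fun fg => (IsDensity.point fg.1).mul (IsDensity.tangent fg.2)

theorem isDensity_omega : IsDensity (M.par ⊤) (omegaDensity M (I := I) (N := N)) :=
  IsDensity.list_sum M.α fun fg => (IsDensity.tangent fg.1).mul (IsDensity.tangent fg.2)

theorem isDensity_EField (a : M.Fun) :
    IsDensity (M.par ⊤) (fun V _ _ _ X _ => EField M I N V X a : Density I N M.Fun) :=
  (IsDensity.point (M.euler ⊤ a)).sub (IsDensity.point a).number

theorem isDensity_EField_tangent (a : M.Fun) :
    IsDensity (M.par ⊤) (fun V _ _ _ _ ξ => EField M I N V ξ a : Density I N M.Fun) :=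
  (IsDensity.tangent (M.euler ⊤ a)).sub (IsDensity.tangent a).number

theorem alpha_mem (hX : IsPoint I N (M.par ⊤) V X) (hξ : IsTangent I N (M.par ⊤) V 1 X ξ) :
    evalOne X ξ M.α ∈ Form.par I N V ((m + 1 : ℤ) : ZMod 2) :=
  Form.mem_par.2 fun x => by
    rw [val_evalOne]
    exact M.α_parity _ _ _ (hX.targetPoint hξ x)

theorem omega_mem (hX : IsPoint I N (M.par ⊤) V X) (hξ : IsTangent I N (M.par ⊤) V 1 X ξ) :
    evalD ξ M.α ∈ Form.par I N V ((m + 1 : ℤ) + 1 : ZMod 2) :=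
  Form.mem_par.2 fun x => by
    rw [val_evalD]
    exact M.α_parity.evalD_mem M.exists_add (hX.targetPoint hξ x)

/-- The target Euler field contributes the degree `m` at each point, and the degree operator of
`T[1]N`, being a derivation, is collected from the two factors into one term. After integration it
becomes multiplication by `d`. -/
theorem alpha_euler (hX : IsPoint I N (M.par ⊤) V X) (hξ : IsTangent I N (M.par ⊤) V 1 X ξ) :
    (M.α.map fun fg => EField M I N V X fg.1 * ξ fg.2 + X fg.1 * EField M I N V ξ fg.2).sum =
      (m : ℝ) • evalOne X ξ M.α - (evalOne X ξ M.α).number I := by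
  have h1 : (M.α.map fun fg => X (M.euler ⊤ fg.1) * ξ fg.2 + X fg.1 * ξ (M.euler ⊤ fg.2)).sum =
      (m : ℝ) • evalOne X ξ M.α := by
    refine Form.ext fun x => ?_
    rw [Form.val_list_sum, Form.val_smul, val_evalOne, ← M.α_degree _ _ _ (hX.targetPoint hξ x),
      evalOne, evalOne, List.map_map, List.map_map, list_sum_map_add]
    rfl
  rw [← h1, evalOne, Form.number_list_sum, list_sum_map_sub]
  congr 1
  refine List.map_congr_left fun fg _ => ?_
  rw [EField_apply, EField_apply, Form.number_mul, sub_mul, mul_sub]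
  abel

theorem omega_euler (hX : IsPoint I N (M.par ⊤) V X) (hξ : IsTangent I N (M.par ⊤) V 1 X ξ) :
    (M.α.map fun fg => EField M I N V ξ fg.1 * ξ fg.2 + ξ fg.1 * EField M I N V ξ fg.2).sum =
      (m : ℝ) • evalD ξ M.α - (evalD ξ M.α).number I := by
  have h1 : (M.α.map fun fg => ξ (M.euler ⊤ fg.1) * ξ fg.2 + ξ fg.1 * ξ (M.euler ⊤ fg.2)).sum =
      (m : ℝ) • evalD ξ M.α := by
    refine Form.ext fun x => ?_
    rw [Form.val_list_sum, Form.val_smul, val_evalD,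
      ← M.α_degree.evalD_eq M.exists_add (hX.targetPoint hξ x)]
    rfl
  rw [← h1, evalD, Form.number_list_sum, list_sum_map_sub]
  congr 1
  refine List.map_congr_left fun fg _ => ?_
  rw [EField_apply, EField_apply, Form.number_mul, sub_mul, mul_sub]
  abel

variable [IsManifold I ∞ N]

theorem isDensity_kinetic : IsDensity (M.par ⊤) (kineticDensity M (I := I) (N := N)) :=
  IsDensity.list_sum M.α fun fg => (IsDensity.point fg.1).mul (IsDensity.point fg.2).exteriorDeriv

theorem isDensity_kineticVariation :
    IsDensity (M.par ⊤) (kineticVariation M (I := I) (N := N)) :=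
  IsDensity.list_sum M.α fun fg =>
    ((IsDensity.tangent fg.1).mul (IsDensity.point fg.2).exteriorDeriv).sub
      ((IsDensity.point fg.1).inv.mul (IsDensity.tangent fg.2).exteriorDeriv)

variable [T2Space N] [SigmaCompactSpace N] [CompactSpace N] (o : Orient I N)

theorem isForm_alpha {k : ℤ} (hk : k = m + 1 - d) :
    IsForm (M.par ⊤) 1 (k : ZMod 2) (alphaForm M I o) := by
  refine isForm_integral (F := alphaDensity M) o (isDensity_alpha M) 1
    (c' := ((m + 1 : ℤ) : ZMod 2)) ?_ fun V _ _ _ X ξ hX hξ => ⟨alpha_mem M hX hξ, fun t => ?_⟩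
  · rw [hk]; push_cast; rw [sub_eq_add_neg, ZMod.neg_eq_self_mod_two]
  · refine Form.ext fun x => ?_
    rw [pow_one, Form.val_smul, alphaDensity, alphaDensity, val_evalOne, val_evalOne, evalOne,
      evalOne, List.smul_sum, List.map_map]
    congr 1
    refine List.map_congr_left fun fg _ => ?_
    simp only [Form.val_smul, Function.comp_apply, mul_smul_comm]

theorem isForm_omega {k : ℤ} (hk : k = m + 1 - d) :
    IsForm (M.par ⊤) 2 ((k + 1 : ℤ) : ZMod 2) (omegaForm M I o) := by
  refine isForm_integral (F := omegaDensity M) o (isDensity_omega M) 2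
    (c' := ((m + 1 : ℤ) + 1 : ZMod 2)) ?_ fun V _ _ _ X ξ hX hξ => ⟨omega_mem M hX hξ, fun t => ?_⟩
  · rw [hk]; push_cast; rw [sub_eq_add_neg, ZMod.neg_eq_self_mod_two]; ring
  · refine Form.ext fun x => ?_
    rw [Form.val_smul, omegaDensity, omegaDensity, val_evalD, val_evalD, evalD, evalD,
      List.smul_sum, List.map_map]
    congr 1
    refine List.map_congr_left fun fg _ => ?_
    simp only [Form.val_smul, Function.comp_apply, smul_mul_smul_comm, pow_two]

theorem isForm_action {k : ℤ} (hk : k = m + 1 - d) :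
    IsForm (M.par ⊤) 0 (k : ZMod 2) (action M I o) := by
  have hk' : ((m + 1 : ℤ) : ZMod 2) + (d : ZMod 2) = (k : ZMod 2) := by
    rw [hk]; push_cast; rw [sub_eq_add_neg, ZMod.neg_eq_self_mod_two]
  exact IsForm.add (Ψ := (kineticDensity M).integral o)
    (Φ := Density.integral o fun _ _ _ _ X _ => X M.Θ)
    (isForm_integral o (isDensity_kinetic M) 0 hk' fun V _ _ _ X ξ hX _ =>
      ⟨alpha_mem M hX hX.exteriorDeriv, fun t => by rw [pow_zero, Form.one_smul]; rfl⟩)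
    (isForm_integral o (IsDensity.point M.Θ) 0 hk' fun V _ _ _ X ξ hX _ =>
      ⟨hX.1.parity _ _ M.Θ_parity, fun t => by rw [pow_zero, Form.one_smul]⟩)

theorem isDelta_alpha :
    IsDelta (M.par ⊤) (alphaForm M I o) (FForm.smul ((-1) ^ d) (omegaForm M I o)) :=
  isDelta_integral (F := alphaDensity M) (F' := omegaDensity M) o (isDensity_alpha M)
    (isDensity_omega M) fun V _ _ _ X ξ _ _ η hη hηη =>
    (Form.IsShift.list_sum M.α fun fg => (Form.IsShift.self η _ _).mul hη hηη
      (Form.IsShift.rfl' η (ξ fg.2))).congr (by simp only [mul_zero, add_zero]; rfl)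

theorem isDelta_omega : IsDelta (M.par ⊤) (omegaForm M I o) FForm.zero :=
  fun V V' _ _ _ _ _ _ L X ξ hX hξ η _ => by
    rw [FForm.zero, map_zero, mul_zero, add_zero]
    have h := isDensity_omega M V X ξ hX hξ
    exact (congrArg (Form.integral I o) (h.2 V' L)).trans (Form.integral_bc o h.1 L)

theorem isDelta_kinetic :
    IsDelta (M.par ⊤) ((kineticDensity M).integral o)
      (FForm.smul ((-1) ^ d) ((kineticVariation M).integral o)) :=
  isDelta_integral o (isDensity_kinetic M) (isDensity_kineticVariation M)
    fun V _ _ _ X ξ hX hξ η hη hηη =>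
    (Form.IsShift.list_sum M.α fun fg => (Form.IsShift.self η _ _).mul hη hηη
      ((Form.IsShift.self η (X fg.2) (ξ fg.2)).exteriorDeriv hη (hX.2 _) (hξ.2 _))).congr (by
        refine congrArg List.sum (List.map_congr_left fun fg _ => ?_)
        rw [ksign_one_one, Form.neg_one_smul, Form.gpow_one, mul_neg, sub_eq_add_neg])

/-- The integrand of the variation of the action. -/
def actionVariation : Density I N M.Fun := fun V _ _ _ X ξ => kineticVariation M V X ξ + ξ M.Θ

theorem isDensity_actionVariation :
    IsDensity (M.par ⊤) (actionVariation M (I := I) (N := N)) :=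
  (isDensity_kineticVariation M).add (IsDensity.tangent M.Θ)

theorem isDelta_action :
    IsDelta (M.par ⊤) (action M I o) (FForm.smul ((-1) ^ d) ((actionVariation M).integral o)) := by
  have h2 : IsDelta (M.par ⊤) (Density.integral o fun _ _ _ _ X _ => X M.Θ)
      (FForm.smul ((-1) ^ d) (Density.integral o fun _ _ _ _ _ ξ => ξ M.Θ)) :=
    isDelta_integral o (IsDensity.point M.Θ) (IsDensity.tangent M.Θ)
      fun V _ _ _ X ξ _ _ η _ _ => Form.IsShift.self η _ _
  refine ((isDelta_kinetic M o).add h2).congr fun V _ _ _ X ξ hX hξ => ?_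
  simp only [FForm.smul, Density.integral, actionVariation]
  rw [Form.integral_add o (isDensity_kineticVariation M V X ξ hX hξ).1 (hξ.2 _), smul_add]

/-- This is `δ² = 0` made explicit: the two terms of the kinetic variation each produce `dξ`
multiplied by the inverted `ξ`, and they cancel, while the term from `Θ` does not depend on `X`. -/
theorem isDelta_actionVariation :
    IsDelta (M.par ⊤) ((actionVariation M).integral o) FForm.zero := by
  refine (isDelta_integral o (isDensity_actionVariation M) (F' := fun _ _ _ _ _ _ => 0)
    IsDensity.zero fun V _ _ _ X ξ hX hξ η hη hηη => ?_).congr fun V _ _ _ X ξ _ _ => ?_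
  · refine ((Form.IsShift.list_sum M.α fun fg =>
      ((Form.IsShift.rfl' η (ξ fg.1)).mul hη hηη
        ((Form.IsShift.self η (X fg.2) (ξ fg.2)).exteriorDeriv hη (hX.2 _) (hξ.2 _))).sub
      (((Form.IsShift.self η (X fg.1) (ξ fg.1)).inv hη).mul hη hηη
        (Form.IsShift.rfl' η ((ξ fg.2).exteriorDeriv I)))).add
      (Form.IsShift.rfl' η (ξ M.Θ))).congr ?_
    rw [add_zero]
    refine List.sum_eq_zero fun y hy => ?_
    obtain ⟨fg, -, rfl⟩ := List.mem_map.1 hy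
    rw [ksign_one_one, Form.neg_one_smul, Form.neg_one_smul, Form.gpow_one, zero_mul, zero_add,
      mul_zero, add_zero, mul_neg, neg_mul, sub_self]
  · simp only [FForm.smul, Density.integral, FForm.zero]
    rw [Form.integral_zero, smul_zero]

/-- `D5`, `D4` and `D4'` are the integrands of `ι_E ω`, `ι_E α` and `δ ι_E α`. In the sum the terms
with an inverted `ξ` cancel, leaving `alpha_euler`; the pairs of signs `(-1)^d` cancel as well, and
the weight is `m - d = k - 1`. -/
theorem isLieDerivative_alpha {k : ℤ} (hk : k = m + 1 - d) :
    IsLieDerivative (M.par ⊤) 0 (EField M I N) (alphaForm M I o)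
      (FForm.smul ((k - 1 : ℤ) : ℝ) (alphaForm M I o)) := by
  let D5 : Density I N M.Fun := fun V _ _ _ X ξ =>
    (M.α.map fun fg => EField M I N V X fg.1 * ξ fg.2 + (ξ fg.1).inv * EField M I N V X fg.2).sum
  let D4 : Density I N M.Fun := fun V _ _ _ X ξ =>
    (M.α.map fun fg => (X fg.1).inv * EField M I N V X fg.2).sum
  let D4' : Density I N M.Fun := fun V _ _ _ X ξ =>
    (M.α.map fun fg => X fg.1 * EField M I N V ξ fg.2 - (ξ fg.1).inv * EField M I N V X fg.2).sum
  have h5 : IsDensity (M.par ⊤) D5 := IsDensity.list_sum M.α fun fg =>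
    ((isDensity_EField M fg.1).mul (IsDensity.tangent fg.2)).add
      ((IsDensity.tangent fg.1).inv.mul (isDensity_EField M fg.2))
  have h4 : IsDensity (M.par ⊤) D4 := IsDensity.list_sum M.α fun fg =>
    (IsDensity.point fg.1).inv.mul (isDensity_EField M fg.2)
  have h4' : IsDensity (M.par ⊤) D4' := IsDensity.list_sum M.α fun fg =>
    ((IsDensity.point fg.1).mul (isDensity_EField_tangent M fg.2)).sub
      ((IsDensity.tangent fg.1).inv.mul (isDensity_EField M fg.2))
  have hE := isVectorField_EField (I := I) (N := N) M
  refine ⟨_, _, _, _, isDelta_alpha M o, (isContraction_integral_even (F := omegaDensity M)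
      (F' := D5) o hE (isDensity_omega M) h5 ?_).smul _, isContraction_integral_even
      (F := alphaDensity M) (F' := D4) o hE (isDensity_alpha M) h4 ?_,
      (isDelta_integral (F' := D4') o h4 h4' ?_).smul _, ?_⟩
  · intro V _ _ _ X ξ hX hξ θ hθ hθθ
    refine (Form.IsShift.list_sum M.α fun fg => (Form.IsShift.self θ _ _).mul hθ hθθ
      (Form.IsShift.self θ _ _)).congr ?_
    simp only [Form.gpow_one, D5]
  · intro V _ _ _ X ξ hX hξ θ hθ hθθ
    refine (Form.IsShift.list_sum M.α fun fg => (Form.IsShift.rfl' θ _).mul hθ hθθ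
      (Form.IsShift.self θ _ _)).congr ?_
    simp only [Form.gpow_one, D4, zero_mul, zero_add]
  · intro V _ _ _ X ξ hX hξ η hη hηη
    refine (Form.IsShift.list_sum M.α fun fg => ((Form.IsShift.self η _ _).inv hη).mul hη hηη
      (isShift_EField M (X := X) (Y := ξ) η fg.2)).congr ?_
    refine congrArg List.sum (List.map_congr_left fun fg _ => ?_)
    rw [ksign_one_one, Form.neg_one_smul, Form.gpow_one, Form.inv_inv, neg_mul]
    abel
  · intro V _ _ _ X ξ hX hξ
    simp only [FForm.smul, Density.integral]
    rw [neg_one_pow_smul_smul, neg_one_pow_smul_smul, ksign_zero_left, one_smul,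
      ← Form.integral_add o (h5 V X ξ hX hξ).1 (h4' V X ξ hX hξ).1]
    have h : D5 V X ξ + D4' V X ξ = (m : ℝ) • evalOne X ξ M.α - (evalOne X ξ M.α).number I := by
      rw [← alpha_euler M hX hξ, list_sum_map_add]
      refine congrArg List.sum (List.map_congr_left fun fg _ => ?_)
      abel
    have hs : (evalOne X ξ M.α).IsSmooth I := (isDensity_alpha M V X ξ hX hξ).1
    rw [h, Form.integral_sub o (hs.smul _) hs.number, Form.integral_smul o hs,
      Form.integral_number o hs, ← sub_smul, alphaForm]
    congr 1
    rw [hk]; push_cast; ring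

/-- As `ω_N` is closed, only `δ ι_E ω_N` contributes, and the variation of the integrand of `ι_E
ω_N` is the expression in `omega_euler`. -/
theorem isLieDerivative_omega {k : ℤ} (hk : k = m + 1 - d) :
    IsLieDerivative (M.par ⊤) 0 (EField M I N) (omegaForm M I o)
      (FForm.smul ((k - 1 : ℤ) : ℝ) (omegaForm M I o)) := by
  let D5 : Density I N M.Fun := fun V _ _ _ X ξ =>
    (M.α.map fun fg => EField M I N V X fg.1 * ξ fg.2 + (ξ fg.1).inv * EField M I N V X fg.2).sum
  let D5' : Density I N M.Fun := fun V _ _ _ X ξ =>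
    (M.α.map fun fg => EField M I N V ξ fg.1 * ξ fg.2 + ξ fg.1 * EField M I N V ξ fg.2).sum
  have h5 : IsDensity (M.par ⊤) D5 := IsDensity.list_sum M.α fun fg =>
    ((isDensity_EField M fg.1).mul (IsDensity.tangent fg.2)).add
      ((IsDensity.tangent fg.1).inv.mul (isDensity_EField M fg.2))
  have h5' : IsDensity (M.par ⊤) D5' := IsDensity.list_sum M.α fun fg =>
    ((isDensity_EField_tangent M fg.1).mul (IsDensity.tangent fg.2)).add
      ((IsDensity.tangent fg.1).mul (isDensity_EField_tangent M fg.2))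
  have hE := isVectorField_EField (I := I) (N := N) M
  refine ⟨_, _, _, _, isDelta_omega M o, isContraction_zero 0 _, isContraction_integral_even
      (F := omegaDensity M) (F' := D5) o hE (isDensity_omega M) h5 ?_,
      (isDelta_integral (F' := D5') o h5 h5' ?_).smul _, ?_⟩
  · intro V _ _ _ X ξ hX hξ θ hθ hθθ
    refine (Form.IsShift.list_sum M.α fun fg => (Form.IsShift.self θ _ _).mul hθ hθθ
      (Form.IsShift.self θ _ _)).congr ?_
    simp only [Form.gpow_one, D5]
  · intro V _ _ _ X ξ hX hξ η hη hηη
    refine (Form.IsShift.list_sum M.α fun fg =>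
      ((isShift_EField M (X := X) (Y := ξ) η fg.1).mul hη hηη (Form.IsShift.rfl' η (ξ fg.2))).add
      ((Form.IsShift.rfl' η (ξ fg.1).inv).mul hη hηη
        (isShift_EField M (X := X) (Y := ξ) η fg.2))).congr ?_
    refine congrArg List.sum (List.map_congr_left fun fg _ => ?_)
    rw [Form.gpow_one, Form.gpow_one, Form.inv_inv, mul_zero, add_zero, zero_mul, zero_add]
  · intro V _ _ _ X ξ hX hξ
    simp only [FForm.smul, Density.integral, FForm.zero]
    rw [neg_one_pow_smul_smul, ksign_zero_left, one_smul, zero_add]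
    have hs : (evalD ξ M.α).IsSmooth I := (isDensity_omega M V X ξ hX hξ).1
    have h : D5' V X ξ = (m : ℝ) • evalD ξ M.α - (evalD ξ M.α).number I := omega_euler M hX hξ
    rw [h, Form.integral_sub o (hs.smul _) hs.number, Form.integral_smul o hs,
      Form.integral_number o hs, ← sub_smul, omegaForm]
    congr 1
    rw [hk]; push_cast; ring

theorem isLieDerivative_action {k : ℤ} (hk : k = m + 1 - d) :
    IsLieDerivative (M.par ⊤) 0 (EField M I N) (action M I o)
      (FForm.smul (k : ℝ) (action M I o)) := by
  let D7 : Density I N M.Fun := fun V _ _ _ X ξ =>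
    (M.α.map fun fg => EField M I N V X fg.1 * (X fg.2).exteriorDeriv I +
      X fg.1 * (EField M I N V X fg.2).exteriorDeriv I).sum + EField M I N V X M.Θ
  have h7 : IsDensity (M.par ⊤) D7 := (IsDensity.list_sum M.α fun fg =>
    ((isDensity_EField M fg.1).mul (IsDensity.point fg.2).exteriorDeriv).add
      ((IsDensity.point fg.1).mul (isDensity_EField M fg.2).exteriorDeriv)).add
    (isDensity_EField M M.Θ)
  have hE := isVectorField_EField (I := I) (N := N) M
  refine ⟨_, _, FForm.zero, FForm.zero, isDelta_action M o, (isContraction_integral_even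
      (F' := D7) o hE (isDensity_actionVariation M) h7 ?_).smul _, ?_, isDelta_zero, ?_⟩
  · intro V _ _ _ X ξ hX hξ θ hθ hθθ
    have hEX := (hE V X hX).1.2
    refine ((Form.IsShift.list_sum M.α fun fg =>
      ((Form.IsShift.self θ _ _).mul hθ hθθ (Form.IsShift.rfl' θ ((X fg.2).exteriorDeriv I))).sub
      ((Form.IsShift.rfl' θ (X fg.1).inv).mul hθ hθθ ((Form.IsShift.self θ (ξ fg.2)
        (EField M I N V X fg.2)).exteriorDeriv hθ (hξ.2 _) (hEX _)))).add
      (Form.IsShift.self θ _ _)).congr ?_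
    refine congrArg (· + _) (congrArg List.sum (List.map_congr_left fun fg _ => ?_))
    rw [Form.gpow_one, Form.gpow_one, Form.inv_inv, ksign_one_one, Form.neg_one_smul, mul_zero,
      zero_mul, add_zero, zero_add, mul_neg, sub_neg_eq_add]
  · intro V V' _ _ _ _ _ _ L X ξ hX hξ θ _ _
    rw [FForm.zero, map_zero, mul_zero, add_zero]
    exact ((isForm_action M o hk) V X ξ hX hξ).2.2 V' L
  · intro V _ _ _ X ξ hX hξ
    simp only [FForm.smul, Density.integral, FForm.zero]
    rw [neg_one_pow_smul_smul, smul_zero, add_zero]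
    let κ : Form I N V := evalOne X (deRhamField M I N V X) M.α
    have hκ : κ.IsSmooth I := (isDensity_kinetic M V X ξ hX hξ).1
    have hΘ : (X M.Θ).IsSmooth I := hX.2 _
    have h : D7 V X ξ = ((m : ℝ) • κ - κ.number I + κ) +
        (((m + 1 : ℤ) : ℝ) • X M.Θ - (X M.Θ).number I) := by
      refine congrArg₂ (· + ·) ?_ ?_
      · have hm : _ = (m : ℝ) • κ - κ.number I := alpha_euler M hX hX.exteriorDeriv
        have hκ' : κ = (M.α.map fun fg => X fg.1 * (X fg.2).exteriorDeriv I).sum := rfl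
        rw [← hm]
        conv_rhs => rw [hκ']
        rw [list_sum_map_add]
        refine congrArg List.sum (List.map_congr_left fun fg _ => ?_)
        -- Commuting `d` with the degree operator produces an additional `dX`. This raises the
        -- weight of the kinetic term from `m - d` to `m + 1 - d`, the weight of the interaction
        -- term.
        have h1 : (EField M I N V X fg.2).exteriorDeriv I =
            EField M I N V (fun a => (X a).exteriorDeriv I) fg.2 + (X fg.2).exteriorDeriv I := by
          rw [EField_apply, EField_apply, Form.exteriorDeriv_sub (hX.2 _) (hX.2 _).number,
            Form.number_exteriorDeriv (hX.2 _)]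
          abel
        rw [h1, mul_add, ← add_assoc]
        rfl
      · rw [EField_apply, M.Θ_degree, hX.1.map_smul]
    rw [h, Form.integral_add o (((hκ.smul _).sub hκ.number).add hκ) ((hΘ.smul _).sub hΘ.number),
      Form.integral_add o ((hκ.smul _).sub hκ.number) hκ, Form.integral_sub o (hκ.smul _) hκ.number,
      Form.integral_sub o (hΘ.smul _) hΘ.number, Form.integral_smul o hκ, Form.integral_smul o hΘ,
      Form.integral_number o hκ, Form.integral_number o hΘ, action, hk]
    push_cast
    module

end Forms

/-! ### The Hamiltonian condition -/

section Hamiltonian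

variable {m : ℤ} (M : HamiltonianDGManifold m) {d : ℕ} {H : Type*} [TopologicalSpace H]
  {I : ModelWithCorners ℝ (Eu d) H} {N : Type*} [TopologicalSpace N] [ChartedSpace H N]
  [IsManifold I ∞ N]

/-- The integrand of `ι_Q ω`. -/
def omegaContraction : Density I N M.Fun := fun V _ _ _ X ξ =>
  (M.α.map fun fg => QField M I N V X fg.1 * ξ fg.2 + ξ fg.1 * QField M I N V X fg.2).sum

theorem isDensity_omegaContraction :
    IsDensity (M.par ⊤) (omegaContraction M (I := I) (N := N)) := by
  have hQ : ∀ a, IsDensity (M.par ⊤) (fun V _ _ _ X _ => QField M I N V X a : Density I N M.Fun) :=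
    fun a => (IsDensity.point a).exteriorDeriv.add (IsDensity.point (M.Q a))
  exact IsDensity.list_sum M.α fun fg =>
    ((hQ fg.1).mul (IsDensity.tangent fg.2)).add ((IsDensity.tangent fg.1).mul (hQ fg.2))

theorem exteriorDeriv_list_sum {ι V : Type*} [AddCommGroup V] [Module ℝ V] [FiniteDimensional ℝ V]
    (l : List ι) (f : ι → Form I N V) (h : ∀ i, (f i).IsSmooth I) :
    ((l.map f).sum).exteriorDeriv I = (l.map fun i => (f i).exteriorDeriv I).sum := by
  induction l with
  | nil => exact Form.exteriorDeriv_zero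
  | cons a l ih =>
    rw [List.map_cons, List.sum_cons, List.map_cons, List.sum_cons,
      Form.exteriorDeriv_add (h a) (Form.isSmooth_list_sum l f fun i _ => h i), ih]

/-- The part of `Q_N` from the target gives `ξ Θ` by `ι_Q ω = dΘ` at each point. The de Rham part
gives `df(X) ξ g + ξ f dg(X)`, which the Leibniz rule for `d(f(X) ξ g)` rewrites as the kinetic
variation plus an exact form. This is integration by parts before integrating. -/
theorem omegaContraction_eq {V : Type} [AddCommGroup V] [Module ℝ V] [FiniteDimensional ℝ V]
    {X ξ : M.Fun → Form I N V} (hX : IsPoint I N (M.par ⊤) V X)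
    (hξ : IsTangent I N (M.par ⊤) V 1 X ξ) :
    omegaContraction M V X ξ = actionVariation M V X ξ + (evalOne X ξ M.α).exteriorDeriv I := by
  have h1 : (M.α.map fun fg => X (M.Q fg.1) * ξ fg.2 + ξ fg.1 * X (M.Q fg.2)).sum = ξ M.Θ := by
    refine Form.ext fun x => ?_
    have hx := hX.targetPoint hξ x
    have h := M.hamiltonian.eval hx
    rw [evalOne_one hx] at h
    rw [← h, Form.val_list_sum]
    refine congrArg List.sum (List.map_congr_left fun fg _ => ?_)
    rw [two_zmod 1, gradePow_zero, Form.val_add, Form.val_mul, Form.val_mul]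
  rw [omegaContraction, actionVariation, kineticVariation, ← h1, evalOne,
    exteriorDeriv_list_sum _ _ fun fg => (hX.2 _).mul (hξ.2 _), list_sum_map_add, list_sum_map_add]
  refine congrArg List.sum (List.map_congr_left fun fg _ => ?_)
  rw [QField_apply, QField_apply, Form.exteriorDeriv_mul (hX.2 _) (hξ.2 _), add_mul, mul_add]
  abel

variable [T2Space N] [SigmaCompactSpace N] [CompactSpace N] (o : Orient I N)

theorem isContraction_QField_omega : IsContraction (M.par ⊤) 1 (QField M I N) (omegaForm M I o)
    (fun V _ _ _ X ξ => (actionVariation M V X ξ).integral I o +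
      ((evalOne X ξ M.α).exteriorDeriv I).integral I o) := by
  refine (isContraction_integral_odd (F := omegaDensity M) o (isVectorField_QField M)
    (isDensity_omega M) (isDensity_omegaContraction M)
    fun V _ _ _ X ξ hX hξ θ hθ hθθ => ?_).congr fun V _ _ _ X ξ hX hξ => ?_
  · refine (Form.IsShift.list_sum M.α fun fg => (Form.IsShift.self θ _ _).mul hθ hθθ
      (Form.IsShift.self θ _ _)).congr ?_
    simp only [Form.gpow_zero, omegaContraction]
  · rw [Density.integral, omegaContraction_eq M hX hξ]
    exact Form.integral_add o (isDensity_actionVariation M V X ξ hX hξ).1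
      (isDensity_alpha M V X ξ hX hξ).1.exteriorDeriv

end Hamiltonian

/-! ### The Hamiltonian condition on closed manifolds -/

section Closed

variable {m : ℤ} (M : HamiltonianDGManifold m) {d : ℕ} {B : Type*} [TopologicalSpace B]
  [ChartedSpace (Eu d) B] [IsManifold (𝓡 d) ∞ B] [T2Space B] [SigmaCompactSpace B]
  [CompactSpace B] (o : Orient (𝓡 d) B)

theorem isContraction_QField_omega_closed :
    IsContraction (M.par ⊤) 1 (QField M (𝓡 d) B) (omegaForm M (𝓡 d) o)
      ((actionVariation M).integral o) :=
  (isContraction_QField_omega M o).congr fun V _ _ _ X ξ hX hξ => by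
    have hs : (evalOne X ξ M.α).IsSmooth (𝓡 d) := (isDensity_alpha M V X ξ hX hξ).1
    rw [Form.integral_exteriorDeriv_closed o hs, add_zero]
    rfl

theorem hamiltonian_closed : ∃ δS : FForm (𝓡 d) B M.Fun,
    IsDelta (M.par ⊤) (action M (𝓡 d) o) δS ∧
    IsContraction (M.par ⊤) 1 (QField M (𝓡 d) B) (omegaForm M (𝓡 d) o)
      (FForm.smul ((-1) ^ d) δS) :=
  ⟨_, isDelta_action M o, (isContraction_QField_omega_closed M o).congr fun V _ _ _ X ξ _ _ => by
    rw [FForm.smul, FForm.smul, neg_one_pow_smul_smul]⟩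

/-- Since `ω_N` is closed and its contraction with `Q_N` is, up to sign, the variation of the
action, Cartan's formula reduces the claim to `δ² S_N = 0`. -/
theorem isLieDerivative_QField_omega_closed :
    IsLieDerivative (M.par ⊤) 1 (QField M (𝓡 d) B) (omegaForm M (𝓡 d) o) FForm.zero :=
  ⟨_, _, _, _, isDelta_omega M o, isContraction_zero 1 _, isContraction_QField_omega_closed M o,
    isDelta_actionVariation M o, fun V _ _ _ X ξ _ _ => by simp [FForm.zero]⟩

end Closed

/-! ### The restriction of fields to the boundary -/

section Boundary

variable {m : ℤ} (M : HamiltonianDGManifold m) {d : ℕ} {N B : Type*} [TopologicalSpace N]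
  [ChartedSpace (EuclideanHalfSpace (d + 1)) N] [IsManifold (𝓡∂ (d + 1)) ∞ N]
  [TopologicalSpace B] [ChartedSpace (EuclideanSpace ℝ (Fin d)) B] [IsManifold (𝓡 d) ∞ B]
  {oN : Orient (𝓡∂ (d + 1)) N} {oB : Orient (𝓡 d) B} {j : B → N}

/-- Pullback of forms to the boundary, as a homomorphism. -/
def Form.comapHom (V : Type*) [AddCommGroup V] [Module ℝ V] (j : B → N) :
    Form (𝓡∂ (d + 1)) N V →ₐ[ℝ] Form (𝓡 d) B V where
  toFun β := β.comap j
  map_one' := Form.comap_one j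
  map_mul' := Form.comap_mul j
  map_zero' := Form.ext fun _ => map_zero _
  map_add' := Form.comap_add j
  commutes' r := by
    rw [Algebra.algebraMap_eq_smul_one, Algebra.algebraMap_eq_smul_one, Form.comap_smul,
      Form.comap_one]

theorem Form.comap_list_sum {ι V : Type*} [AddCommGroup V] [Module ℝ V] (j : B → N) (l : List ι)
    (f : ι → Form (𝓡∂ (d + 1)) N V) :
    ((l.map f).sum).comap j = ((l.map fun i => (f i).comap j).sum : Form (𝓡 d) B V) :=
  (map_list_sum (Form.comapHom V j) _).trans (by rw [List.map_map]; rfl)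

theorem IsDerAlong.list_sum {ι A B : Type*} [Ring A] [Algebra ℝ A] [Ring B] [Algebra ℝ B]
    {𝒜 : ZMod 2 → Submodule ℝ A} {P : ZMod 2 → Submodule ℝ B} {p : ZMod 2} {x : A → B}
    (l : List ι) {ξ : ι → A → B} (h : ∀ i ∈ l, IsDerAlong 𝒜 P p x (ξ i)) :
    IsDerAlong 𝒜 P p x fun a => (l.map fun i => ξ i a).sum := by
  induction l with
  | nil => exact IsDerAlong.zero p x
  | cons a l ih =>
    simp only [List.map_cons, List.sum_cons]
    exact (h a (by simp)).add (ih fun i hi => h i (by simp [hi]))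

theorem HamiltonianDGManifold.exists_hamiltonianField {k : ZMod 2} {g : M.Fun}
    (hg : g ∈ M.par ⊤ k) : ∃ v : M.Fun → M.Fun, IsDerAlong (M.par ⊤) (M.par ⊤) (k + m) id v ∧
      IsTargetContraction (M.par ⊤) (k + m) v M.α [(1, g)] := by
  refine (M.nondegenerate (k + m) [(1, g)] fun V _ _ _ x ξ hx => ?_).exists
  rw [evalOne_one hx]
  have := hx.2.parity k g hg
  have h2 : (k + m + 1 + m : ZMod 2) = k + 1 := by
    rw [add_right_comm, add_assoc k, two_zmod, add_zero]
  rwa [h2]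

variable (h : IsOrientedBoundary oN oB j)
include h

theorem IsOrientedBoundary.isPoint_comap {A : Type*} [Ring A] [Algebra ℝ A]
    {𝒜 : ZMod 2 → Submodule ℝ A} {V : Type} [AddCommGroup V] [Module ℝ V] [FiniteDimensional ℝ V]
    {X : A → Form (𝓡∂ (d + 1)) N V} (hX : IsPoint (𝓡∂ (d + 1)) N 𝒜 V X) :
    IsPoint (𝓡 d) B 𝒜 V fun a => (X a).pull j :=
  ⟨hX.1.comp (Form.comapHom V j) fun _ _ => Form.comap_mem j, fun a => (hX.2 a).comap h.smooth⟩

theorem IsOrientedBoundary.isTangent_comap {A : Type*} [Ring A] [Algebra ℝ A]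
    {𝒜 : ZMod 2 → Submodule ℝ A} {V : Type} [AddCommGroup V] [Module ℝ V] [FiniteDimensional ℝ V]
    {p : ZMod 2} {X ζ : A → Form (𝓡∂ (d + 1)) N V} (hζ : IsTangent (𝓡∂ (d + 1)) N 𝒜 V p X ζ) :
    IsTangent (𝓡 d) B 𝒜 V p (fun a => (X a).pull j) fun a => (ζ a).pull j :=
  ⟨hζ.1.comp (Form.comapHom V j) fun _ _ => Form.comap_mem j, fun a => (hζ.2 a).comap h.smooth⟩

variable [T2Space N] [SigmaCompactSpace N] [CompactSpace N] [CompactSpace B]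

/-- A tangent vector is not extended function by function, which would destroy the Leibniz rule.
Only its finitely many coefficients with respect to the generating vector fields are extended; the
combination of the lifted fields is then automatically a derivation along `X`. -/
theorem IsOrientedBoundary.exists_tangent {V : Type} [AddCommGroup V] [Module ℝ V]
    [FiniteDimensional ℝ V] {p : ZMod 2} {X : M.Fun → Form (𝓡∂ (d + 1)) N V}
    {ζ' : M.Fun → Form (𝓡 d) B V} (hX : IsPoint (𝓡∂ (d + 1)) N (M.par ⊤) V X)
    (hζ : IsTangent (𝓡 d) B (M.par ⊤) V p (fun a => (X a).pull j) ζ') :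
    ∃ ζ : M.Fun → Form (𝓡∂ (d + 1)) N V, IsTangent (𝓡∂ (d + 1)) N (M.par ⊤) V p X ζ ∧
      ∀ a, (ζ a).pull j = ζ' a := by
  obtain ⟨G, hG, hgen⟩ := exists_generators M.exists_add fun k g hg =>
    M.exists_hamiltonianField hg
  have hc : ∀ e : ZMod 2 × M.Fun × (M.Fun → M.Fun), ∃ γ : Form (𝓡∂ (d + 1)) N V,
      e ∈ G → γ.IsSmooth (𝓡∂ (d + 1)) ∧ γ ∈ Form.par (𝓡∂ (d + 1)) N V (e.1 + p) ∧
        γ.comap j = ζ' e.2.1 := by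
    intro e
    by_cases he : e ∈ G
    · obtain ⟨γ, hγ⟩ := h.exists_comap_eq (hζ.2 e.2.1) (hζ.1.parity e.1 e.2.1 (hG e he).1)
      exact ⟨γ, fun _ => hγ⟩
    · exact ⟨0, fun he' => absurd he' he⟩
  choose c hc using hc
  refine ⟨fun a => (G.map fun e => c e * X (e.2.2 a)).sum, ⟨IsDerAlong.list_sum G fun e he => ?_,
    fun a => Form.isSmooth_list_sum G _ fun e he => (hc e he).1.mul (hX.2 _)⟩, fun a => ?_⟩
  · have := (hX.mul_left (hX.lift (hG e he).2) (hc e he).2.1 (hc e he).1).1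
    rwa [add_right_comm, two_zmod, zero_add] at this
  · refine Form.ext fun b => ?_
    refine Eq.trans ?_ (hgen _ p _ _ ((h.isPoint_comap hX).val b) (hζ.val b) a).symm
    have h1 : Form.pull j ((G.map fun e => c e * X (e.2.2 a)).sum) =
      (G.map fun e => (c e * X (e.2.2 a)).comap j).sum := Form.comap_list_sum j G _
    rw [h1, Form.val_list_sum]
    refine congrArg List.sum (List.map_congr_left fun e he => ?_)
    rw [Form.comap_mul, (hc e he).2.2]
    rfl

variable [T2Space B] [SigmaCompactSpace B]

theorem IsOrientedBoundary.isBVBFVPair : IsBVBFVPair (M.par ⊤) j (EField M (𝓡∂ (d + 1)) N)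
    (QField M (𝓡∂ (d + 1)) N) (omegaForm M (𝓡∂ (d + 1)) oN) (action M (𝓡∂ (d + 1)) oN)
    (EField M (𝓡 d) B) (QField M (𝓡 d) B) (alphaForm M (𝓡 d) oB) where
  restrict_point _ _ _ _ _ hX := h.isPoint_comap hX
  restrict_tangent _ _ _ _ _ _ _ _ hζ := h.isTangent_comap hζ
  submersion _ _ _ _ _ _ _ hX hζ := h.exists_tangent M hX hζ
  E_project V _ _ _ X hX a := by
    change ((X _ - (X a).number _).comap j : Form (𝓡 d) B V) = _
    rw [Form.comap_sub, ← Form.number_comap]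
    rfl
  Q_project V _ _ _ X hX a := by
    change (((X a).exteriorDeriv _ + X _).comap j : Form (𝓡 d) B V) = _
    rw [Form.comap_add, ← Form.exteriorDeriv_comap h.smooth (hX.2 a)]
    rfl
  hamiltonian := by
    refine ⟨_, isDelta_action M oN, (isContraction_QField_omega M oN).congr
      fun V _ _ _ X ξ hX hξ => ?_⟩
    have hs : (evalOne X ξ M.α).IsSmooth (𝓡∂ (d + 1)) := (isDensity_alpha M V X ξ hX hξ).1
    rw [FForm.comb, FForm.smul, neg_one_pow_smul_smul, one_smul, h.stokes hs]
    refine congrArg₂ (· + ·) rfl (congrArg (Form.integral (𝓡 d) oB) ?_)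
    refine (Form.comap_list_sum j M.α _).trans ?_
    refine congrArg List.sum (List.map_congr_left fun fg _ => ?_)
    rw [Form.comap_mul]
    rfl

end Boundary

/-! ### Nondegeneracy of the integration pairing -/

section Pairing

variable {d : ℕ} {H : Type*} [TopologicalSpace H]
  {I : ModelWithCorners ℝ (Eu d) H} {N : Type*} [TopologicalSpace N] [ChartedSpace H N]
  [IsManifold I ∞ N] {V : Type*} [AddCommGroup V] [Module ℝ V]

/-- The form with constant coefficients on Euclidean space. -/
def Form.euclidean (w : Fib (Eu d) V) : Form 𝓘(ℝ, Eu d) (Eu d) V := fun _ => w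

theorem Form.val_euclidean (w : Fib (Eu d) V) (y : Eu d) : (Form.euclidean w).val y = w := rfl

variable (I) in
/-- The form with constant coefficients in the chart at `c`. -/
def Form.coordForm (c : N) (w : Fib (Eu d) V) : Form I N V :=
  (Form.euclidean w).comap (extChartAt I c)

theorem Form.inChart_coordForm {c : N} {y : Eu d} (hy : y ∈ (extChartAt I c).target)
    (w : Fib (Eu d) V) : (Form.coordForm I c w).inChart I c y = w := by
  rw [Form.inChart_eq, Form.coordForm, Form.val_comap, fibMap_fibMap, Form.val_euclidean]
  have h : (eucDeriv I 𝓘(ℝ, Eu d) (extChartAt I c) ((extChartAt I c).symm y)).comp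
      (chartInvDeriv I c y) = ContinuousLinearMap.id ℝ (Eu d) :=
    mfderiv_extChartAt_comp_mfderivWithin_extChartAt_symm hy
  have h2 := congrArg ContinuousLinearMap.toLinearMap h
  rw [ContinuousLinearMap.toLinearMap_comp] at h2
  rw [h2]
  exact fibMap_id w

theorem Form.coordForm_mem (c : N) {w : Fib (Eu d) V} {i : ZMod 2} (h : w ∈ Gr.par _ i) :
    Form.coordForm I c w ∈ Form.par I N V i :=
  Form.comap_mem _ (Form.mem_par.2 fun _ => h)

/-- Compactness of the support lets a test function in the chart be extended by zero to all of `N`;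
in a Hausdorff space the transported support remains closed. -/
theorem exists_function_of_chart [T2Space N] (c : N) {g : Eu d → ℝ} (hg : ContDiff ℝ ∞ g)
    (hgc : HasCompactSupport g) (hgU : tsupport g ⊆ (extChartAt I c).target) :
    ∃ f : N → ℝ, ContMDiff I 𝓘(ℝ, ℝ) ∞ f ∧ tsupport f ⊆ (extChartAt I c).source ∧
      ∀ y ∈ (extChartAt I c).target, f ((extChartAt I c).symm y) = g y := by
  set K := (extChartAt I c).symm '' tsupport g with hK
  have hKc : IsCompact K := IsCompact.image_of_continuousOn hgc
    ((continuousOn_extChartAt_symm c).mono hgU)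
  have hKs : K ⊆ (extChartAt I c).source := by
    rintro _ ⟨y, hy, rfl⟩
    exact (extChartAt I c).map_target (hgU hy)
  let f : N → ℝ := Set.indicator (extChartAt I c).source fun x => g (extChartAt I c x)
  have hf0 : ∀ x ∉ K, f x = 0 := by
    intro x hx
    by_cases hs : x ∈ (extChartAt I c).source
    · refine (Set.indicator_of_mem hs _).trans (image_eq_zero_of_notMem_tsupport fun h => hx ?_)
      exact ⟨_, h, (extChartAt I c).left_inv hs⟩
    · exact Set.indicator_of_notMem hs _
  refine ⟨f, fun x => ?_, ?_, fun y hy => ?_⟩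
  · by_cases hs : x ∈ (extChartAt I c).source
    · have h1 : ContMDiffAt I 𝓘(ℝ, ℝ) ∞ (fun x => g (extChartAt I c x)) x :=
        hg.contMDiff.contMDiffAt.comp x (contMDiffAt_extChartAt' (by simpa using hs))
      refine h1.congr_of_eventuallyEq ?_
      filter_upwards [(isOpen_extChartAt_source c).mem_nhds hs] with z hz
      exact Set.indicator_of_mem hz _
    · refine (contMDiffAt_const (c := (0 : ℝ))).congr_of_eventuallyEq ?_
      filter_upwards [hKc.isClosed.isOpen_compl.mem_nhds fun h => hs (hKs h)] with z hz
      exact hf0 z hz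
  · refine Set.Subset.trans (closure_minimal (fun x hx => ?_) hKc.isClosed) hKs
    by_contra h
    exact hx (hf0 x h)
  · refine (Set.indicator_of_mem ((extChartAt I c).map_target hy) _).trans ?_
    rw [(extChartAt I c).right_inv hy]

variable [FiniteDimensional ℝ V]

theorem Form.isSmooth_euclidean (w : Fib (Eu d) V) :
    (Form.euclidean w).IsSmooth 𝓘(ℝ, Eu d) := by
  refine Form.isSmooth_iff.2 fun x y _ => ?_
  have : (Form.euclidean w).inChart 𝓘(ℝ, Eu d) x = fun _ => w := by
    ext1 z
    rw [Form.inChart_eq, Form.val_euclidean]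
    have h : chartInvDeriv 𝓘(ℝ, Eu d) x z = ContinuousLinearMap.id ℝ (Eu d) := by
      rw [chartInvDeriv, extChartAt_model_space_eq_id]
      exact mfderivWithin_id (by simpa using uniqueMDiffWithinAt_univ _)
    rw [h]
    exact fibMap_id w
  rw [this]
  exact contDiffWithinAt_const

theorem Form.isSmooth_fmul_coordForm (c : N) (w : Fib (Eu d) V) {f : N → ℝ}
    (hf : ContMDiff I 𝓘(ℝ, ℝ) ∞ f) (hfs : tsupport f ⊆ (extChartAt I c).source) :
    ((Form.coordForm I c w).fmul f).IsSmooth I :=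
  Form.isSmooth_fmul_of_tsupport (fun _ _ hy hyU =>
    (Form.isSmooth_euclidean w).contDiffWithinAt_comap (isOpen_extChartAt_source c)
      (by rw [extChartAt_source]; exact contMDiffOn_extChartAt) hy hyU) hf hfs

variable [T2Space N] [SigmaCompactSpace N] [CompactSpace N] (o : Orient I N)

/-- A smooth form which is orthogonal to all smooth forms vanishes. -/
theorem Form.eq_zero_of_integral {β : Form I N V} (hβ : β.IsSmooth I)
    (h : ∀ (i : ZMod 2), ∀ u ∈ Form.par I N V i, u.IsSmooth I → (u * β).integral I o = 0) :
    β = 0 := by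
  have := FiniteDimensional.complete ℝ (Gr V)
  refine Form.ext fun c => ?_
  rw [Form.val_eq_inChart, Form.val_zero]
  -- By the nondegeneracy of the wedge pairing it suffices to test against constant monomials in the
  -- chart at the point, multiplied by bump functions.
  refine eq_zero_of_topCoeff fun L => ?_
  set T := (extChartAt I c).target with hT
  set w := covecProd V L with hw
  let F : Eu d → Gr V := fun y => o.chartSign c y • topCoeff (w * β.inChart I c y)
  have hF : ContinuousOn F T := by
    refine (o.continuousOn_chartSign c).smul fun y hy => ?_
    have := contDiffWithinAt_linear (topCoeffL d V ∘ₗ LinearMap.mulLeft ℝ w)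
      (hβ.contDiffWithinAt hy)
    exact this.continuousWithinAt.mono (extChartAt_target_subset_range c)
  have hFi : ContinuousOn F (interior T) := hF.mono interior_subset
  -- The fundamental lemma of the calculus of variations, on the interior of the chart target, where
  -- compactly supported smooth test functions extend to `N`.
  have hae := isOpen_interior.ae_eq_zero_of_integral_contDiff_smul_eq_zero
    (hFi.locallyIntegrableOn (μ := MeasureTheory.volume) isOpen_interior.measurableSet)
    fun g hg hgc hgU => by
      have hgT : tsupport g ⊆ T := hgU.trans interior_subset
      obtain ⟨f, hf, hfs, hfg⟩ := exists_function_of_chart c hg hgc hgT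
      have hu := Form.isSmooth_fmul_coordForm c w hf hfs
      have h1 := h _ _ (Form.fmul_mem f (Form.coordForm_mem c (covecProd_mem L))) hu
      rw [Form.integral_eq_chart o c (hu.mul hβ) fun x hx => by
        rw [Form.val_mul, Form.val_fmul,
          image_eq_zero_of_notMem_tsupport fun h => hx (hfs h), zero_smul, zero_mul]] at h1
      rw [← h1, ← MeasureTheory.setIntegral_eq_integral_of_forall_compl_eq_zero (s := T)]
      · refine MeasureTheory.setIntegral_congr_fun (measurableSet_extChartAt_target c) fun y hy => ?_
        rw [Form.inChart_mul, Form.inChart_fmul, Form.inChart_coordForm hy, hfg y hy,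
          smul_mul_assoc, ← topCoeffL_apply, map_smul, topCoeffL_apply, smul_comm]
      · intro y hy
        rw [image_eq_zero_of_notMem_tsupport fun h => hy (hgT h), zero_smul]
  have h0 : Set.EqOn F (fun _ => 0) (interior T) :=
    MeasureTheory.Measure.eqOn_open_of_ae_eq
      ((MeasureTheory.ae_restrict_iff' isOpen_interior.measurableSet).2 hae) isOpen_interior hFi
      continuousOn_const
  -- The point may lie on the boundary of `N`; there the vanishing follows by continuity, as the
  -- target lies in the closure of its interior.
  have h1 := h0.of_subset_closure hF continuousOn_const interior_subset
    extChartAt_target_subset_closure_interior (mem_extChartAt_target c)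
  refine (smul_eq_zero.1 h1).resolve_left ?_
  have h2 := o.chartDens_ne_zero (mem_extChartAt_target (I := I) c)
  rw [Orient.chartSign]
  rcases h2.lt_or_gt with h2 | h2
  · rw [sign_neg h2]; simp
  · rw [sign_pos h2]; simp

end Pairing

/-! ### The AKSZ data -/

theorem ksign_ne_zero (i j : ZMod 2) : ksign i j ≠ 0 := fun h => by
  simpa [h] using ksign_mul_self i j

section Datum

variable {m : ℤ} (M : HamiltonianDGManifold m) {d : ℕ} {H : Type*} [TopologicalSpace H]
  {I : ModelWithCorners ℝ (Eu d) H} {N : Type*} [TopologicalSpace N] [ChartedSpace H N]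

theorem evalD_tangent_eq_zero {V : Type} [AddCommGroup V] [Module ℝ V] [FiniteDimensional ℝ V]
    {q : ZMod 2}
    {φ : Form I N V} (hφ : φ ∈ Form.par I N V q) (hφφ : φ * φ = 0) (u : M.Fun → Form I N V) :
    evalD (fun a => φ * u a) M.α = 0 :=
  Form.ext fun x => by
    rw [val_evalD]
    exact evalD_mul (Form.mem_par.1 hφ x) (congrArg (fun β => Form.val β x) hφφ) _ _

/-- Contracting `ω` with the Hamiltonian field of `g` leaves `dg`, evaluated on the remaining
tangent vector. The term quadratic in `θ` vanishes because `θ² = 0`. -/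
theorem evalD_add_hamiltonian {V : Type} [AddCommGroup V] [Module ℝ V] [FiniteDimensional ℝ V]
    {p r : ZMod 2} {v : M.Fun → M.Fun} {g : M.Fun}
    (hv : IsTargetContraction (M.par ⊤) r v M.α [(1, g)]) {X ζ : M.Fun → Form I N V}
    (hX : IsPoint I N (M.par ⊤) V X) (hζ : IsTangent I N (M.par ⊤) V p X ζ) {θ : Gr V}
    (hθ : θ ∈ Gr.par V (p + 1)) (hθθ : θ * θ = 0) {φ : Form I N V}
    (hφ : φ ∈ Form.par I N V (r + 1)) (hφφ : φ * φ = 0) :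
    evalD (fun a => φ * X (v a) + Form.const I θ * ζ a) M.α = φ * (Form.const I θ * ζ g) := by
  refine Form.ext fun x => ?_
  have h1 := hv.evalD_add (hX.val x) (hζ.val x) (constMap_mem (E := Eu d) hθ)
    (Form.mem_par.1 hφ x) (congrArg (fun β => Form.val β x) hφφ)
  rw [evalD_mul (constMap_mem hθ) (by rw [← map_mul, hθθ, map_zero]), zero_add] at h1
  rw [val_evalD]
  refine Eq.trans ?_ h1
  refine congrArg (fun f => evalD f M.α) (funext fun a => ?_)
  rw [Form.val_add]
  exact add_comm _ _

variable [IsManifold I ∞ N] [T2Space N] [SigmaCompactSpace N] [CompactSpace N] (o : Orient I N)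

/-- The transgression of a symplectic form is weakly nondegenerate. -/
theorem isNondegenerate_omega : IsNondegenerate (M.par ⊤) (omegaForm M I o) := by
  intro V _ _ _ X ζ p hX hζ hker a
  suffices hom : ∀ (k : ZMod 2), ∀ g ∈ M.par ⊤ k, ζ g = 0 by
    obtain ⟨b, hb, c, hc, rfl⟩ := M.exists_add a
    rw [hζ.1.map_add, hom 0 b hb, hom 1 c hc, add_zero]
  intro k g hg
  obtain ⟨v, hv, hvg⟩ := M.exists_hamiltonianField hg
  set r : ZMod 2 := k + m
  refine Form.eq_zero_of_integral o (hζ.2 g) fun i u hu hus => ?_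
  -- The parity of `ε` makes `φ = ε u` of parity `r + 1`, so that `φ X∘v` is odd, and `ε² = 0`
  -- forces `φ² = 0` whatever the parity of `u`. The second parameter `θ` is the one multiplying `ζ`
  -- in the definition of the kernel.
  obtain ⟨V₁, _, _, _, L₁, ε, hε, hεε, hcan₁, -⟩ := Gr.exists_fresh V (r + 1 + i)
  obtain ⟨V₂, _, _, _, L₂, θ, hθ, hθθ, hcan₂, -⟩ := Gr.exists_fresh V₁ (p + 1)
  set L := L₂ ∘ₗ L₁ with hL
  set ε₂ := ExteriorAlgebra.map L₂ ε with hε₂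
  have hε₂m : ε₂ ∈ Gr.par V₂ (r + 1 + i) := Gr.map_mem L₂ hε
  have hε₂ε : ε₂ * ε₂ = 0 := by rw [hε₂, ← map_mul, hεε, map_zero]
  set φ : Form I N V₂ := Form.const I ε₂ * u.bc I L with hφdef
  have hu₂ : u.bc I L ∈ Form.par I N V₂ i := Form.bc_mem L hu
  have hφ : φ ∈ Form.par I N V₂ (r + 1) := by
    have := Form.mul_mem (Form.const_mem (I := I) (N := N) hε₂m) hu₂
    rwa [add_assoc (r + 1), two_zmod, add_zero] at this
  have hφs : φ.IsSmooth I := (Form.isSmooth_const ε₂).mul (hus.bc L)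
  have hφφ : φ * φ = 0 := by
    rw [hφdef, mul_assoc, ← mul_assoc (u.bc I L), Form.mul_const hε₂m, mul_assoc, ← mul_assoc,
      Form.const_mul_self hε₂ε, zero_mul]
  have hY := hX.bc L
  have hζ₂ := hζ.bc L
  have hξ : IsTangent I N (M.par ⊤) V₂ 1 (fun a => (X a).bc I L)
      fun a => φ * (X (v a)).bc I L := by
    have := hY.mul_left (hY.lift hv) hφ hφs
    rwa [add_right_comm, two_zmod, zero_add] at this
  -- The kernel condition, tested on the variation `φ X∘v`. The left side reduces to the integral of
  -- `φ θ ζ(g)`, the right side to zero.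
  have h1 : (evalD (fun a => φ * (X (v a)).bc I L + Form.const I θ * (ζ a).bc I L) M.α).integral I o =
      (evalD (fun a => φ * (X (v a)).bc I L) M.α).integral I o := hker V₂ L _ hξ θ hθ hθθ
  rw [evalD_add_hamiltonian M hvg hY hζ₂ hθ hθθ hφ hφφ, evalD_tangent_eq_zero M hφ hφφ,
    Form.integral_zero] at h1
  have hs : (u * ζ g).IsSmooth I := hus.mul (hζ.2 g)
  have h2 : φ * (Form.const I θ * (ζ g).bc I L) = ksign i (p + 1) •
      (Form.const I ε₂ * (Form.const I θ * (u * ζ g).bc I L)) := by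
    rw [hφdef, mul_assoc, ← mul_assoc (u.bc I L), Form.supercomm hu₂ (Form.const_mem hθ),
      Form.bc_mul, ← mul_assoc (Form.const I θ)]
    refine Eq.trans ?_ (mul_smul_comm (ksign i (p + 1)) (Form.const I ε₂) _)
    exact congrArg _ (smul_mul_assoc (ksign i (p + 1)) (Form.const I θ * u.bc I L) ((ζ g).bc I L))
  have hs₂ : (Form.const I θ * (u * ζ g).bc I L).IsSmooth I :=
    (Form.isSmooth_const θ).mul (hs.bc L)
  rw [h2, Form.integral_smul o ((Form.isSmooth_const ε₂).mul hs₂),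
    Form.integral_const_mul o hs₂ hε₂m, Form.integral_const_mul o (hs.bc L) hθ,
    Form.integral_bc o hs, mul_smul_comm, ← mul_assoc, Gr.supercomm hε₂m hθ, smul_mul_assoc,
    hL, ← Gr.map_map, mul_assoc, hε₂, ← map_mul] at h1
  -- Up to nonzero signs, what remains is `θ ε ∫ u ζ(g) = 0`, from which the two fresh parameters
  -- are cancelled in turn.
  simp only [smul_eq_zero, ksign_ne_zero, false_or] at h1
  exact hcan₁ _ (hcan₂ _ h1)

theorem isBVDatum {k : ℤ} (hk : k = m + 1 - d) : IsBVDatum (M.par ⊤) k (EField M I N)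
    (QField M I N) (alphaForm M I o) (omegaForm M I o) (action M I o) where
  E_field := isVectorField_EField M
  Q_field := isVectorField_QField M
  Q_gh := isBracket_EField_QField M
  Q_sq := isBracket_QField_QField M
  α_form := isForm_alpha M o hk
  Ω_form := isForm_omega M o hk
  S_form := isForm_action M o hk
  α_gh := isLieDerivative_alpha M o hk
  Ω_gh := isLieDerivative_omega M o hk
  S_gh := isLieDerivative_action M o hk
  exact := ⟨_, isDelta_alpha M o, fun V _ _ _ X ξ _ _ => by
    rw [FForm.smul, neg_one_pow_smul_smul]⟩
  closed := isDelta_omega M o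
  nondegenerate := isNondegenerate_omega M o

end Datum

theorem isClosedBVDatum {m : ℤ} (M : HamiltonianDGManifold m) {d : ℕ} {B : Type*}
    [TopologicalSpace B] [ChartedSpace (Eu d) B] [IsManifold (𝓡 d) ∞ B] [T2Space B]
    [SigmaCompactSpace B] [CompactSpace B] (o : Orient (𝓡 d) B) {k : ℤ} (hk : k = m + 1 - d) :
    IsClosedBVDatum (M.par ⊤) k (EField M (𝓡 d) B) (QField M (𝓡 d) B) (alphaForm M (𝓡 d) o)
      (omegaForm M (𝓡 d) o) (action M (𝓡 d) o) where
  toIsBVDatum := isBVDatum M o hk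
  hamiltonian := hamiltonian_closed M o
  invariant := isLieDerivative_QField_omega_closed M o

end AKSZ

end

theorem mainTheorem2 (n : ℕ) (M : AKSZ.HamiltonianDGManifold ((n : ℤ) - 1)) :
    (∀ (d : ℕ) (B : Type*) [TopologicalSpace B] [ChartedSpace (EuclideanSpace ℝ (Fin d)) B]
        [IsManifold (𝓡 d) ∞ B] [T2Space B] [CompactSpace B] (o : AKSZ.Orient (𝓡 d) B),
      AKSZ.IsClosedBVDatum (M.par ⊤) ((n : ℤ) - d) (AKSZ.EField M (𝓡 d) B)
        (AKSZ.QField M (𝓡 d) B) (AKSZ.alphaForm M (𝓡 d) o) (AKSZ.omegaForm M (𝓡 d) o)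
        (AKSZ.action M (𝓡 d) o)) ∧
    (∀ (d : ℕ) (N : Type*) [TopologicalSpace N] [ChartedSpace (EuclideanHalfSpace (d + 1)) N]
        [IsManifold (𝓡∂ (d + 1)) ∞ N] [T2Space N] [CompactSpace N]
        (B : Type*) [TopologicalSpace B] [ChartedSpace (EuclideanSpace ℝ (Fin d)) B]
        [IsManifold (𝓡 d) ∞ B] [T2Space B] [CompactSpace B]
        (oN : AKSZ.Orient (𝓡∂ (d + 1)) N) (oB : AKSZ.Orient (𝓡 d) B) (j : B → N),
      AKSZ.IsOrientedBoundary oN oB j →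
      AKSZ.IsBVDatum (M.par ⊤) ((n : ℤ) - (d + 1 : ℕ)) (AKSZ.EField M (𝓡∂ (d + 1)) N)
        (AKSZ.QField M (𝓡∂ (d + 1)) N) (AKSZ.alphaForm M (𝓡∂ (d + 1)) oN)
        (AKSZ.omegaForm M (𝓡∂ (d + 1)) oN) (AKSZ.action M (𝓡∂ (d + 1)) oN) ∧
      AKSZ.IsBVBFVPair (M.par ⊤) j (AKSZ.EField M (𝓡∂ (d + 1)) N)
        (AKSZ.QField M (𝓡∂ (d + 1)) N) (AKSZ.omegaForm M (𝓡∂ (d + 1)) oN)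
        (AKSZ.action M (𝓡∂ (d + 1)) oN) (AKSZ.EField M (𝓡 d) B) (AKSZ.QField M (𝓡 d) B)
        (AKSZ.alphaForm M (𝓡 d) oB)) := by
  refine ⟨fun d B _ _ _ _ _ o => AKSZ.isClosedBVDatum M o (by ring),
    fun d N _ _ _ _ _ B _ _ _ _ _ oN oB j h =>
      ⟨AKSZ.isBVDatum M oN (by ring), h.isBVBFVPair M⟩⟩
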